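/- **Setting.** Let $X\subset\mathbb C^m$ be open and let $A(\lambda;x)$, $x\in X$, be $\mathfrak{sl}_2(\mathbb C)$-valued, rational in $\lambda$, with finite poles exactly at $N$ pairwise distinct points $a_1(x),\dots,a_N(x)$ holomorphic in $x$, and holomorphic in $(\lambda,x)$ away from the poles. Consider $d\Psi/d\lambda=A(\lambda)\Psi$. Let $t=a_\tau(x)=x_i$ be a first order pole of $A$ with residue $A_t$, the other poles being independent of the coordinate $x_i$. An isomonodromy deformation with respect to $t$ means that near every nonsingular point the system has a fundamental solution, holomorphic in $(\lambda,x)$, which also satisfies $$\frac{d\Psi}{dt}=\Big(-\frac{A_t}{\lambda-t}+R(\lambda)\Big)\Psi$$ with $R$ rational in $\lambda$. Let $t_1=a_\kappa(x)$ be a first order pole of $A$ (possibly $t_1=t$). The deformation is $t_1$-non-Schlesinger if $R$ has a pole at $\lambda=t_1$ (for all $x\in X$). A Schlesinger transformation centred at $p$ is $$\Psi=D^{-1}R_p^{-1}(\lambda)\Phi,\qquad R_p(\lambda)=\begin{pmatrix}0&0\\0&1\end{pmatrix}\sqrt{\lambda-p}+\begin{pmatrix}1&0\\c&0\end{pmatrix}\frac1{\sqrt{\lambda-p}},$$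 with $D$ invertible and independent of $\lambda$; $D$, $c$ are holomorphic in the parameters. Poles are poles in $\mathbb C$ unless $\infty$ is mentioned. Call $\infty$ generic of order $d\ge-1$ if, for all $x\in X$, $A=L\lambda^d+o(\lambda^d)$ as $\lambda\to\infty$ with $L=L(x)$ having distinct eigenvalues $\pm\theta/2$, and $\theta\notin\mathbb Z$ if $d=-1$. **Proposition.** Let a $t_1$-non-Schlesinger isomonodromy deformation with respect to $t$ be given. (1) Every $x_0\in X$ has an open neighbourhood $V\subset X$ over which finitely many Schlesinger transformations centred at $t_1$ transform the system to $d\hat\Phi/d\lambda=\hat A(\lambda)\hat\Phi$, where $\hat A$ is rational in $\lambda$ with values in $\mathfrak{sl}_2(\mathbb C)$, has no pole at $t_1$, and has the same other poles, with the same orders, as $A$. If $\infty$ is generic of order $d$, then also $\hat A=\hat L\lambda^d+o(\lambda^d)$ as $\lambda\to\infty$ with $\hat L\ne0$. (2) The transformations in (1) can be chosen so that moreover the following holds. Suppose that $t_1=x_j$, that the other poles of $A$ do not depend on the coordinate $x_j$, that $A$ is also isomonodromic with respect to $t_1$, $$\frac{d\Psi}{dt_1}=\Big(-\frac{A_{t_1}}{\lambda-t_1}+R_1(\lambda)\Big)\Psi,$$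 with $R_1$ rational in $\lambda$, and that all poles of $R_1$ in $\mathbb{CP}^1$ are first order poles of $A$ (for the point $\infty$: if $R_1$ has a pole at $\infty$, then $A=O(1/\lambda)$ there, i.e. $\infty$ is Fuchsian). Then every nonempty open $W\subset V$ contains a nonempty open $V'$ over which finitely many additional Schlesinger transformations, centred at $t_1$ or at finite poles of $R_1$, lead from $\hat A$ to a rational $\mathfrak{sl}_2(\mathbb C)$-valued coefficient which is independent of $t_1$, has no pole at $t_1$, and whose poles are among the poles of $A$. If $\infty$ is generic of order $d$, this coefficient again is $\hat L\lambda^d+o(\lambda^d)$ at $\infty$ with $\hat L\ne0$. -/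

import Mathlib

open Filter Topology

/-- `2 × 2` matrices whose entries are rational functions of `λ`. -/
abbrev RatMat : Type := Matrix (Fin 2) (Fin 2) (RatFunc ℂ)

noncomputable section

namespace RatMat

/-- The value of a rational matrix at `l` (meaningful when `l` is not a pole). -/
def evalAt (M : RatMat) (l : ℂ) : Matrix (Fin 2) (Fin 2) ℂ :=
  M.map fun f => f.eval (RingHom.id ℂ) l

/-- The order of the pole of `M` at the finite point `q`, with value `0` if `M` has no pole there:
the largest multiplicity of `q` as a root of the reduced denominator of an entry. -/
def poleOrder (M : RatMat) (q : ℂ) : ℕ :=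
  Finset.univ.sup fun ab : Fin 2 × Fin 2 => (M ab.1 ab.2).denom.rootMultiplicity q

/-- `q ∈ ℂ` is a pole of `M`. -/
def IsPole (M : RatMat) (q : ℂ) : Prop := M.poleOrder q ≠ 0

/-- The residue of `M` at a pole `q` of order one: the value of `(λ - q) M(λ)` at `λ = q`. -/
def residue (M : RatMat) (q : ℂ) : Matrix (Fin 2) (Fin 2) ℂ :=
  Matrix.of fun a b => ((RatFunc.X - RatFunc.C q) * M a b).eval (RingHom.id ℂ) q

/-- The rational matrix `C / (λ - q)`. -/
def simplePole (q : ℂ) (C : Matrix (Fin 2) (Fin 2) ℂ) : RatMat :=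
  C.map fun c => RatFunc.C c / (RatFunc.X - RatFunc.C q)

/-- `M(λ) = L λ ^ d + o(λ ^ d)` as `λ → ∞`. -/
def HasCoeffAtInfty (M : RatMat) (d : ℤ) (L : Matrix (Fin 2) (Fin 2) ℂ) : Prop :=
  ∀ a b, Tendsto (fun l : ℂ => l ^ (-d) * M.evalAt l a b) (Bornology.cobounded ℂ) (𝓝 (L a b))

/-- `M` has no pole at `λ = ∞`. -/
def RegularAtInfty (M : RatMat) : Prop := ∃ L, M.HasCoeffAtInfty 0 L

/-- The system `dΨ/dλ = M Ψ` has at worst a Fuchsian singularity at `λ = ∞`, that is, `M(λ)` is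
`O(1/λ)`; equivalently the form `M(λ) dλ` has at most a first order pole at `∞`. -/
def FuchsianAtInfty (M : RatMat) : Prop := ∃ L, M.HasCoeffAtInfty (-1) L

/-- `Ψ` solves `dΨ/dλ = M Ψ` in a neighbourhood of `l₀`. -/
def IsSolutionNear (M : RatMat) (l₀ : ℂ) (Ψ : ℂ → Matrix (Fin 2) (Fin 2) ℂ) : Prop :=
  ∀ᶠ l in 𝓝 l₀, ∀ a b, HasDerivAt (fun l' => Ψ l' a b) ((M.evalAt l * Ψ l) a b) l

end RatMat

/-- The matrix `R = diag(0,1) √(λ - p) + (1 0; c 0) / √(λ - p)`, where `s` stands for the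
chosen value of `√(λ - p)`. -/
def schlesingerMatrix (s c : ℂ) : Matrix (Fin 2) (Fin 2) ℂ :=
  s • !![0, 0; 0, 1] + s⁻¹ • !![1, 0; c, 0]

/-- The Schlesinger transformation `Ψ = D⁻¹ R⁻¹ Φ`, i.e. `Φ = R D Ψ`, centred at `p`, with constant
(in `λ`) invertible `D` and parameter `c`, takes the system with coefficient `A` to the
system with coefficient `B`: for every local branch `s` of `√(λ - p)` it takes
solutions to solutions. -/
def IsSchlesingerTransform (p : ℂ) (D : Matrix (Fin 2) (Fin 2) ℂ) (c : ℂ) (A B : RatMat) : Prop :=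
  D.det ≠ 0 ∧
  ∀ l₀ : ℂ, l₀ ≠ p → ¬ A.IsPole l₀ →
    ∀ s : ℂ → ℂ, AnalyticAt ℂ s l₀ → (∀ᶠ l in 𝓝 l₀, s l ^ 2 = l - p) →
    ∀ Ψ : ℂ → Matrix (Fin 2) (Fin 2) ℂ, A.IsSolutionNear l₀ Ψ →
      B.IsSolutionNear l₀ fun l => schlesingerMatrix (s l) c * D * Ψ l

/-- A family of rational matrices depending on `m` complex parameters. -/
abbrev RatFamily (m : ℕ) : Type := (Fin m → ℂ) → RatMat

/-- `A` is, over the parameter domain `X`, a holomorphic family of rational `sl₂`-matrices whose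
finite poles are exactly the pairwise distinct points `a k x`, which move holomorphically. -/
structure IsHolomorphicFamily {m N : ℕ} (X : Set (Fin m → ℂ)) (A : RatFamily m)
    (a : Fin N → (Fin m → ℂ) → ℂ) : Prop where
  trace_eq_zero : ∀ x ∈ X, (A x).trace = 0
  analytic_pole : ∀ k, AnalyticOnNhd ℂ (a k) X
  pole_injective : ∀ x ∈ X, Function.Injective fun k => a k x
  isPole_iff : ∀ x ∈ X, ∀ q, (A x).IsPole q ↔ ∃ k, a k x = q
  analytic : ∀ x ∈ X, ∀ l, ¬ (A x).IsPole l → ∀ b c,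
    AnalyticAt ℂ (fun z : (Fin m → ℂ) × ℂ => (A z.1).evalAt z.2 b c) (x, l)

/-- The parameter `x i` is the position of the pole `a τ`, and the other poles do not move
with `x i`. -/
def IsPoleParameter {m N : ℕ} (X : Set (Fin m → ℂ)) (a : Fin N → (Fin m → ℂ) → ℂ)
    (i : Fin m) (τ : Fin N) : Prop :=
  (∀ x ∈ X, a τ x = x i) ∧
  ∀ k, k ≠ τ → ∀ x ∈ X, HasDerivAt (fun s => a k (Function.update x i s)) 0 (x i)

/-- Near every nonsingular point the equations `∂Ψ/∂λ = A Ψ` and `∂Ψ/∂xᵢ = U Ψ` have a common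
fundamental solution. -/
def HasCommonSolution {m : ℕ} (X : Set (Fin m → ℂ)) (A U : RatFamily m) (i : Fin m) : Prop :=
  ∀ x₀ ∈ X, ∀ l₀ : ℂ, ¬ (A x₀).IsPole l₀ → ¬ (U x₀).IsPole l₀ →
    ∃ Ψ : (Fin m → ℂ) × ℂ → Matrix (Fin 2) (Fin 2) ℂ,
      (∀ b c, AnalyticAt ℂ (fun z => Ψ z b c) (x₀, l₀)) ∧
      ∀ᶠ z : (Fin m → ℂ) × ℂ in 𝓝 (x₀, l₀),
        (Ψ z).det ≠ 0 ∧
        (∀ b c, HasDerivAt (fun l => Ψ (z.1, l) b c) (((A z.1).evalAt z.2 * Ψ z) b c) z.2) ∧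
        ∀ b c, HasDerivAt (fun s => Ψ (Function.update z.1 i s, z.2) b c)
          (((U z.1).evalAt z.2 * Ψ z) b c) (z.1 i)

/-- `A` is deformed isomonodromically with respect to its first order pole `t = a τ x = x i`
according to `∂Ψ/∂t = (- A_t / (λ - t) + R(λ)) Ψ`, with `R` rational in `λ`. -/
structure IsIsomonodromic {m N : ℕ} (X : Set (Fin m → ℂ)) (A : RatFamily m)
    (a : Fin N → (Fin m → ℂ) → ℂ) (i : Fin m) (τ : Fin N) (R : RatFamily m) : Prop where
  isPoleParameter : IsPoleParameter X a i τ
  poleOrder_eq_one : ∀ x ∈ X, (A x).poleOrder (a τ x) = 1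
  hasCommonSolution : HasCommonSolution X A
    (fun x => -RatMat.simplePole (a τ x) ((A x).residue (a τ x)) + R x) i

/-- The isomonodromy deformation with respect to `t = a τ x = x i` is `t₁`-non-Schlesinger, where
`t₁ = a κ x` is a first order pole of `A` (`κ = τ` is allowed): `R` has a pole at `t₁`. -/
structure IsNonSchlesinger {m N : ℕ} (X : Set (Fin m → ℂ)) (A : RatFamily m)
    (a : Fin N → (Fin m → ℂ) → ℂ) (i : Fin m) (τ κ : Fin N) (R : RatFamily m) : Prop where
  isIsomonodromic : IsIsomonodromic X A a i τ R
  poleOrder_eq_one : ∀ x ∈ X, (A x).poleOrder (a κ x) = 1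
  isPole : ∀ x ∈ X, (R x).IsPole (a κ x)

/-- The deformation with respect to `t₁ = a κ x = x j` is isomonodromic and weak: every pole in
`ℂ ∪ {∞}` of the rational function `R₁` is a first order (Fuchsian) pole of `A`. -/
structure IsWeakIsomonodromic {m N : ℕ} (X : Set (Fin m → ℂ)) (A : RatFamily m)
    (a : Fin N → (Fin m → ℂ) → ℂ) (j : Fin m) (κ : Fin N) (R₁ : RatFamily m) : Prop where
  isIsomonodromic : IsIsomonodromic X A a j κ R₁
  poleOrder_eq_one : ∀ x ∈ X, ∀ q, (R₁ x).IsPole q → (A x).poleOrder q = 1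
  atInfty : ∀ x ∈ X, ¬ (R₁ x).RegularAtInfty → (A x).FuchsianAtInfty

/-- One Schlesinger transformation of families over `V`, centred at one of the points `p x`,
`p ∈ C`; the matrix `D` and the function `c` depend holomorphically on the parameters. -/
def SchlesingerStep {m : ℕ} (V : Set (Fin m → ℂ)) (C : Set ((Fin m → ℂ) → ℂ))
    (A B : RatFamily m) : Prop :=
  ∃ p ∈ C, ∃ (D : (Fin m → ℂ) → Matrix (Fin 2) (Fin 2) ℂ) (c : (Fin m → ℂ) → ℂ),
    (∀ e f, AnalyticOnNhd ℂ (fun x => D x e f) V) ∧ AnalyticOnNhd ℂ c V ∧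
    ∀ x ∈ V, IsSchlesingerTransform (p x) (D x) (c x) (A x) (B x)

/-- Finitely many successive Schlesinger transformations over `V` with centres in `C`. -/
def SchlesingerChain {m : ℕ} (V : Set (Fin m → ℂ)) (C : Set ((Fin m → ℂ) → ℂ)) :
    RatFamily m → RatFamily m → Prop :=
  Relation.ReflTransGen (SchlesingerStep V C)

/-- The point `∞` is a generic singularity, with `A(λ) dλ` having there a pole of order
`d + 2 ≥ 1`: `A = L λ ^ d + …` where `L` has distinct eigenvalues `± θ / 2`, and, if `∞` is
Fuchsian (`d = -1`), the difference `θ` of the eigenvalues is not an integer. -/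
def IsGenericAtInfty {m : ℕ} (X : Set (Fin m → ℂ)) (A : RatFamily m) (d : ℤ) : Prop :=
  -1 ≤ d ∧ ∀ x ∈ X, ∃ L : Matrix (Fin 2) (Fin 2) ℂ, (A x).HasCoeffAtInfty d L ∧
    L.det ≠ 0 ∧ (d = -1 → ∀ n : ℤ, L.det ≠ -((n : ℂ) ^ 2 / 4))

/-- For every parameter value in `V` the exact order of growth of `A` at `∞` is `d`. -/
def HasOrderAtInfty {m : ℕ} (V : Set (Fin m → ℂ)) (A : RatFamily m) (d : ℤ) : Prop :=
  ∀ x ∈ V, ∃ L : Matrix (Fin 2) (Fin 2) ℂ, (A x).HasCoeffAtInfty d L ∧ L ≠ 0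

end

/-!
# Removal of the pole of a non-Schlesinger isomonodromy deformation

**Gauge transformations.** Up to a scalar factor, a Schlesinger transformation with parameter `c = 0`
is the gauge transformation by the polynomial matrix `diag(1, λ - p) D`.  Throughout, a system is
transformed by polynomial matrices `Q`, where `(det Q)^(-1/2) Q Ψ` solves the transformed system
(`PolyMat.IsGauge`); this keeps coefficients traceless, and scalar factors of `Q` do not matter.

**Removal of the pole.** Let `U` be the coefficient of the deformation equation.  By the zero
curvature equation, `W = U + (∂ t₁ / ∂ t) A`, which has a pole at `t₁` because `R` has one, solves
`ζ W' + [W, ζ A] = g` with `ζ = λ - t₁` and `g` holomorphic at `t₁`.  Comparison of the leading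
coefficients shows that the residue of `A` at `t₁` has the eigenvalues `± n / 2`, where `n ≥ 1` is the
order of the pole of `W` (`IsNonSchlesinger.exists_hasPolarSolution`).  A transformation
`diag(1, λ - t₁) D`, where the first row of `D` is a left eigenvector of the residue for `n / 2`,
lowers `n` by one and carries `W` along.  For `n = 1` the existence of `W` forces the new residue to
vanish, not only to be nilpotent (`HasPolarSolution.step`), so that after `n` steps there is no pole.
The second row of `D` is free, and is used to keep `∞` generic: `D` maps an eigenvector of the leading
coefficient to a multiple of the first basis vector (`IsGauge.generic_step`).  Genericity provides two
eigenvectors, one of which is compatible with the first row.  For `d = -1` the step shifts `θ / 2` by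
`± 1 / 2`, and `θ` remains different from all integers.

**Independence of the parameter.** Locally, the linear flow of `U` in the direction `x j` gives a
matrix `G` which compares the system at `x` with the system at `x₀`, the point `x` with `x j` replaced
by a fixed value (`IsLocalDeformation.exists_flow`).  At the poles of `R₁` both systems are Fuchsian,
and by Grönwall's inequality `G` grows at most polynomially; at the other poles it is bounded.  The
same holds at `∞`.  The reduced systems are compared by a scalar multiple of `T(x₀) G T(x)⁻¹`, where
`T` is the product of the transformations used for the reduction.  They are holomorphic near `t₁`, and
so is then the comparison, because it is constant in terms of fundamental matrices
(`exists_extension_of_annulus`).  Clearing the remaining poles, one obtains a polynomial matrix `P`,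
holomorphic in `x`, which transforms the reduced system at `x` into the one at `x₀`, and whose
determinant vanishes at poles of `R₁` only (`IsBoundedDeformation.exists_gauge_family`).

It remains to factorize `P` into Schlesinger transformations.  Where `det P` vanishes at `λ = p`, a
factor `diag(1, λ - p) D` splits off.  When the determinant has become constant, the Euclidean
algorithm on the columns gives elementary matrices, which are products of transformations with centre
`t₁`.  Divisions by functions of `x` occur, which is why the parameter domain has to be shrunk to a
smaller open set (`isGenericallySchlesingerProduct_of_det`).
-/

/-! ### Holomorphic functions of several variables -/

section SeveralVariables

open MeasureTheory Metric Set
open scoped Real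

variable {E : Type*} [NormedAddCommGroup E] [NormedSpace ℂ E]

theorem torusMap_mem_closedBall {n : ℕ} (c : Fin n → ℂ) {r : ℝ} (hr : 0 ≤ r) (θ : Fin n → ℝ) :
    torusMap c (fun _ => r) θ ∈ closedBall c r := by
  rw [mem_closedBall, dist_pi_le_iff hr]
  intro i
  simp [torusMap, abs_of_nonneg hr, Complex.norm_exp_ofReal_mul_I]

theorem continuous_torusMap {n : ℕ} (c : Fin n → ℂ) (r : Fin n → ℝ) :
    Continuous (torusMap c r) := by
  unfold torusMap
  fun_prop

theorem torusMap_sub_ne_zero {n : ℕ} {c z : Fin n → ℂ} {r : ℝ} (hz : z ∈ ball c r)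
    (θ : Fin n → ℝ) (i : Fin n) : torusMap c (fun _ => r) θ i - z i ≠ 0 := by
  intro h
  have hr : 0 < r := dist_nonneg.trans_lt hz
  have h1 : dist (z i) (c i) < r := (dist_le_pi_dist z c i).trans_lt hz
  rw [← sub_eq_zero.1 h] at h1
  simp [torusMap, Complex.norm_exp_ofReal_mul_I, abs_of_pos hr] at h1

/-- The Cauchy integral formula on a polydisc. -/
theorem torusIntegral_cauchy [CompleteSpace E] {n : ℕ} (c : Fin n → ℂ) {r : ℝ} {f : (Fin n → ℂ) → E}
    (hf : ∀ z ∈ closedBall c r, DifferentiableAt ℂ f z) {z : Fin n → ℂ} (hz : z ∈ ball c r) :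
    (∯ w in T(c, fun _ => r), (∏ i, (w i - z i))⁻¹ • f w) = (2 * π * Complex.I : ℂ) ^ n • f z := by
  have hr : 0 < r := dist_nonneg.trans_lt hz
  induction n with
  | zero => simp [Subsingleton.elim c z]
  | succ n ih =>
    have hint : TorusIntegrable (fun w => (∏ i, (w i - z i))⁻¹ • f w) c (fun _ => r) := by
      refine ContinuousOn.integrableOn_compact isCompact_Icc ?_
      refine Continuous.continuousOn ?_
      refine Continuous.smul ?_ ?_
      · refine Continuous.inv₀ ?_ fun θ => ?_
        · have := continuous_torusMap c (fun _ => r)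
          fun_prop
        · exact Finset.prod_ne_zero_iff.2 fun i _ => torusMap_sub_ne_zero hz θ i
      · rw [continuous_iff_continuousAt]
        intro θ
        exact ContinuousAt.comp (f := torusMap c (fun _ => r)) (hf _ (torusMap_mem_closedBall c hr.le θ)).continuousAt
          (continuous_torusMap c _).continuousAt
    have hz0 : z 0 ∈ ball (c 0) r := (dist_le_pi_dist z c 0).trans_lt hz
    have hzt : z ∘ Fin.succ ∈ ball (c ∘ Fin.succ) r := by
      rw [mem_ball, dist_pi_lt_iff hr] at hz ⊢
      exact fun i => hz _
    have hmem : ∀ x ∈ closedBall (c 0) r, ∀ y ∈ closedBall (c ∘ Fin.succ) r,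
        (Fin.cons x y : Fin (n + 1) → ℂ) ∈ closedBall c r := by
      intro x hx y hy
      rw [mem_closedBall, dist_pi_le_iff hr.le] at hy ⊢
      intro i
      refine Fin.cases ?_ (fun i => ?_) i
      · simpa using hx
      · simpa using hy i
    have hcons1 : ∀ x : ℂ, Differentiable ℂ (fun y : Fin n → ℂ => (Fin.cons x y : Fin (n + 1) → ℂ)) := by
      intro x
      rw [differentiable_pi]
      intro i
      refine Fin.cases ?_ (fun i => ?_) i
      · simp
      · simp only [Fin.cons_succ]; fun_prop
    have hcons2 : ∀ y : Fin n → ℂ, Differentiable ℂ (fun x : ℂ => (Fin.cons x y : Fin (n + 1) → ℂ)) := by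
      intro y
      rw [differentiable_pi]
      intro i
      refine Fin.cases ?_ (fun i => ?_) i
      · simp only [Fin.cons_zero]; fun_prop
      · simp
    rw [torusIntegral_succ hint]
    have key : ∀ x ∈ sphere (c 0) r,
        (∯ y in T(c ∘ Fin.succ, (fun _ : Fin (n + 1) => r) ∘ Fin.succ),
          (∏ i, ((Fin.cons x y : Fin (n + 1) → ℂ) i - z i))⁻¹ • f (Fin.cons x y)) =
        (x - z 0)⁻¹ • (2 * π * Complex.I : ℂ) ^ n • f (Fin.cons x (z ∘ Fin.succ)) := by
      intro x hx
      have := ih (c ∘ Fin.succ) (f := fun y => f (Fin.cons x y))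
        (fun y hy => ((hf _ (hmem x (sphere_subset_closedBall hx) y hy)).comp y (hcons1 x y))) hzt
      rw [← this, ← torusIntegral_smul]
      congr 1
      funext y
      rw [Fin.prod_univ_succ, mul_inv, mul_smul]
      simp
    rw [circleIntegral.integral_congr hr.le key]
    have h2 : DifferentiableOn ℂ (fun x => f (Fin.cons x (z ∘ Fin.succ))) (closedBall (c 0) r) := by
      intro x hx
      exact ((hf _ (hmem x hx _ (ball_subset_closedBall hzt))).comp x (hcons2 _ x)).differentiableWithinAt
    have h3 := (h2.diffContOnCl_ball (U := closedBall (c 0) r) Subset.rfl).circleIntegral_sub_inv_smul hz0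
    simp_rw [smul_comm _ ((2 * π * Complex.I : ℂ) ^ n)]
    rw [circleIntegral.integral_smul, h3, smul_smul, ← pow_succ]
    congr 2
    funext i
    refine Fin.cases ?_ (fun i => ?_) i <;> simp

/-- A function on a polydisc that is represented by its Cauchy integral over the distinguished
boundary is analytic. -/
theorem analyticOnNhd_of_eq_torusIntegral {n : ℕ} (c : Fin n → ℂ) {r : ℝ} {f : (Fin n → ℂ) → E}
    (hf : ContinuousOn f (closedBall c r))
    (h : ∀ z ∈ ball c r,
      (∯ w in T(c, fun _ => r), (∏ i, (w i - z i))⁻¹ • f w) = (2 * π * Complex.I : ℂ) ^ n • f z) :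
    AnalyticOnNhd ℂ f (ball c r) := by
  intro z₀ hz₀
  have hr : 0 < r := dist_nonneg.trans_lt hz₀
  let K : Set (Fin n → ℝ) := Icc 0 fun _ => 2 * π
  have : CompactSpace K := isCompact_iff_compactSpace.1 isCompact_Icc
  let μ : Measure K := Measure.comap Subtype.val volume
  have : IsFiniteMeasure μ := ⟨by
    rw [comap_subtype_coe_apply measurableSet_Icc, image_univ, Subtype.range_coe]
    exact isCompact_Icc.measure_lt_top⟩
  let F : C(K, E) := ⟨fun θ => (∏ i, (r : ℂ) * Complex.exp ((θ.1 i : ℂ) * Complex.I) * Complex.I) •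
      f (torusMap c (fun _ => r) θ.1), by
    refine Continuous.smul (continuous_finsetProd _ fun i _ => ?_) ?_
    · have : Continuous fun θ : K => θ.1 i := (continuous_apply i).comp continuous_subtype_val
      exact (continuous_const.mul (Complex.continuous_exp.comp
        ((Complex.continuous_ofReal.comp this).mul continuous_const))).mul continuous_const
    exact hf.comp_continuous ((continuous_torusMap c _).comp continuous_subtype_val)
      (fun θ => torusMap_mem_closedBall c hr.le _)⟩
  let I : C(K, ℂ) →L[ℂ] E := LinearMap.mkContinuous
    { toFun := fun k => ∫ θ, k θ • F θ ∂μ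
      map_add' := fun k k' => by
        simp only [ContinuousMap.add_apply, add_smul]
        exact integral_add
          ((k.continuous.smul F.continuous).integrable_of_hasCompactSupport
            (HasCompactSupport.of_compactSpace _))
          ((k'.continuous.smul F.continuous).integrable_of_hasCompactSupport
            (HasCompactSupport.of_compactSpace _))
      map_smul' := fun a k => by
        simp only [ContinuousMap.smul_apply, smul_assoc, RingHom.id_apply]
        exact integral_smul _ _ }
    (‖F‖ * μ.real univ) (fun k => by
      refine (norm_integral_le_of_norm_le_const (C := ‖k‖ * ‖F‖) (.of_forall fun θ => ?_)).trans ?_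
      · rw [norm_smul]
        gcongr
        · exact k.norm_coe_le_norm θ
        · exact F.norm_coe_le_norm θ
      · apply le_of_eq; ring)
  let k : (Fin n → ℂ) → C(K, ℂ) := fun z => ∏ i : Fin n,
    ((⟨fun θ => torusMap c (fun _ => r) θ.1 i, by
      have := (continuous_torusMap c (fun _ => r)).comp (continuous_subtype_val (p := (· ∈ K)))
      exact (continuous_apply i).comp this⟩ : C(K, ℂ)) -
      algebraMap ℂ C(K, ℂ) (z i))
  have hk : ∀ z θ, k z θ = ∏ i, (torusMap c (fun _ => r) θ.1 i - z i) := by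
    intro z θ
    simp [k, ContinuousMap.prod_apply]
  have hunit : ∀ z ∈ ball c r, IsUnit (k z) := by
    intro z hz
    rw [ContinuousMap.isUnit_iff_forall_ne_zero]
    intro θ
    rw [hk]
    exact Finset.prod_ne_zero_iff.2 fun i _ => torusMap_sub_ne_zero hz _ i
  have hkan : AnalyticAt ℂ k z₀ := by
    refine Finset.analyticAt_fun_prod _ fun i _ => analyticAt_const.sub ?_
    exact ((algebraMapCLM ℂ C(K, ℂ)).analyticAt _).comp
      ((ContinuousLinearMap.proj (R := ℂ) (φ := fun _ : Fin n => ℂ) i).analyticAt z₀)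
  have hinv : AnalyticAt ℂ (fun z => Ring.inverse (k z)) z₀ := by
    obtain ⟨u, hu⟩ := hunit z₀ hz₀
    have := analyticAt_inverse (𝕜 := ℂ) u
    rw [hu] at this
    exact this.comp hkan
  have hI : AnalyticAt ℂ (fun z => ((2 * π * Complex.I : ℂ) ^ n)⁻¹ • I (Ring.inverse (k z))) z₀ :=
    analyticAt_const.smul ((I.analyticAt _).comp hinv)
  refine hI.congr ?_
  filter_upwards [isOpen_ball.mem_nhds hz₀] with z hz
  have h2 : ((2 * π * Complex.I : ℂ) ^ n) ≠ 0 := by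
    simp [Real.pi_ne_zero]
  rw [inv_smul_eq_iff₀ h2, ← h z hz]
  change ∫ θ, (Ring.inverse (k z)) θ • F θ ∂μ = _
  have hval : ∀ θ, (Ring.inverse (k z)) θ = (k z θ)⁻¹ := by
    intro θ
    have := Ring.inverse_mul_cancel _ (hunit z hz)
    have h3 := congrArg (fun g : C(K, ℂ) => g θ) this
    simp only [ContinuousMap.mul_apply, ContinuousMap.one_apply] at h3
    exact eq_inv_of_mul_eq_one_left h3
  rw [torusIntegral, ← integral_subtype_comap measurableSet_Icc]
  refine integral_congr_ae (.of_forall fun θ => ?_)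
  simp only [hval, hk]
  rw [smul_comm]
  simp [F]

theorem TendstoUniformlyOn.analyticOnNhd_ball [CompleteSpace E] {n : ℕ} {c : Fin n → ℂ} {r : ℝ}
    {F : ℕ → (Fin n → ℂ) → E} {f : (Fin n → ℂ) → E}
    (hF : ∀ k, ∀ z ∈ closedBall c r, DifferentiableAt ℂ (F k) z)
    (h : TendstoUniformlyOn F f atTop (closedBall c r)) : AnalyticOnNhd ℂ f (ball c r) := by
  have hfc : ContinuousOn f (closedBall c r) :=
    h.continuousOn (Eventually.frequently <| .of_forall fun k z hz =>
      (hF k z hz).continuousAt.continuousWithinAt)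
  refine analyticOnNhd_of_eq_torusIntegral c hfc fun z hz => ?_
  have hr : 0 < r := dist_nonneg.trans_lt hz
  have h1 : Tendsto (fun k => (2 * π * Complex.I : ℂ) ^ n • F k z) atTop
      (𝓝 ((2 * π * Complex.I : ℂ) ^ n • f z)) :=
    (h.tendsto_at (ball_subset_closedBall hz)).const_smul _
  refine tendsto_nhds_unique ?_ h1
  have h2 : ∀ k, (2 * π * Complex.I : ℂ) ^ n • F k z = _ :=
    fun k => (torusIntegral_cauchy c (hF k) hz).symm
  simp_rw [h2]
  let Φ : (Fin n → ℝ) → ℂ := fun θ => (∏ i, (r : ℂ) * Complex.exp ((θ i : ℂ) * Complex.I) * Complex.I) *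
    (∏ i, (torusMap c (fun _ => r) θ i - z i))⁻¹
  have hΦ : Continuous Φ := by
    refine Continuous.mul (by fun_prop) (Continuous.inv₀ ?_ fun θ => ?_)
    · have := continuous_torusMap c (fun _ => r)
      fun_prop
    · exact Finset.prod_ne_zero_iff.2 fun i _ => torusMap_sub_ne_zero hz θ i
  have hT : ∀ g : (Fin n → ℂ) → E, (∯ w in T(c, fun _ => r), (∏ i, (w i - z i))⁻¹ • g w) =
      ∫ θ in Icc (0 : Fin n → ℝ) fun _ => 2 * π, Φ θ • g (torusMap c (fun _ => r) θ) := by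
    intro g
    simp only [torusIntegral, Φ, mul_smul]
  simp_rw [hT]
  obtain ⟨M, hM⟩ := (isCompact_Icc (a := (0 : Fin n → ℝ)) (b := fun _ => 2 * π)).exists_bound_of_continuousOn
    (hΦ.continuousOn)
  obtain ⟨M', hM'⟩ := (isCompact_closedBall c r).exists_bound_of_continuousOn hfc
  have h1' : ∀ᶠ k in atTop, ∀ w ∈ closedBall c r, dist (f w) (F k w) < 1 :=
    Metric.tendstoUniformlyOn_iff.1 h 1 one_pos
  refine tendsto_integral_filter_of_dominated_convergence (fun _ => M * (M' + 1)) ?_ ?_ ?_ ?_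
  · refine .of_forall fun k => ?_
    refine Continuous.aestronglyMeasurable (hΦ.smul ?_)
    rw [continuous_iff_continuousAt]
    intro θ
    exact ContinuousAt.comp (f := torusMap c (fun _ => r))
      (hF k _ (torusMap_mem_closedBall c hr.le θ)).continuousAt (continuous_torusMap c _).continuousAt
  · filter_upwards [h1'] with k hk
    filter_upwards [ae_restrict_mem measurableSet_Icc] with θ hθ
    rw [norm_smul]
    have a1 := hM θ hθ
    have a2 := hM' _ (torusMap_mem_closedBall c hr.le θ)
    have a3 := hk _ (torusMap_mem_closedBall c hr.le θ)
    have a4 : ‖F k (torusMap c (fun _ => r) θ)‖ ≤ M' + 1 := by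
      have := norm_le_norm_add_norm_sub (f (torusMap c (fun _ => r) θ)) (F k (torusMap c (fun _ => r) θ))
      rw [dist_eq_norm] at a3
      linarith
    have := norm_nonneg (Φ θ)
    gcongr
    exact this.trans a1
  · exact integrableOn_const (by exact isCompact_Icc.measure_lt_top.ne)
  · refine .of_forall fun θ => ?_
    exact (h.tendsto_at (torusMap_mem_closedBall c hr.le θ)).const_smul _


/-- The integral of a holomorphic function of several variables over an interval of real
parameters is again analytic. -/
theorem analyticOnNhd_ball_intervalIntegral [CompleteSpace E] {n : ℕ} {c : Fin n → ℂ} {r : ℝ}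
    {a b : ℝ} (hab : a ≤ b) {g : (Fin n → ℂ) → ℝ → E}
    (hc : ContinuousOn (Function.uncurry g) (closedBall c r ×ˢ Icc a b))
    (hd : ∀ s ∈ Icc a b, ∀ z ∈ closedBall c r, DifferentiableAt ℂ (fun z => g z s) z) :
    AnalyticOnNhd ℂ (fun z => ∫ s in a..b, g z s) (ball c r) := by
  have hcomp : IsCompact (closedBall c r ×ˢ Icc a b) := (isCompact_closedBall c r).prod isCompact_Icc
  obtain ⟨M, hM⟩ := hcomp.exists_bound_of_continuousOn hc
  have hI : ∀ z, ∫ s in a..b, g z s = ∫ s in Icc a b, g z s := fun z => by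
    rw [intervalIntegral.integral_of_le hab, integral_Icc_eq_integral_Ioc]
  simp_rw [hI]
  have hgz : ∀ z ∈ closedBall c r, ContinuousOn (g z) (Icc a b) := fun z hz =>
    hc.comp (f := fun s => (z, s)) (by fun_prop) fun s hs => ⟨hz, hs⟩
  refine analyticOnNhd_of_eq_torusIntegral c ?_ fun z hz => ?_
  · refine continuousOn_of_dominated (bound := fun _ => M) ?_ ?_ ?_ ?_
    · exact fun z hz => (hgz z hz).aestronglyMeasurable measurableSet_Icc
    · intro z hz
      filter_upwards [ae_restrict_mem measurableSet_Icc] with s hs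
      exact hM (z, s) ⟨hz, hs⟩
    · exact integrableOn_const (by exact isCompact_Icc.measure_lt_top.ne)
    · filter_upwards [ae_restrict_mem measurableSet_Icc] with s hs
      exact hc.comp (f := fun z => (z, s)) (by fun_prop) fun z hz => ⟨hz, hs⟩
  · have hr : 0 < r := dist_nonneg.trans_lt hz
    have hT : ∀ f : (Fin n → ℂ) → E, (∯ w in T(c, fun _ => r), (∏ i, (w i - z i))⁻¹ • f w) =
        ∫ θ in Icc (0 : Fin n → ℝ) fun _ => 2 * π,
          ((∏ i, (r : ℂ) * Complex.exp ((θ i : ℂ) * Complex.I) * Complex.I) *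
          (∏ i, (torusMap c (fun _ => r) θ i - z i))⁻¹) • f (torusMap c (fun _ => r) θ) := by
      intro f
      simp only [torusIntegral, mul_smul]
    rw [hT, ← integral_smul]
    simp_rw [← integral_smul]
    rw [integral_integral_swap]
    · refine setIntegral_congr_fun measurableSet_Icc fun s hs => ?_
      rw [← hT (fun w => g w s), torusIntegral_cauchy c (hd s hs) hz]
    · rw [Measure.prod_restrict]
      refine ContinuousOn.integrableOn_compact (isCompact_Icc.prod isCompact_Icc) ?_
      refine ContinuousOn.smul ?_ ?_
      · refine Continuous.continuousOn ?_
        refine Continuous.mul (by fun_prop) (Continuous.inv₀ ?_ fun θ => ?_)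
        · have := continuous_torusMap c (fun _ => r)
          fun_prop
        · exact Finset.prod_ne_zero_iff.2 fun i _ => torusMap_sub_ne_zero hz _ i
      · refine hc.comp (f := fun q : (Fin n → ℝ) × ℝ => (torusMap c (fun _ => r) q.1, q.2)) ?_ ?_
        · have := continuous_torusMap c (fun _ => r)
          fun_prop
        · exact fun q hq => ⟨torusMap_mem_closedBall c hr.le _, hq.2⟩

variable {Z : Type*} [NormedAddCommGroup Z] [NormedSpace ℂ Z] [FiniteDimensional ℂ Z]

/-- Locally uniform limits of analytic functions of several variables are analytic. -/
theorem analyticOnNhd_of_tendsto_locally_uniformly [CompleteSpace E] {U : Set Z}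
    {F : ℕ → Z → E} {f : Z → E} (hU : IsOpen U) (hF : ∀ k, AnalyticOnNhd ℂ (F k) U)
    (h : ∀ z ∈ U, ∃ t ∈ 𝓝 z, TendstoUniformlyOn F f atTop t) : AnalyticOnNhd ℂ f U := by
  intro z₀ hz₀
  let e : Z ≃L[ℂ] (Fin (Module.finrank ℂ Z) → ℂ) := (Module.finBasis ℂ Z).equivFunL
  obtain ⟨t, ht, htu⟩ := h z₀ hz₀
  have h1 : e.symm ⁻¹' (t ∩ U) ∈ 𝓝 (e z₀) :=
    e.symm.continuous.continuousAt.preimage_mem_nhds (by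
      rw [e.symm_apply_apply]; exact inter_mem ht (hU.mem_nhds hz₀))
  obtain ⟨r, hr, hrs⟩ := Metric.nhds_basis_closedBall.mem_iff.1 h1
  have h2 := TendstoUniformlyOn.analyticOnNhd_ball (c := e z₀) (r := r)
    (F := fun k => F k ∘ e.symm) (f := f ∘ e.symm)
    (fun k z hz => ((hF k _ (hrs hz).2).comp (e.symm.analyticAt z)).differentiableAt)
    ((htu.comp e.symm).mono (hrs.trans (preimage_mono inter_subset_left)))
  have h3 := (h2 (e z₀) (mem_ball_self hr)).comp (e.analyticAt z₀)
  refine h3.congr (.of_forall fun z => ?_)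
  simp

/-- The integral of an analytic function of several variables over an interval of real
parameters is again analytic. -/
theorem analyticOnNhd_intervalIntegral [CompleteSpace E] {U : Set Z} (hU : IsOpen U) {a b : ℝ}
    (hab : a ≤ b) {g : Z → ℝ → E} (hc : ContinuousOn (Function.uncurry g) (U ×ˢ Icc a b))
    (hd : ∀ s ∈ Icc a b, AnalyticOnNhd ℂ (fun z => g z s) U) :
    AnalyticOnNhd ℂ (fun z => ∫ s in a..b, g z s) U := by
  intro z₀ hz₀
  let e : Z ≃L[ℂ] (Fin (Module.finrank ℂ Z) → ℂ) := (Module.finBasis ℂ Z).equivFunL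
  have h1 : e.symm ⁻¹' U ∈ 𝓝 (e z₀) :=
    e.symm.continuous.continuousAt.preimage_mem_nhds (by
      rw [e.symm_apply_apply]; exact hU.mem_nhds hz₀)
  obtain ⟨r, hr, hrs⟩ := Metric.nhds_basis_closedBall.mem_iff.1 h1
  have hc' : ContinuousOn (Function.uncurry fun z s => g (e.symm z) s)
      (closedBall (e z₀) r ×ˢ Icc a b) := by
    have hm : MapsTo (fun q : (Fin (Module.finrank ℂ Z) → ℂ) × ℝ => (e.symm q.1, q.2))
        (closedBall (e z₀) r ×ˢ Icc a b) (U ×ˢ Icc a b) := fun q hq => ⟨hrs hq.1, hq.2⟩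
    have hcont : Continuous (fun q : (Fin (Module.finrank ℂ Z) → ℂ) × ℝ => (e.symm q.1, q.2)) :=
      (e.symm.continuous.comp continuous_fst).prodMk continuous_snd
    exact hc.comp hcont.continuousOn hm
  have hd' : ∀ s ∈ Icc a b, ∀ z ∈ closedBall (e z₀) r,
      DifferentiableAt ℂ (fun z => g (e.symm z) s) z := by
    intro s hs z hz
    have h4 : DifferentiableAt ℂ (fun z => g z s) (e.symm z) := (hd s hs _ (hrs hz)).differentiableAt
    exact h4.comp z e.symm.differentiableAt
  have h2 := analyticOnNhd_ball_intervalIntegral hab hc' hd'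
  have h3 := (h2 (e z₀) (mem_ball_self hr)).comp (e.analyticAt z₀)
  refine h3.congr (.of_forall fun z => ?_)
  simp

/-- **Removable singularities with parameters.**  If `f (x, ·)` is holomorphic and has a limit at
`p x` in a punctured disc, then `f` extends analytically across the hypersurface `w = p x`. -/
theorem exists_analyticOnNhd_extension [CompleteSpace E] {f : Z × ℂ → E} {p : Z → ℂ} {x₀ : Z}
    {r : ℝ} (hr : 0 < r) (hp : ContinuousAt p x₀)
    (hf : ∀ᶠ x in 𝓝 x₀, ∀ w ∈ closedBall (p x₀) r, w ≠ p x → AnalyticAt ℂ f (x, w))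
    (hb : ∀ᶠ x in 𝓝 x₀, ∃ y, Tendsto (fun w => f (x, w)) (𝓝[≠] (p x)) (𝓝 y)) :
    ∃ (F : Z × ℂ → E) (O : Set Z), IsOpen O ∧ x₀ ∈ O ∧ AnalyticOnNhd ℂ F (O ×ˢ ball (p x₀) r) ∧
      ∀ x ∈ O, ∀ w ∈ ball (p x₀) r, w ≠ p x → F (x, w) = f (x, w) := by
  have hpr : ∀ᶠ x in 𝓝 x₀, p x ∈ ball (p x₀) r := hp (ball_mem_nhds _ hr)
  obtain ⟨O, hO, hOo, hx₀⟩ := _root_.eventually_nhds_iff.1 ((hf.and hb).and hpr)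
  let g : Z × ℂ → ℝ → E := fun q θ =>
    deriv (circleMap (p x₀) r) θ • (circleMap (p x₀) r θ - q.2)⁻¹ • f (q.1, circleMap (p x₀) r θ)
  have hcm : ∀ θ : ℝ, circleMap (p x₀) r θ ∈ sphere (p x₀) r := fun θ =>
    circleMap_mem_sphere _ hr.le θ
  have hne : ∀ θ : ℝ, ∀ w ∈ ball (p x₀) r, circleMap (p x₀) r θ ≠ w := fun θ w hw h => by
    have h1 := hcm θ
    rw [h, mem_sphere] at h1
    rw [mem_ball] at hw
    exact hw.ne h1
  have hfa : ∀ x ∈ O, ∀ θ, AnalyticAt ℂ f (x, circleMap (p x₀) r θ) := fun x hx θ =>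
    (hO x hx).1.1 _ (sphere_subset_closedBall (hcm θ)) (hne θ _ (hO x hx).2)
  have hU : IsOpen (O ×ˢ ball (p x₀) r) := hOo.prod isOpen_ball
  have hgc : ContinuousOn (Function.uncurry g) ((O ×ˢ ball (p x₀) r) ×ˢ Icc 0 (2 * π)) := by
    rintro ⟨⟨x, w⟩, θ⟩ ⟨⟨hx, hw⟩, -⟩
    refine ContinuousAt.continuousWithinAt ?_
    have h1 : ContinuousAt (fun q : (Z × ℂ) × ℝ => deriv (circleMap (p x₀) r) q.2) ((x, w), θ) := by
      simp only [deriv_circleMap]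
      have : Continuous (fun q : (Z × ℂ) × ℝ => circleMap 0 r q.2 * Complex.I) :=
        ((continuous_circleMap 0 r).comp continuous_snd).mul continuous_const
      exact this.continuousAt
    have h2 : ContinuousAt (fun q : (Z × ℂ) × ℝ => (circleMap (p x₀) r q.2 - q.1.2)⁻¹)
        ((x, w), θ) := by
      refine ContinuousAt.inv₀ ?_ (sub_ne_zero.2 (hne θ w hw))
      exact (((continuous_circleMap _ r).comp continuous_snd).sub
        (continuous_snd.comp continuous_fst)).continuousAt
    have h3 : ContinuousAt (fun q : (Z × ℂ) × ℝ => f (q.1.1, circleMap (p x₀) r q.2))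
        ((x, w), θ) := by
      refine ContinuousAt.comp (f := fun q : (Z × ℂ) × ℝ => (q.1.1, circleMap (p x₀) r q.2))
        (hfa x hx θ).continuousAt ?_
      exact ((continuous_fst.comp continuous_fst).prodMk
        ((continuous_circleMap _ r).comp continuous_snd)).continuousAt
    exact h1.smul (h2.smul h3)
  have hga : ∀ θ ∈ Icc 0 (2 * π), AnalyticOnNhd ℂ (fun q => g q θ) (O ×ˢ ball (p x₀) r) := by
    rintro θ - ⟨x, w⟩ ⟨hx, hw⟩
    refine analyticAt_const.smul (AnalyticAt.smul ?_ ?_)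
    · exact (analyticAt_const.sub analyticAt_snd).inv (sub_ne_zero.2 (hne θ w hw))
    · exact (hfa x hx θ).comp_of_eq (f := fun q : Z × ℂ => (q.1, circleMap (p x₀) r θ))
        (analyticAt_fst.prod analyticAt_const) rfl
  have key := analyticOnNhd_intervalIntegral hU Real.two_pi_pos.le hgc hga
  refine ⟨fun q => (2 * π * Complex.I : ℂ)⁻¹ • ∫ θ in (0 : ℝ)..2 * π, g q θ, O, hOo, hx₀,
    fun q hq => analyticAt_const.smul (key q hq), fun x hx w hw hwp => ?_⟩
  obtain ⟨y, hy⟩ := (hO x hx).1.2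
  let h : ℂ → E := Function.update (fun w => f (x, w)) (p x) y
  have hha : ∀ w ∈ closedBall (p x₀) r, w ≠ p x → DifferentiableAt ℂ h w := by
    intro w hw hwp
    have h1 : DifferentiableAt ℂ (fun w => f (x, w)) w :=
      (((hO x hx).1.1 w hw hwp).comp_of_eq (f := fun w => (x, w))
        (analyticAt_const.prod analyticAt_id) rfl).differentiableAt
    refine h1.congr_of_eventuallyEq ?_
    filter_upwards [isOpen_compl_singleton.mem_nhds hwp] with v hv
    exact Function.update_of_ne hv _ _
  have hhc : ContinuousAt h (p x) := by
    rw [continuousAt_update_same]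
    exact hy
  have hcont : ContinuousOn h (closedBall (p x₀) r) := by
    intro w hw
    rcases eq_or_ne w (p x) with rfl | hwp
    · exact hhc.continuousWithinAt
    · exact (hha w hw hwp).continuousAt.continuousWithinAt
  have hC := Complex.two_pi_I_inv_smul_circleIntegral_sub_inv_smul_of_differentiable_on_off_countable
    (countable_singleton (p x)) hw hcont
    (fun w hw => hha w (ball_subset_closedBall hw.1) hw.2)
  rw [show h w = f (x, w) from Function.update_of_ne hwp _ _] at hC
  rw [← hC, circleIntegral]
  refine congrArg (fun v : E => (2 * π * Complex.I : ℂ)⁻¹ • v) ?_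
  refine intervalIntegral.integral_congr fun θ _ => ?_
  simp only [g]
  rw [show h (circleMap (p x₀) r θ) = f (x, circleMap (p x₀) r θ) from
    Function.update_of_ne (hne θ _ (hO x hx).2) _ _]

end SeveralVariables

/-! ### Linear flows and polynomial growth -/

section LinearFlow

open Metric Set

variable {Z : Type*} [NormedAddCommGroup Z] [NormedSpace ℂ Z]
variable {𝔸 : Type*} [NormedRing 𝔸] [NormedAlgebra ℂ 𝔸]

/-- The terms of the Picard series of the equation `∂G/∂e = - G u` with `G = 1` on the hyperplane
`τ = t₀`, where `e` is a direction with `τ e = 1`. -/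
noncomputable def picardTerm (e : Z) (τ : Z →L[ℂ] ℂ) (t₀ : ℂ) (u : Z → 𝔸) : ℕ → Z → 𝔸
  | 0 => fun _ => 1
  | n + 1 => fun z => -((τ z - t₀) • ∫ s in (0 : ℝ)..1,
      picardTerm e τ t₀ u n (z + (t₀ + s * (τ z - t₀) - τ z) • e) *
        u (z + (t₀ + s * (τ z - t₀) - τ z) • e))

variable {e : Z} {τ : Z →L[ℂ] ℂ} {t₀ : ℂ} {ρ : ℝ} {u : Z → 𝔸} {D : Set Z}

theorem mem_ball_segment {t : ℂ} (ht : t ∈ ball t₀ ρ) {s : ℝ} (hs : s ∈ Icc (0 : ℝ) 1) :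
    t₀ + s * (t - t₀) ∈ ball t₀ ρ := by
  rw [mem_ball, dist_eq_norm] at ht ⊢
  rw [add_sub_cancel_left, norm_mul, Complex.norm_real, Real.norm_of_nonneg hs.1]
  exact (mul_le_of_le_one_left (norm_nonneg _) hs.2).trans_lt ht

theorem analyticOnNhd_picardTerm [FiniteDimensional ℂ Z] [CompleteSpace 𝔸] (hD : IsOpen D)
    (hρ : ∀ z ∈ D, τ z ∈ ball t₀ ρ)
    (hs : ∀ z ∈ D, ∀ t ∈ ball t₀ ρ, z + (t - τ z) • e ∈ D) (hu : AnalyticOnNhd ℂ u D) (n : ℕ) :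
    AnalyticOnNhd ℂ (picardTerm e τ t₀ u n) D := by
  induction n with
  | zero => exact fun z _ => analyticAt_const
  | succ n ih =>
    have hm : ∀ z ∈ D, ∀ s ∈ Icc (0 : ℝ) 1, z + (t₀ + s * (τ z - t₀) - τ z) • e ∈ D :=
      fun z hz s hs' => hs z hz _ (mem_ball_segment (hρ z hz) hs')
    have hh : AnalyticOnNhd ℂ (fun z => picardTerm e τ t₀ u n z * u z) D := ih.mul hu
    have key := analyticOnNhd_intervalIntegral hD (zero_le_one (α := ℝ))
      (g := fun z s => picardTerm e τ t₀ u n (z + (t₀ + s * (τ z - t₀) - τ z) • e) *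
        u (z + (t₀ + s * (τ z - t₀) - τ z) • e)) ?_ ?_
    · intro z hz
      exact (((τ.analyticAt z).sub analyticAt_const).smul (key z hz)).neg
    · refine hh.continuousOn.comp
        (f := fun q : Z × ℝ => q.1 + (t₀ + q.2 * (τ q.1 - t₀) - τ q.1) • e) ?_ ?_
      · exact Continuous.continuousOn (by fun_prop)
      · rintro ⟨z, s⟩ ⟨hz, hs'⟩
        exact hm z hz s hs'
    · intro s hs' z hz
      refine (hh _ (hm z hz s hs')).comp_of_eq
        (f := fun z => z + (t₀ + s * (τ z - t₀) - τ z) • e) ?_ rfl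
      have := τ.analyticAt z
      fun_prop

theorem hasDerivAt_picardTerm_succ [FiniteDimensional ℂ Z] [CompleteSpace 𝔸] (hD : IsOpen D)
    (hτ : τ e = 1) (hρ : ∀ z ∈ D, τ z ∈ ball t₀ ρ)
    (hs : ∀ z ∈ D, ∀ t ∈ ball t₀ ρ, z + (t - τ z) • e ∈ D) (hu : AnalyticOnNhd ℂ u D) (n : ℕ)
    {z : Z} (hz : z ∈ D) :
    HasDerivAt (fun s : ℂ => picardTerm e τ t₀ u (n + 1) (z + s • e))
      (-(picardTerm e τ t₀ u n z * u z)) 0 := by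
  let h : ℂ → 𝔸 := fun t => picardTerm e τ t₀ u n (z + (t - τ z) • e) * u (z + (t - τ z) • e)
  have hh : DifferentiableOn ℂ h (ball t₀ ρ) := by
    intro t ht
    have h1 : AnalyticAt ℂ (fun z => picardTerm e τ t₀ u n z * u z) (z + (t - τ z) • e) :=
      (analyticOnNhd_picardTerm hD hρ hs hu n _ (hs z hz t ht)).mul (hu _ (hs z hz t ht))
    exact (h1.differentiableAt.comp t (f := fun t : ℂ => z + (t - τ z) • e)
      (by fun_prop)).differentiableWithinAt
  obtain ⟨H, hH⟩ := hh.isExactOn_ball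
  have hρz := hρ z hz
  have h0 : t₀ ∈ ball t₀ ρ := mem_ball_self (dist_nonneg.trans_lt hρz)
  have hint : ∀ T ∈ ball t₀ ρ,
      (T - t₀) • ∫ s in (0 : ℝ)..1, h (t₀ + s * (T - t₀)) = H T - H t₀ := by
    intro T hT
    have h2 : ∀ s ∈ uIcc (0 : ℝ) 1, HasDerivAt (fun s : ℝ => H (t₀ + s * (T - t₀)))
        ((T - t₀) • h (t₀ + s * (T - t₀))) s := by
      intro s hs'
      rw [uIcc_of_le zero_le_one] at hs'
      have h3 : HasDerivAt (fun s : ℝ => t₀ + s * (T - t₀)) (T - t₀) s := by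
        simpa using ((Complex.ofRealCLM.hasDerivAt (x := s)).mul_const (T - t₀)).const_add t₀
      exact (hH _ (mem_ball_segment hT hs')).scomp s h3
    have h4 : ContinuousOn (fun s : ℝ => (T - t₀) • h (t₀ + s * (T - t₀))) (uIcc 0 1) := by
      rw [uIcc_of_le zero_le_one]
      refine continuousOn_const.smul (hh.continuousOn.comp (f := fun s : ℝ => t₀ + s * (T - t₀))
        (Continuous.continuousOn (by fun_prop)) fun s hs' => mem_ball_segment hT hs')
    have := intervalIntegral.integral_eq_sub_of_hasDerivAt h2 h4.intervalIntegrable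
    rw [intervalIntegral.integral_smul] at this
    simpa using this
  have hev : (fun s : ℂ => picardTerm e τ t₀ u (n + 1) (z + s • e)) =ᶠ[𝓝 0]
      fun s => -(H (τ z + s) - H t₀) := by
    have h5 : ∀ᶠ s : ℂ in 𝓝 0, τ z + s ∈ ball t₀ ρ := by
      have : ContinuousAt (fun s : ℂ => τ z + s) 0 := by fun_prop
      exact this (isOpen_ball.mem_nhds (by simpa using hρz))
    filter_upwards [h5] with s hs'
    rw [← hint _ hs']
    simp only [picardTerm, map_add, map_smul, hτ, smul_eq_mul, mul_one, h]
    have h6 : ∀ v : ℝ, z + s • e + (t₀ + v * (τ z + s - t₀) - (τ z + s)) • e =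
        z + (t₀ + v * (τ z + s - t₀) - τ z) • e := fun v => by
      rw [add_assoc, ← add_smul]; congr 2; ring
    simp_rw [h6]
  refine HasDerivAt.congr_of_eventuallyEq ?_ hev
  have h7 : HasDerivAt (fun s : ℂ => H (τ z + s)) (h (τ z)) 0 := by
    have := hH (τ z) hρz
    have h8 : HasDerivAt (fun s : ℂ => τ z + s) 1 0 := (hasDerivAt_id (0 : ℂ)).const_add (τ z)
    have h9 : HasDerivAt H (h (τ z)) (τ z + 0) := by simpa using this
    have h10 := h9.scomp (0 : ℂ) h8
    rw [one_smul] at h10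
    exact h10
  refine HasDerivAt.congr_deriv (h7.sub_const (H t₀)).neg ?_
  simp [h]

theorem norm_picardTerm_le {K : Set Z} {M : ℝ} (hM : ∀ z ∈ K, ‖u z‖ ≤ M) (hτ : τ e = 1)
    (hK : ∀ z ∈ K, ∀ s ∈ Icc (0 : ℝ) 1, z + (t₀ + s * (τ z - t₀) - τ z) • e ∈ K) (n : ℕ)
    {z : Z} (hz : z ∈ K) :
    ‖picardTerm e τ t₀ u n z‖ ≤ ‖(1 : 𝔸)‖ * ((M * ‖τ z - t₀‖) ^ n / n.factorial) := by
  induction n generalizing z with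
  | zero => simp [picardTerm]
  | succ n ih =>
    have hM0 : 0 ≤ M := (norm_nonneg _).trans (hM z hz)
    simp only [picardTerm, norm_neg, norm_smul]
    have h1 : ∀ s ∈ Icc (0 : ℝ) 1, ‖picardTerm e τ t₀ u n (z + (t₀ + s * (τ z - t₀) - τ z) • e) *
        u (z + (t₀ + s * (τ z - t₀) - τ z) • e)‖ ≤
        ‖(1 : 𝔸)‖ * ((M * ‖τ z - t₀‖) ^ n / n.factorial) * M * s ^ n := by
      intro s hs
      refine (norm_mul_le _ _).trans ?_
      have h2 := ih (hK z hz s hs)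
      have h3 : τ (z + (t₀ + s * (τ z - t₀) - τ z) • e) - t₀ = s * (τ z - t₀) := by
        simp [hτ]
      rw [h3, norm_mul, Complex.norm_real, Real.norm_of_nonneg hs.1] at h2
      calc _ ≤ (‖(1 : 𝔸)‖ * ((M * (s * ‖τ z - t₀‖)) ^ n / n.factorial)) * M := by
            have := hs.1
            exact mul_le_mul h2 (hM _ (hK z hz s hs)) (norm_nonneg _) (by positivity)
        _ = _ := by ring
    have h4 : ‖∫ s in (0 : ℝ)..1, picardTerm e τ t₀ u n (z + (t₀ + s * (τ z - t₀) - τ z) • e) *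
        u (z + (t₀ + s * (τ z - t₀) - τ z) • e)‖ ≤
        ∫ s in (0 : ℝ)..1, ‖(1 : 𝔸)‖ * ((M * ‖τ z - t₀‖) ^ n / n.factorial) * M * s ^ n :=
      intervalIntegral.norm_integral_le_of_norm_le zero_le_one
        (.of_forall fun s hs => h1 s ⟨hs.1.le, hs.2⟩)
        (Continuous.intervalIntegrable (by fun_prop) _ _)
    rw [intervalIntegral.integral_const_mul, integral_pow] at h4
    calc _ ≤ ‖τ z - t₀‖ * _ := mul_le_mul_of_nonneg_left h4 (norm_nonneg _)
      _ = _ := by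
        rw [Nat.factorial_succ]
        push_cast
        field_simp
        ring

/-- **Linear differential equations with holomorphic parameters.**  On a domain `D` whose slices in
the direction `e` are discs around the hyperplane `τ = t₀`, the equation `∂G/∂e = - G u` has an
analytic solution with `G = 1` on that hyperplane. -/
theorem exists_linear_flow [FiniteDimensional ℂ Z] [CompleteSpace 𝔸] (hD : IsOpen D)
    (hτ : τ e = 1) (hρ : ∀ z ∈ D, τ z ∈ ball t₀ ρ)
    (hs : ∀ z ∈ D, ∀ t ∈ ball t₀ ρ, z + (t - τ z) • e ∈ D) (hu : AnalyticOnNhd ℂ u D) :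
    ∃ G : Z → 𝔸, AnalyticOnNhd ℂ G D ∧ (∀ z ∈ D, τ z = t₀ → G z = 1) ∧
      ∀ z ∈ D, HasDerivAt (fun s : ℂ => G (z + s • e)) (-(G z * u z)) 0 := by
  have hloc : ∀ z ∈ D, ∃ t ∈ 𝓝 z, ∃ C : ℕ → ℝ, Summable C ∧
      ∀ n, ∀ w ∈ t, ‖picardTerm e τ t₀ u n w‖ ≤ C n := by
    intro z hz
    have : ProperSpace Z := FiniteDimensional.proper ℂ Z
    obtain ⟨t, ht, htD, htc⟩ := local_compact_nhds (hD.mem_nhds hz)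
    let m : Z × ℝ → Z := fun q => q.1 + (t₀ + q.2 * (τ q.1 - t₀) - τ q.1) • e
    have hm : Continuous m := by fun_prop
    have hKc : IsCompact (m '' (t ×ˢ Icc 0 1)) := (htc.prod isCompact_Icc).image hm
    have hKD : m '' (t ×ˢ Icc 0 1) ⊆ D := by
      rintro _ ⟨⟨w, s⟩, ⟨hw, hs'⟩, rfl⟩
      exact hs w (htD hw) _ (mem_ball_segment (hρ w (htD hw)) hs')
    obtain ⟨M, hM⟩ := hKc.exists_bound_of_continuousOn (hu.continuousOn.mono hKD)
    have hτm : ∀ w (s : ℝ), τ (m (w, s)) - t₀ = s * (τ w - t₀) := fun w s => by simp [m, hτ]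
    have hKs : ∀ w ∈ m '' (t ×ˢ Icc 0 1), ∀ s ∈ Icc (0 : ℝ) 1,
        w + (t₀ + s * (τ w - t₀) - τ w) • e ∈ m '' (t ×ˢ Icc 0 1) := by
      rintro _ ⟨⟨w, s⟩, ⟨hw, hs'⟩, rfl⟩ s' hs''
      refine ⟨(w, s' * s), ⟨hw, mul_nonneg hs''.1 hs'.1, mul_le_one₀ hs''.2 hs'.1 hs'.2⟩, ?_⟩
      have h1 := hτm w s
      have h2 : τ (m (w, s)) = t₀ + s * (τ w - t₀) := by rw [← h1]; ring
      rw [h2]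
      simp only [m]
      rw [add_assoc, ← add_smul]
      congr 2
      push_cast
      ring
    have htK : t ⊆ m '' (t ×ˢ Icc 0 1) := fun w hw => ⟨(w, 1), ⟨hw, by simp⟩, by simp [m]⟩
    refine ⟨t, ht, fun n => ‖(1 : 𝔸)‖ * ((M * ρ) ^ n / n.factorial),
      (Real.summable_pow_div_factorial _).mul_left _, fun n w hw => ?_⟩
    refine (norm_picardTerm_le hM hτ hKs n (htK hw)).trans ?_
    have hM0 : 0 ≤ M := (norm_nonneg _).trans (hM _ (htK hw))
    have h3 : ‖τ w - t₀‖ ≤ ρ := by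
      rw [← dist_eq_norm]; exact (hρ w (htD hw)).le
    have := norm_nonneg (1 : 𝔸)
    change _ ≤ ‖(1 : 𝔸)‖ * ((M * ρ) ^ n / n.factorial)
    gcongr
  have hunif : ∀ z ∈ D, ∃ t ∈ 𝓝 z, TendstoUniformlyOn
      (fun N w => ∑ n ∈ Finset.range N, picardTerm e τ t₀ u n w)
      (fun w => ∑' n, picardTerm e τ t₀ u n w) atTop t := by
    intro z hz
    obtain ⟨t, ht, C, hC, hCb⟩ := hloc z hz
    exact ⟨t, ht, tendstoUniformlyOn_tsum_nat hC hCb⟩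
  have hpan := analyticOnNhd_picardTerm hD hρ hs hu
  have han : AnalyticOnNhd ℂ (fun w => ∑' n, picardTerm e τ t₀ u n w) D :=
    analyticOnNhd_of_tendsto_locally_uniformly hD
      (fun N z hz => Finset.analyticAt_fun_sum _ fun n _ => hpan n z hz) hunif
  refine ⟨_, han, ?_, ?_⟩
  · intro z hz hz0
    rw [tsum_eq_single 0]
    · rfl
    · intro n hn
      obtain ⟨k, rfl⟩ := Nat.exists_eq_succ_of_ne_zero hn
      simp [picardTerm, hz0]
  · intro z hz
    let V : Set ℂ := (fun s : ℂ => z + s • e) ⁻¹' D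
    have hVo : IsOpen V := hD.preimage (by fun_prop)
    have h0V : (0 : ℂ) ∈ V := by simpa [V] using hz
    have hmap : ∀ s : ℂ, AnalyticAt ℂ (fun s : ℂ => z + s • e) s := fun s => by fun_prop
    have hdiff : ∀ n, DifferentiableOn ℂ (fun s : ℂ => picardTerm e τ t₀ u n (z + s • e)) V :=
      fun n s hs' => ((hpan n _ hs').comp_of_eq (hmap s) rfl).differentiableAt.differentiableWithinAt
    have hT : TendstoLocallyUniformlyOn
        (fun N (s : ℂ) => ∑ n ∈ Finset.range N, picardTerm e τ t₀ u n (z + s • e))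
        (fun s : ℂ => ∑' n, picardTerm e τ t₀ u n (z + s • e)) atTop V := by
      intro U hU s hs'
      obtain ⟨t, ht, htu⟩ := hunif _ hs'
      refine ⟨(fun s : ℂ => z + s • e) ⁻¹' t, mem_nhdsWithin_of_mem_nhds
        ((hmap s).continuousAt ht), ?_⟩
      filter_upwards [htu U hU] with N hN s' hs''
      exact hN _ hs''
    have hd := (hT.deriv (.of_forall fun N => DifferentiableOn.fun_sum fun n _ => hdiff n)
      hVo).tendsto_at h0V
    have hd2 := (tendsto_add_atTop_iff_nat 1).2 hd
    have hval : ∀ N, deriv (fun s : ℂ => ∑ n ∈ Finset.range (N + 1),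
        picardTerm e τ t₀ u n (z + s • e)) 0 =
        -((∑ n ∈ Finset.range N, picardTerm e τ t₀ u n z) * u z) := by
      intro N
      have h1 : HasDerivAt (fun s : ℂ => ∑ n ∈ Finset.range N,
          picardTerm e τ t₀ u (n + 1) (z + s • e))
          (∑ n ∈ Finset.range N, -(picardTerm e τ t₀ u n z * u z)) 0 :=
        HasDerivAt.fun_sum fun n _ => hasDerivAt_picardTerm_succ hD hτ hρ hs hu n hz
      have h2 := h1.add_const (1 : 𝔸)
      rw [Finset.sum_neg_distrib, ← Finset.sum_mul] at h2
      rw [← h2.deriv]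
      congr 1
      funext s
      rw [Finset.sum_range_succ']
      rfl
    simp only [Function.comp_def, hval] at hd2
    have hlim : Tendsto (fun N => -((∑ n ∈ Finset.range N, picardTerm e τ t₀ u n z) * u z)) atTop
        (𝓝 (-((∑' n, picardTerm e τ t₀ u n z) * u z))) := by
      obtain ⟨t, ht, htu⟩ := hunif z hz
      exact ((htu.tendsto_at (mem_of_mem_nhds ht)).mul_const _).neg
    have huniq := tendsto_nhds_unique hlim hd2
    rw [huniq]
    refine DifferentiableAt.hasDerivAt ?_
    have h0 : AnalyticAt ℂ (fun w => ∑' n, picardTerm e τ t₀ u n w) (z + (0 : ℂ) • e) := by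
      simpa using han z hz
    exact (h0.comp_of_eq (hmap 0) rfl).differentiableAt

end LinearFlow

section Growth

open Set

/-- Grönwall's inequality for a solution of a homogeneous linear differential equation. -/
theorem norm_le_mul_exp_of_norm_deriv_le {E : Type*} [NormedAddCommGroup E] [NormedSpace ℝ E]
    {f f' : ℝ → E} {C S : ℝ} (hS : 0 ≤ S) (hf : ∀ s ∈ Icc 0 S, HasDerivAt f (f' s) s)
    (hb : ∀ s ∈ Icc 0 S, ‖f' s‖ ≤ C * ‖f s‖) : ‖f S‖ ≤ ‖f 0‖ * Real.exp (C * S) := by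
  have := norm_le_gronwallBound_of_norm_deriv_right_le (f := f) (f' := f') (δ := ‖f 0‖) (K := C)
    (ε := 0) (a := 0) (b := S) (fun s hs => (hf s hs).continuousAt.continuousWithinAt)
    (fun s hs => (hf s ⟨hs.1, hs.2.le⟩).hasDerivWithinAt) le_rfl
    (fun s hs => by simpa using hb s ⟨hs.1, hs.2.le⟩) S ⟨hS, le_rfl⟩
  simpa [gronwallBound_ε0] using this

/-- An entire function of polynomial growth is a polynomial. -/
theorem exists_polynomial_of_differentiable {M : ℕ} {h : ℂ → ℂ} (hd : Differentiable ℂ h)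
    {C R : ℝ} (hg : ∀ l, R ≤ ‖l‖ → ‖h l‖ ≤ C * ‖l‖ ^ M) :
    ∃ p : Polynomial ℂ, p.natDegree ≤ M ∧ ∀ l, h l = p.eval l := by
  induction M generalizing h C R with
  | zero =>
    obtain ⟨B, hB⟩ := (isCompact_closedBall (0 : ℂ) R).exists_bound_of_continuousOn
      hd.continuous.continuousOn
    have hbd : Bornology.IsBounded (range h) := by
      refine isBounded_iff_forall_norm_le.2 ⟨max B C, ?_⟩
      rintro _ ⟨l, rfl⟩
      rcases le_total R ‖l‖ with hl | hl
      · exact (by simpa using hg l hl : ‖h l‖ ≤ C).trans (le_max_right _ _)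
      · exact (hB l (by simpa using hl)).trans (le_max_left _ _)
    exact ⟨Polynomial.C (h 0), by simp, fun l => by
      simpa using hd.apply_eq_apply_of_bounded hbd l 0⟩
  | succ M ih =>
    have h1 : Differentiable ℂ (dslope h 0) := by
      rw [← differentiableOn_univ, Complex.differentiableOn_dslope univ_mem]
      exact hd.differentiableOn
    obtain ⟨q, hq, hqe⟩ := ih h1 (C := C + ‖h 0‖) (R := max R 1) (by
      intro l hl
      have hl1 : 1 ≤ ‖l‖ := (le_max_right _ _).trans hl
      have hl0 : l ≠ 0 := by rintro rfl; simp at hl1; linarith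
      rw [dslope_of_ne _ hl0, slope_def_field, norm_div, sub_zero, div_le_iff₀ (by linarith)]
      have h2 := hg l ((le_max_left _ _).trans hl)
      have h3 : 1 ≤ ‖l‖ ^ (M + 1) := one_le_pow₀ hl1
      calc ‖h l - h 0‖ ≤ ‖h l‖ + ‖h 0‖ := norm_sub_le _ _
        _ ≤ C * ‖l‖ ^ (M + 1) + ‖h 0‖ * ‖l‖ ^ (M + 1) := by
            gcongr
            exact le_mul_of_one_le_right (norm_nonneg _) h3
        _ = _ := by ring)
    refine ⟨Polynomial.C (h 0) + Polynomial.X * q, ?_, fun l => ?_⟩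
    · refine (Polynomial.natDegree_add_le _ _).trans (max_le (by simp) ?_)
      refine Polynomial.natDegree_mul_le.trans ?_
      have := Polynomial.natDegree_X_le (R := ℂ)
      omega
    · have := sub_smul_dslope h 0 l
      rw [hqe l] at this
      simp only [sub_zero, smul_eq_mul] at this
      simp [this]

/-- A function of polynomial growth that is holomorphic up to finitely many bounded isolated
singularities agrees off these with a polynomial. -/
theorem exists_polynomial_of_bounded_singularities {M : ℕ} (S : Finset ℂ) {h : ℂ → ℂ}
    (hd : ∀ l, l ∉ S → DifferentiableAt ℂ h l)
    (hb : ∀ z ∈ S, ∃ B, ∀ᶠ l in 𝓝[≠] z, ‖h l‖ ≤ B)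
    {C R : ℝ} (hg : ∀ l, l ∉ S → R ≤ ‖l‖ → ‖h l‖ ≤ C * ‖l‖ ^ M) :
    ∃ p : Polynomial ℂ, p.natDegree ≤ M ∧ ∀ l, l ∉ S → h l = p.eval l := by
  induction S using Finset.induction_on generalizing h R with
  | empty =>
    obtain ⟨p, hp, hpe⟩ := exists_polynomial_of_differentiable (fun l => hd l (by simp))
      (fun l hl => hg l (by simp) hl)
    exact ⟨p, hp, fun l _ => hpe l⟩
  | insert z S hz ih =>
    obtain ⟨B, hB⟩ := hb z (by simp)
    have hnear : ∀ᶠ l in 𝓝 z, l ∉ S := by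
      have : IsOpen ((S : Set ℂ)ᶜ) := S.finite_toSet.isClosed.isOpen_compl
      exact this.mem_nhds (by simpa using hz)
    have hev : ∀ᶠ l in 𝓝[≠] z, DifferentiableAt ℂ h l := by
      filter_upwards [hnear.filter_mono nhdsWithin_le_nhds, self_mem_nhdsWithin] with l hl hl'
      exact hd l (by simp only [Finset.mem_insert, not_or]; exact ⟨hl', hl⟩)
    have hlim := Complex.tendsto_limUnder_of_differentiable_on_punctured_nhds_of_bounded_under hev
      ⟨B + ‖h z‖, by
        rw [eventually_map]
        filter_upwards [hB] with l hl
        exact (norm_sub_le _ _).trans (by gcongr)⟩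
    set y := limUnder (𝓝[≠] z) h with hy
    let h' := Function.update h z y
    have hne : ∀ l, l ≠ z → h' l = h l := fun l hl => Function.update_of_ne hl _ _
    have hcz : ContinuousAt h' z := continuousAt_update_same.2 hlim
    have hdz : DifferentiableAt ℂ h' z := by
      refine (Complex.analyticAt_of_differentiable_on_punctured_nhds_of_continuousAt ?_
        hcz).differentiableAt
      filter_upwards [hev, self_mem_nhdsWithin] with l hl hl'
      refine hl.congr_of_eventuallyEq ?_
      filter_upwards [isOpen_compl_singleton.mem_nhds hl'] with v hv using hne v hv
    have hd' : ∀ l, l ∉ S → DifferentiableAt ℂ h' l := by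
      intro l hl
      rcases eq_or_ne l z with rfl | hlz
      · exact hdz
      · refine (hd l (by simp [hl, hlz])).congr_of_eventuallyEq ?_
        filter_upwards [isOpen_compl_singleton.mem_nhds hlz] with v hv using hne v hv
    obtain ⟨p, hp, hpe⟩ := ih hd' (R := max R (‖z‖ + 1)) (by
      intro w hw
      obtain ⟨B', hB'⟩ := hb w (by simp [hw])
      refine ⟨B', ?_⟩
      have hwz : w ≠ z := fun h => hz (h ▸ hw)
      filter_upwards [hB', mem_nhdsWithin_of_mem_nhds (isOpen_compl_singleton.mem_nhds hwz)]
        with l hl hl'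
      rwa [hne l hl']) (by
      intro l hl hR
      have hlz : l ≠ z := by
        rintro rfl
        have := (le_max_right _ _).trans hR
        linarith
      rw [hne l hlz]
      exact hg l (by simp [hl, hlz]) ((le_max_left _ _).trans hR))
    refine ⟨p, hp, fun l hl => ?_⟩
    simp only [Finset.mem_insert, not_or] at hl
    rw [← hpe l hl.2, hne l hl.1]

end Growth

/-! ### Regular points of rational functions and rational matrices -/

section RationalFunctions

open Polynomial

namespace RatFunc

/-- The rational function `f` has no pole at `q`. -/
def IsRegularAt (f : RatFunc ℂ) (q : ℂ) : Prop := f.denom.eval q ≠ 0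

/-- The value of a rational function at a point. -/
noncomputable abbrev value (f : RatFunc ℂ) (q : ℂ) : ℂ := f.eval (RingHom.id ℂ) q

variable {f g : RatFunc ℂ} {q : ℂ}

theorem isRegularAt_algebraMap (p : ℂ[X]) (q : ℂ) :
    (algebraMap ℂ[X] (RatFunc ℂ) p).IsRegularAt q := by
  simp [IsRegularAt]

theorem isRegularAt_C (c q : ℂ) : (C c).IsRegularAt q := by simp [IsRegularAt]

theorem isRegularAt_X (q : ℂ) : (X : RatFunc ℂ).IsRegularAt q := by simp [IsRegularAt]

theorem isRegularAt_of_denom_dvd {p : ℂ[X]} (h : f.denom ∣ p) (hp : p.eval q ≠ 0) :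
    f.IsRegularAt q := fun h0 => hp (by
  obtain ⟨r, rfl⟩ := h
  simp [h0])

theorem IsRegularAt.add (hf : f.IsRegularAt q) (hg : g.IsRegularAt q) : (f + g).IsRegularAt q :=
  isRegularAt_of_denom_dvd (denom_add_dvd f g) (by simpa using ⟨hf, hg⟩)

theorem IsRegularAt.mul (hf : f.IsRegularAt q) (hg : g.IsRegularAt q) : (f * g).IsRegularAt q :=
  isRegularAt_of_denom_dvd (denom_mul_dvd f g) (by simpa using ⟨hf, hg⟩)

theorem IsRegularAt.neg (hf : f.IsRegularAt q) : (-f).IsRegularAt q := by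
  have := (isRegularAt_C (-1) q).mul hf
  simpa using this

theorem IsRegularAt.sub (hf : f.IsRegularAt q) (hg : g.IsRegularAt q) : (f - g).IsRegularAt q := by
  rw [sub_eq_add_neg]
  exact hf.add hg.neg

theorem IsRegularAt.sum {ι : Type*} {s : Finset ι} {F : ι → RatFunc ℂ}
    (h : ∀ i ∈ s, (F i).IsRegularAt q) : (∑ i ∈ s, F i).IsRegularAt q := by
  classical
  induction s using Finset.induction_on with
  | empty => simp [IsRegularAt]
  | insert a s ha ih =>
    rw [Finset.sum_insert ha]
    exact (h a (by simp)).add (ih fun i hi => h i (by simp [hi]))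

theorem isRegularAt_div {p r : ℂ[X]} (hr : r.eval q ≠ 0) :
    (algebraMap ℂ[X] (RatFunc ℂ) p / algebraMap ℂ[X] (RatFunc ℂ) r).IsRegularAt q :=
  isRegularAt_of_denom_dvd (denom_div_dvd p r) hr

theorem value_add (hf : f.IsRegularAt q) (hg : g.IsRegularAt q) :
    (f + g).value q = f.value q + g.value q := eval_add _ _ hf hg

theorem value_mul (hf : f.IsRegularAt q) (hg : g.IsRegularAt q) :
    (f * g).value q = f.value q * g.value q := eval_mul _ _ hf hg

theorem value_neg (hf : f.IsRegularAt q) : (-f).value q = -f.value q := by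
  have := value_mul (isRegularAt_C (-1) q) hf
  rw [map_neg, map_one, neg_one_mul] at this
  rw [this, show (-1 : RatFunc ℂ) = C (-1) by simp, value, eval_C]
  simp

theorem value_sub (hf : f.IsRegularAt q) (hg : g.IsRegularAt q) :
    (f - g).value q = f.value q - g.value q := by
  rw [sub_eq_add_neg, value_add hf hg.neg, value_neg hg, sub_eq_add_neg]

theorem value_algebraMap (p : ℂ[X]) (q : ℂ) :
    (algebraMap ℂ[X] (RatFunc ℂ) p).value q = p.eval q := by
  simp [value, eval₂_id]

theorem value_div {p r : ℂ[X]} (hr : r.eval q ≠ 0) :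
    (algebraMap ℂ[X] (RatFunc ℂ) p / algebraMap ℂ[X] (RatFunc ℂ) r).value q =
      p.eval q / r.eval q := by
  have hr0 : algebraMap ℂ[X] (RatFunc ℂ) r ≠ 0 := by
    refine algebraMap_ne_zero ?_
    rintro rfl
    simp at hr
  have := value_mul (isRegularAt_div (p := p) hr) (isRegularAt_algebraMap r q)
  rw [div_mul_cancel₀ _ hr0, value_algebraMap, value_algebraMap] at this
  rw [this, mul_div_cancel_right₀ _ hr]

theorem analyticAt_value (hf : f.IsRegularAt q) : AnalyticAt ℂ f.value q := by
  have h : f.value = fun l => f.num.eval l / f.denom.eval l := by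
    funext l
    simp [value, eval, eval₂_id]
  rw [h]
  exact (AnalyticOnNhd.eval_polynomial f.num q trivial).div
    (AnalyticOnNhd.eval_polynomial f.denom q trivial) hf

theorem finite_not_isRegularAt (f : RatFunc ℂ) : {q | ¬ f.IsRegularAt q}.Finite := by
  refine (f.denom.roots.toFinset.finite_toSet).subset fun q hq => ?_
  simp only [Finset.mem_coe, Multiset.mem_toFinset]
  rw [mem_roots f.denom_ne_zero]
  simpa [IsRegularAt] using hq

theorem eventually_isRegularAt (f : RatFunc ℂ) (q : ℂ) : ∀ᶠ l in 𝓝[≠] q, f.IsRegularAt l := by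
  have h := f.finite_not_isRegularAt.subset (Set.sdiff_subset (t := {q}))
  filter_upwards [mem_nhdsWithin_of_mem_nhds (h.isClosed.isOpen_compl.mem_nhds (by simp)),
    self_mem_nhdsWithin] with l hl hl'
  by_contra hc
  exact hl ⟨hc, hl'⟩

theorem IsRegularAt.eventually (hf : f.IsRegularAt q) : ∀ᶠ l in 𝓝 q, f.IsRegularAt l := by
  have : ContinuousAt (fun l => f.denom.eval l) q := f.denom.continuousAt
  exact this.eventually_ne hf

theorem eq_zero_of_infinite {S : Set ℂ} (hS : S.Infinite) (h : ∀ l ∈ S, f.value l = 0) : f = 0 := by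
  by_contra hf
  have h1 : S \ {l | ¬ f.IsRegularAt l} ⊆ f.num.roots.toFinset := by
    rintro l ⟨hl, hr⟩
    simp only [Set.mem_ofPred_eq, not_not] at hr
    have h2 := h l hl
    simp only [value, eval, eval₂_id] at h2
    rcases div_eq_zero_iff.1 h2 with h3 | h3
    · simp only [Finset.mem_coe, Multiset.mem_toFinset]
      rw [mem_roots (by simpa using hf)]
      exact h3
    · exact absurd h3 hr
  exact (hS.sdiff f.finite_not_isRegularAt) ((Finset.finite_toSet _).subset h1)

theorem eq_of_infinite {S : Set ℂ} (hS : S.Infinite) (h : ∀ l ∈ S, f.value l = g.value l) :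
    f = g := by
  have hS' : (S \ ({l | ¬ f.IsRegularAt l} ∪ {l | ¬ g.IsRegularAt l})).Infinite :=
    hS.sdiff (f.finite_not_isRegularAt.union g.finite_not_isRegularAt)
  refine sub_eq_zero.1 (eq_zero_of_infinite hS' ?_)
  rintro l ⟨hl, hr⟩
  simp only [Set.mem_union, Set.mem_ofPred_eq, not_or, not_not] at hr
  rw [value_sub hr.1 hr.2, h l hl, sub_self]

/-- Poles are visible on values: a rational function that agrees near `q` with a function
continuous at `q` has no pole at `q`. -/
theorem isRegularAt_of_tendsto {y : ℂ} (h : Tendsto f.value (𝓝[≠] q) (𝓝 y)) :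
    f.IsRegularAt q := by
  intro h0
  have hcop := f.isCoprime_num_denom
  have hn : f.num.eval q ≠ 0 := by
    intro hn
    obtain ⟨a, b, hab⟩ := hcop
    have := congrArg (fun p => p.eval q) hab
    simp [hn, h0] at this
  have h1 : Tendsto (fun l => f.value l * f.denom.eval l) (𝓝[≠] q) (𝓝 (y * f.denom.eval q)) :=
    h.mul (f.denom.continuousAt.tendsto.mono_left nhdsWithin_le_nhds)
  have h2 : Tendsto (fun l => f.num.eval l) (𝓝[≠] q) (𝓝 (f.num.eval q)) :=
    f.num.continuousAt.tendsto.mono_left nhdsWithin_le_nhds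
  have h3 : (fun l => f.value l * f.denom.eval l) =ᶠ[𝓝[≠] q] fun l => f.num.eval l := by
    filter_upwards [f.eventually_isRegularAt q] with l hl
    simp only [value, eval, eval₂_id]
    exact div_mul_cancel₀ _ hl
  have h4 := tendsto_nhds_unique (h1.congr' h3) h2
  rw [h0, mul_zero] at h4
  exact hn h4.symm

theorem rootMultiplicity_denom_le_iff {n : ℕ} :
    f.denom.rootMultiplicity q ≤ n ↔ ((X - C q) ^ n * f).IsRegularAt q := by
  have hX : (X - C q : RatFunc ℂ) = algebraMap ℂ[X] (RatFunc ℂ) (Polynomial.X - Polynomial.C q) := by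
    simp
  have hf := f.num_div_denom
  constructor
  · intro hn
    obtain ⟨d, hd⟩ := f.denom.pow_rootMultiplicity_dvd q
    have hd0 : d.eval q ≠ 0 := by
      have h1 := Polynomial.eval_divByMonic_pow_rootMultiplicity_ne_zero (p := f.denom) q
        f.denom_ne_zero
      have h2 : f.denom /ₘ (Polynomial.X - Polynomial.C q) ^ f.denom.rootMultiplicity q = d := by
        nth_rw 1 [hd]
        exact mul_divByMonic_cancel_left _ ((monic_X_sub_C q).pow _)
      rwa [h2] at h1
    have hdz : algebraMap ℂ[X] (RatFunc ℂ) d ≠ 0 := by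
      refine algebraMap_ne_zero ?_; rintro rfl; simp at hd0
    have hXz : algebraMap ℂ[X] (RatFunc ℂ) (Polynomial.X - Polynomial.C q) ≠ 0 := by
      refine algebraMap_ne_zero ?_; exact Polynomial.X_sub_C_ne_zero q
    have h3 : (X - C q) ^ n * f = algebraMap ℂ[X] (RatFunc ℂ)
        ((Polynomial.X - Polynomial.C q) ^ (n - f.denom.rootMultiplicity q) * f.num) /
        algebraMap ℂ[X] (RatFunc ℂ) d := by
      nth_rw 1 [← hf]
      rw [hd, hX, map_mul, map_mul, map_pow, map_pow,
        ← pow_sub_mul_pow (algebraMap ℂ[X] (RatFunc ℂ) (Polynomial.X - Polynomial.C q)) hn]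
      rw [← hd]
      field_simp
    rw [h3]
    exact isRegularAt_div hd0
  · intro h
    set g := (X - C q) ^ n * f with hg
    have hXz : (X - C q : RatFunc ℂ) ^ n ≠ 0 := by
      rw [hX, ← map_pow]; refine algebraMap_ne_zero ?_
      exact pow_ne_zero _ (Polynomial.X_sub_C_ne_zero q)
    have hgd : f = algebraMap ℂ[X] (RatFunc ℂ) g.num / algebraMap ℂ[X] (RatFunc ℂ)
        (g.denom * (Polynomial.X - Polynomial.C q) ^ n) := by
      rw [map_mul, ← div_div, g.num_div_denom, map_pow, ← hX, hg, mul_div_cancel_left₀ _ hXz]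
    have hdvd : f.denom ∣ g.denom * (Polynomial.X - Polynomial.C q) ^ n := by
      conv_lhs => rw [hgd]
      exact denom_div_dvd _ _
    have hne : g.denom * (Polynomial.X - Polynomial.C q) ^ n ≠ 0 :=
      mul_ne_zero g.denom_ne_zero (pow_ne_zero _ (Polynomial.X_sub_C_ne_zero q))
    refine (rootMultiplicity_le_rootMultiplicity_of_dvd hne hdvd q).trans ?_
    rw [rootMultiplicity_mul hne, rootMultiplicity_X_sub_C_pow,
      rootMultiplicity_eq_zero (by exact h), zero_add]

end RatFunc

namespace RatMat

/-- The rational matrix `M` has no pole at `q`. -/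
def IsRegularAt (M : RatMat) (q : ℂ) : Prop := ∀ a b, (M a b).IsRegularAt q

variable {M K : RatMat} {q : ℂ}

theorem poleOrder_le_iff {n : ℕ} :
    M.poleOrder q ≤ n ↔ IsRegularAt ((RatFunc.X - RatFunc.C q) ^ n • M) q := by
  rw [poleOrder, Finset.sup_le_iff]
  simp only [Finset.mem_univ, true_imp_iff, Prod.forall, RatFunc.rootMultiplicity_denom_le_iff,
    IsRegularAt, Matrix.smul_apply, smul_eq_mul]

theorem not_isPole_iff : ¬ M.IsPole q ↔ IsRegularAt M q := by
  rw [IsPole, not_not, ← Nat.le_zero, poleOrder_le_iff]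
  simp

theorem IsRegularAt.add (hM : IsRegularAt M q) (hK : IsRegularAt K q) : IsRegularAt (M + K) q :=
  fun a b => (hM a b).add (hK a b)

theorem IsRegularAt.sub (hM : IsRegularAt M q) (hK : IsRegularAt K q) : IsRegularAt (M - K) q :=
  fun a b => (hM a b).sub (hK a b)

theorem IsRegularAt.mul (hM : IsRegularAt M q) (hK : IsRegularAt K q) : IsRegularAt (M * K) q :=
  fun a b => by
    rw [Matrix.mul_apply]
    exact .sum fun c _ => (hM a c).mul (hK c b)

theorem IsRegularAt.smul {f : RatFunc ℂ} (hf : f.IsRegularAt q) (hM : IsRegularAt M q) :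
    IsRegularAt (f • M) q := fun a b => hf.mul (hM a b)

theorem evalAt_apply (M : RatMat) (l : ℂ) (a b : Fin 2) : M.evalAt l a b = (M a b).value l := rfl

theorem evalAt_add (hM : IsRegularAt M q) (hK : IsRegularAt K q) :
    (M + K).evalAt q = M.evalAt q + K.evalAt q := by
  ext a b
  exact RatFunc.value_add (hM a b) (hK a b)

theorem evalAt_sub (hM : IsRegularAt M q) (hK : IsRegularAt K q) :
    (M - K).evalAt q = M.evalAt q - K.evalAt q := by
  ext a b
  exact RatFunc.value_sub (hM a b) (hK a b)

theorem evalAt_mul (hM : IsRegularAt M q) (hK : IsRegularAt K q) :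
    evalAt (M * K) q = M.evalAt q * K.evalAt q := by
  ext a b
  simp only [evalAt_apply, Matrix.mul_apply, Fin.sum_univ_two]
  rw [RatFunc.value_add ((hM _ _).mul (hK _ _)) ((hM _ _).mul (hK _ _)),
    RatFunc.value_mul (hM _ _) (hK _ _), RatFunc.value_mul (hM _ _) (hK _ _)]

theorem evalAt_smul {f : RatFunc ℂ} (hf : f.IsRegularAt q) (hM : IsRegularAt M q) :
    evalAt (f • M) q = f.value q • M.evalAt q := by
  ext a b
  exact RatFunc.value_mul hf (hM a b)

theorem eventually_isRegularAt (M : RatMat) (q : ℂ) : ∀ᶠ l in 𝓝[≠] q, IsRegularAt M l := by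
  simp only [IsRegularAt, eventually_all]
  exact fun a b => (M a b).eventually_isRegularAt q

theorem finite_not_isRegularAt (M : RatMat) : {q | ¬ IsRegularAt M q}.Finite := by
  have : {q | ¬ IsRegularAt M q} ⊆ ⋃ a, ⋃ b, {q | ¬ (M a b).IsRegularAt q} := by
    intro q hq
    simp only [IsRegularAt, Set.mem_ofPred_eq, not_forall] at hq
    obtain ⟨a, b, h⟩ := hq
    exact Set.mem_iUnion.2 ⟨a, Set.mem_iUnion.2 ⟨b, h⟩⟩
  exact (Set.finite_iUnion fun a => Set.finite_iUnion fun b =>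
    (M a b).finite_not_isRegularAt).subset this

theorem IsRegularAt.eventually (hM : IsRegularAt M q) : ∀ᶠ l in 𝓝 q, IsRegularAt M l := by
  simp only [IsRegularAt, eventually_all]
  exact fun a b => (hM a b).eventually

theorem eq_of_infinite {S : Set ℂ} (hS : S.Infinite) (h : ∀ l ∈ S, M.evalAt l = K.evalAt l) :
    M = K := by
  ext a b
  exact RatFunc.eq_of_infinite hS fun l hl => congrFun (congrFun (h l hl) a) b

end RatMat

end RationalFunctions

/-! ### Gauge transformations by polynomial matrices -/

section GaugeTransformations

open Polynomial

/-- `2 × 2` matrices with entries polynomial in `λ`. -/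
abbrev PolyMat : Type := Matrix (Fin 2) (Fin 2) ℂ[X]

namespace PolyMat

/-- A polynomial matrix as a rational matrix. -/
noncomputable def toRat (Q : PolyMat) : RatMat := Q.map (algebraMap ℂ[X] (RatFunc ℂ))

/-- The entrywise derivative of a polynomial matrix. -/
noncomputable def deriv (Q : PolyMat) : PolyMat := Q.map derivative

/-- The value of a polynomial matrix at a point. -/
noncomputable def evalAt (Q : PolyMat) (l : ℂ) : Matrix (Fin 2) (Fin 2) ℂ := Q.map (Polynomial.eval l)

theorem toRat_mul (Q P : PolyMat) : toRat (Q * P) = toRat Q * toRat P := Matrix.map_mul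

theorem toRat_apply (Q : PolyMat) (a b : Fin 2) : Q.toRat a b = algebraMap ℂ[X] (RatFunc ℂ) (Q a b) :=
  rfl

theorem evalAt_apply (Q : PolyMat) (l : ℂ) (a b : Fin 2) : Q.evalAt l a b = (Q a b).eval l := rfl

theorem deriv_apply (Q : PolyMat) (a b : Fin 2) : Q.deriv a b = derivative (Q a b) := rfl

theorem deriv_mul (Q P : PolyMat) : deriv (Q * P) = deriv Q * P + Q * deriv P := by
  ext1 a b
  simp only [deriv_apply, Matrix.mul_apply, Matrix.add_apply, Fin.sum_univ_two, derivative_add,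
    derivative_mul]
  ring

theorem det_evalAt (Q : PolyMat) (l : ℂ) : (Q.evalAt l).det = Q.det.eval l :=
  (RingHom.map_det (Polynomial.evalRingHom l) Q).symm

theorem isRegularAt_toRat (Q : PolyMat) (l : ℂ) : RatMat.IsRegularAt Q.toRat l :=
  fun _ _ => RatFunc.isRegularAt_algebraMap _ _

theorem toRat_evalAt (Q : PolyMat) (l : ℂ) : Q.toRat.evalAt l = Q.evalAt l := by
  ext a b
  exact RatFunc.value_algebraMap _ _

theorem hasDerivAt_evalAt (Q : PolyMat) (l : ℂ) (a b : Fin 2) :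
    HasDerivAt (fun l => Q.evalAt l a b) (Q.deriv.evalAt l a b) l :=
  (Q a b).hasDerivAt l

theorem toRat_mul_adjugate (Q : PolyMat) :
    toRat Q * toRat Q.adjugate = algebraMap ℂ[X] (RatFunc ℂ) Q.det • (1 : RatMat) := by
  rw [← toRat_mul, Matrix.mul_adjugate]
  ext1 a b
  simp only [toRat_apply, Matrix.smul_apply, smul_eq_mul, map_mul, Matrix.one_apply]
  split_ifs <;> simp

/-- Half the logarithmic derivative of the determinant. -/
noncomputable def halfLogDeriv (Q : PolyMat) : RatFunc ℂ :=
  RatFunc.C (1 / 2) *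
    (algebraMap ℂ[X] (RatFunc ℂ) (derivative Q.det) / algebraMap ℂ[X] (RatFunc ℂ) Q.det)

theorem halfLogDeriv_mul {Q P : PolyMat} (hQ : Q.det ≠ 0) (hP : P.det ≠ 0) :
    halfLogDeriv (Q * P) = halfLogDeriv Q + halfLogDeriv P := by
  have hQ' := RatFunc.algebraMap_ne_zero hQ
  have hP' := RatFunc.algebraMap_ne_zero hP
  simp only [halfLogDeriv, Matrix.det_mul, derivative_mul, map_add, map_mul]
  field_simp

theorem isRegularAt_halfLogDeriv {Q : PolyMat} {l : ℂ} (h : Q.det.eval l ≠ 0) :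
    Q.halfLogDeriv.IsRegularAt l :=
  (RatFunc.isRegularAt_C _ _).mul (RatFunc.isRegularAt_div h)

theorem value_halfLogDeriv {Q : PolyMat} {l : ℂ} (h : Q.det.eval l ≠ 0) :
    Q.halfLogDeriv.value l = 1 / 2 * ((derivative Q.det).eval l / Q.det.eval l) := by
  rw [halfLogDeriv, RatFunc.value_mul (RatFunc.isRegularAt_C _ _) (RatFunc.isRegularAt_div h),
    RatFunc.value_div h, RatFunc.value, RatFunc.eval_C]
  rfl

end PolyMat

open PolyMat

/-- `B` is the coefficient of the system solved by `(det Q)^(-1/2) Q Ψ`, where `Ψ` solves the system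
with coefficient `A`.  The scalar factor keeps the coefficients traceless, and makes the relation
depend on `Q` only up to scalar rational factors. -/
def IsGauge (Q : PolyMat) (A B : RatMat) : Prop :=
  B * Q.toRat = Q.toRat * A + Q.deriv.toRat - Q.halfLogDeriv • Q.toRat

namespace IsGauge

variable {Q P : PolyMat} {A B C : RatMat}

theorem comp (h : IsGauge Q A B) (h' : IsGauge P B C) (hQ : Q.det ≠ 0) (hP : P.det ≠ 0) :
    IsGauge (P * Q) A C := by
  unfold IsGauge at *
  rw [halfLogDeriv_mul hP hQ, deriv_mul, toRat_mul, ← mul_assoc, h', sub_mul, add_mul,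
    mul_assoc _ B, h]
  have : toRat (P.deriv * Q + P * Q.deriv) =
      P.deriv.toRat * Q.toRat + P.toRat * Q.deriv.toRat := by
    rw [← toRat_mul, ← toRat_mul]
    ext1 a b
    simp [toRat_apply]
  rw [this, mul_sub, mul_add, add_smul, Matrix.smul_mul, Matrix.mul_smul, mul_assoc]
  abel

theorem eq_mul_adjugate (h : IsGauge Q A B) (hQ : Q.det ≠ 0) :
    B = (algebraMap ℂ[X] (RatFunc ℂ) Q.det)⁻¹ •
      ((Q.toRat * A + Q.deriv.toRat - Q.halfLogDeriv • Q.toRat) * toRat Q.adjugate) := by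
  rw [← show B * Q.toRat = _ from h, mul_assoc, toRat_mul_adjugate, Matrix.mul_smul, mul_one,
    smul_smul, inv_mul_cancel₀ (RatFunc.algebraMap_ne_zero hQ), one_smul]

theorem unique {B' : RatMat} (h : IsGauge Q A B) (h' : IsGauge Q A B') (hQ : Q.det ≠ 0) :
    B = B' := by
  rw [h.eq_mul_adjugate hQ, h'.eq_mul_adjugate hQ]

theorem _root_.exists_isGauge (A : RatMat) (hQ : Q.det ≠ 0) : ∃ B, IsGauge Q A B := by
  have hadj : toRat Q.adjugate * Q.toRat = algebraMap ℂ[X] (RatFunc ℂ) Q.det • (1 : RatMat) := by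
    rw [← toRat_mul, Matrix.adjugate_mul, ← Matrix.mul_adjugate, toRat_mul, toRat_mul_adjugate]
  refine ⟨(algebraMap ℂ[X] (RatFunc ℂ) Q.det)⁻¹ •
      ((Q.toRat * A + Q.deriv.toRat - Q.halfLogDeriv • Q.toRat) * toRat Q.adjugate), ?_⟩
  unfold IsGauge
  rw [Matrix.smul_mul, mul_assoc, hadj, Matrix.mul_smul, mul_one,
    smul_smul, inv_mul_cancel₀ (RatFunc.algebraMap_ne_zero hQ), one_smul]

/-- Only the class of `Q` modulo scalars matters. -/
theorem _root_.isGauge_smul_iff {f : ℂ[X]} (hf : f ≠ 0) (hQ : Q.det ≠ 0) :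
    IsGauge (f • Q) A B ↔ IsGauge Q A B := by
  have hf' := RatFunc.algebraMap_ne_zero hf
  have hQ' := RatFunc.algebraMap_ne_zero hQ
  have h1 : (f • Q).toRat = algebraMap ℂ[X] (RatFunc ℂ) f • Q.toRat := by
    ext1 a b; simp [toRat_apply]
  have h2 : (f • Q).deriv.toRat = algebraMap ℂ[X] (RatFunc ℂ) (derivative f) • Q.toRat +
      algebraMap ℂ[X] (RatFunc ℂ) f • Q.deriv.toRat := by
    ext1 a b
    simp only [toRat_apply, deriv_apply, Matrix.smul_apply, Matrix.add_apply, smul_eq_mul,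
      derivative_mul, map_add, map_mul]
  have h3 : (f • Q).halfLogDeriv = algebraMap ℂ[X] (RatFunc ℂ) (derivative f) /
      algebraMap ℂ[X] (RatFunc ℂ) f + Q.halfLogDeriv := by
    simp only [halfLogDeriv, Matrix.det_smul, Fintype.card_fin, sq, derivative_mul, map_add,
      map_mul]
    have : (RatFunc.C (1 / 2) : RatFunc ℂ) * 2 = 1 := by
      rw [← map_ofNat RatFunc.C 2, ← map_mul]; norm_num
    field_simp
    linear_combination (algebraMap ℂ[X] (RatFunc ℂ) (derivative f) * algebraMap ℂ[X] (RatFunc ℂ) Q.det) * this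
  have key : Q.toRat * A * 1 = Q.toRat * A := mul_one _
  unfold IsGauge
  rw [h1, h2, h3, Matrix.mul_smul, Matrix.smul_mul, add_smul, smul_smul, smul_smul,
    div_mul_cancel₀ _ hf']
  have h4 : algebraMap ℂ[X] (RatFunc ℂ) f • (Q.toRat * A) +
      (algebraMap ℂ[X] (RatFunc ℂ) (derivative f) • Q.toRat +
        algebraMap ℂ[X] (RatFunc ℂ) f • Q.deriv.toRat) -
      (algebraMap ℂ[X] (RatFunc ℂ) (derivative f) • Q.toRat +
        (Q.halfLogDeriv * algebraMap ℂ[X] (RatFunc ℂ) f) • Q.toRat) =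
      algebraMap ℂ[X] (RatFunc ℂ) f • (Q.toRat * A + Q.deriv.toRat - Q.halfLogDeriv • Q.toRat) := by
    rw [smul_sub, smul_add, smul_smul, mul_comm Q.halfLogDeriv]
    abel
  rw [h4]
  exact (smul_right_injective _ hf').eq_iff

theorem trace_eq_zero (h : IsGauge Q A B) (hQ : Q.det ≠ 0) (hA : A.trace = 0) : B.trace = 0 := by
  have hQ' := RatFunc.algebraMap_ne_zero hQ
  rw [h.eq_mul_adjugate hQ, Matrix.trace_smul]
  have h1 : (Q.toRat * A * toRat Q.adjugate).trace = 0 := by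
    rw [Matrix.trace_mul_comm, ← mul_assoc, ← toRat_mul, Matrix.adjugate_mul, ← Matrix.mul_adjugate,
      toRat_mul, toRat_mul_adjugate, Matrix.smul_mul, one_mul, Matrix.trace_smul, hA, smul_zero]
  have h2 : (Q.deriv.toRat * toRat Q.adjugate).trace =
      algebraMap ℂ[X] (RatFunc ℂ) (derivative Q.det) := by
    rw [← toRat_mul]
    simp only [Matrix.trace_fin_two, Matrix.det_fin_two, toRat_apply, deriv_apply, Matrix.mul_apply,
      Fin.sum_univ_two, Matrix.adjugate_fin_two, Matrix.of_apply, Matrix.cons_val', Matrix.cons_val_zero,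
      Matrix.cons_val_one, Matrix.cons_val_fin_one, derivative_sub, derivative_mul, ← map_add]
    congr 1
    ring
  rw [sub_mul, add_mul, Matrix.trace_sub, Matrix.trace_add, h1, h2, Matrix.smul_mul,
    toRat_mul_adjugate, smul_smul, Matrix.trace_smul, Matrix.trace_one]
  have : (RatFunc.C (1 / 2) : RatFunc ℂ) * 2 = 1 := by
    rw [← map_ofNat RatFunc.C 2, ← map_mul]; norm_num
  rw [smul_eq_zero]
  right
  simp only [halfLogDeriv, smul_eq_mul, Fintype.card_fin, Nat.cast_ofNat]
  field_simp
  linear_combination -(algebraMap ℂ[X] (RatFunc ℂ) (derivative Q.det)) * this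

theorem isRegularAt {l : ℂ} (h : IsGauge Q A B) (hl : Q.det.eval l ≠ 0)
    (hA : RatMat.IsRegularAt A l) : RatMat.IsRegularAt B l := by
  have hQ : Q.det ≠ 0 := by rintro h; simp [h] at hl
  rw [h.eq_mul_adjugate hQ]
  refine .smul ?_ (((((isRegularAt_toRat _ _).mul hA).add (isRegularAt_toRat _ _)).sub
    (.smul (isRegularAt_halfLogDeriv hl) (isRegularAt_toRat _ _))).mul (isRegularAt_toRat _ _))
  have := RatFunc.isRegularAt_div (p := 1) hl
  simpa using this

theorem evalAt_mul {l : ℂ} (h : IsGauge Q A B) (hl : Q.det.eval l ≠ 0)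
    (hA : RatMat.IsRegularAt A l) :
    B.evalAt l * Q.evalAt l = Q.evalAt l * A.evalAt l + Q.deriv.evalAt l -
      (1 / 2 * ((derivative Q.det).eval l / Q.det.eval l)) • Q.evalAt l := by
  have h1 := congrArg (fun M => RatMat.evalAt M l) (show B * Q.toRat = _ from h)
  rw [RatMat.evalAt_mul (h.isRegularAt hl hA) (isRegularAt_toRat _ _),
    RatMat.evalAt_sub (((isRegularAt_toRat _ _).mul hA).add (isRegularAt_toRat _ _))
      (.smul (isRegularAt_halfLogDeriv hl) (isRegularAt_toRat _ _)),
    RatMat.evalAt_add ((isRegularAt_toRat _ _).mul hA) (isRegularAt_toRat _ _),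
    RatMat.evalAt_mul (isRegularAt_toRat _ _) hA,
    RatMat.evalAt_smul (isRegularAt_halfLogDeriv hl) (isRegularAt_toRat _ _),
    value_halfLogDeriv hl, toRat_evalAt, toRat_evalAt] at h1
  exact h1

theorem poleOrder_le {q : ℂ} (h : IsGauge Q A B) (hq : Q.det.eval q ≠ 0) :
    B.poleOrder q ≤ A.poleOrder q := by
  have hQ : Q.det ≠ 0 := by rintro h; simp [h] at hq
  rw [RatMat.poleOrder_le_iff]
  have hA := RatMat.poleOrder_le_iff.1 (le_refl (A.poleOrder q))
  set n := A.poleOrder q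
  rw [h.eq_mul_adjugate hQ]
  have hX : ((RatFunc.X - RatFunc.C q) ^ n : RatFunc ℂ).IsRegularAt q := by
    have := RatFunc.isRegularAt_algebraMap ((X - Polynomial.C q) ^ n) q
    simpa using this
  have hinv : ((algebraMap ℂ[X] (RatFunc ℂ) Q.det)⁻¹).IsRegularAt q := by
    have := RatFunc.isRegularAt_div (p := 1) hq
    simpa using this
  rw [smul_comm, ← Matrix.smul_mul ((RatFunc.X - RatFunc.C q) ^ n) _ (toRat Q.adjugate), smul_sub,
    smul_add, ← Matrix.mul_smul Q.toRat]
  exact .smul hinv (.mul (.sub (.add ((isRegularAt_toRat _ _).mul hA)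
    (.smul hX (isRegularAt_toRat _ _))) (.smul hX (.smul (isRegularAt_halfLogDeriv hq)
    (isRegularAt_toRat _ _)))) (isRegularAt_toRat _ _))

theorem symm_adjugate (h : IsGauge Q A B) (hQ : Q.det ≠ 0) : IsGauge Q.adjugate B A := by
  have hadj : Q.adjugate.det = Q.det := by simp [Matrix.det_adjugate]
  obtain ⟨A', hA'⟩ := exists_isGauge B (Q := Q.adjugate) (by rwa [hadj])
  have h1 := h.comp hA' hQ (by rwa [hadj])
  rw [Matrix.adjugate_mul, isGauge_smul_iff hQ (by simp)] at h1
  have h2 : IsGauge 1 A A := by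
    unfold IsGauge
    have : (1 : PolyMat).deriv = 0 := by
      ext1 a b
      rw [deriv_apply, Matrix.one_apply]
      split_ifs <;> simp
    have h3 : (1 : PolyMat).toRat = 1 := Matrix.map_one _ (map_zero _) (map_one _)
    have h4 : (0 : PolyMat).toRat = 0 := Matrix.map_zero _ (map_zero _)
    rw [this, h3, h4]
    simp [halfLogDeriv]
  rwa [h1.unique h2 (by simp)] at hA'

theorem poleOrder_eq {q : ℂ} (h : IsGauge Q A B) (hq : Q.det.eval q ≠ 0) :
    B.poleOrder q = A.poleOrder q := by
  have hQ : Q.det ≠ 0 := by rintro h; simp [h] at hq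
  refine le_antisymm (h.poleOrder_le hq) ((h.symm_adjugate hQ).poleOrder_le ?_)
  simpa [Matrix.det_adjugate] using hq

end IsGauge

end GaugeTransformations

/-! ### Schlesinger transformations as gauge transformations -/

section SchlesingerChains

open Polynomial

/-- The polynomial gauge matrix `diag(1, λ - p) D`, which is proportional to the Schlesinger
transformation with matrix `D`, parameter `c = 0` and centre `p`. -/
noncomputable def stepPoly (p : ℂ) (D : Matrix (Fin 2) (Fin 2) ℂ) : PolyMat :=
  !![1, 0; 0, X - C p] * D.map C

theorem det_map_C (D : Matrix (Fin 2) (Fin 2) ℂ) : Matrix.det (D.map C) = C D.det :=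
  (RingHom.map_det C D).symm

theorem det_stepPoly (p : ℂ) (D : Matrix (Fin 2) (Fin 2) ℂ) :
    (stepPoly p D).det = (X - C p) * C D.det := by
  rw [stepPoly, Matrix.det_mul, det_map_C]
  simp [Matrix.det_fin_two]

theorem stepPoly_zero (p : ℂ) (D : Matrix (Fin 2) (Fin 2) ℂ) (b : Fin 2) :
    stepPoly p D 0 b = C (D 0 b) := by
  rw [stepPoly, Matrix.mul_apply, Fin.sum_univ_two]
  simp only [Matrix.of_apply, Matrix.map_apply, Matrix.cons_val_zero, Matrix.cons_val_one,
    one_mul, zero_mul, add_zero]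

theorem stepPoly_one (p : ℂ) (D : Matrix (Fin 2) (Fin 2) ℂ) (b : Fin 2) :
    stepPoly p D 1 b = (X - C p) * C (D 1 b) := by
  rw [stepPoly, Matrix.mul_apply, Fin.sum_univ_two]
  simp only [Matrix.of_apply, Matrix.map_apply, Matrix.cons_val_zero, Matrix.cons_val_one,
    zero_mul, zero_add]

theorem schlesingerMatrix_mul {s l p : ℂ} (D : Matrix (Fin 2) (Fin 2) ℂ) (hs0 : s ≠ 0)
    (hs : s ^ 2 = l - p) :
    schlesingerMatrix s 0 * D = s⁻¹ • (stepPoly p D).evalAt l := by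
  have h1 : s = s⁻¹ * (l - p) := by
    rw [← hs]; field_simp
  have h2 : schlesingerMatrix s 0 = !![s⁻¹, 0; 0, s] := by
    ext a b
    fin_cases a <;> fin_cases b <;> simp [schlesingerMatrix]
  ext a b
  rw [h2, Matrix.smul_apply, PolyMat.evalAt_apply, Matrix.mul_apply, Fin.sum_univ_two]
  fin_cases a
  · simp only [Fin.zero_eta, stepPoly_zero]
    simp
  · simp only [Fin.mk_one, stepPoly_one]
    simp only [Matrix.of_apply, Matrix.cons_val_zero, Matrix.cons_val_one, zero_mul, zero_add,
      eval_mul, eval_sub, eval_X, eval_C, smul_eq_mul]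
    rw [← mul_assoc, ← h1]

/-- A polynomial gauge transformation `diag(1, λ - p) D` is a Schlesinger transformation. -/
theorem IsGauge.isSchlesingerTransform {p : ℂ} {D : Matrix (Fin 2) (Fin 2) ℂ} {A B : RatMat}
    (h : IsGauge (stepPoly p D) A B) (hD : D.det ≠ 0) : IsSchlesingerTransform p D 0 A B := by
  refine ⟨hD, fun l₀ hl₀ hA s hs hs2 Ψ hΨ => ?_⟩
  have hAreg := (RatMat.not_isPole_iff.1 hA).eventually
  have hlp : ∀ᶠ l in 𝓝 l₀, l ≠ p := isOpen_ne.mem_nhds hl₀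
  have hsd : ∀ᶠ l in 𝓝 l₀, DifferentiableAt ℂ s l :=
    hs.eventually_analyticAt.mono fun l hl => hl.differentiableAt
  filter_upwards [hAreg, hlp, hsd, hs2.eventually_nhds, hΨ] with l hAl hl hsl hs2l hΨl a b
  set Q := stepPoly p D with hQ
  have hdet : Q.det.eval l ≠ 0 := by
    rw [hQ, det_stepPoly]
    simpa [sub_eq_zero] using ⟨hl, hD⟩
  have hlp' : l - p ≠ 0 := sub_ne_zero.2 hl
  have hs2' := hs2l.self_of_nhds
  have hs0 : s l ≠ 0 := fun h0 => hlp' (by rw [← hs2', h0]; simp)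
  have hs' : 2 * s l * deriv s l = 1 := by
    have h1 : HasDerivAt (fun l => s l ^ 2) (2 * s l * deriv s l) l := by
      exact (hsl.hasDerivAt.fun_pow 2).congr_deriv (by simp)
    have h2 : HasDerivAt (fun l => l - p) 1 l := (hasDerivAt_id l).sub_const p
    exact h1.unique (h2.congr_of_eventuallyEq hs2l)
  have hev : (fun l' => (schlesingerMatrix (s l') 0 * D * Ψ l') a b) =ᶠ[𝓝 l]
      fun l' => (s l')⁻¹ * (Q.evalAt l' * Ψ l') a b := by
    have hs0' : ∀ᶠ l' in 𝓝 l, s l' ≠ 0 := hsl.continuousAt.eventually_ne hs0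
    filter_upwards [hs2l, hs0'] with l' h1 h2
    rw [schlesingerMatrix_mul D h2 h1, Matrix.smul_mul, Matrix.smul_apply, smul_eq_mul]
  have hQd : HasDerivAt (fun l' => (Q.evalAt l' * Ψ l') a b)
      ((Q.deriv.evalAt l * Ψ l + Q.evalAt l * (A.evalAt l * Ψ l)) a b) l := by
    simp only [Matrix.mul_apply (M := Q.evalAt _), Matrix.mul_apply (M := Q.deriv.evalAt _),
      Matrix.add_apply, Fin.sum_univ_two]
    exact (((Q.hasDerivAt_evalAt l a 0).mul (hΨl 0 b)).add
      ((Q.hasDerivAt_evalAt l a 1).mul (hΨl 1 b))).congr_deriv (by ring)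
  have hinv : HasDerivAt (fun l' => (s l')⁻¹) (-(deriv s l) / s l ^ 2) l := hsl.hasDerivAt.inv hs0
  refine HasDerivAt.congr_of_eventuallyEq ?_ hev
  have hB := h.evalAt_mul hdet hAl
  have hδ : 1 / 2 * ((derivative Q.det).eval l / Q.det.eval l) = deriv s l / s l := by
    rw [hQ, det_stepPoly]
    simp only [derivative_mul, derivative_sub, derivative_X, derivative_C, eval_mul,
      eval_sub, eval_X, eval_C, sub_zero, one_mul, mul_zero, add_zero]
    rw [← hs2']
    field_simp
    linear_combination -(1 : ℂ) * hs'
  rw [hδ] at hB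
  refine (hinv.mul hQd).congr_deriv ?_
  have h3 : B.evalAt l * (schlesingerMatrix (s l) 0 * D * Ψ l) =
      (s l)⁻¹ • ((Q.evalAt l * A.evalAt l + Q.deriv.evalAt l - (deriv s l / s l) • Q.evalAt l) * Ψ l) := by
    rw [schlesingerMatrix_mul D hs0 hs2', Matrix.smul_mul, Matrix.mul_smul, ← mul_assoc, hB]
  rw [h3, sub_mul, add_mul, Matrix.smul_mul, mul_assoc]
  simp only [Matrix.smul_apply, Matrix.sub_apply, Matrix.add_apply, smul_eq_mul]
  field_simp
  ring

variable {m : ℕ} {V V' : Set (Fin m → ℂ)} {𝒞 𝒞' : Set ((Fin m → ℂ) → ℂ)}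

theorem SchlesingerChain.mono (hV : V' ⊆ V) (hC : 𝒞 ⊆ 𝒞') {A B : RatFamily m}
    (h : SchlesingerChain V 𝒞 A B) : SchlesingerChain V' 𝒞' A B := by
  refine Relation.ReflTransGen.mono ?_ _ _ h
  rintro A B ⟨p, hp, D, c, hD, hc, hstep⟩
  exact ⟨p, hC hp, D, c, fun e f x hx => hD e f x (hV hx), fun x hx => hc x (hV hx),
    fun x hx => hstep x (hV hx)⟩

/-- The gauge transformation by the family `Q` of polynomial matrices is, over `V`, a product of
finitely many Schlesinger transformations with centres in `𝒞`. -/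
def IsSchlesingerProduct (V : Set (Fin m → ℂ)) (𝒞 : Set ((Fin m → ℂ) → ℂ))
    (Q : (Fin m → ℂ) → PolyMat) : Prop :=
  ∀ A B : RatFamily m, (∀ x ∈ V, IsGauge (Q x) (A x) (B x)) → SchlesingerChain V 𝒞 A B

namespace IsSchlesingerProduct

variable {Q P : (Fin m → ℂ) → PolyMat}

theorem step {p : (Fin m → ℂ) → ℂ} (hp : p ∈ 𝒞) {D : (Fin m → ℂ) → Matrix (Fin 2) (Fin 2) ℂ}
    (hD : ∀ a b, AnalyticOnNhd ℂ (fun x => D x a b) V) (hdet : ∀ x ∈ V, (D x).det ≠ 0) :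
    IsSchlesingerProduct V 𝒞 fun x => stepPoly (p x) (D x) := fun _ _ hAB =>
  .single ⟨p, hp, D, fun _ => 0, hD, fun _ _ => analyticAt_const,
    fun x hx => (hAB x hx).isSchlesingerTransform (hdet x hx)⟩

theorem mul (hQ : IsSchlesingerProduct V 𝒞 Q) (hP : IsSchlesingerProduct V 𝒞 P)
    (hdQ : ∀ x ∈ V, (Q x).det ≠ 0) (hdP : ∀ x ∈ V, (P x).det ≠ 0) :
    IsSchlesingerProduct V 𝒞 fun x => P x * Q x := by
  intro A B hAB
  have : ∀ x, ∃ B', x ∈ V → IsGauge (Q x) (A x) B' := fun x => by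
    by_cases hx : x ∈ V
    · obtain ⟨B', hB'⟩ := exists_isGauge (A x) (hdQ x hx)
      exact ⟨B', fun _ => hB'⟩
    · exact ⟨0, fun h => absurd h hx⟩
  choose B' hB' using this
  refine (hQ A B' hB').trans (hP B' B fun x hx => ?_)
  obtain ⟨B'', hB''⟩ := exists_isGauge (B' x) (hdP x hx)
  have h1 := (hB' x hx).comp hB'' (hdQ x hx) (hdP x hx)
  rwa [h1.unique (hAB x hx) (by rw [Matrix.det_mul]; exact mul_ne_zero (hdP x hx) (hdQ x hx))]
    at hB''

theorem of_smul {f : (Fin m → ℂ) → ℂ[X]} (hf : ∀ x ∈ V, f x ≠ 0) (hd : ∀ x ∈ V, (Q x).det ≠ 0)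
    (h : IsSchlesingerProduct V 𝒞 P) (hPQ : ∀ x ∈ V, P x = f x • Q x) :
    IsSchlesingerProduct V 𝒞 Q := fun A B hAB => h A B fun x hx => by
  rw [hPQ x hx]
  exact (isGauge_smul_iff (hf x hx) (hd x hx)).2 (hAB x hx)

theorem congr (h : IsSchlesingerProduct V 𝒞 P) (hPQ : ∀ x ∈ V, P x = Q x) :
    IsSchlesingerProduct V 𝒞 Q := fun A B hAB => h A B fun x hx => by
  rw [hPQ x hx]
  exact hAB x hx

variable {p : (Fin m → ℂ) → ℂ}

/-- A gauge transformation that does not depend on `λ` is a product of two Schlesinger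
transformations with the same centre. -/
theorem const (hp : p ∈ 𝒞) {D : (Fin m → ℂ) → Matrix (Fin 2) (Fin 2) ℂ}
    (hD : ∀ a b, AnalyticOnNhd ℂ (fun x => D x a b) V) (hdet : ∀ x ∈ V, (D x).det ≠ 0) :
    IsSchlesingerProduct V 𝒞 fun x => (D x).map C := by
  let J : Matrix (Fin 2) (Fin 2) ℂ := !![0, 1; 1, 0]
  have hJ : J.det ≠ 0 := by simp [J]
  have hJD : ∀ x ∈ V, (J * D x).det ≠ 0 := fun x hx => by
    rw [Matrix.det_mul]; exact mul_ne_zero hJ (hdet x hx)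
  have h1 := step (V := V) hp (D := fun x => J * D x) (by
    intro a b x hx
    simp only [Matrix.mul_apply, Fin.sum_univ_two]
    exact (analyticAt_const.mul (hD _ _ x hx)).add (analyticAt_const.mul (hD _ _ x hx))) hJD
  have h2 := step (V := V) hp (D := fun _ => J) (fun a b x hx => analyticAt_const) (fun _ _ => hJ)
  have h3 := h1.mul h2 (fun x hx => by
      rw [det_stepPoly]; exact mul_ne_zero (X_sub_C_ne_zero _) (C_ne_zero.2 (hJD x hx)))
    (fun x hx => by
      rw [det_stepPoly]; exact mul_ne_zero (X_sub_C_ne_zero _) (C_ne_zero.2 hJ))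
  refine of_smul (f := fun x => X - C (p x)) (fun x _ => X_sub_C_ne_zero _) (fun x hx => by
    rw [det_map_C]; exact C_ne_zero.2 (hdet x hx)) h3 fun x hx => ?_
  have hJ0 : ∀ b, (J * D x) 0 b = D x 1 b := fun b => by
    simp [J, Matrix.mul_apply, Fin.sum_univ_two, -Matrix.cons_mul]
  have hJ1 : ∀ b, (J * D x) 1 b = D x 0 b := fun b => by
    simp [J, Matrix.mul_apply, Fin.sum_univ_two, -Matrix.cons_mul]
  ext1 a b
  rw [Matrix.mul_apply, Fin.sum_univ_two, stepPoly_zero, stepPoly_one, hJ0, hJ1, Matrix.smul_apply,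
    smul_eq_mul, Matrix.map_apply]
  fin_cases a
  · simp only [Fin.zero_eta, stepPoly_zero]
    simp [J]
  · simp only [Fin.mk_one, stepPoly_one]
    simp [J]

theorem elementary (hp : p ∈ 𝒞) {μ : (Fin m → ℂ) → ℂ} (hμ : AnalyticOnNhd ℂ μ V) (k : ℕ) :
    IsSchlesingerProduct V 𝒞 fun x => !![1, 0; C (μ x) * (X - C (p x)) ^ k, 1] := by
  induction k with
  | zero =>
    refine congr (const hp (D := fun x => !![1, 0; μ x, 1]) ?_ ?_) ?_
    · intro a b
      fin_cases a <;> fin_cases b <;> simp [analyticOnNhd_const, hμ]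
    · intro x _; simp
    · intro x _
      ext1 a b
      fin_cases a <;> fin_cases b <;> simp
  | succ k ih =>
    let J : Matrix (Fin 2) (Fin 2) ℂ := !![0, 1; 1, 0]
    have hJ : J.det ≠ 0 := by simp [J]
    have h1 := step (V := V) hp (D := fun _ => J) (fun a b x hx => analyticAt_const) (fun _ _ => hJ)
    have h2 := const (V := V) hp (D := fun _ => J) (fun a b x hx => analyticAt_const) (fun _ _ => hJ)
    have h4 := step (V := V) hp (D := fun _ => 1) (fun a b x hx => analyticAt_const)
      (fun _ _ => by simp)
    have d1 : ∀ x ∈ V, (stepPoly (p x) J).det ≠ 0 := fun x hx => by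
      rw [det_stepPoly]; exact mul_ne_zero (X_sub_C_ne_zero _) (C_ne_zero.2 hJ)
    have d2 : ∀ x ∈ V, Matrix.det (J.map C : PolyMat) ≠ 0 := fun x hx => by
      rw [det_map_C]; exact C_ne_zero.2 hJ
    have d4 : ∀ x ∈ V, (stepPoly (p x) 1).det ≠ 0 := fun x hx => by
      rw [det_stepPoly]; exact mul_ne_zero (X_sub_C_ne_zero _) (by simp)
    have dE : ∀ j, ∀ x ∈ V, Matrix.det (!![1, 0; C (μ x) * (X - C (p x)) ^ j, 1] : PolyMat) ≠ 0 :=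
      fun j x _ => by simp
    have d12 : ∀ x ∈ V, Matrix.det ((J.map C : PolyMat) * stepPoly (p x) J) ≠ 0 := fun x hx => by
      rw [Matrix.det_mul]; exact mul_ne_zero (d2 x hx) (d1 x hx)
    have h5 := ((h1.mul h2 d1 d2).mul ih d12 (dE k)).mul h4
      (fun x hx => by rw [Matrix.det_mul]; exact mul_ne_zero (dE k x hx) (d12 x hx)) d4
    refine of_smul (f := fun x => X - C (p x)) (fun x _ => X_sub_C_ne_zero _) (dE (k + 1)) h5
      fun x hx => ?_
    have e1 : stepPoly (p x) J = !![0, 1; X - C (p x), 0] := by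
      ext1 a b
      fin_cases a <;> fin_cases b <;>
        simp only [Fin.zero_eta, Fin.mk_one, stepPoly_zero, stepPoly_one] <;> simp [J]
    have e2 : (J.map C : PolyMat) = !![0, 1; 1, 0] := by
      ext1 a b
      fin_cases a <;> fin_cases b <;> simp [J]
    have e4 : stepPoly (p x) 1 = !![1, 0; 0, X - C (p x)] := by
      ext1 a b
      fin_cases a <;> fin_cases b <;>
        simp only [Fin.zero_eta, Fin.mk_one, stepPoly_zero, stepPoly_one] <;> simp
    rw [e1, e2, e4]
    ext1 a b
    fin_cases a <;> fin_cases b <;> simp [pow_succ]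
    left
    ring

end IsSchlesingerProduct

end SchlesingerChains

/-! ### Factorization of polynomial matrices into Schlesinger steps -/

section Factorization

open Polynomial

variable {m : ℕ} {V V' : Set (Fin m → ℂ)} {q r : (Fin m → ℂ) → ℂ[X]} {p : (Fin m → ℂ) → ℂ}

/-- A family of polynomials of bounded degree whose coefficients are holomorphic in the
parameters. -/
structure IsAnalyticPoly (V : Set (Fin m → ℂ)) (q : (Fin m → ℂ) → ℂ[X]) : Prop where
  coeff : ∀ n, AnalyticOnNhd ℂ (fun x => (q x).coeff n) V
  bdd : ∃ d, ∀ x ∈ V, (q x).natDegree ≤ d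

namespace IsAnalyticPoly

theorem mono (h : IsAnalyticPoly V q) (hV : V' ⊆ V) : IsAnalyticPoly V' q :=
  ⟨fun n x hx => h.coeff n x (hV hx), h.bdd.imp fun _ hd x hx => hd x (hV hx)⟩

theorem C (hp : AnalyticOnNhd ℂ p V) : IsAnalyticPoly V fun x => Polynomial.C (p x) := by
  refine ⟨fun n => ?_, 0, fun x _ => by simp⟩
  simp only [coeff_C]
  split_ifs
  · exact hp
  · exact analyticOnNhd_const

theorem const (s : ℂ[X]) : IsAnalyticPoly V fun _ => s :=
  ⟨fun _ => analyticOnNhd_const, s.natDegree, fun _ _ => le_rfl⟩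

theorem add (hq : IsAnalyticPoly V q) (hr : IsAnalyticPoly V r) :
    IsAnalyticPoly V fun x => q x + r x := by
  obtain ⟨d, hd⟩ := hq.bdd
  obtain ⟨e, he⟩ := hr.bdd
  refine ⟨fun n => ?_, max d e, fun x hx => natDegree_add_le_of_le (hd x hx) (he x hx)⟩
  simp only [coeff_add]
  exact (hq.coeff n).add (hr.coeff n)

theorem mul (hq : IsAnalyticPoly V q) (hr : IsAnalyticPoly V r) :
    IsAnalyticPoly V fun x => q x * r x := by
  obtain ⟨d, hd⟩ := hq.bdd
  obtain ⟨e, he⟩ := hr.bdd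
  refine ⟨fun n => ?_, d + e, fun x hx => natDegree_mul_le_of_le (hd x hx) (he x hx)⟩
  simp only [coeff_mul]
  exact Finset.analyticOnNhd_fun_sum _ fun i _ => (hq.coeff _).mul (hr.coeff _)

theorem neg (hq : IsAnalyticPoly V q) : IsAnalyticPoly V fun x => -q x := by
  simpa using (const (-1)).mul hq

theorem sub (hq : IsAnalyticPoly V q) (hr : IsAnalyticPoly V r) :
    IsAnalyticPoly V fun x => q x - r x := by
  simpa [sub_eq_add_neg] using hq.add hr.neg

theorem X_sub_C (hp : AnalyticOnNhd ℂ p V) : IsAnalyticPoly V fun x => X - Polynomial.C (p x) :=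
  (const X).sub (C hp)

theorem pow (hq : IsAnalyticPoly V q) (n : ℕ) : IsAnalyticPoly V fun x => q x ^ n := by
  induction n with
  | zero => simpa using const 1
  | succ n ih => simpa [pow_succ] using ih.mul hq

theorem eval (hq : IsAnalyticPoly V q) (hp : AnalyticOnNhd ℂ p V) (hV : IsOpen V) :
    AnalyticOnNhd ℂ (fun x => (q x).eval (p x)) V := by
  obtain ⟨d, hd⟩ := hq.bdd
  have h1 : AnalyticOnNhd ℂ (fun x => ∑ i ∈ Finset.range (d + 1), (q x).coeff i * p x ^ i) V :=
    Finset.analyticOnNhd_fun_sum _ fun i _ => (hq.coeff i).mul (hp.pow i)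
  exact h1.congr hV fun x hx => (eval_eq_sum_range' (Nat.lt_succ_of_le (hd x hx)) _).symm

theorem divByMonic (hq : IsAnalyticPoly V q) (hp : AnalyticOnNhd ℂ p V) (hV : IsOpen V) :
    IsAnalyticPoly V fun x => q x /ₘ (X - Polynomial.C (p x)) := by
  obtain ⟨d, hd⟩ := hq.bdd
  refine ⟨fun n => ?_, d, fun x hx => ?_⟩
  · have h1 : AnalyticOnNhd ℂ (fun x => ∑ i ∈ Finset.Icc (n + 1) d,
        p x ^ (i - (n + 1)) * (q x).coeff i) V :=
      Finset.analyticOnNhd_fun_sum _ fun i _ => (hp.pow _).mul (hq.coeff i)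
    refine h1.congr hV fun x hx => ?_
    rw [coeff_divByMonic_X_sub_C]
    symm
    refine Finset.sum_subset (Finset.Icc_subset_Icc_right (hd x hx)) fun i hi hi' => ?_
    have : (q x).natDegree < i := by
      simp only [Finset.mem_Icc] at hi hi'
      omega
    rw [coeff_eq_zero_of_natDegree_lt this, mul_zero]
  · rw [natDegree_divByMonic _ (monic_X_sub_C _)]
    exact (Nat.sub_le _ _).trans (hd x hx)

end IsAnalyticPoly

/-- A family of polynomial matrices with analytic entries. -/
def IsAnalyticPolyMat (V : Set (Fin m → ℂ)) (Q : (Fin m → ℂ) → PolyMat) : Prop :=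
  ∀ a b, IsAnalyticPoly V fun x => Q x a b

namespace IsAnalyticPolyMat

variable {Q P : (Fin m → ℂ) → PolyMat}

theorem mono (h : IsAnalyticPolyMat V Q) (hV : V' ⊆ V) : IsAnalyticPolyMat V' Q :=
  fun a b => (h a b).mono hV

theorem mul (hQ : IsAnalyticPolyMat V Q) (hP : IsAnalyticPolyMat V P) :
    IsAnalyticPolyMat V fun x => Q x * P x := fun a b => by
  simp only [Matrix.mul_apply, Fin.sum_univ_two]
  exact ((hQ _ _).mul (hP _ _)).add ((hQ _ _).mul (hP _ _))

theorem map_C {D : (Fin m → ℂ) → Matrix (Fin 2) (Fin 2) ℂ}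
    (hD : ∀ a b, AnalyticOnNhd ℂ (fun x => D x a b) V) :
    IsAnalyticPolyMat V fun x => (D x).map Polynomial.C := fun a b =>
  IsAnalyticPoly.C (hD a b)

theorem stepPoly (hp : AnalyticOnNhd ℂ p V) {D : (Fin m → ℂ) → Matrix (Fin 2) (Fin 2) ℂ}
    (hD : ∀ a b, AnalyticOnNhd ℂ (fun x => D x a b) V) :
    IsAnalyticPolyMat V fun x => stepPoly (p x) (D x) := fun a b => by
  fin_cases a
  · simp only [Fin.zero_eta, stepPoly_zero]
    exact IsAnalyticPoly.C (hD 0 b)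
  · simp only [Fin.mk_one, stepPoly_one]
    exact (IsAnalyticPoly.X_sub_C hp).mul (IsAnalyticPoly.C (hD 1 b))

end IsAnalyticPolyMat

variable {𝒞 : Set ((Fin m → ℂ) → ℂ)}

/-- Over some nonempty open part of `V`, the gauge transformation by `Q` is a product of
Schlesinger transformations with centres in `𝒞`. -/
def IsGenericallySchlesingerProduct (V : Set (Fin m → ℂ)) (𝒞 : Set ((Fin m → ℂ) → ℂ))
    (Q : (Fin m → ℂ) → PolyMat) : Prop :=
  ∃ V', IsOpen V' ∧ V'.Nonempty ∧ V' ⊆ V ∧ IsSchlesingerProduct V' 𝒞 Q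

/-- Euclidean division of columns, when the second column has the smaller degree.  Since the
determinant is constant, the leading coefficients of the columns are proportional, and subtracting a
multiple of the second column lowers the degree of the first, away from the parameters at which the
leading coefficient of the second column vanishes. -/
theorem IsGenericallySchlesingerProduct.of_reduction (hp : p ∈ 𝒞) (hpV : AnalyticOnNhd ℂ p V)
    (hV : IsOpen V) (hne : V.Nonempty) {Q : (Fin m → ℂ) → PolyMat} (hQ : IsAnalyticPolyMat V Q)
    {c : (Fin m → ℂ) → ℂ} (hc : ∀ x ∈ V, c x ≠ 0) (hdet : ∀ x ∈ V, (Q x).det = C (c x)) {d₀ d₁ : ℕ}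
    (h0 : ∀ x ∈ V, ∀ a, (Q x a 0).natDegree ≤ d₀) (h1 : ∀ x ∈ V, ∀ a, (Q x a 1).natDegree ≤ d₁)
    (hd : d₁ ≤ d₀) (hpos : 0 < d₀)
    (ih : ∀ V₁ ⊆ V, IsOpen V₁ → V₁.Nonempty → ∀ Q₁ : (Fin m → ℂ) → PolyMat,
      IsAnalyticPolyMat V₁ Q₁ → (∀ x ∈ V₁, (Q₁ x).det = C (c x)) → ∀ e₀ e₁, e₀ + e₁ < d₀ + d₁ →
      (∀ x ∈ V₁, ∀ a, (Q₁ x a 0).natDegree ≤ e₀) → (∀ x ∈ V₁, ∀ a, (Q₁ x a 1).natDegree ≤ e₁) →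
      IsGenericallySchlesingerProduct V₁ 𝒞 Q₁) :
    IsGenericallySchlesingerProduct V 𝒞 Q := by
  have hdrop : ∀ {s : ℂ[X]} {d : ℕ}, s.natDegree ≤ d → s.coeff d = 0 → s.natDegree ≤ d - 1 := by
    intro s d hs h
    rcases Nat.eq_zero_or_pos d with rfl | hd
    · simpa using hs
    · have : s.natDegree ≠ d := by
        rintro rfl
        rw [coeff_natDegree, leadingCoeff_eq_zero] at h
        simp [h] at hd
      omega
  by_cases hz : ∀ x ∈ V, ∀ a, (Q x a 1).coeff d₁ = 0
  · rcases Nat.eq_zero_or_pos d₁ with rfl | hd₁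
    · exfalso
      obtain ⟨x, hx⟩ := hne
      have h2 : ∀ a, Q x a 1 = 0 := fun a => by
        rw [eq_C_of_natDegree_le_zero (h1 x hx a), hz x hx a, C_0]
      have h3 := hdet x hx
      rw [Matrix.det_fin_two, h2, h2] at h3
      simp only [mul_zero, zero_mul, sub_zero] at h3
      exact hc x hx (C_eq_zero.1 h3.symm)
    · exact ih V subset_rfl hV hne Q hQ hdet d₀ (d₁ - 1) (by omega) h0
        fun x hx a => hdrop (h1 x hx a) (hz x hx a)
  · push Not at hz
    obtain ⟨x₀, hx₀, a, ha⟩ := hz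
    set L : Fin 2 → (Fin m → ℂ) → ℂ := fun b x => (Q x b 1).coeff d₁ with hL
    set M : Fin 2 → (Fin m → ℂ) → ℂ := fun b x => (Q x b 0).coeff d₀ with hM
    have hLan : ∀ b, AnalyticOnNhd ℂ (L b) V := fun b => (hQ b 1).coeff d₁
    have hMan : ∀ b, AnalyticOnNhd ℂ (M b) V := fun b => (hQ b 0).coeff d₀
    set V₁ := V ∩ {x | L a x ≠ 0} with hV₁
    have hV₁o : IsOpen V₁ := (hLan a).continuousOn.isOpen_inter_preimage hV isOpen_ne
    have hV₁V : V₁ ⊆ V := Set.inter_subset_left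
    set μ : (Fin m → ℂ) → ℂ := fun x => M a x / L a x with hμ
    have hμan : AnalyticOnNhd ℂ μ V₁ := fun x hx => (hMan a x hx.1).div (hLan a x hx.1) hx.2
    have hlead : ∀ x ∈ V, M 0 x * L 1 x = M 1 x * L 0 x := by
      intro x hx
      have h2 := congrArg (fun s => s.coeff (d₀ + d₁)) (hdet x hx)
      simp only [Matrix.det_fin_two, coeff_sub] at h2
      rw [coeff_mul_add_eq_of_natDegree_le (h0 x hx 0) (h1 x hx 1), mul_comm (Q x 0 1),
        coeff_mul_add_eq_of_natDegree_le (h0 x hx 1) (h1 x hx 0), coeff_C,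
        if_neg (by omega)] at h2
      exact sub_eq_zero.1 h2
    have hlead' : ∀ x ∈ V₁, ∀ b, M b x = μ x * L b x := by
      rintro x ⟨hx, hxa⟩ b
      have h2 := hlead x hx
      have h3 : L a x ≠ 0 := hxa
      rw [hμ]
      field_simp
      fin_cases a <;> fin_cases b <;> simp only [Fin.zero_eta, Fin.mk_one]
      · linear_combination -h2
      · linear_combination h2
    set Z : (Fin m → ℂ) → ℂ[X] := fun x => C (μ x) * (X - C (p x)) ^ (d₀ - d₁) with hZ
    have hZan : IsAnalyticPoly V₁ Z := (IsAnalyticPoly.C hμan).mul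
      ((IsAnalyticPoly.X_sub_C (fun x hx => hpV x hx.1)).pow _)
    set Q₁ : (Fin m → ℂ) → PolyMat := fun x => Q x * !![1, 0; -Z x, 1] with hQ₁
    have hQ₁0 : ∀ x b, Q₁ x b 0 = Q x b 0 - Z x * Q x b 1 := fun x b => by
      simp only [hQ₁, Matrix.mul_apply, Fin.sum_univ_two]
      simp
      ring
    have hQ₁1 : ∀ x b, Q₁ x b 1 = Q x b 1 := fun x b => by
      simp only [hQ₁, Matrix.mul_apply, Fin.sum_univ_two]
      simp
    have hQ₁an : IsAnalyticPolyMat V₁ Q₁ := by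
      intro b e
      fin_cases e
      · simp only [Fin.zero_eta, hQ₁0]
        exact ((hQ _ _).mono hV₁V).sub (hZan.mul ((hQ _ _).mono hV₁V))
      · simp only [Fin.mk_one, hQ₁1]
        exact (hQ _ _).mono hV₁V
    have hZnat : ∀ x, (Z x).natDegree ≤ d₀ - d₁ := fun x => by
      refine (natDegree_C_mul_le _ _).trans ?_
      rw [natDegree_pow, natDegree_X_sub_C, mul_one]
    have hZc : ∀ x, (Z x).coeff (d₀ - d₁) = μ x := fun x => by
      have h2 : ((X - C (p x)) ^ (d₀ - d₁)).coeff (d₀ - d₁) = 1 := by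
        have h3 := ((monic_X_sub_C (p x)).pow (d₀ - d₁)).coeff_natDegree
        rwa [natDegree_pow, natDegree_X_sub_C, mul_one] at h3
      simp only [hZ]
      rw [coeff_C_mul, h2, mul_one]
    have hsplit : d₀ - d₁ + d₁ = d₀ := by omega
    obtain ⟨V', hV'o, hV'ne, hV'V₁, hprod⟩ := ih V₁ hV₁V hV₁o ⟨x₀, hx₀, ha⟩ Q₁ hQ₁an
      (fun x hx => by
        simp only [hQ₁]
        rw [Matrix.det_mul, hdet x hx.1]
        simp)
      (d₀ - 1) d₁ (by omega)
      (fun x hx b => by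
        rw [hQ₁0]
        refine hdrop ((natDegree_sub_le_of_le (h0 x hx.1 b) (natDegree_mul_le_of_le (hZnat x)
          (h1 x hx.1 b))).trans (by omega)) ?_
        have h4 := coeff_mul_add_eq_of_natDegree_le (hZnat x) (h1 x hx.1 b)
        rw [hsplit] at h4
        rw [coeff_sub, h4, hZc]
        exact sub_eq_zero.2 (hlead' x hx b))
      (fun x hx b => by rw [hQ₁1]; exact h1 x hx.1 b)
    refine ⟨V', hV'o, hV'ne, hV'V₁.trans hV₁V, ?_⟩
    have h5 := (IsSchlesingerProduct.elementary (V := V') hp (fun x hx => hμan x (hV'V₁ hx))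
      (d₀ - d₁)).mul hprod (fun x _ => by simp) (fun x hx => by
        simp only [hQ₁]
        rw [Matrix.det_mul, hdet x (hV'V₁ hx).1]
        simpa using hc x (hV'V₁ hx).1)
    refine h5.congr fun x hx => ?_
    simp only [hQ₁, mul_assoc]
    have h6 : (!![1, 0; -Z x, 1] * !![1, 0; C (μ x) * (X - C (p x)) ^ (d₀ - d₁), 1] : PolyMat) = 1 := by
      ext1 b e
      fin_cases b <;> fin_cases e <;> simp [hZ]
    rw [h6, mul_one]

/-- A polynomial matrix with constant determinant is, at generic parameters, a product of
Schlesinger transformations with a prescribed centre. -/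
theorem IsGenericallySchlesingerProduct.of_unimodular (hp : p ∈ 𝒞) (n : ℕ) :
    ∀ (V : Set (Fin m → ℂ)) (c : (Fin m → ℂ) → ℂ), AnalyticOnNhd ℂ p V → IsOpen V → V.Nonempty →
      ∀ Q : (Fin m → ℂ) → PolyMat, IsAnalyticPolyMat V Q →
      (∀ x ∈ V, c x ≠ 0) → (∀ x ∈ V, (Q x).det = C (c x)) →
      ∀ d₀ d₁ : ℕ, d₀ + d₁ ≤ n →
      (∀ x ∈ V, ∀ a, (Q x a 0).natDegree ≤ d₀) → (∀ x ∈ V, ∀ a, (Q x a 1).natDegree ≤ d₁) →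
      IsGenericallySchlesingerProduct V 𝒞 Q := by
  induction n with
  | zero =>
    intro V c hpV hV hne Q hQ hc hdet d₀ d₁ hd h0 h1
    have hdeg : ∀ x ∈ V, ∀ a b, (Q x a b).natDegree ≤ 0 := by
      intro x hx a b
      fin_cases b
      · exact (h0 x hx a).trans (by omega)
      · exact (h1 x hx a).trans (by omega)
    have hQC : ∀ x ∈ V, (Matrix.of fun a b => (Q x a b).coeff 0).map C = Q x := by
      intro x hx
      ext1 a b
      exact (eq_C_of_natDegree_le_zero (hdeg x hx a b)).symm
    refine ⟨V, hV, hne, subset_rfl, (IsSchlesingerProduct.const hp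
      (D := fun x => Matrix.of fun a b => (Q x a b).coeff 0) (fun a b => (hQ a b).coeff 0)
      fun x hx h => ?_).congr hQC⟩
    have h2 := det_map_C (Matrix.of fun a b => (Q x a b).coeff 0)
    rw [hQC x hx, h, hdet x hx, C_0, C_eq_zero] at h2
    exact hc x hx h2
  | succ n ih =>
    intro V c hpV hV hne Q hQ hc hdet d₀ d₁ hd h0 h1
    rcases Nat.lt_or_ge n (d₀ + d₁) with hlt | hle
    swap
    · exact ih V c hpV hV hne Q hQ hc hdet d₀ d₁ hle h0 h1
    rcases le_total d₁ d₀ with hdd | hdd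
    · exact .of_reduction hp hpV hV hne hQ hc hdet h0 h1 hdd (by omega)
        fun V₁ hV₁ hV₁o hV₁n Q₁ hQ₁ hdet₁ e₀ e₁ he => ih V₁ c (fun x hx => hpV x (hV₁ hx)) hV₁o hV₁n
          Q₁ hQ₁ (fun x hx => hc x (hV₁ hx)) hdet₁ e₀ e₁ (by omega)
    · let J : Matrix (Fin 2) (Fin 2) ℂ := !![0, 1; 1, 0]
      have hJ : J.det ≠ 0 := by simp [J]
      have e2 : (J.map C : PolyMat) = !![0, 1; 1, 0] := by
        ext1 a b
        fin_cases a <;> fin_cases b <;> simp [J]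
      have hJ0 : ∀ x a, (Q x * J.map C) a 0 = Q x a 1 := fun x a => by
        rw [e2, Matrix.mul_apply, Fin.sum_univ_two]; simp
      have hJ1 : ∀ x a, (Q x * J.map C) a 1 = Q x a 0 := fun x a => by
        rw [e2, Matrix.mul_apply, Fin.sum_univ_two]; simp
      have hJJ : (J.map C * J.map C : PolyMat) = 1 := by
        rw [e2]
        ext1 b e
        fin_cases b <;> fin_cases e <;> simp
      have hdet' : ∀ x ∈ V, Matrix.det (Q x * J.map C : PolyMat) = C (-c x) := fun x hx => by
        rw [Matrix.det_mul, hdet x hx, e2]; simp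
      have hc' : ∀ x ∈ V, -c x ≠ 0 := fun x hx => neg_ne_zero.2 (hc x hx)
      obtain ⟨V', hV'o, hV'n, hV', hprod⟩ : IsGenericallySchlesingerProduct V 𝒞
          (fun x => Q x * J.map C) := by
        refine .of_reduction (d₀ := d₁) (d₁ := d₀) hp hpV hV hne
          (hQ.mul (IsAnalyticPolyMat.map_C fun a b => analyticOnNhd_const)) hc' hdet'
          (fun x hx a => by rw [hJ0]; exact h1 x hx a)
          (fun x hx a => by rw [hJ1]; exact h0 x hx a) hdd (by omega) ?_
        exact fun V₁ hV₁ hV₁o hV₁n Q₁ hQ₁ hdet₁ e₀ e₁ he => ih V₁ _ (fun x hx => hpV x (hV₁ hx))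
          hV₁o hV₁n Q₁ hQ₁ (fun x hx => hc' x (hV₁ hx)) hdet₁ e₀ e₁ (by omega)
      refine ⟨V', hV'o, hV'n, hV', ?_⟩
      have h5 := (IsSchlesingerProduct.const (V := V') hp (D := fun _ => J)
        (fun a b => analyticOnNhd_const) fun _ _ => hJ).mul hprod
        (fun x _ => by rw [det_map_C]; exact C_ne_zero.2 hJ)
        (fun x hx => by rw [hdet' x (hV' hx)]; exact C_ne_zero.2 (hc' x (hV' hx)))
      exact h5.congr fun x hx => by rw [mul_assoc, hJJ, mul_one]

/-- A family of polynomial matrices that degenerates along `λ = p` can be divided by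
`diag(1, λ - p) D`, after shrinking the parameter domain. -/
theorem IsAnalyticPolyMat.exists_eq_mul_stepPoly {Q : (Fin m → ℂ) → PolyMat}
    (hQ : IsAnalyticPolyMat V Q) (hV : IsOpen V) (hne : V.Nonempty) (hpV : AnalyticOnNhd ℂ p V)
    (hdet : ∀ x ∈ V, (Q x).det.eval (p x) = 0) :
    ∃ V', IsOpen V' ∧ V'.Nonempty ∧ V' ⊆ V ∧
      ∃ (D : (Fin m → ℂ) → Matrix (Fin 2) (Fin 2) ℂ) (Q' : (Fin m → ℂ) → PolyMat),
      (∀ a b, AnalyticOnNhd ℂ (fun x => D x a b) V') ∧ (∀ x ∈ V', (D x).det ≠ 0) ∧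
      IsAnalyticPolyMat V' Q' ∧ ∀ x ∈ V', Q' x * _root_.stepPoly (p x) (D x) = C (D x).det • Q x := by
  -- it suffices to find an invertible `N` whose second column lies in the kernel of `Q` at `p`
  have key : ∀ V' ⊆ V, IsOpen V' → V'.Nonempty → ∀ N : (Fin m → ℂ) → Matrix (Fin 2) (Fin 2) ℂ,
      (∀ a b, AnalyticOnNhd ℂ (fun x => N x a b) V') → (∀ x ∈ V', (N x).det ≠ 0) →
      (∀ x ∈ V', ∀ a, (Q x a 0).eval (p x) * N x 0 1 + (Q x a 1).eval (p x) * N x 1 1 = 0) →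
      ∃ V', IsOpen V' ∧ V'.Nonempty ∧ V' ⊆ V ∧
        ∃ (D : (Fin m → ℂ) → Matrix (Fin 2) (Fin 2) ℂ) (Q' : (Fin m → ℂ) → PolyMat),
        (∀ a b, AnalyticOnNhd ℂ (fun x => D x a b) V') ∧ (∀ x ∈ V', (D x).det ≠ 0) ∧
        IsAnalyticPolyMat V' Q' ∧ ∀ x ∈ V', Q' x * _root_.stepPoly (p x) (D x) = C (D x).det • Q x := by
    intro V' hV' hV'o hV'n N hN hNdet hker
    have hQN := (hQ.mono hV').mul (IsAnalyticPolyMat.map_C hN)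
    have hpV' : AnalyticOnNhd ℂ p V' := fun x hx => hpV x (hV' hx)
    refine ⟨V', hV'o, hV'n, hV', fun x => (N x).adjugate, fun x => Matrix.of fun a b =>
      if b = 0 then (Q x * (N x).map C) a 0 else (Q x * (N x).map C) a 1 /ₘ (X - C (p x)),
      ?_, fun x hx => ?_, ?_, fun x hx => ?_⟩
    · intro a b
      simp only [Matrix.adjugate_fin_two]
      fin_cases a <;> fin_cases b <;> simp
      · exact hN _ _
      · exact (hN _ _).neg
      · exact (hN _ _).neg
      · exact hN _ _
    · rw [Matrix.det_adjugate]; simpa using hNdet x hx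
    · intro a b
      fin_cases b
      · simpa using hQN a 0
      · simpa using (hQN a 1).divByMonic hpV' hV'o
    · have hroot : ∀ a, (Q x * (N x).map C) a 1 /ₘ (X - C (p x)) * (X - C (p x)) =
          (Q x * (N x).map C) a 1 := by
        intro a
        rw [mul_comm]
        refine mul_divByMonic_eq_iff_isRoot.2 ?_
        rw [IsRoot, Matrix.mul_apply, Fin.sum_univ_two]
        simpa using hker x hx a
      have hadj : ((N x).map C * (N x).adjugate.map C : PolyMat) = C (N x).det • (1 : PolyMat) := by
        rw [← Matrix.map_mul, Matrix.mul_adjugate]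
        ext1 a b
        simp only [Matrix.map_apply, Matrix.smul_apply, smul_eq_mul, C_mul, Matrix.one_apply]
        split_ifs <;> simp
      rw [Matrix.det_adjugate]
      simp only [Fintype.card_fin, Nat.add_one_sub_one, pow_one]
      rw [show C (N x).det • Q x = (Q x * (N x).map C) * (N x).adjugate.map C by
        rw [mul_assoc, hadj, Matrix.mul_smul, mul_one]]
      ext1 a b
      rw [Matrix.mul_apply, Fin.sum_univ_two, stepPoly_zero, stepPoly_one,
        Matrix.mul_apply (M := Q x * (N x).map C), Fin.sum_univ_two]
      simp only [Matrix.of_apply, if_true, one_ne_zero, if_false, Matrix.map_apply]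
      rw [← mul_assoc, hroot]
  by_cases hz : ∀ x ∈ V, ∀ a b, (Q x a b).eval (p x) = 0
  · exact key V subset_rfl hV hne (fun _ => 1) (fun a b => analyticOnNhd_const) (by simp)
      fun x hx a => by rw [hz x hx, hz x hx]; simp
  · push Not at hz
    obtain ⟨x₀, hx₀, a, b, hab⟩ := hz
    have hev : ∀ a b, AnalyticOnNhd ℂ (fun x => (Q x a b).eval (p x)) V := fun a b =>
      (hQ a b).eval hpV hV
    have hV₁V : V ∩ {x | (Q x a b).eval (p x) ≠ 0} ⊆ V := Set.inter_subset_left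
    have hker : ∀ x ∈ V, ∀ e, (Q x e 0).eval (p x) * -(Q x a 1).eval (p x) +
        (Q x e 1).eval (p x) * (Q x a 0).eval (p x) = 0 := by
      intro x hx e
      have h1 := hdet x hx
      rw [Matrix.det_fin_two] at h1
      simp only [eval_sub, eval_mul] at h1
      fin_cases a <;> fin_cases e <;> simp only [Fin.zero_eta, Fin.mk_one]
      · ring
      · linear_combination h1
      · linear_combination -h1
      · ring
    refine key _ hV₁V ((hev a b).continuousOn.isOpen_inter_preimage hV isOpen_ne) ⟨x₀, hx₀, hab⟩
      (fun x => if b = 0 then !![1, -(Q x a 1).eval (p x); 0, (Q x a 0).eval (p x)]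
        else !![0, -(Q x a 1).eval (p x); 1, (Q x a 0).eval (p x)]) ?_ ?_ ?_
    · intro e f
      have h0 := (hev a 0).mono hV₁V
      have h1 := ((hev a 1).mono hV₁V).neg
      fin_cases b <;> fin_cases e <;> fin_cases f <;> simp [analyticOnNhd_const] <;> assumption
    · rintro x ⟨hx, hxab⟩
      fin_cases b <;> simpa [Matrix.det_fin_two] using hxab
    · rintro x ⟨hx, -⟩ e
      have h1 := hker x hx e
      fin_cases b <;> simpa using h1

/-- A family of polynomial matrices whose determinant vanishes only along finitely many holomorphic
points is, at generic parameters, a product of Schlesinger transformations centred there. -/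
theorem isGenericallySchlesingerProduct_of_det (hp : p ∈ 𝒞)
    (cs : List ((Fin m → ℂ) → ℂ)) : ∀ (V : Set (Fin m → ℂ)) (c : (Fin m → ℂ) → ℂ),
      AnalyticOnNhd ℂ p V → IsOpen V → V.Nonempty → (∀ q ∈ cs, q ∈ 𝒞 ∧ AnalyticOnNhd ℂ q V) →
      ∀ Q : (Fin m → ℂ) → PolyMat, IsAnalyticPolyMat V Q →
      (∀ x ∈ V, c x ≠ 0) → (∀ x ∈ V, (Q x).det = C (c x) * (cs.map fun q => X - C (q x)).prod) →
      IsGenericallySchlesingerProduct V 𝒞 Q := by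
  induction cs with
  | nil =>
    intro V c hpV hV hne _ Q hQ hc hdet
    choose d hd using fun a b => (hQ a b).bdd
    refine .of_unimodular hp _ V c hpV hV hne Q hQ hc (fun x hx => by simpa using hdet x hx)
      (d 0 0 + d 1 0) (d 0 1 + d 1 1) le_rfl (fun x hx a => ?_) (fun x hx a => ?_)
    · fin_cases a
      · exact (hd 0 0 x hx).trans (by omega)
      · exact (hd 1 0 x hx).trans (by omega)
    · fin_cases a
      · exact (hd 0 1 x hx).trans (by omega)
      · exact (hd 1 1 x hx).trans (by omega)
  | cons q cs ih =>
    intro V c hpV hV hne hcs Q hQ hc hdet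
    obtain ⟨hq, hqV⟩ := hcs q (by simp)
    obtain ⟨V₁, hV₁o, hV₁n, hV₁, D, Q', hD, hDdet, hQ', hQQ'⟩ :=
      hQ.exists_eq_mul_stepPoly hV hne hqV fun x hx => by rw [hdet x hx]; simp
    have hQ'det : ∀ x ∈ V₁, (Q' x).det =
        C (c x * (D x).det) * (cs.map fun q => X - C (q x)).prod := by
      intro x hx
      have h1 := congrArg Matrix.det (hQQ' x hx)
      rw [Matrix.det_mul, det_stepPoly, Matrix.det_smul, hdet x (hV₁ hx), List.map_cons,
        List.prod_cons, Fintype.card_fin] at h1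
      have h2 : ((X - C (q x)) * C (D x).det : ℂ[X]) ≠ 0 :=
        mul_ne_zero (X_sub_C_ne_zero _) (C_ne_zero.2 (hDdet x hx))
      refine mul_right_cancel₀ h2 (h1.trans ?_)
      rw [C_mul]
      ring
    obtain ⟨V', hV'o, hV'n, hV', hprod⟩ := ih V₁ (fun x => c x * (D x).det)
      (fun x hx => hpV x (hV₁ hx)) hV₁o hV₁n
      (fun q' hq' => ⟨(hcs q' (by simp [hq'])).1, fun x hx => (hcs q' (by simp [hq'])).2 x (hV₁ hx)⟩)
      Q' hQ' (fun x hx => mul_ne_zero (hc x (hV₁ hx)) (hDdet x hx)) hQ'det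
    have hprod0 : ∀ x, ((cs.map fun q => X - C (q x)).prod : ℂ[X]) ≠ 0 := fun x => by
      refine List.prod_ne_zero ?_
      simp only [List.mem_map, not_exists, not_and]
      exact fun q _ => X_sub_C_ne_zero _
    refine ⟨V', hV'o, hV'n, hV'.trans hV₁, ?_⟩
    have h5 := (IsSchlesingerProduct.step (V := V') hq (fun a b x hx => hD a b x (hV' hx))
      fun x hx => hDdet x (hV' hx)).mul hprod
      (fun x hx => by
        rw [det_stepPoly]
        exact mul_ne_zero (X_sub_C_ne_zero _) (C_ne_zero.2 (hDdet x (hV' hx))))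
      (fun x hx => by
        rw [hQ'det x (hV' hx)]
        exact mul_ne_zero (C_ne_zero.2 (mul_ne_zero (hc x (hV₁ (hV' hx))) (hDdet x (hV' hx))))
          (hprod0 x))
    refine .of_smul (f := fun x => C (D x).det) (fun x hx => C_ne_zero.2 (hDdet x (hV' hx)))
      (fun x hx => ?_) h5 fun x hx => hQQ' x (hV' hx)
    rw [hdet x (hV₁ (hV' hx)), List.map_cons, List.prod_cons]
    exact mul_ne_zero (C_ne_zero.2 (hc x (hV₁ (hV' hx))))
      (mul_ne_zero (X_sub_C_ne_zero _) (hprod0 x))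

end Factorization

/-! ### Systems with a polar solution of the commutator equation -/

section MatrixFunctions

variable {E : Type*} [NormedAddCommGroup E] [NormedSpace ℂ E]

/-- The entries of `v` have the entries of `v'` as derivatives at `l`. -/
def HasMatDerivAt (v : ℂ → Matrix (Fin 2) (Fin 2) ℂ) (v' : Matrix (Fin 2) (Fin 2) ℂ) (l : ℂ) :
    Prop :=
  ∀ a b, HasDerivAt (fun l => v l a b) (v' a b) l

/-- The entries of `v` are analytic at `z`. -/
def AnalyticMatAt (v : E → Matrix (Fin 2) (Fin 2) ℂ) (z : E) : Prop :=
  ∀ a b, AnalyticAt ℂ (fun z => v z a b) z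

namespace HasMatDerivAt

variable {v w : ℂ → Matrix (Fin 2) (Fin 2) ℂ} {v' w' : Matrix (Fin 2) (Fin 2) ℂ} {l : ℂ}

theorem const (D : Matrix (Fin 2) (Fin 2) ℂ) (l : ℂ) : HasMatDerivAt (fun _ => D) 0 l :=
  fun _ _ => hasDerivAt_const _ _

theorem add (hv : HasMatDerivAt v v' l) (hw : HasMatDerivAt w w' l) :
    HasMatDerivAt (fun l => v l + w l) (v' + w') l := fun a b => (hv a b).add (hw a b)

theorem mul (hv : HasMatDerivAt v v' l) (hw : HasMatDerivAt w w' l) :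
    HasMatDerivAt (fun l => v l * w l) (v' * w l + v l * w') l := fun a b => by
  simp only [Matrix.mul_apply, Matrix.add_apply, Fin.sum_univ_two]
  exact (((hv a 0).mul (hw 0 b)).add ((hv a 1).mul (hw 1 b))).congr_deriv (by ring)

theorem smul {f : ℂ → ℂ} {f' : ℂ} (hf : HasDerivAt f f' l) (hv : HasMatDerivAt v v' l) :
    HasMatDerivAt (fun l => f l • v l) (f' • v l + f l • v') l := fun a b =>
  hf.mul (hv a b)

theorem congr (hv : HasMatDerivAt v v' l) (h : w =ᶠ[𝓝 l] v) : HasMatDerivAt w v' l := fun a b =>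
  (hv a b).congr_of_eventuallyEq (h.mono fun l hl => by simp only [hl])

theorem unique (hv : HasMatDerivAt v v' l) (hw : HasMatDerivAt v w' l) : v' = w' := by
  ext a b
  exact (hv a b).unique (hw a b)

end HasMatDerivAt

namespace AnalyticMatAt

variable {v w : E → Matrix (Fin 2) (Fin 2) ℂ} {z : E}

theorem const (D : Matrix (Fin 2) (Fin 2) ℂ) (z : E) : AnalyticMatAt (fun _ => D) z :=
  fun _ _ => analyticAt_const

theorem add (hv : AnalyticMatAt v z) (hw : AnalyticMatAt w z) :
    AnalyticMatAt (fun z => v z + w z) z := fun a b => (hv a b).add (hw a b)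

theorem sub (hv : AnalyticMatAt v z) (hw : AnalyticMatAt w z) :
    AnalyticMatAt (fun z => v z - w z) z := fun a b => (hv a b).sub (hw a b)

theorem smul {f : E → ℂ} (hf : AnalyticAt ℂ f z) (hv : AnalyticMatAt v z) :
    AnalyticMatAt (fun z => f z • v z) z := fun a b => hf.mul (hv a b)

theorem mul (hv : AnalyticMatAt v z) (hw : AnalyticMatAt w z) :
    AnalyticMatAt (fun z => v z * w z) z := fun a b => by
  simp only [Matrix.mul_apply, Fin.sum_univ_two]
  exact ((hv a 0).mul (hw 0 b)).add ((hv a 1).mul (hw 1 b))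

theorem det (hv : AnalyticMatAt v z) : AnalyticAt ℂ (fun z => (v z).det) z := by
  simp only [Matrix.det_fin_two]
  exact ((hv 0 0).mul (hv 1 1)).sub ((hv 0 1).mul (hv 1 0))

theorem adjugate (hv : AnalyticMatAt v z) : AnalyticMatAt (fun z => (v z).adjugate) z := by
  intro a b
  simp only [Matrix.adjugate_fin_two]
  fin_cases a <;> fin_cases b <;> simp
  · exact hv _ _
  · exact (hv _ _).neg
  · exact (hv _ _).neg
  · exact hv _ _

theorem congr (hv : AnalyticMatAt v z) (h : v =ᶠ[𝓝 z] w) : AnalyticMatAt w z := fun a b =>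
  (hv a b).congr (h.mono fun z hz => by simp only [hz])

theorem continuousAt (hv : AnalyticMatAt v z) : ContinuousAt v z :=
  tendsto_pi_nhds.2 fun a => tendsto_pi_nhds.2 fun b => (hv a b).continuousAt

theorem eventually (hv : AnalyticMatAt v z) : ∀ᶠ y in 𝓝 z, AnalyticMatAt v y := by
  simp only [AnalyticMatAt, eventually_all]
  exact fun a b => (hv a b).eventually_analyticAt

theorem eventually_hasMatDerivAt {v : ℂ → Matrix (Fin 2) (Fin 2) ℂ} {z : ℂ}
    (hv : AnalyticMatAt v z) :
    ∀ᶠ l in 𝓝 z, HasMatDerivAt v (Matrix.of fun a b => deriv (fun l => v l a b) l) l :=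
  hv.eventually.mono fun _ hl a b => (hl a b).differentiableAt.hasDerivAt

end AnalyticMatAt

end MatrixFunctions

section PolarSolutions

/-- The equation `ζ V' + [V, f] = g`, where `ζ = λ - p`, has near `p` a solution `V = ζ ^ (-k) v`
with a pole at `p`, for some analytic `g`. -/
def IsPolarSolution (f : ℂ → Matrix (Fin 2) (Fin 2) ℂ) (p : ℂ) (k : ℕ)
    (v g : ℂ → Matrix (Fin 2) (Fin 2) ℂ) : Prop :=
  1 ≤ k ∧ AnalyticMatAt v p ∧ AnalyticMatAt g p ∧ v p ≠ 0 ∧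
    ∀ᶠ l in 𝓝 p, ∀ a b, (l - p) * deriv (fun l => v l a b) l - k * v l a b +
      (v l * f l - f l * v l) a b = (l - p) ^ k * g l a b

/-- The equation `ζ V' + [V, f] = g` has a solution with a pole at `p`, where `g` is tangent at `p`
to the traceless matrices with the same determinant as `f p`. -/
def HasPolarSolution (f : ℂ → Matrix (Fin 2) (Fin 2) ℂ) (p : ℂ) : Prop :=
  ∃ k v g, IsPolarSolution f p k v g ∧ (g p).trace = 0 ∧ (g p * f p).trace = 0

variable {f : ℂ → Matrix (Fin 2) (Fin 2) ℂ} {p : ℂ} {k : ℕ} {v g : ℂ → Matrix (Fin 2) (Fin 2) ℂ}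

theorem IsPolarSolution.commutator_eq (h : IsPolarSolution f p k v g) :
    v p * f p - f p * v p = (k : ℂ) • v p := by
  obtain ⟨hk, -, -, -, heq⟩ := h
  ext a b
  have := heq.self_of_nhds a b
  rw [sub_self, zero_pow (by omega)] at this
  rw [Matrix.smul_apply, smul_eq_mul]
  linear_combination this

/-- The order of the pole is determined by the eigenvalues `± k / 2` of `f p`. -/
theorem IsPolarSolution.det_eq (h : IsPolarSolution f p k v g) (htr : (f p).trace = 0) :
    (f p).det = -((k : ℂ) ^ 2 / 4) := by
  have h1 := h.commutator_eq
  obtain ⟨hk, -, -, hv, -⟩ := h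
  have hk0 : (k : ℂ) ≠ 0 := by exact_mod_cast (by omega : k ≠ 0)
  have hsq : f p * f p = -(f p).det • (1 : Matrix (Fin 2) (Fin 2) ℂ) := by
    rw [Matrix.trace_fin_two] at htr
    have h2 : f p 1 1 = -f p 0 0 := by linear_combination htr
    ext a b
    fin_cases a <;> fin_cases b <;>
      simp [Matrix.mul_apply, Fin.sum_univ_two, Matrix.det_fin_two, h2] <;> ring
  set F := f p
  set W := v p
  -- `F` anticommutes with `W`, because `k (W F + F W) = [W, F ^ 2] = 0`
  have h2 : (k : ℂ) • (W * F + F * W) = 0 := by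
    have : (k : ℂ) • (W * F + F * W) = ((k : ℂ) • W) * F + F * ((k : ℂ) • W) := by
      rw [smul_add, Matrix.smul_mul, Matrix.mul_smul]
    rw [this, ← h1, sub_mul, mul_sub, mul_assoc W, hsq, ← mul_assoc F F, hsq, mul_assoc F W]
    simp only [Matrix.mul_smul, Matrix.smul_mul, mul_one, one_mul]
    abel
  have h3 : F * W = -(W * F) := by
    have := (smul_eq_zero.1 h2).resolve_left hk0
    exact eq_neg_of_add_eq_zero_right this
  have h4 : (2 : ℂ) • (W * F) = (k : ℂ) • W := by
    rw [← h1, h3, two_smul]; abel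
  have h5 : ((k : ℂ) ^ 2 + 4 * F.det) • W = 0 := by
    have h6 : (k : ℂ) • ((k : ℂ) • W) = (-(4 * F.det)) • W := by
      rw [← h4, smul_comm, ← Matrix.smul_mul, ← h4, Matrix.smul_mul, mul_assoc, hsq, smul_smul,
        Matrix.mul_smul, mul_one, smul_smul]
      congr 1; ring
    rw [add_smul, sq, mul_smul, h6, ← add_smul]
    simp
  have h7 := (smul_eq_zero.1 h5).resolve_right hv
  linear_combination h7 / 4

theorem deriv_mul_mul_apply {v : ℂ → Matrix (Fin 2) (Fin 2) ℂ} {l : ℂ}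
    (D E : Matrix (Fin 2) (Fin 2) ℂ)
    (hv : HasMatDerivAt v (Matrix.of fun a b => deriv (fun l => v l a b) l) l) (a b : Fin 2) :
    deriv (fun l => (D * v l * E) a b) l =
      (D * (Matrix.of fun a b => deriv (fun l => v l a b) l) * E) a b := by
  have := (((HasMatDerivAt.const D l).mul hv).mul (HasMatDerivAt.const E l)) a b
  refine this.deriv.trans ?_
  simp

theorem HasPolarSolution.conj (h : HasPolarSolution f p) {D E : Matrix (Fin 2) (Fin 2) ℂ}
    (hED : E * D = 1) : HasPolarSolution (fun l => D * f l * E) p := by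
  obtain ⟨k, v, g, ⟨hk, hv, hg, hv0, heq⟩, htr, htr'⟩ := h
  refine ⟨k, fun l => D * v l * E, fun l => D * g l * E, ⟨hk, ?_, ?_, ?_, ?_⟩, ?_, ?_⟩
  · exact ((AnalyticMatAt.const D p).mul hv).mul (AnalyticMatAt.const E p)
  · exact ((AnalyticMatAt.const D p).mul hg).mul (AnalyticMatAt.const E p)
  · intro h0
    apply hv0
    simp only at h0
    calc v p = (E * D) * v p * (E * D) := by rw [hED]; simp
      _ = E * (D * v p * E) * D := by simp only [mul_assoc]
      _ = 0 := by rw [h0]; simp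
  · filter_upwards [heq, hv.eventually_hasMatDerivAt] with l hl hd a b
    have h1 : (l - p) • (Matrix.of fun a b => deriv (fun l => v l a b) l) - (k : ℂ) • v l +
        (v l * f l - f l * v l) = (l - p) ^ k • g l := by
      ext a b
      simpa using hl a b
    have h2 : D * v l * E * (D * f l * E) - D * f l * E * (D * v l * E) =
        D * (v l * f l - f l * v l) * E := by
      have : ∀ M K : Matrix (Fin 2) (Fin 2) ℂ, D * M * E * (D * K * E) = D * (M * K) * E := by
        intro M K
        calc D * M * E * (D * K * E) = D * M * (E * D) * K * E := by simp only [mul_assoc]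
          _ = D * (M * K) * E := by rw [hED, mul_one]; simp only [mul_assoc]
      rw [this, this, ← sub_mul, ← mul_sub]
    rw [deriv_mul_mul_apply D E hd, h2]
    have h3 := congrArg (fun M => (D * M * E) a b) h1
    simp only [mul_add, mul_sub, add_mul, sub_mul, Matrix.mul_smul, Matrix.smul_mul,
      Matrix.add_apply, Matrix.sub_apply, Matrix.smul_apply, smul_eq_mul] at h3 ⊢
    exact h3
  · rw [Matrix.trace_mul_comm, ← mul_assoc, hED, one_mul, htr]
  · have : D * g p * E * (D * f p * E) = D * (g p * f p) * E := by
      calc D * g p * E * (D * f p * E) = D * g p * (E * D) * f p * E := by simp only [mul_assoc]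
        _ = D * (g p * f p) * E := by rw [hED, mul_one]; simp only [mul_assoc]
    rw [this, Matrix.trace_mul_comm, ← mul_assoc, hED, one_mul, htr']

theorem AnalyticAt.exists_eq_sub_mul {φ : ℂ → ℂ} (h : AnalyticAt ℂ φ p) (h0 : φ p = 0) :
    ∃ u : ℂ → ℂ, AnalyticAt ℂ u p ∧ ∀ l, φ l = (l - p) * u l := by
  obtain ⟨s, hs⟩ := h
  refine ⟨dslope φ p, ⟨_, hs.has_fpower_series_dslope_fslope⟩, fun l => ?_⟩
  have := sub_smul_dslope φ p l
  rw [h0, sub_zero, smul_eq_mul] at this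
  exact this.symm

/-- If the first row of `f p` is a multiple of `(1, 0)`, a constant matrix can be subtracted from
the polar solution so that `g p` becomes lower triangular. -/
theorem HasPolarSolution.exists_lower_triangular {n : ℕ} (h : HasPolarSolution f p) (hn : 1 ≤ n)
    (hf : AnalyticMatAt f p) (h00 : f p 0 0 = n / 2) (h11 : f p 1 1 = -(n / 2)) :
    ∃ k v g, IsPolarSolution f p k v g ∧ (g p).trace = 0 ∧ (g p * f p).trace = 0 ∧ g p 0 1 = 0 := by
  obtain ⟨k, v, g, ⟨hk, hv, hg, hv0, heq⟩, htr, htr'⟩ := h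
  have hn0 : (n : ℂ) ≠ 0 := by exact_mod_cast (by omega : n ≠ 0)
  -- subtracting `E` from `V` subtracts `[E, f]` from `g`; at `p` its upper right entry is `-n * E 0 1`
  set E : Matrix (Fin 2) (Fin 2) ℂ := !![0, -(g p 0 1) / n; 0, 0] with hE
  have hpow : AnalyticAt ℂ (fun l : ℂ => (l - p) ^ k) p := (analyticAt_id.sub analyticAt_const).pow k
  refine ⟨k, fun l => v l - (l - p) ^ k • E, fun l => g l - (E * f l - f l * E),
    ⟨hk, ?_, ?_, ?_, ?_⟩, ?_, ?_, ?_⟩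
  · exact hv.sub (AnalyticMatAt.smul hpow (.const E p))
  · exact hg.sub (((AnalyticMatAt.const E p).mul hf).sub (hf.mul (.const E p)))
  · simp only [sub_self]
    rw [zero_pow (by omega)]; simpa using hv0
  · filter_upwards [heq, hv.eventually_hasMatDerivAt] with l hl hd a b
    have hd1 : HasDerivAt (fun l => (l - p) ^ k) (k * (l - p) ^ (k - 1)) l := by
      exact (((hasDerivAt_id l).sub_const p).fun_pow k).congr_deriv (by simp)
    have hd2 := (hd a b).sub (hd1.mul_const (E a b))
    have hd3 : deriv (fun l => (v l - (l - p) ^ k • E) a b) l =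
        deriv (fun l => v l a b) l - k * (l - p) ^ (k - 1) * E a b := hd2.deriv
    rw [hd3]
    have h1 := hl a b
    have h2 : (l - p) * (l - p) ^ (k - 1) = (l - p) ^ k := by
      rw [← pow_succ']; congr 1; omega
    simp only [sub_mul, mul_sub, Matrix.smul_mul, Matrix.mul_smul, Matrix.sub_apply,
      Matrix.smul_apply, smul_eq_mul] at h1 ⊢
    linear_combination h1 - k * E a b * h2
  · rw [Matrix.trace_sub, Matrix.trace_sub, Matrix.trace_mul_comm, sub_self, sub_zero, htr]
  · rw [sub_mul, Matrix.trace_sub, htr', sub_mul, Matrix.trace_sub,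
      Matrix.trace_mul_comm (E * f p), ← mul_assoc, sub_self, sub_zero]
  · simp only [Matrix.sub_apply, Matrix.mul_apply, Fin.sum_univ_two]
    simp [hE, h00, h11]
    field_simp
    ring

/-- How a polar solution passes through the gauge transformation by `diag(1, ζ)`: the eigenvalues
`± n / 2` of `f p` become `± (n - 1) / 2`, and in the last case `n = 1` the value at `p` of the
transformed coefficient is zero, not merely nilpotent. -/
theorem HasPolarSolution.step {n : ℕ} (h : HasPolarSolution f p) (hn : 1 ≤ n)
    (hf : AnalyticMatAt f p) (h00 : f p 0 0 = n / 2) (h01 : f p 0 1 = 0) (h11 : f p 1 1 = -(n / 2))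
    {F : ℂ → Matrix (Fin 2) (Fin 2) ℂ} (hF : AnalyticMatAt F p)
    (hF00 : ∀ᶠ l in 𝓝 p, F l 0 0 = f l 0 0 - 1 / 2) (hF01 : ∀ᶠ l in 𝓝 p, (l - p) * F l 0 1 = f l 0 1)
    (hF10 : ∀ᶠ l in 𝓝 p, F l 1 0 = (l - p) * f l 1 0)
    (hF11 : ∀ᶠ l in 𝓝 p, F l 1 1 = f l 1 1 + 1 / 2) :
    (2 ≤ n → HasPolarSolution F p) ∧ (n = 1 → F p 0 1 = 0) := by
  obtain ⟨k, v, g, hsol, htr, htr', hg01⟩ := h.exists_lower_triangular hn hf h00 h11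
  have hdet := hsol.det_eq (by rw [Matrix.trace_fin_two, h00, h11]; ring)
  have hcomm := hsol.commutator_eq
  obtain ⟨hk, hv, hg, hv0, heq⟩ := hsol
  have hkn : k = n := by
    rw [Matrix.det_fin_two, h00, h11, h01] at hdet
    have : (n : ℂ) ^ 2 = (k : ℂ) ^ 2 := by linear_combination -4 * hdet
    have h2 : n ^ 2 = k ^ 2 := by exact_mod_cast this
    exact (Nat.pow_left_injective (n := 2) (by norm_num) h2).symm
  subst hkn
  have hn0 : (k : ℂ) ≠ 0 := by exact_mod_cast (by omega : k ≠ 0)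
  -- the leading coefficient `v p` is a multiple of the lower nilpotent matrix
  have c01 := congrFun (congrFun hcomm 0) 1
  have c00 := congrFun (congrFun hcomm 0) 0
  have c11 := congrFun (congrFun hcomm 1) 1
  simp only [Matrix.sub_apply, Matrix.mul_apply, Fin.sum_univ_two, Matrix.smul_apply, smul_eq_mul,
    h00, h01, h11] at c01 c00 c11
  have v01 : v p 0 1 = 0 := by
    have : (k : ℂ) * v p 0 1 = 0 := by linear_combination -c01 / 2
    exact (mul_eq_zero.1 this).resolve_left hn0
  rw [v01] at c00 c11
  have v00 : v p 0 0 = 0 := by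
    have : (k : ℂ) * v p 0 0 = 0 := by linear_combination -c00
    exact (mul_eq_zero.1 this).resolve_left hn0
  have v11 : v p 1 1 = 0 := by
    have : (k : ℂ) * v p 1 1 = 0 := by linear_combination -c11
    exact (mul_eq_zero.1 this).resolve_left hn0
  have v10 : v p 1 0 ≠ 0 := by
    intro h10
    apply hv0
    ext a b
    fin_cases a <;> fin_cases b <;> simp [v00, v01, v11, h10]
  -- the diagonal of `g p` vanishes
  have g00 : g p 0 0 = 0 ∧ g p 1 1 = 0 := by
    rw [Matrix.trace_fin_two] at htr htr'
    simp only [Matrix.mul_apply, Fin.sum_univ_two, h00, h01, h11, hg01] at htr'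
    have : (k : ℂ) * g p 0 0 = 0 := by linear_combination htr' + k / 2 * htr
    have h1 := (mul_eq_zero.1 this).resolve_left hn0
    exact ⟨h1, by linear_combination htr - h1⟩
  obtain ⟨u00, hu00, hv00⟩ := (hv 0 0).exists_eq_sub_mul v00
  obtain ⟨u11, hu11, hv11⟩ := (hv 1 1).exists_eq_sub_mul v11
  obtain ⟨s, hs, hv01⟩ := (hv 0 1).exists_eq_sub_mul v01
  obtain ⟨q, hq, hgq⟩ := (hg 0 1).exists_eq_sub_mul hg01
  have hder : ∀ {u : ℂ → ℂ} {l : ℂ}, DifferentiableAt ℂ u l →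
      deriv (fun l => (l - p) * u l) l = u l + (l - p) * deriv u l := by
    intro u l hu
    have := ((hasDerivAt_id l).sub_const p).mul hu.hasDerivAt
    exact this.deriv.trans (by simp)
  have hext : ∀ {φ ψ : ℂ → ℂ}, ContinuousAt φ p → ContinuousAt ψ p → (∀ᶠ l in 𝓝[≠] p, φ l = ψ l) →
      ∀ᶠ l in 𝓝 p, φ l = ψ l := fun h1 h2 h3 =>
    (h1.eventuallyEq_nhds_iff_eventuallyEq_nhdsNE h2).1 h3
  have hζ : ContinuousAt (fun l : ℂ => l - p) p := by fun_prop
  -- the upper right entry of `v` has a double zero: its coefficient equation at `p` is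
  -- `(1 - 2 k) s p = 0`
  have hs0 : s p = 0 := by
    have h1 : ∀ᶠ l in 𝓝 p, (1 - k) * s l + (l - p) * deriv s l +
        (v l 0 0 * F l 0 1 + s l * f l 1 1 - f l 0 0 * s l - F l 0 1 * v l 1 1) =
        (l - p) ^ k * q l := by
      refine hext ?_ ?_ ?_
      · exact ((continuousAt_const.mul hs.continuousAt).add (hζ.mul hs.deriv.continuousAt)).add
          (((((hv 0 0).continuousAt.mul (hF 0 1).continuousAt).add
            (hs.continuousAt.mul (hf 1 1).continuousAt)).sub
            ((hf 0 0).continuousAt.mul hs.continuousAt)).sub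
            ((hF 0 1).continuousAt.mul (hv 1 1).continuousAt))
      · exact (hζ.pow k).mul hq.continuousAt
      · filter_upwards [nhdsWithin_le_nhds heq, nhdsWithin_le_nhds hF01, self_mem_nhdsWithin,
          nhdsWithin_le_nhds hs.eventually_analyticAt] with l hl hFl hlp hsl
        have hlp' : l - p ≠ 0 := sub_ne_zero.2 hlp
        have h2 := hl 0 1
        simp only [hv01, hder hsl.differentiableAt, hgq, Matrix.sub_apply, Matrix.mul_apply,
          Fin.sum_univ_two, ← hFl] at h2
        refine mul_left_cancel₀ hlp' ?_
        linear_combination h2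
    have h2 := h1.self_of_nhds
    rw [v00, v11, h00, h11, sub_self, zero_pow (by omega)] at h2
    have h3 : (1 - 2 * (k : ℂ)) * s p = 0 := by linear_combination h2
    refine (mul_eq_zero.1 h3).resolve_left ?_
    intro h4
    have : (1 : ℂ) = (2 * k : ℕ) := by push_cast; linear_combination h4
    have : 1 = 2 * k := by exact_mod_cast this
    omega
  obtain ⟨u01, hu01, hsu⟩ := hs.exists_eq_sub_mul hs0
  obtain ⟨k, rfl⟩ : ∃ j, k = j + 1 := ⟨k - 1, by omega⟩
  -- the new polar solution is `diag(1, ζ) V diag(1, ζ)⁻¹`, of pole order one less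
  set w : ℂ → Matrix (Fin 2) (Fin 2) ℂ := fun l => !![u00 l, u01 l; v l 1 0, u11 l] with hw
  set G : ℂ → Matrix (Fin 2) (Fin 2) ℂ := fun l => !![g l 0 0, q l; (l - p) * g l 1 0, g l 1 1]
    with hG
  have hwan : AnalyticMatAt w p := by
    intro a b
    fin_cases a <;> fin_cases b <;> simp [hw]
    exacts [hu00, hu01, hv 1 0, hu11]
  have hGan : AnalyticMatAt G p := by
    intro a b
    fin_cases a <;> fin_cases b <;> simp [hG]
    exacts [hg 0 0, hq, (analyticAt_id.sub analyticAt_const).mul (hg 1 0), hg 1 1]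
  have hFw : AnalyticMatAt (fun l => w l * F l - F l * w l) p := (hwan.mul hF).sub (hF.mul hwan)
  have hw' : ∀ᶠ l in 𝓝 p, ∀ a b, (l - p) * deriv (fun l => w l a b) l - k * w l a b +
      (w l * F l - F l * w l) a b = (l - p) ^ k * G l a b := by
    rw [eventually_all]; intro a
    rw [eventually_all]; intro b
    refine hext (((hζ.mul (hwan a b).deriv.continuousAt).sub
      (continuousAt_const.mul (hwan a b).continuousAt)).add (hFw a b).continuousAt)
      ((hζ.pow k).mul (hGan a b).continuousAt) ?_
    filter_upwards [nhdsWithin_le_nhds heq, nhdsWithin_le_nhds hF00, nhdsWithin_le_nhds hF01,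
      nhdsWithin_le_nhds hF10, nhdsWithin_le_nhds hF11, self_mem_nhdsWithin,
      nhdsWithin_le_nhds hu01.eventually_analyticAt,
      nhdsWithin_le_nhds hu00.eventually_analyticAt,
      nhdsWithin_le_nhds hu11.eventually_analyticAt] with l hl e00 e01 e10 e11 hlp d01 d00 d11
    have hlp' : l - p ≠ 0 := sub_ne_zero.2 hlp
    have hds : deriv (fun l => (l - p) * ((l - p) * u01 l)) l =
        (l - p) * u01 l + (l - p) * (u01 l + (l - p) * deriv u01 l) := by
      have hd : DifferentiableAt ℂ (fun l => (l - p) * u01 l) l := by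
        have := d01.differentiableAt
        fun_prop
      rw [hder hd, hder d01.differentiableAt]
    have f00 : f l 0 0 = F l 0 0 + 1 / 2 := by rw [e00]; ring
    have f11 : f l 1 1 = F l 1 1 - 1 / 2 := by rw [e11]; ring
    have h2 := hl a b
    fin_cases a <;> fin_cases b <;>
      simp only [Fin.zero_eta, Fin.mk_one, hv01, hv00, hv11,
        hder d00.differentiableAt, hder d11.differentiableAt, hgq, hds, Matrix.sub_apply,
        Matrix.mul_apply, Fin.sum_univ_two, ← e01, f00, f11, hsu, hw, hG, Matrix.of_apply,
        Matrix.cons_val', Matrix.cons_val_zero, Matrix.cons_val_one, Matrix.cons_val_fin_one,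
        e10, Nat.cast_add, Nat.cast_one, pow_succ] at h2 ⊢
    · refine mul_left_cancel₀ hlp' ?_
      linear_combination h2
    · refine mul_left_cancel₀ (mul_ne_zero hlp' hlp') ?_
      linear_combination h2
    · linear_combination h2
    · refine mul_left_cancel₀ hlp' ?_
      linear_combination h2
  have hG00 : G p 0 0 = 0 ∧ G p 1 1 = 0 ∧ G p 1 0 = 0 := by simp [hG, g00]
  have e00 := hF00.self_of_nhds
  have e10 := hF10.self_of_nhds
  rw [sub_self, zero_mul] at e10
  constructor
  · intro hk2
    refine ⟨k, w, G, ⟨by omega, hwan, hGan, ?_, hw'⟩, ?_, ?_⟩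
    · intro h0
      exact v10 (by simpa [hw] using congrFun (congrFun h0 1) 0)
    · rw [Matrix.trace_fin_two, hG00.1, hG00.2.1, add_zero]
    · rw [Matrix.trace_fin_two]
      simp only [Matrix.mul_apply, Fin.sum_univ_two, hG00.1, hG00.2.1, hG00.2.2, e10]
      ring
  -- for `n = 1` the equation no longer has a pole, and its upper left entry at `p` is
  -- `F p 0 1 * v p 1 0 = 0`: this excludes logarithms
  · intro hk1
    have hk0 : k = 0 := by omega
    subst hk0
    have h3 := hw'.self_of_nhds 0 0
    rw [hG00.1] at h3
    simp only [Matrix.sub_apply, Matrix.mul_apply, Fin.sum_univ_two, sub_self, e10] at h3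
    have h4 : F p 0 1 * v p 1 0 = 0 := by
      have : w p 1 0 = v p 1 0 := by simp [hw]
      rw [← this]
      push_cast at h3
      linear_combination -h3
    exact (mul_eq_zero.1 h4).resolve_right v10

end PolarSolutions

/-! ### Expansions at a pole and the zero curvature equation -/

section RegularParts

namespace RatFunc

variable {f : RatFunc ℂ} {q : ℂ}

theorem IsRegularAt.exists_eq_mul (hf : f.IsRegularAt q) (h0 : f.value q = 0) :
    ∃ g : RatFunc ℂ, g.IsRegularAt q ∧ f = (X - C q) * g := by
  have hn : f.num.IsRoot q := by
    have h1 : f.value q = f.num.eval q / f.denom.eval q := by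
      simp [value, eval, Polynomial.eval₂_id]
    rw [h1] at h0
    exact (div_eq_zero_iff.1 h0).resolve_right hf
  refine ⟨algebraMap _ _ (f.num /ₘ (Polynomial.X - Polynomial.C q)) / algebraMap _ _ f.denom,
    isRegularAt_div hf, ?_⟩
  have h2 := Polynomial.mul_divByMonic_eq_iff_isRoot.2 hn
  have h3 : (X - C q : RatFunc ℂ) = algebraMap _ _ (Polynomial.X - Polynomial.C q) := by simp
  rw [h3, ← mul_div_assoc, ← map_mul, h2, f.num_div_denom]

theorem isRegularAt_X_sub_C (p q : ℂ) : (X - C p : RatFunc ℂ).IsRegularAt q :=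
  (isRegularAt_X q).sub (isRegularAt_C p q)

theorem value_X_sub_C (p q : ℂ) : (X - C p : RatFunc ℂ).value q = q - p := by
  rw [value_sub (isRegularAt_X q) (isRegularAt_C p q)]
  simp [value]

theorem IsRegularAt.pow (hf : f.IsRegularAt q) (n : ℕ) : (f ^ n).IsRegularAt q := by
  induction n with
  | zero => simpa using isRegularAt_C 1 q
  | succ n ih => rw [pow_succ]; exact ih.mul hf

theorem value_pow (hf : f.IsRegularAt q) (n : ℕ) : (f ^ n).value q = f.value q ^ n := by
  induction n with
  | zero => simp [value]
  | succ n ih => rw [pow_succ, value_mul (hf.pow n) hf, ih, pow_succ]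

theorem X_sub_C_ne_zero (q : ℂ) : (X - C q : RatFunc ℂ) ≠ 0 := by
  have h3 : (X - C q : RatFunc ℂ) = algebraMap _ _ (Polynomial.X - Polynomial.C q) := by simp
  rw [h3]
  exact algebraMap_ne_zero (Polynomial.X_sub_C_ne_zero q)

theorem isRegularAt_inv_X_sub_C {p q : ℂ} (h : q ≠ p) : ((X - C p : RatFunc ℂ)⁻¹).IsRegularAt q := by
  have := isRegularAt_div (p := 1) (r := Polynomial.X - Polynomial.C p) (q := q)
    (by simpa [sub_eq_zero] using h)
  simpa using this

end RatFunc

namespace RatMat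

variable {M K : RatMat} {q : ℂ}

theorem IsRegularAt.exists_eq_smul (hM : IsRegularAt M q) (h0 : M.evalAt q = 0) :
    ∃ K : RatMat, IsRegularAt K q ∧ M = (RatFunc.X - RatFunc.C q) • K := by
  choose K hK hMK using fun a b => (hM a b).exists_eq_mul (congrFun (congrFun h0 a) b)
  exact ⟨Matrix.of K, hK, by ext1 a b; exact hMK a b⟩

theorem evalAt_smul_X_sub_C_pow {p l : ℂ} (hM : IsRegularAt M l) (k : ℕ) :
    evalAt ((RatFunc.X - RatFunc.C p) ^ k • M) l = (l - p) ^ k • M.evalAt l := by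
  rw [evalAt_smul ((RatFunc.isRegularAt_X_sub_C p l).pow k) hM,
    RatFunc.value_pow (RatFunc.isRegularAt_X_sub_C p l), RatFunc.value_X_sub_C]

theorem evalAt_smul_X_sub_C {p l : ℂ} (hM : IsRegularAt M l) :
    evalAt ((RatFunc.X - RatFunc.C p) • M) l = (l - p) • M.evalAt l := by
  simpa using evalAt_smul_X_sub_C_pow (p := p) hM 1

theorem poleOrder_le_one_iff :
    M.poleOrder q ≤ 1 ↔ IsRegularAt ((RatFunc.X - RatFunc.C q) • M) q := by
  rw [poleOrder_le_iff, pow_one]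

theorem evalAt_poleOrder_ne_zero (h : M.IsPole q) :
    evalAt ((RatFunc.X - RatFunc.C q) ^ M.poleOrder q • M) q ≠ 0 := by
  intro h0
  obtain ⟨K, hK, hMK⟩ := (poleOrder_le_iff.1 le_rfl).exists_eq_smul h0
  obtain ⟨k, hk⟩ : ∃ k, M.poleOrder q = k + 1 := ⟨_, (Nat.succ_pred_eq_of_ne_zero h).symm⟩
  rw [hk, pow_succ', mul_smul] at hMK
  have h1 := smul_right_injective RatMat (RatFunc.X_sub_C_ne_zero q) hMK
  have h2 : M.poleOrder q ≤ k := poleOrder_le_iff.2 (by rwa [h1])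
  omega

theorem residue_eq (M : RatMat) (q : ℂ) :
    M.residue q = evalAt ((RatFunc.X - RatFunc.C q) • M) q := rfl

theorem isRegularAt_simplePole {p : ℂ} (h : q ≠ p) (D : Matrix (Fin 2) (Fin 2) ℂ) :
    IsRegularAt (simplePole p D) q := fun a b => by
  simp only [simplePole, Matrix.map_apply, div_eq_mul_inv]
  exact (RatFunc.isRegularAt_C _ _).mul (RatFunc.isRegularAt_inv_X_sub_C h)

theorem evalAt_simplePole {p : ℂ} (h : q ≠ p) (D : Matrix (Fin 2) (Fin 2) ℂ) :
    evalAt (simplePole p D) q = (q - p)⁻¹ • D := by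
  have h1 : (RatFunc.X - RatFunc.C p) • simplePole p D = D.map RatFunc.C := by
    ext1 a b
    simp only [simplePole, Matrix.smul_apply, Matrix.map_apply, smul_eq_mul]
    rw [mul_div_cancel₀ _ (RatFunc.X_sub_C_ne_zero p)]
  have h2 := evalAt_smul_X_sub_C (p := p) (isRegularAt_simplePole h D)
  rw [h1] at h2
  have h3 : evalAt (D.map RatFunc.C) q = D := by
    ext a b
    simp [evalAt]
  rw [h3] at h2
  conv_rhs => rw [h2]
  rw [smul_smul, inv_mul_cancel₀ (sub_ne_zero.2 h), one_smul]

theorem isRegularAt_sub_simplePole (h : M.poleOrder q ≤ 1) :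
    IsRegularAt (M - simplePole q (M.residue q)) q := by
  rw [poleOrder_le_one_iff] at h
  have h1 : (RatFunc.X - RatFunc.C q) • simplePole q (M.residue q) = (M.residue q).map RatFunc.C := by
    ext1 a b
    simp only [simplePole, Matrix.smul_apply, Matrix.map_apply, smul_eq_mul]
    rw [mul_div_cancel₀ _ (RatFunc.X_sub_C_ne_zero q)]
  have h2 : IsRegularAt ((M.residue q).map RatFunc.C : RatMat) q := fun a b => RatFunc.isRegularAt_C _ _
  have h3 : IsRegularAt ((RatFunc.X - RatFunc.C q) • (M - simplePole q (M.residue q))) q := by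
    rw [smul_sub, h1]
    exact h.sub h2
  have h4 : evalAt ((RatFunc.X - RatFunc.C q) • (M - simplePole q (M.residue q))) q = 0 := by
    rw [smul_sub, h1, evalAt_sub h h2, ← residue_eq]
    ext a b
    simp [evalAt]
  obtain ⟨K, hK, hMK⟩ := h3.exists_eq_smul h4
  have h5 := smul_right_injective RatMat (RatFunc.X_sub_C_ne_zero q) hMK
  rwa [h5]

theorem analyticMatAt_evalAt (hM : IsRegularAt M q) : AnalyticMatAt M.evalAt q := fun a b =>
  RatFunc.analyticAt_value (hM a b)

end RatMat

end RegularParts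

section ZeroCurvature

variable {m : ℕ}

theorem hasDerivAt_update_of_differentiableAt {φ : (Fin m → ℂ) × ℂ → ℂ} {z : (Fin m → ℂ) × ℂ}
    (h : DifferentiableAt ℂ φ z) (i : Fin m) :
    HasDerivAt (fun s => φ (Function.update z.1 i s, z.2)) (fderiv ℂ φ z (Pi.single i 1, 0))
      (z.1 i) := by
  have h1 : HasDerivAt (fun s => ((Function.update z.1 i s, z.2) : (Fin m → ℂ) × ℂ))
      (Pi.single i 1, 0) (z.1 i) := (hasDerivAt_update z.1 i (z.1 i)).prodMk (hasDerivAt_const _ _)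
  have h2 : HasFDerivAt φ (fderiv ℂ φ z) (Function.update z.1 i (z.1 i), z.2) := by
    rw [Function.update_eq_self]; exact h.hasFDerivAt
  exact h2.comp_hasDerivAt (z.1 i) h1

theorem hasDerivAt_snd_of_differentiableAt {φ : (Fin m → ℂ) × ℂ → ℂ} {z : (Fin m → ℂ) × ℂ}
    (h : DifferentiableAt ℂ φ z) :
    HasDerivAt (fun l => φ (z.1, l)) (fderiv ℂ φ z (0, 1)) z.2 := by
  have h1 : HasDerivAt (fun l => ((z.1, l) : (Fin m → ℂ) × ℂ)) (0, 1) z.2 :=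
    (hasDerivAt_const _ _).prodMk (hasDerivAt_id _)
  exact h.hasFDerivAt.comp_hasDerivAt z.2 h1

/-- The entrywise derivative of a matrix-valued function in the direction `e`. -/
noncomputable def matFDeriv (v : (Fin m → ℂ) × ℂ → Matrix (Fin 2) (Fin 2) ℂ) (z e : (Fin m → ℂ) × ℂ) :
    Matrix (Fin 2) (Fin 2) ℂ :=
  Matrix.of fun a b => fderiv ℂ (fun z => v z a b) z e

variable {v w : (Fin m → ℂ) × ℂ → Matrix (Fin 2) (Fin 2) ℂ} {z e : (Fin m → ℂ) × ℂ}

theorem matFDeriv_mul (hv : AnalyticMatAt v z) (hw : AnalyticMatAt w z) :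
    matFDeriv (fun z => v z * w z) z e = matFDeriv v z e * w z + v z * matFDeriv w z e := by
  ext a b
  simp only [matFDeriv, Matrix.of_apply, Matrix.mul_apply, Matrix.add_apply, Fin.sum_univ_two]
  have hd : ∀ c, HasFDerivAt (fun z => v z a c * w z c b) _ z := fun c =>
    (hv a c).differentiableAt.hasFDerivAt.fun_mul (hw c b).differentiableAt.hasFDerivAt
  rw [((hd 0).fun_add (hd 1)).fderiv]
  simp only [add_apply, smul_apply, smul_eq_mul]
  ring

theorem matFDeriv_smul {f : (Fin m → ℂ) × ℂ → ℂ} (hf : AnalyticAt ℂ f z) (hw : AnalyticMatAt w z) :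
    matFDeriv (fun z => f z • w z) z e = fderiv ℂ f z e • w z + f z • matFDeriv w z e := by
  ext a b
  simp only [matFDeriv, Matrix.of_apply, Matrix.smul_apply, Matrix.add_apply, smul_eq_mul]
  rw [(hf.differentiableAt.hasFDerivAt.fun_mul (hw a b).differentiableAt.hasFDerivAt).fderiv]
  simp only [add_apply, smul_apply, smul_eq_mul]
  ring

theorem matFDeriv_sub (hv : AnalyticMatAt v z) (hw : AnalyticMatAt w z) :
    matFDeriv (fun z => v z - w z) z e = matFDeriv v z e - matFDeriv w z e := by
  ext a b
  simp only [matFDeriv, Matrix.of_apply, Matrix.sub_apply]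
  rw [((hv a b).differentiableAt.hasFDerivAt.fun_sub (hw a b).differentiableAt.hasFDerivAt).fderiv]
  rfl

theorem matFDeriv_congr (h : v =ᶠ[𝓝 z] w) : matFDeriv v z e = matFDeriv w z e := by
  ext a b
  simp only [matFDeriv, Matrix.of_apply]
  have h1 : (fun z => v z a b) =ᶠ[𝓝 z] fun z => w z a b := h.mono fun z hz => by simp only [hz]
  rw [h1.fderiv_eq]

theorem AnalyticMatAt.matFDeriv (hv : AnalyticMatAt v z) :
    AnalyticMatAt (fun z => matFDeriv v z e) z := fun a b =>
  ((ContinuousLinearMap.apply ℂ ℂ e).analyticAt _).comp (hv a b).fderiv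

theorem matFDeriv_comm (hv : AnalyticMatAt v z) (e e' : (Fin m → ℂ) × ℂ) :
    matFDeriv (fun z => matFDeriv v z e) z e' = matFDeriv (fun z => matFDeriv v z e') z e := by
  ext a b
  have h1 : IsSymmSndFDerivAt ℂ (fun z => v z a b) z :=
    (hv a b).contDiffAt.isSymmSndFDerivAt (n := ⊤) (by simp)
  have h2 : ∀ e e', fderiv ℂ (fun z => fderiv ℂ (fun z => v z a b) z e) z e' =
      fderiv ℂ (fderiv ℂ fun z => v z a b) z e' e := fun e e' => by
    have h3 := (hv a b).fderiv.differentiableAt.hasFDerivAt.clm_apply (hasFDerivAt_const e z)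
    rw [h3.fderiv]
    simp
  simp only [_root_.matFDeriv, Matrix.of_apply]
  rw [h2, h2]
  exact h1 e' e

variable {X : Set (Fin m → ℂ)} {A U : RatFamily m} {i : Fin m}

/-- The compatibility condition of the two systems satisfied by a common solution. -/
theorem HasCommonSolution.zero_curvature (h : HasCommonSolution X A U i) {x : Fin m → ℂ} (hx : x ∈ X)
    {l : ℂ} (hAl : RatMat.IsRegularAt (A x) l) (hUl : RatMat.IsRegularAt (U x) l)
    (hA : AnalyticMatAt (fun z : (Fin m → ℂ) × ℂ => (A z.1).evalAt z.2) (x, l)) :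
    AnalyticMatAt (fun z : (Fin m → ℂ) × ℂ => (U z.1).evalAt z.2) (x, l) ∧
    matFDeriv (fun z => (A z.1).evalAt z.2) (x, l) (Pi.single i 1, 0) =
      matFDeriv (fun z => (U z.1).evalAt z.2) (x, l) (0, 1) +
      ((U x).evalAt l * (A x).evalAt l - (A x).evalAt l * (U x).evalAt l) := by
  obtain ⟨Ψ, hΨ, hev⟩ := h x hx l (RatMat.not_isPole_iff.2 hAl)
    (RatMat.not_isPole_iff.2 hUl)
  have hΨ' : AnalyticMatAt Ψ (x, l) := hΨ
  have h2 : ∀ᶠ z in 𝓝 (x, l), matFDeriv Ψ z (0, 1) = (A z.1).evalAt z.2 * Ψ z := by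
    filter_upwards [hev, hΨ'.eventually] with z hz hzan
    ext a b
    exact (hasDerivAt_snd_of_differentiableAt (hzan a b).differentiableAt).unique (hz.2.1 a b)
  have h1 : ∀ᶠ z in 𝓝 (x, l), matFDeriv Ψ z (Pi.single i 1, 0) = (U z.1).evalAt z.2 * Ψ z := by
    filter_upwards [hev, hΨ'.eventually] with z hz hzan
    ext a b
    exact (hasDerivAt_update_of_differentiableAt (hzan a b).differentiableAt i).unique (hz.2.2 a b)
  have hdet : (Ψ (x, l)).det ≠ 0 := hev.self_of_nhds.1
  have hU : AnalyticMatAt (fun z : (Fin m → ℂ) × ℂ => (U z.1).evalAt z.2) (x, l) := by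
    refine ((hΨ'.matFDeriv (e := (Pi.single i 1, 0))).mul
      (AnalyticMatAt.smul (hΨ'.det.fun_inv hdet) hΨ'.adjugate)).congr ?_
    filter_upwards [h1, hev] with z hz1 hz2
    rw [hz1, mul_assoc, Matrix.mul_smul, Matrix.mul_adjugate, smul_smul, inv_mul_cancel₀ hz2.1,
      one_smul, mul_one]
  refine ⟨hU, ?_⟩
  have hcomm := matFDeriv_comm hΨ' (0, 1) (Pi.single i 1, 0)
  rw [matFDeriv_congr h1, matFDeriv_congr h2, matFDeriv_mul hA hΨ', matFDeriv_mul hU hΨ',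
    h1.self_of_nhds, h2.self_of_nhds] at hcomm
  have hunit : IsUnit (Ψ (x, l)) := (Matrix.isUnit_iff_isUnit_det _).2 (isUnit_iff_ne_zero.2 hdet)
  refine hunit.mul_left_injective ?_
  simp only at hcomm ⊢
  rw [add_mul, sub_mul, mul_assoc, mul_assoc, add_sub_assoc', ← hcomm]
  abel

end ZeroCurvature

/-! ### The residue at the pole of a non-Schlesinger deformation -/

section PoleResidue

variable {m N : ℕ} {X V : Set (Fin m → ℂ)} {A B : RatFamily m} {a : Fin N → (Fin m → ℂ) → ℂ}
  {κ : Fin N}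

theorem eventually_forall_ne {x : Fin m → ℂ} (ha : ∀ k, ContinuousAt (a k) x) {l : ℂ}
    (hl : ∀ k, l ≠ a k x) : ∀ᶠ z : (Fin m → ℂ) × ℂ in 𝓝 (x, l), ∀ k, z.2 ≠ a k z.1 := by
  rw [eventually_all]
  intro k
  have h : ContinuousAt (fun z : (Fin m → ℂ) × ℂ => z.2 - a k z.1) (x, l) :=
    continuousAt_snd.sub (ContinuousAt.comp (g := a k) (ha k) continuousAt_fst)
  filter_upwards [h.eventually_ne (sub_ne_zero.2 (hl k))] with z hz
  exact sub_ne_zero.1 hz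

/-- A family of rational matrices, holomorphic away from the points `a k x`, which has at most a
simple pole at `a κ x`. -/
structure HasSimplePole (V : Set (Fin m → ℂ)) (B : RatFamily m) (a : Fin N → (Fin m → ℂ) → ℂ)
    (κ : Fin N) : Prop where
  isRegularAt : ∀ x ∈ V, ∀ l, (∀ k, l ≠ a k x) → RatMat.IsRegularAt (B x) l
  analytic : ∀ x ∈ V, ∀ l, (∀ k, l ≠ a k x) →
    AnalyticMatAt (fun z : (Fin m → ℂ) × ℂ => (B z.1).evalAt z.2) (x, l)
  poleOrder_le : ∀ x ∈ V, (B x).poleOrder (a κ x) ≤ 1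

theorem IsHolomorphicFamily.isRegularAt (hA : IsHolomorphicFamily X A a) {x : Fin m → ℂ} (hx : x ∈ X)
    {l : ℂ} (hl : ∀ k, l ≠ a k x) : RatMat.IsRegularAt (A x) l := by
  rw [← RatMat.not_isPole_iff, hA.isPole_iff x hx]
  rintro ⟨k, hk⟩
  exact hl k hk.symm

theorem IsHolomorphicFamily.hasSimplePole (hA : IsHolomorphicFamily X A a)
    (h : ∀ x ∈ X, (A x).poleOrder (a κ x) = 1) : HasSimplePole X A a κ where
  isRegularAt _ hx _ hl := hA.isRegularAt hx hl
  analytic x hx l hl := hA.analytic x hx l (RatMat.not_isPole_iff.2 (hA.isRegularAt hx hl))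
  poleOrder_le x hx := (h x hx).le

theorem HasSimplePole.isRegularAt_smul (h : HasSimplePole V B a κ) {x : Fin m → ℂ} (hx : x ∈ V) :
    RatMat.IsRegularAt ((RatFunc.X - RatFunc.C (a κ x)) • B x) (a κ x) :=
  RatMat.poleOrder_le_one_iff.1 (h.poleOrder_le x hx)

/-- A disc around the pole `a κ x₀` that contains no other pole, for parameters near `x₀`. -/
theorem IsHolomorphicFamily.exists_radius (hA : IsHolomorphicFamily X A a) {x₀ : Fin m → ℂ}
    (hx₀ : x₀ ∈ X) (κ : Fin N) : ∃ r > 0, ∀ᶠ x in 𝓝 x₀, ∀ w ∈ Metric.closedBall (a κ x₀) r,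
      ∀ k, k ≠ κ → w ≠ a k x := by
  have h1 : ∀ᶠ r in 𝓝[>] (0 : ℝ), ∀ k, k ≠ κ → r < dist (a k x₀) (a κ x₀) := by
    rw [eventually_all]
    intro k
    by_cases hk : k = κ
    · simp [hk]
    · have : 0 < dist (a k x₀) (a κ x₀) := dist_pos.2 fun h => hk (hA.pole_injective x₀ hx₀ h)
      filter_upwards [Ioo_mem_nhdsGT this] with r hr _ using hr.2
  obtain ⟨r, hr, hr0⟩ := (h1.and self_mem_nhdsWithin).exists
  refine ⟨r, hr0, ?_⟩
  have h2 : ∀ᶠ x in 𝓝 x₀, ∀ k, k ≠ κ → r < dist (a k x) (a κ x₀) := by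
    rw [eventually_all]
    intro k
    by_cases hk : k = κ
    · simp [hk]
    · have hc := ((hA.analytic_pole k x₀ hx₀).continuousAt.dist continuousAt_const).eventually_const_lt
        (hr k hk)
      filter_upwards [hc] with x hx _ using hx
  filter_upwards [h2] with x hx w hw k hk hwk
  have := hx k hk
  rw [Metric.mem_closedBall, hwk] at hw
  exact absurd this (not_lt.2 hw)

/-- The product `(λ - a κ x) B(x, λ)` is jointly holomorphic along the pole. -/
theorem HasSimplePole.analyticMatAt (h : HasSimplePole V B a κ) (hA : IsHolomorphicFamily X A a)
    (hV : IsOpen V) (hVX : V ⊆ X) {x₀ : Fin m → ℂ} (hx₀ : x₀ ∈ V) :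
    AnalyticMatAt (fun z : (Fin m → ℂ) × ℂ =>
      RatMat.evalAt ((RatFunc.X - RatFunc.C (a κ z.1)) • B z.1) z.2) (x₀, a κ x₀) := by
  obtain ⟨r, hr, hrx⟩ := hA.exists_radius (hVX hx₀) κ
  have hVn : ∀ᶠ x in 𝓝 x₀, x ∈ V := hV.mem_nhds hx₀
  have hp : ContinuousAt (a κ) x₀ := (hA.analytic_pole κ x₀ (hVX hx₀)).continuousAt
  have hsm : ∀ x l, (∀ k, l ≠ a k x) → x ∈ V →
      RatMat.evalAt ((RatFunc.X - RatFunc.C (a κ x)) • B x) l = (l - a κ x) • (B x).evalAt l :=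
    fun x l hl hx => RatMat.evalAt_smul_X_sub_C (h.isRegularAt x hx l hl)
  intro b c
  have hlim : ∀ x ∈ V, Tendsto (fun w => RatMat.evalAt ((RatFunc.X - RatFunc.C (a κ x)) • B x) w b c)
      (𝓝[≠] (a κ x)) (𝓝 (RatMat.evalAt ((RatFunc.X - RatFunc.C (a κ x)) • B x) (a κ x) b c)) :=
    fun x hx => (RatMat.analyticMatAt_evalAt (h.isRegularAt_smul hx) b c).continuousAt.tendsto.mono_left
      nhdsWithin_le_nhds
  obtain ⟨F, O, hO, hx₀O, hF, hFf⟩ := exists_analyticOnNhd_extension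
    (f := fun z : (Fin m → ℂ) × ℂ => (z.2 - a κ z.1) * (B z.1).evalAt z.2 b c) (p := a κ) hr hp
    (by
      filter_upwards [hrx, hVn] with x hx hxV w hw hwp
      have hne : ∀ k, w ≠ a k x := fun k => by
        by_cases hk : k = κ
        · rw [hk]; exact hwp
        · exact hx w hw k hk
      have h1 : AnalyticAt ℂ (fun z : (Fin m → ℂ) × ℂ => a κ z.1) (x, w) :=
        AnalyticAt.comp (g := a κ) (hA.analytic_pole κ x (hVX hxV)) analyticAt_fst
      exact (analyticAt_snd.sub h1).mul (h.analytic x hxV w hne b c))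
    (by
      filter_upwards [hVn] with x hxV
      refine ⟨_, (hlim x hxV).congr' ?_⟩
      filter_upwards [(B x).eventually_isRegularAt (a κ x)] with w hw
      rw [RatMat.evalAt_smul_X_sub_C hw]
      rfl)
  have hz₀ : (x₀, a κ x₀) ∈ O ×ˢ Metric.ball (a κ x₀) r := ⟨hx₀O, Metric.mem_ball_self hr⟩
  refine (hF _ hz₀).congr ?_
  have hev1 : ∀ᶠ z in 𝓝 (x₀, a κ x₀), z ∈ O ×ˢ Metric.ball (a κ x₀) r :=
    (hO.prod Metric.isOpen_ball).mem_nhds hz₀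
  have hev2 : ∀ᶠ z : (Fin m → ℂ) × ℂ in 𝓝 (x₀, a κ x₀), z.1 ∈ V ∧
      ∀ w ∈ Metric.closedBall (a κ x₀) r, ∀ k, k ≠ κ → w ≠ a k z.1 :=
    (continuous_fst.tendsto (x₀, a κ x₀)).eventually (hVn.and hrx)
  filter_upwards [hev1, hev2] with z hz1 hz2
  have hoff : ∀ w ∈ Metric.ball (a κ x₀) r, w ≠ a κ z.1 →
      F (z.1, w) = RatMat.evalAt ((RatFunc.X - RatFunc.C (a κ z.1)) • B z.1) w b c := by
    intro w hw hwp
    rw [hFf z.1 hz1.1 w hw hwp, hsm z.1 w _ hz2.1]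
    · rfl
    · intro k
      by_cases hk : k = κ
      · rw [hk]; exact hwp
      · exact hz2.2 w (Metric.ball_subset_closedBall hw) k hk
  by_cases hzp : z.2 = a κ z.1
  · have h1 : Tendsto (fun w => F (z.1, w)) (𝓝[≠] (a κ z.1)) (𝓝 (F z)) := by
      have h2 : ContinuousAt (fun w => F (z.1, w)) (a κ z.1) := by
        have h3 : ContinuousAt F (z.1, a κ z.1) := by rw [← hzp]; exact (hF z hz1).continuousAt
        exact h3.comp (by fun_prop)
      have h4 : F z = F (z.1, a κ z.1) := by rw [← hzp]
      rw [h4]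
      exact h2.tendsto.mono_left nhdsWithin_le_nhds
    have h2 := hlim z.1 hz2.1
    rw [← hzp] at h2 ⊢
    rw [← hzp] at h1
    refine tendsto_nhds_unique h1 (h2.congr' ?_)
    have hball : ∀ᶠ w in 𝓝[≠] z.2, w ∈ Metric.ball (a κ x₀) r :=
      nhdsWithin_le_nhds (Metric.isOpen_ball.mem_nhds hz1.2)
    filter_upwards [hball, self_mem_nhdsWithin] with w hw hwz
    rw [hoff w hw (by rw [← hzp]; exact hwz), hzp]
  · exact hoff z.2 hz1.2 hzp

theorem HasSimplePole.residue_analytic (h : HasSimplePole V B a κ) (hA : IsHolomorphicFamily X A a)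
    (hV : IsOpen V) (hVX : V ⊆ X) (b c : Fin 2) :
    AnalyticOnNhd ℂ (fun x => (B x).residue (a κ x) b c) V := by
  intro x hx
  exact AnalyticAt.comp (g := fun z : (Fin m → ℂ) × ℂ =>
    RatMat.evalAt ((RatFunc.X - RatFunc.C (a κ z.1)) • B z.1) z.2 b c) (f := fun x => (x, a κ x))
    (h.analyticMatAt hA hV hVX hx b c) (analyticAt_id.prod (hA.analytic_pole κ x (hVX hx)))

end PoleResidue

section InitialPolarSolution

variable {m N : ℕ} {X : Set (Fin m → ℂ)} {A : RatFamily m} {a : Fin N → (Fin m → ℂ) → ℂ}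
  {i : Fin m} {τ κ : Fin N} {R : RatFamily m}

/-- The velocity of the pole `a κ` with respect to the pole parameter `x i`. -/
theorem IsPoleParameter.fderiv_eq (h : IsPoleParameter X a i τ) (hX : IsOpen X)
    (hA : IsHolomorphicFamily X A a) {x : Fin m → ℂ} (hx : x ∈ X) :
    fderiv ℂ (a κ) x (Pi.single i 1) = if κ = τ then 1 else 0 := by
  have h1 : HasDerivAt (fun s => a κ (Function.update x i s)) (fderiv ℂ (a κ) x (Pi.single i 1))
      (x i) := by
    have h2 : HasFDerivAt (a κ) (fderiv ℂ (a κ) x) (Function.update x i (x i)) := by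
      rw [Function.update_eq_self]
      exact (hA.analytic_pole κ x hx).differentiableAt.hasFDerivAt
    exact h2.comp_hasDerivAt (x i) (hasDerivAt_update x i (x i))
  split_ifs with hκ
  · subst hκ
    have hcont : Tendsto (fun s => Function.update x i s) (𝓝 (x i)) (𝓝 x) := by
      have : ContinuousAt (fun s => Function.update x i s) (x i) := by fun_prop
      simpa using this.tendsto
    have h2 : (fun s => a κ (Function.update x i s)) =ᶠ[𝓝 (x i)] fun s => s := by
      filter_upwards [hcont.eventually (hX.mem_nhds hx)] with s hs
      rw [h.1 _ hs]; simp
    exact h1.unique ((hasDerivAt_id' _).congr_of_eventuallyEq h2)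
  · exact h1.unique (h.2 κ hκ x hx)

/-- The coefficient `U + (∂ t₁ / ∂ t) A`, where `U` is the coefficient of the deformation equation,
has at `t₁` the pole of `R`, and it becomes a polar solution at `t₁` by the zero curvature
condition. -/
theorem IsNonSchlesinger.exists_isPolarSolution (hX : IsOpen X) (hA : IsHolomorphicFamily X A a)
    (hR : IsNonSchlesinger X A a i τ κ R) {x : Fin m → ℂ} (hx : x ∈ X) :
    ∃ k v, IsPolarSolution (RatMat.evalAt ((RatFunc.X - RatFunc.C (a κ x)) • A x)) (a κ x) k v
      fun l => matFDeriv (fun z : (Fin m → ℂ) × ℂ =>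
          RatMat.evalAt ((RatFunc.X - RatFunc.C (a κ z.1)) • A z.1) z.2) (x, l) (Pi.single i 1, 0) +
        fderiv ℂ (a κ) x (Pi.single i 1) • matFDeriv (fun z : (Fin m → ℂ) × ℂ =>
          RatMat.evalAt ((RatFunc.X - RatFunc.C (a κ z.1)) • A z.1) z.2) (x, l) (0, 1) := by
  have hpole : HasSimplePole X A a κ := hA.hasSimplePole hR.poleOrder_eq_one
  have hpt := hR.isIsomonodromic.isPoleParameter.fderiv_eq hX hA hx (κ := κ)
  set p := a κ x with hp
  set c := fderiv ℂ (a κ) x (Pi.single i 1) with hc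
  set U : RatFamily m := fun x => -RatMat.simplePole (a τ x) ((A x).residue (a τ x)) + R x with hU
  set F : (Fin m → ℂ) × ℂ → Matrix (Fin 2) (Fin 2) ℂ := fun z =>
    RatMat.evalAt ((RatFunc.X - RatFunc.C (a κ z.1)) • A z.1) z.2 with hF
  have hFan : AnalyticMatAt F (x, p) := hpole.analyticMatAt hA hX subset_rfl hx
  set W : RatMat := U x + RatFunc.C c • A x with hW
  have hWR : RatMat.IsRegularAt (W - R x) p := by
    have h1 : W - R x = RatFunc.C c • A x - RatMat.simplePole (a τ x) ((A x).residue (a τ x)) := by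
      simp only [hW, hU]; abel
    rw [h1, hpt]
    split_ifs with hκ
    · subst hκ
      rw [map_one, one_smul]
      exact RatMat.isRegularAt_sub_simplePole (hpole.poleOrder_le x hx)
    · rw [map_zero, zero_smul]
      refine RatMat.IsRegularAt.sub (fun _ _ => ?_) (RatMat.isRegularAt_simplePole ?_ _)
      · simpa using RatFunc.isRegularAt_C 0 p
      · exact fun h => hκ (hA.pole_injective x hx h)
  have hWpole : W.IsPole p := by
    by_contra h
    rw [RatMat.not_isPole_iff] at h
    have := h.sub hWR
    rw [sub_sub_cancel] at this
    exact RatMat.not_isPole_iff.2 this (hR.isPole x hx)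
  set k := W.poleOrder p with hk
  have hk1 : 1 ≤ k := Nat.one_le_iff_ne_zero.2 hWpole
  have hvreg : RatMat.IsRegularAt ((RatFunc.X - RatFunc.C p) ^ k • W) p :=
    RatMat.poleOrder_le_iff.1 le_rfl
  have hvan := RatMat.analyticMatAt_evalAt hvreg
  have hfan := RatMat.analyticMatAt_evalAt (hpole.isRegularAt_smul hx)
  have hembed : AnalyticAt ℂ (fun l : ℂ => ((x, l) : (Fin m → ℂ) × ℂ)) p :=
    analyticAt_const.prod analyticAt_id
  have hgan : AnalyticMatAt (fun l => matFDeriv F (x, l) (Pi.single i 1, 0) +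
      c • matFDeriv F (x, l) (0, 1)) p := by
    refine AnalyticMatAt.add (fun b d => ?_) (AnalyticMatAt.smul analyticAt_const fun b d => ?_)
    · exact AnalyticAt.comp (g := fun z => matFDeriv F z (Pi.single i 1, 0) b d)
        (hFan.matFDeriv b d) hembed
    · exact AnalyticAt.comp (g := fun z => matFDeriv F z (0, 1) b d) (hFan.matFDeriv b d) hembed
  refine ⟨k, _, hk1, hvan, hgan, RatMat.evalAt_poleOrder_ne_zero hWpole, ?_⟩
  rw [eventually_all]; intro b
  rw [eventually_all]; intro d
  have hζ : ContinuousAt (fun l : ℂ => l - p) p := by fun_prop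
  have hcomm : AnalyticMatAt (fun l => RatMat.evalAt ((RatFunc.X - RatFunc.C p) ^ k • W) l *
      RatMat.evalAt ((RatFunc.X - RatFunc.C p) • A x) l -
      RatMat.evalAt ((RatFunc.X - RatFunc.C p) • A x) l *
      RatMat.evalAt ((RatFunc.X - RatFunc.C p) ^ k • W) l) p := (hvan.mul hfan).sub (hfan.mul hvan)
  refine (ContinuousAt.eventuallyEq_nhds_iff_eventuallyEq_nhdsNE
    (((hζ.mul (hvan b d).deriv.continuousAt).sub
      (continuousAt_const.mul (hvan b d).continuousAt)).add (hcomm b d).continuousAt)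
    ((hζ.pow k).mul (hgan b d).continuousAt)).1 ?_
  have hfin : ∀ᶠ l in 𝓝[≠] p, ∀ j, l ≠ a j x := by
    rw [eventually_all]
    intro j
    by_cases hj : a j x = p
    · rw [hj]; exact self_mem_nhdsWithin
    · exact nhdsWithin_le_nhds (isOpen_ne.mem_nhds (Ne.symm hj))
  filter_upwards [hfin, (U x).eventually_isRegularAt p, self_mem_nhdsWithin] with l hl hUl hlp
  have hlp' : l - p ≠ 0 := sub_ne_zero.2 hlp
  have hAl := hpole.isRegularAt x hx l hl
  have hAan := hpole.analytic x hx l hl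
  obtain ⟨hUan, hzc⟩ := hR.isIsomonodromic.hasCommonSolution.zero_curvature hx hAl hUl hAan
  have hcC : (RatFunc.C c : RatFunc ℂ).IsRegularAt l := RatFunc.isRegularAt_C _ _
  have hWl : RatMat.IsRegularAt W l := hUl.add (.smul hcC hAl)
  have hWval : ∀ l', RatMat.IsRegularAt (U x) l' → RatMat.IsRegularAt (A x) l' →
      W.evalAt l' = (U x).evalAt l' + c • (A x).evalAt l' := fun l' h1 h2 => by
    rw [hW, RatMat.evalAt_add h1 (.smul (RatFunc.isRegularAt_C _ _) h2),
      RatMat.evalAt_smul (RatFunc.isRegularAt_C _ _) h2]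
    simp [RatFunc.value]
  set 𝒜 : (Fin m → ℂ) × ℂ → Matrix (Fin 2) (Fin 2) ℂ := fun z => (A z.1).evalAt z.2 with h𝒜
  set 𝒰 : (Fin m → ℂ) × ℂ → Matrix (Fin 2) (Fin 2) ℂ := fun z => (U z.1).evalAt z.2 with h𝒰
  -- derivative of the polar solution
  have hWd : HasMatDerivAt W.evalAt (matFDeriv 𝒰 (x, l) (0, 1) + c • matFDeriv 𝒜 (x, l) (0, 1)) l := by
    have h1 : HasMatDerivAt (fun l => 𝒰 (x, l)) (matFDeriv 𝒰 (x, l) (0, 1)) l := fun b d =>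
      hasDerivAt_snd_of_differentiableAt (z := (x, l)) (hUan b d).differentiableAt
    have h2 : HasMatDerivAt (fun l => 𝒜 (x, l)) (matFDeriv 𝒜 (x, l) (0, 1)) l := fun b d =>
      hasDerivAt_snd_of_differentiableAt (z := (x, l)) (hAan b d).differentiableAt
    have h3 := h1.add (HasMatDerivAt.smul (hasDerivAt_const l c) h2)
    rw [zero_smul, zero_add] at h3
    refine h3.congr ?_
    filter_upwards [hUl.eventually, hAl.eventually] with l' h1 h2 using hWval l' h1 h2
  have hpowd : HasDerivAt (fun l => (l - p) ^ k) (k * (l - p) ^ (k - 1)) l :=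
    (((hasDerivAt_id l).sub_const p).fun_pow k).congr_deriv (by simp)
  have hvd := (HasMatDerivAt.smul hpowd hWd).congr
    (w := RatMat.evalAt ((RatFunc.X - RatFunc.C p) ^ k • W)) (by
      filter_upwards [hWl.eventually] with l' h using RatMat.evalAt_smul_X_sub_C_pow h k)
  change (l - p) * deriv (fun l => RatMat.evalAt ((RatFunc.X - RatFunc.C p) ^ k • W) l b d) l -
    k * RatMat.evalAt ((RatFunc.X - RatFunc.C p) ^ k • W) l b d +
    (RatMat.evalAt ((RatFunc.X - RatFunc.C p) ^ k • W) l *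
      RatMat.evalAt ((RatFunc.X - RatFunc.C p) • A x) l -
      RatMat.evalAt ((RatFunc.X - RatFunc.C p) • A x) l *
      RatMat.evalAt ((RatFunc.X - RatFunc.C p) ^ k • W) l) b d =
    (l - p) ^ k * (matFDeriv F (x, l) (Pi.single i 1, 0) + c • matFDeriv F (x, l) (0, 1)) b d
  rw [(hvd b d).deriv, RatMat.evalAt_smul_X_sub_C_pow hWl, RatMat.evalAt_smul_X_sub_C hAl,
    hWval l hUl hAl]
  -- derivatives of `F = (λ - t₁) A`
  have hζan : AnalyticAt ℂ (fun z : (Fin m → ℂ) × ℂ => z.2 - a κ z.1) (x, l) :=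
    analyticAt_snd.sub (AnalyticAt.comp (g := a κ) (hA.analytic_pole κ x hx) analyticAt_fst)
  have hζd : ∀ e, fderiv ℂ (fun z : (Fin m → ℂ) × ℂ => z.2 - a κ z.1) (x, l) e =
      e.2 - fderiv ℂ (a κ) x e.1 := by
    intro e
    have h1 : HasFDerivAt (fun z : (Fin m → ℂ) × ℂ => a κ z.1)
        ((fderiv ℂ (a κ) x).comp (ContinuousLinearMap.fst ℂ _ _)) (x, l) :=
      HasFDerivAt.comp (g := a κ) (x, l) (hA.analytic_pole κ x hx).differentiableAt.hasFDerivAt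
        hasFDerivAt_fst
    rw [((hasFDerivAt_snd (p := (x, l))).fun_sub h1).fderiv]
    rfl
  have hFev : F =ᶠ[𝓝 (x, l)] fun z => (z.2 - a κ z.1) • 𝒜 z := by
    have h1 : ∀ᶠ z : (Fin m → ℂ) × ℂ in 𝓝 (x, l), z.1 ∈ X :=
      (continuous_fst.tendsto (x, l)).eventually (hX.mem_nhds hx)
    have h2 : ∀ᶠ z : (Fin m → ℂ) × ℂ in 𝓝 (x, l), ∀ j, z.2 ≠ a j z.1 :=
      eventually_forall_ne (fun k => (hA.analytic_pole k x hx).continuousAt) hl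
    filter_upwards [h1, h2] with z hz1 hz2
    exact RatMat.evalAt_smul_X_sub_C (hpole.isRegularAt z.1 hz1 z.2 hz2)
  rw [matFDeriv_congr hFev, matFDeriv_congr hFev, matFDeriv_smul hζan hAan, matFDeriv_smul hζan hAan,
    hζd, hζd, hzc]
  simp only [map_zero, ← hc, ← hp]
  have hpk : (l - p) * (l - p) ^ (k - 1) = (l - p) ^ k := by
    rw [← pow_succ']; congr 1; omega
  simp only [Matrix.add_apply, Matrix.sub_apply, Matrix.smul_apply, smul_eq_mul, Matrix.mul_apply,
    Fin.sum_univ_two, h𝒜, h𝒰]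
  linear_combination (k * ((U x).evalAt l b d + c * (A x).evalAt l b d)) * hpk

/-- Unlike `RatFunc.value_neg`, this does not exclude poles, where both sides are `0`. -/
theorem RatFunc.value_neg' (f : RatFunc ℂ) (q : ℂ) : (-f).value q = -f.value q := by
  by_cases hf : f.IsRegularAt q
  · exact RatFunc.value_neg hf
  · have h0 : ∀ g : RatFunc ℂ, ¬ g.IsRegularAt q → g.value q = 0 := fun g hg => by
      have : g.denom.eval q = 0 := not_not.1 hg
      simp [RatFunc.value, RatFunc.eval, Polynomial.eval₂_id, this]
    rw [h0 f hf, h0 (-f) fun h => hf (by simpa using h.neg), neg_zero]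

theorem RatMat.trace_evalAt {M : RatMat} (h : M.trace = 0) (q : ℂ) : (M.evalAt q).trace = 0 := by
  rw [Matrix.trace_fin_two] at h ⊢
  rw [RatMat.evalAt_apply, RatMat.evalAt_apply, eq_neg_of_add_eq_zero_right h, RatFunc.value_neg']
  ring

/-- The residue has near every parameter value the constant determinant `- n ^ 2 / 4`, `n ≥ 1`, and
the polar solution satisfies the trace conditions, because the residue moves in this conjugacy
class. -/
theorem IsNonSchlesinger.exists_hasPolarSolution (hX : IsOpen X) (hA : IsHolomorphicFamily X A a)
    (hR : IsNonSchlesinger X A a i τ κ R) {x₀ : Fin m → ℂ} (hx₀ : x₀ ∈ X) :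
    ∃ n : ℕ, 1 ≤ n ∧ ∀ᶠ x in 𝓝 x₀, ((A x).residue (a κ x)).det = -((n : ℂ) ^ 2 / 4) ∧
      HasPolarSolution (RatMat.evalAt ((RatFunc.X - RatFunc.C (a κ x)) • A x)) (a κ x) := by
  have hpole : HasSimplePole X A a κ := hA.hasSimplePole hR.poleOrder_eq_one
  have htr : ∀ x ∈ X, ∀ l, (RatMat.evalAt ((RatFunc.X - RatFunc.C (a κ x)) • A x) l).trace = 0 :=
    fun x hx l => RatMat.trace_evalAt (by rw [Matrix.trace_smul, hA.trace_eq_zero x hx, smul_zero]) l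
  choose! k v hkv using fun x hx => hR.exists_isPolarSolution hX hA (x := x) hx
  have hdet : ∀ x ∈ X, ((A x).residue (a κ x)).det = -((k x : ℂ) ^ 2 / 4) := fun x hx =>
    (hkv x hx).det_eq (htr x hx _)
  have hres : ∀ x ∈ X, AnalyticMatAt (fun x => (A x).residue (a κ x)) x := fun x hx b c =>
    hpole.residue_analytic hA hX subset_rfl b c x hx
  -- `k x` is a continuous function with integral values
  have hconst : ∀ᶠ x in 𝓝 x₀, k x = k x₀ := by
    have h1 : ContinuousAt (fun x => ((A x).residue (a κ x)).det) x₀ := (hres x₀ hx₀).det.continuousAt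
    filter_upwards [h1.eventually (Metric.ball_mem_nhds _ (by norm_num : (0 : ℝ) < 1 / 4)),
      hX.mem_nhds hx₀] with x hx hxX
    rw [dist_eq_norm, hdet x hxX, hdet x₀ hx₀] at hx
    have h2 : -((k x : ℂ) ^ 2 / 4) - -((k x₀ : ℂ) ^ 2 / 4) =
        (((k x₀ : ℤ) ^ 2 - (k x : ℤ) ^ 2 : ℤ) : ℂ) / 4 := by push_cast; ring
    rw [h2, norm_div, Complex.norm_intCast] at hx
    have h3 : |((((k x₀ : ℤ) ^ 2 - (k x : ℤ) ^ 2 : ℤ)) : ℝ)| < 1 := by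
      have : ‖(4 : ℂ)‖ = 4 := by simp
      rw [this] at hx
      linarith
    have h4 : |(k x₀ : ℤ) ^ 2 - (k x : ℤ) ^ 2| < 1 := by exact_mod_cast h3
    have h5 : (k x₀ : ℤ) ^ 2 = (k x : ℤ) ^ 2 := by
      have := Int.abs_lt_one_iff.1 h4
      linarith
    have h6 : k x₀ ^ 2 = k x ^ 2 := by exact_mod_cast h5
    exact (Nat.pow_left_injective (n := 2) (by norm_num) h6).symm
  refine ⟨k x₀, (hkv x₀ hx₀).1, ?_⟩
  filter_upwards [hconst.eventually_nhds, hX.mem_nhds hx₀] with x hx hxX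
  refine ⟨by rw [hdet x hxX, hx.self_of_nhds], k x, v x, _, hkv x hxX, ?_⟩
  -- the derivative of the residue in the direction `x i`
  set F : (Fin m → ℂ) × ℂ → Matrix (Fin 2) (Fin 2) ℂ := fun z =>
    RatMat.evalAt ((RatFunc.X - RatFunc.C (a κ z.1)) • A z.1) z.2 with hF
  set G : Matrix (Fin 2) (Fin 2) ℂ := matFDeriv F (x, a κ x) (Pi.single i 1, 0) +
    fderiv ℂ (a κ) x (Pi.single i 1) • matFDeriv F (x, a κ x) (0, 1) with hG
  have hFan : AnalyticMatAt F (x, a κ x) := hpole.analyticMatAt hA hX subset_rfl hxX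
  have hder : ∀ b c, HasFDerivAt (fun x => (A x).residue (a κ x) b c)
      (fderiv ℂ (fun x => (A x).residue (a κ x) b c) x) x := fun b c =>
    (hres x hxX b c).differentiableAt.hasFDerivAt
  have hGval : ∀ b c, fderiv ℂ (fun x => (A x).residue (a κ x) b c) x (Pi.single i 1) = G b c := by
    intro b c
    have h1 : HasFDerivAt (fun x => F (x, a κ x) b c) _ x := HasFDerivAt.comp (g := fun z => F z b c)
      (f := fun x => (x, a κ x)) x (hFan b c).differentiableAt.hasFDerivAt
      ((hasFDerivAt_id x).prodMk (hA.analytic_pole κ x hxX).differentiableAt.hasFDerivAt)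
    have h2 : (fun x => (A x).residue (a κ x) b c) = fun x => F (x, a κ x) b c := rfl
    rw [h2, h1.fderiv]
    have h3 : ∀ e : (Fin m → ℂ) × ℂ, e = (e.1, 0) + e.2 • (0, 1) := fun e => by
      ext <;> simp
    rw [ContinuousLinearMap.comp_apply, h3 (ContinuousLinearMap.prod _ _ _), map_add, map_smul]
    rfl
  have htrG : G 0 0 + G 1 1 = 0 := by
    rw [← hGval, ← hGval]
    have h1 : (fun x => (A x).residue (a κ x) 0 0 + (A x).residue (a κ x) 1 1) =ᶠ[𝓝 x] fun _ => 0 := by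
      filter_upwards [hX.mem_nhds hxX] with y hy
      have := htr y hy (a κ y)
      rwa [Matrix.trace_fin_two] at this
    have h2 := h1.fderiv_eq (𝕜 := ℂ)
    rw [((hder 0 0).fun_add (hder 1 1)).fderiv] at h2
    have h3 := congrArg (fun L => L (Pi.single i 1)) h2
    simpa using h3
  refine ⟨by rw [Matrix.trace_fin_two]; exact htrG, ?_⟩
  -- differentiating the constant determinant gives the second trace condition
  have h1 : (fun x => (A x).residue (a κ x) 0 0 * (A x).residue (a κ x) 1 1 -
      (A x).residue (a κ x) 0 1 * (A x).residue (a κ x) 1 0) =ᶠ[𝓝 x]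
      fun _ => -((k x₀ : ℂ) ^ 2 / 4) := by
    filter_upwards [hX.mem_nhds hxX, hx] with y hy hky
    rw [← Matrix.det_fin_two, hdet y hy, hky]
  have h2 := h1.fderiv_eq (𝕜 := ℂ)
  rw [(((hder 0 0).fun_mul (hder 1 1)).fun_sub ((hder 0 1).fun_mul (hder 1 0))).fderiv] at h2
  have h3 := congrArg (fun L => L (Pi.single i 1)) h2
  simp only [sub_apply, add_apply, smul_apply, smul_eq_mul, fderiv_fun_const, hGval] at h3
  have h4 := htr x hxX (a κ x)
  rw [Matrix.trace_fin_two] at h4 ⊢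
  simp only [Matrix.mul_apply, Fin.sum_univ_two]
  rw [RatMat.residue_eq] at h3
  simp only [Pi.zero_apply, zero_apply] at h3
  linear_combination -h3 + (G 0 0 + G 1 1) * h4

end InitialPolarSolution

/-! ### Effect of one Schlesinger step on residues and at infinity -/

section SingleStep

/-- The coefficient of a system after a gauge transformation by `diag(1, λ - p) D`, in terms of
`Ã = D A D⁻¹`. -/
theorem IsGauge.stepPoly_apply {p : ℂ} {D E : Matrix (Fin 2) (Fin 2) ℂ} {A B : RatMat}
    (h : IsGauge (stepPoly p D) A B) (hD : D.det ≠ 0) (hED : E * D = 1) :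
    B 0 0 = (D.map RatFunc.C * A * E.map RatFunc.C : RatMat) 0 0 -
        RatFunc.C (1 / 2) / (RatFunc.X - RatFunc.C p) ∧
      (RatFunc.X - RatFunc.C p) * B 0 1 = (D.map RatFunc.C * A * E.map RatFunc.C : RatMat) 0 1 ∧
      B 1 0 = (RatFunc.X - RatFunc.C p) * (D.map RatFunc.C * A * E.map RatFunc.C : RatMat) 1 0 ∧
      B 1 1 = (D.map RatFunc.C * A * E.map RatFunc.C : RatMat) 1 1 +
        RatFunc.C (1 / 2) / (RatFunc.X - RatFunc.C p) := by
  set ζ : RatFunc ℂ := RatFunc.X - RatFunc.C p with hζ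
  have hζ0 : ζ ≠ 0 := RatFunc.X_sub_C_ne_zero p
  set A' : RatMat := D.map RatFunc.C * A * E.map RatFunc.C with hA'
  have hA'D : A' * (D.map RatFunc.C : RatMat) = (D.map RatFunc.C : RatMat) * A := by
    rw [hA', mul_assoc, ← Matrix.map_mul, hED, Matrix.map_one _ (map_zero _) (map_one _), mul_one]
  set B' : RatMat := !![A' 0 0 - RatFunc.C (1 / 2) / ζ, A' 0 1 / ζ; ζ * A' 1 0,
    A' 1 1 + RatFunc.C (1 / 2) / ζ] with hB'
  have hT : PolyMat.toRat (stepPoly p D) = !![1, 0; 0, ζ] * (D.map RatFunc.C : RatMat) := by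
    ext1 a b
    rw [PolyMat.toRat_apply, Matrix.mul_apply, Fin.sum_univ_two]
    fin_cases a
    · simp only [Fin.zero_eta, stepPoly_zero]; simp
    · simp only [Fin.mk_one, stepPoly_one]; simp [hζ]
  have hT' : PolyMat.toRat (PolyMat.deriv (stepPoly p D)) =
      !![0, 0; 0, 1] * (D.map RatFunc.C : RatMat) := by
    ext1 a b
    rw [PolyMat.toRat_apply, PolyMat.deriv_apply, Matrix.mul_apply, Fin.sum_univ_two]
    fin_cases a
    · simp only [Fin.zero_eta, stepPoly_zero]; simp
    · simp only [Fin.mk_one, stepPoly_one]; simp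
  have hh : PolyMat.halfLogDeriv (stepPoly p D) = RatFunc.C (1 / 2) / ζ := by
    have hD' : (RatFunc.C D.det : RatFunc ℂ) ≠ 0 := by simpa using hD
    rw [PolyMat.halfLogDeriv, det_stepPoly]
    simp only [Polynomial.derivative_mul, Polynomial.derivative_X,
      Polynomial.derivative_C, sub_zero, mul_zero, add_zero, one_mul, map_mul, map_sub,
      RatFunc.algebraMap_X, RatFunc.algebraMap_C, ← hζ]
    field_simp
  have hg : IsGauge (stepPoly p D) A B' := by
    unfold IsGauge
    rw [hT, hT', hh, mul_assoc _ _ A, ← hA'D, ← mul_assoc, ← mul_assoc, ← Matrix.smul_mul,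
      ← add_mul, ← sub_mul]
    congr 1
    have h2 : (RatFunc.C (1 / 2) + RatFunc.C (1 / 2) : RatFunc ℂ) = 1 := by
      rw [← map_add]; norm_num
    rw [hB', Matrix.eta_fin_two A']
    generalize (RatFunc.C (1 / 2) : RatFunc ℂ) = c at h2
    ext1 a b
    fin_cases a <;> fin_cases b <;> simp [hζ0]
    · field_simp
      linear_combination h2
  have hdet : (stepPoly p D).det ≠ 0 := by
    rw [det_stepPoly]
    exact mul_ne_zero (Polynomial.X_sub_C_ne_zero p) (Polynomial.C_ne_zero.2 hD)
  rw [h.unique hg hdet]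
  refine ⟨by simp [hB'], ?_, by simp [hB'], by simp [hB']⟩
  simp only [hB', Matrix.of_apply, Matrix.cons_val', Matrix.cons_val_zero, Matrix.cons_val_one,
    Matrix.cons_val_fin_one]
  rw [mul_div_cancel₀ _ hζ0]

/-- A Schlesinger transformation adapted to the residue at `p` lowers its eigenvalues `± n / 2` to
`± (n - 1) / 2`. -/
theorem IsGauge.residue_step {p : ℂ} {D E : Matrix (Fin 2) (Fin 2) ℂ} {A B : RatMat} {n : ℕ}
    (h : IsGauge (stepPoly p D) A B) (hn : 1 ≤ n) (hD : D.det ≠ 0) (hED : E * D = 1)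
    (hA : A.poleOrder p ≤ 1) (hpol : HasPolarSolution (RatMat.evalAt ((RatFunc.X - RatFunc.C p) • A)) p)
    (h00 : (D * A.residue p * E) 0 0 = n / 2) (h01 : (D * A.residue p * E) 0 1 = 0)
    (h11 : (D * A.residue p * E) 1 1 = -(n / 2)) :
    B.poleOrder p ≤ 1 ∧ (B.residue p).det = -(((n - 1 : ℕ) : ℂ) ^ 2 / 4) ∧
      (1 ≤ n - 1 → HasPolarSolution (RatMat.evalAt ((RatFunc.X - RatFunc.C p) • B)) p) ∧
      (n - 1 = 0 → RatMat.IsRegularAt B p) := by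
  obtain ⟨b00, b01, b10, b11⟩ := h.stepPoly_apply hD hED
  set ζ : RatFunc ℂ := RatFunc.X - RatFunc.C p with hζ
  have hζ0 : ζ ≠ 0 := RatFunc.X_sub_C_ne_zero p
  set A' : RatMat := D.map RatFunc.C * A * E.map RatFunc.C with hA'
  have hDr : ∀ (K : Matrix (Fin 2) (Fin 2) ℂ) (q : ℂ), RatMat.IsRegularAt (K.map RatFunc.C) q :=
    fun K q a b => RatFunc.isRegularAt_C _ _
  have hDv : ∀ (K : Matrix (Fin 2) (Fin 2) ℂ) (q : ℂ), RatMat.evalAt (K.map RatFunc.C) q = K :=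
    fun K q => by ext a b; simp [RatMat.evalAt]
  have hAreg := RatMat.poleOrder_le_one_iff.1 hA
  have hAA' : ζ • A' = D.map RatFunc.C * (ζ • A) * E.map RatFunc.C := by
    rw [hA', Matrix.mul_smul, Matrix.smul_mul]
  have hA'reg : RatMat.IsRegularAt (ζ • A') p := by
    rw [hAA']; exact ((hDr D p).mul hAreg).mul (hDr E p)
  have hval : ∀ l, RatMat.IsRegularAt (ζ • A) l →
      RatMat.evalAt (ζ • A') l = D * RatMat.evalAt (ζ • A) l * E := fun l hl => by
    rw [hAA', RatMat.evalAt_mul ((hDr D l).mul hl) (hDr E l), RatMat.evalAt_mul (hDr D l) hl, hDv, hDv]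
  set f : ℂ → Matrix (Fin 2) (Fin 2) ℂ := RatMat.evalAt (ζ • A') with hf
  have hfp : f p = D * A.residue p * E := hval p hAreg
  have hfpol : HasPolarSolution f p := by
    have h1 := hpol.conj hED
    obtain ⟨k, v, g, ⟨hk, hv, hg, hv0, heq⟩, htr, htr'⟩ := h1
    refine ⟨k, v, g, ⟨hk, hv, hg, hv0, ?_⟩, htr, by rw [hval p hAreg]; exact htr'⟩
    filter_upwards [heq, hAreg.eventually] with l hl hAl
    rw [hval l hAl]
    exact hl
  -- the entries of `(λ - p) B`
  have c00 : (ζ • B) 0 0 = (ζ • A') 0 0 - RatFunc.C (1 / 2) := by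
    rw [Matrix.smul_apply, Matrix.smul_apply, b00, smul_eq_mul, smul_eq_mul, mul_sub,
      mul_div_cancel₀ _ hζ0]
  have c11 : (ζ • B) 1 1 = (ζ • A') 1 1 + RatFunc.C (1 / 2) := by
    rw [Matrix.smul_apply, Matrix.smul_apply, b11, smul_eq_mul, smul_eq_mul, mul_add,
      mul_div_cancel₀ _ hζ0]
  have c10 : (ζ • B) 1 0 = ζ * (ζ • A') 1 0 := by
    rw [Matrix.smul_apply, Matrix.smul_apply, b10, smul_eq_mul, smul_eq_mul]
  have c01 : ζ * (ζ • B) 0 1 = (ζ • A') 0 1 := by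
    rw [Matrix.smul_apply, Matrix.smul_apply, smul_eq_mul, smul_eq_mul, b01]
  have hζr : ∀ q, ζ.IsRegularAt q := fun q => RatFunc.isRegularAt_X_sub_C p q
  have hζv : ∀ q, ζ.value q = q - p := fun q => RatFunc.value_X_sub_C p q
  have hCr : ∀ q, (RatFunc.C (1 / 2) : RatFunc ℂ).IsRegularAt q := fun q => RatFunc.isRegularAt_C _ q
  have hCv : ∀ q, (RatFunc.C (1 / 2) : RatFunc ℂ).value q = 1 / 2 := fun q => by
    rw [RatFunc.value, RatFunc.eval_C]; rfl
  have hBreg : RatMat.IsRegularAt (ζ • B) p := by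
    intro a b
    fin_cases a <;> fin_cases b <;> simp only [Fin.zero_eta, Fin.mk_one]
    · rw [c00]; exact (hA'reg 0 0).sub (hCr p)
    · obtain ⟨g, hg, hgA⟩ := (hA'reg 0 1).exists_eq_mul (by
        have := congrFun (congrFun hfp 0) 1
        rw [h01] at this
        exact this)
      rw [← c01] at hgA
      rwa [mul_left_cancel₀ hζ0 hgA]
    · rw [c10]; exact (hζr p).mul (hA'reg 1 0)
    · rw [c11]; exact (hA'reg 1 1).add (hCr p)
  set F : ℂ → Matrix (Fin 2) (Fin 2) ℂ := RatMat.evalAt (ζ • B) with hF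
  have e00 : ∀ᶠ l in 𝓝 p, F l 0 0 = f l 0 0 - 1 / 2 := by
    filter_upwards [hA'reg.eventually] with l hl
    rw [hF, hf, RatMat.evalAt_apply, RatMat.evalAt_apply, c00, RatFunc.value_sub (hl 0 0) (hCr l), hCv]
  have e11 : ∀ᶠ l in 𝓝 p, F l 1 1 = f l 1 1 + 1 / 2 := by
    filter_upwards [hA'reg.eventually] with l hl
    rw [hF, hf, RatMat.evalAt_apply, RatMat.evalAt_apply, c11, RatFunc.value_add (hl 1 1) (hCr l), hCv]
  have e10 : ∀ᶠ l in 𝓝 p, F l 1 0 = (l - p) * f l 1 0 := by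
    filter_upwards [hA'reg.eventually] with l hl
    rw [hF, hf, RatMat.evalAt_apply, RatMat.evalAt_apply, c10, RatFunc.value_mul (hζr l) (hl 1 0), hζv]
  have e01 : ∀ᶠ l in 𝓝 p, (l - p) * F l 0 1 = f l 0 1 := by
    filter_upwards [hBreg.eventually] with l hl
    rw [hF, hf, RatMat.evalAt_apply, RatMat.evalAt_apply, ← c01, RatFunc.value_mul (hζr l) (hl 0 1), hζv]
  have hfan := RatMat.analyticMatAt_evalAt hA'reg
  have hFan := RatMat.analyticMatAt_evalAt hBreg
  rw [← hfp] at h00 h01 h11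
  obtain ⟨s1, s2⟩ := hfpol.step hn hfan h00 h01 h11 hFan e00 e01 e10 e11
  have r00 := e00.self_of_nhds
  have r11 := e11.self_of_nhds
  have r10 := e10.self_of_nhds
  rw [h00] at r00
  rw [h11] at r11
  rw [sub_self, zero_mul] at r10
  refine ⟨RatMat.poleOrder_le_one_iff.2 hBreg, ?_, fun h2 => s1 (by omega), fun h1 => ?_⟩
  · rw [RatMat.residue_eq, Matrix.det_fin_two]
    change F p 0 0 * F p 1 1 - F p 0 1 * F p 1 0 = _
    rw [r00, r11, r10, Nat.cast_sub hn]
    push_cast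
    ring
  · have hn1 : n = 1 := by omega
    have r01 := s2 hn1
    obtain ⟨K, hK, hKB⟩ := hBreg.exists_eq_smul (by
      subst hn1
      ext a b
      change F p a b = 0
      fin_cases a <;> fin_cases b <;> simp only [Fin.zero_eta, Fin.mk_one]
      · rw [r00]; norm_num
      · exact r01
      · exact r10
      · rw [r11]; norm_num)
    rwa [smul_right_injective RatMat hζ0 hKB]

end SingleStep

section Infinity

/-- If a rational function is `o(λ ^ d)` at infinity, then it has an expansion
`c λ ^ (d - 1) + o(λ ^ (d - 1))` there. -/
theorem RatFunc.exists_tendsto_cobounded (f : RatFunc ℂ) (d : ℤ)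
    (h : Tendsto (fun l : ℂ => l ^ (-d) * f.value l) (Bornology.cobounded ℂ) (𝓝 0)) :
    ∃ c, Tendsto (fun l : ℂ => l ^ (-d) * (l * f.value l)) (Bornology.cobounded ℂ) (𝓝 c) := by
  set g : ℂ → ℂ := fun w => if w = 0 then 0 else w ^ d * f.value w⁻¹ with hg
  have hg0 : g 0 = 0 := by simp [hg]
  have hg1 : ∀ w ≠ 0, g w = w ^ d * f.value w⁻¹ := fun w hw => by simp [hg, hw]
  have htend : Tendsto (fun w : ℂ => w⁻¹) (𝓝[≠] 0) (Bornology.cobounded ℂ) :=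
    tendsto_inv₀_nhdsNE_zero
  have hcont : ContinuousAt g 0 := by
    rw [continuousAt_iff_punctured_nhds, hg0]
    refine (h.comp htend).congr' ?_
    filter_upwards [self_mem_nhdsWithin] with w hw
    rw [hg1 w hw]
    simp
  have hdiff : ∀ᶠ w in 𝓝[≠] (0 : ℂ), DifferentiableAt ℂ g w := by
    have h1 : ∀ᶠ l in Bornology.cobounded ℂ, f.IsRegularAt l := by
      have := f.finite_not_isRegularAt.isBounded
      filter_upwards [Bornology.isBounded_def.1 this] with l hl
      exact not_not.1 hl
    filter_upwards [htend.eventually h1, self_mem_nhdsWithin] with w hw hw0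
    have hw0' : w ≠ 0 := hw0
    have h2 : DifferentiableAt ℂ (fun w => w ^ d * f.value w⁻¹) w := by
      refine DifferentiableAt.mul (differentiableAt_zpow.2 (Or.inl hw0')) ?_
      exact DifferentiableAt.comp (g := f.value) w (RatFunc.analyticAt_value hw).differentiableAt
        (differentiableAt_inv hw0')
    refine h2.congr_of_eventuallyEq ?_
    filter_upwards [isOpen_ne.mem_nhds hw0'] with u hu using hg1 u hu
  have han := Complex.analyticAt_of_differentiable_on_punctured_nhds_of_continuousAt hdiff hcont
  have hslope := han.differentiableAt.hasDerivAt.tendsto_slope_zero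
  refine ⟨deriv g 0, ?_⟩
  have htend' : Tendsto (fun l : ℂ => l⁻¹) (Bornology.cobounded ℂ) (𝓝[≠] 0) :=
    tendsto_inv₀_cobounded'
  refine (hslope.comp htend').congr' ?_
  filter_upwards [Bornology.eventually_ne_cobounded (0 : ℂ)] with l hl
  simp only [Function.comp_apply, zero_add, hg0, sub_zero, inv_inv, smul_eq_mul]
  rw [hg1 _ (inv_ne_zero hl), inv_inv, inv_zpow, zpow_neg]
  ring

theorem RatMat.eventually_cobounded_isRegularAt (M : RatMat) :
    ∀ᶠ l in Bornology.cobounded ℂ, RatMat.IsRegularAt M l := by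
  filter_upwards [Bornology.isBounded_def.1 M.finite_not_isRegularAt.isBounded] with l hl
  exact not_not.1 hl

theorem RatMat.HasCoeffAtInfty.trace_eq_zero {A : RatMat} {d : ℤ} {L : Matrix (Fin 2) (Fin 2) ℂ}
    (h : A.HasCoeffAtInfty d L) (hA : A.trace = 0) : L.trace = 0 := by
  rw [Matrix.trace_fin_two]
  refine tendsto_nhds_unique ((h 0 0).add (h 1 1)) ?_
  refine tendsto_const_nhds.congr fun l => ?_
  have := RatMat.trace_evalAt hA l
  rw [Matrix.trace_fin_two] at this
  rw [← mul_add, this, mul_zero]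

/-- A Schlesinger transformation whose matrix `D` maps an eigenvector of the leading coefficient at
infinity to a multiple of the first basis vector keeps infinity generic. -/
theorem IsGauge.generic_step {p : ℂ} {D E : Matrix (Fin 2) (Fin 2) ℂ} {A B : RatMat} {d : ℤ}
    {L : Matrix (Fin 2) (Fin 2) ℂ} (h : IsGauge (stepPoly p D) A B) (hD : D.det ≠ 0)
    (hED : E * D = 1) (hA : A.trace = 0) (hd : -1 ≤ d) (hL : A.HasCoeffAtInfty d L)
    (hdet : L.det ≠ 0) (hint : d = -1 → ∀ n : ℤ, L.det ≠ -((n : ℂ) ^ 2 / 4))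
    (h10 : (D * L * E) 1 0 = 0) :
    ∃ L', B.HasCoeffAtInfty d L' ∧ L'.det ≠ 0 ∧
      (d = -1 → ∀ n : ℤ, L'.det ≠ -((n : ℂ) ^ 2 / 4)) := by
  obtain ⟨b00, b01, b10, b11⟩ := h.stepPoly_apply hD hED
  set ζ : RatFunc ℂ := RatFunc.X - RatFunc.C p with hζ
  have hζ0 : ζ ≠ 0 := RatFunc.X_sub_C_ne_zero p
  set A' : RatMat := D.map RatFunc.C * A * E.map RatFunc.C with hA'
  have hDr : ∀ (K : Matrix (Fin 2) (Fin 2) ℂ) (q : ℂ), RatMat.IsRegularAt (K.map RatFunc.C) q :=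
    fun K q a b => RatFunc.isRegularAt_C _ _
  have hDv : ∀ (K : Matrix (Fin 2) (Fin 2) ℂ) (q : ℂ), RatMat.evalAt (K.map RatFunc.C) q = K :=
    fun K q => by ext a b; simp [RatMat.evalAt]
  have hreg : ∀ᶠ l in Bornology.cobounded ℂ, RatMat.IsRegularAt A' l :=
    A'.eventually_cobounded_isRegularAt
  have hBreg : ∀ᶠ l in Bornology.cobounded ℂ, RatMat.IsRegularAt B l :=
    B.eventually_cobounded_isRegularAt
  have hA'L : A'.HasCoeffAtInfty d (D * L * E) := by
    intro a b
    simp only [Matrix.mul_apply, Fin.sum_univ_two]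
    refine ((((hL 0 0).const_mul (D a 0)).add ((hL 1 0).const_mul (D a 1))).mul_const (E 0 b)).add
      ((((hL 0 1).const_mul (D a 0)).add ((hL 1 1).const_mul (D a 1))).mul_const (E 1 b)) |>.congr' ?_
    filter_upwards [A.eventually_cobounded_isRegularAt] with l hl
    rw [hA', RatMat.evalAt_mul ((hDr D l).mul hl) (hDr E l), RatMat.evalAt_mul (hDr D l) hl, hDv, hDv]
    simp only [Matrix.mul_apply, Fin.sum_univ_two]
    ring
  set M := D * L * E with hM
  -- scalar limits
  have hratio : Tendsto (fun l : ℂ => l * (l - p)⁻¹) (Bornology.cobounded ℂ) (𝓝 1) := by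
    have h1 : Tendsto (fun l : ℂ => (1 - p * l⁻¹)⁻¹) (Bornology.cobounded ℂ) (𝓝 (1 - p * 0)⁻¹) :=
      (tendsto_const_nhds.sub (tendsto_inv₀_cobounded.const_mul p)).inv₀ (by simp)
    rw [mul_zero, sub_zero, inv_one] at h1
    refine h1.congr' ?_
    filter_upwards [Bornology.eventually_ne_cobounded (0 : ℂ), Bornology.eventually_ne_cobounded p]
      with l hl hlp
    have : l - p ≠ 0 := sub_ne_zero.2 hlp
    have h2 : 1 - p * l⁻¹ = (l - p) / l := by field_simp
    rw [h2, inv_div]; rfl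
  obtain ⟨ε, hε, hεd, hε'⟩ : ∃ ε : ℂ, Tendsto (fun l : ℂ => l ^ (-d) * l⁻¹ * 2⁻¹)
      (Bornology.cobounded ℂ) (𝓝 ε) ∧ (d = -1 → ε = 1 / 2) ∧ (d ≠ -1 → ε = 0) := by
    by_cases hd1 : d = -1
    · refine ⟨1 / 2, ?_, fun _ => rfl, fun h => absurd hd1 h⟩
      refine tendsto_const_nhds.congr' ?_
      filter_upwards [Bornology.eventually_ne_cobounded (0 : ℂ)] with l hl
      simp [hd1, hl]
    · refine ⟨0, ?_, fun h => absurd h hd1, fun _ => rfl⟩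
      obtain ⟨j, hj⟩ : ∃ j : ℕ, d = j := ⟨d.toNat, by omega⟩
      have h1 : Tendsto (fun l : ℂ => l⁻¹ ^ (j + 1) * 2⁻¹) (Bornology.cobounded ℂ)
          (𝓝 (0 ^ (j + 1) * 2⁻¹)) := (tendsto_inv₀_cobounded.pow _).mul_const _
      rw [zero_pow (by omega), zero_mul] at h1
      refine h1.congr fun l => ?_
      rw [hj, zpow_neg, zpow_natCast, pow_succ, inv_pow]
  have hhalf : Tendsto (fun l : ℂ => l ^ (-d) * ((RatFunc.C (1 / 2) / ζ : RatFunc ℂ).value l))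
      (Bornology.cobounded ℂ) (𝓝 ε) := by
    have h1 := hε.mul hratio
    rw [mul_one] at h1
    refine h1.congr' ?_
    filter_upwards [Bornology.eventually_ne_cobounded (0 : ℂ), Bornology.eventually_ne_cobounded p]
      with l hl hlp
    have h2 : (RatFunc.C (1 / 2) / ζ : RatFunc ℂ).value l = 1 / 2 / (l - p) := by
      have := RatFunc.value_div (p := Polynomial.C (1 / 2)) (r := Polynomial.X - Polynomial.C p)
        (q := l) (by simpa [sub_eq_zero] using hlp)
      simpa [hζ] using this
    rw [h2]
    field_simp
  obtain ⟨γ, hγ⟩ := RatFunc.exists_tendsto_cobounded (A' 1 0) d (by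
    have := hA'L 1 0
    rwa [h10] at this)
  have hC : ∀ᶠ l in Bornology.cobounded ℂ, (RatFunc.C (1 / 2) / ζ : RatFunc ℂ).IsRegularAt l := by
    filter_upwards [Bornology.eventually_ne_cobounded p] with l hl
    rw [div_eq_mul_inv]
    exact (RatFunc.isRegularAt_C _ _).mul (RatFunc.isRegularAt_inv_X_sub_C hl)
  have t00 : Tendsto (fun l : ℂ => l ^ (-d) * B.evalAt l 0 0) (Bornology.cobounded ℂ) (𝓝 (M 0 0 - ε)) := by
    refine ((hA'L 0 0).sub hhalf).congr' ?_
    filter_upwards [hreg, hC] with l hl hl'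
    rw [RatMat.evalAt_apply, RatMat.evalAt_apply, b00, RatFunc.value_sub (hl 0 0) hl', mul_sub]
  have t11 : Tendsto (fun l : ℂ => l ^ (-d) * B.evalAt l 1 1) (Bornology.cobounded ℂ) (𝓝 (M 1 1 + ε)) := by
    refine ((hA'L 1 1).add hhalf).congr' ?_
    filter_upwards [hreg, hC] with l hl hl'
    rw [RatMat.evalAt_apply, RatMat.evalAt_apply, b11, RatFunc.value_add (hl 1 1) hl', mul_add]
  have t01 : Tendsto (fun l : ℂ => l ^ (-d) * B.evalAt l 0 1) (Bornology.cobounded ℂ) (𝓝 0) := by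
    have h1 : Tendsto (fun l : ℂ => (l - p)⁻¹) (Bornology.cobounded ℂ) (𝓝 0) := by
      have := hratio.mul tendsto_inv₀_cobounded
      rw [mul_zero] at this
      refine this.congr' ?_
      filter_upwards [Bornology.eventually_ne_cobounded (0 : ℂ)] with l hl
      field_simp
    have h2 := (hA'L 0 1).mul h1
    rw [mul_zero] at h2
    refine h2.congr' ?_
    filter_upwards [hBreg, Bornology.eventually_ne_cobounded p] with l hl hlp
    have hlp' : l - p ≠ 0 := sub_ne_zero.2 hlp
    rw [RatMat.evalAt_apply, RatMat.evalAt_apply, ← b01,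
      RatFunc.value_mul (RatFunc.isRegularAt_X_sub_C p l) (hl 0 1), RatFunc.value_X_sub_C]
    field_simp
  have t10 : Tendsto (fun l : ℂ => l ^ (-d) * B.evalAt l 1 0) (Bornology.cobounded ℂ)
      (𝓝 (γ - p * 0)) := by
    have h1 := hA'L 1 0
    rw [h10] at h1
    refine (hγ.sub (h1.const_mul p)).congr' ?_
    filter_upwards [hreg] with l hl
    rw [RatMat.evalAt_apply, RatMat.evalAt_apply, b10,
      RatFunc.value_mul (RatFunc.isRegularAt_X_sub_C p l) (hl 1 0), RatFunc.value_X_sub_C]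
    ring
  have htrM : M 0 0 + M 1 1 = 0 := by
    have h1 := hL.trace_eq_zero hA
    have h2 : M.trace = 0 := by rw [hM, Matrix.trace_mul_comm, ← mul_assoc, hED, one_mul, h1]
    rwa [Matrix.trace_fin_two] at h2
  have hdetM : M.det = L.det := by
    have h1 : E.det * D.det = 1 := by rw [← Matrix.det_mul, hED, Matrix.det_one]
    rw [hM, Matrix.det_mul, Matrix.det_mul]
    linear_combination L.det * h1
  rw [Matrix.det_fin_two, h10] at hdetM
  have hM0 : M 0 0 ≠ 0 := fun h0 => hdet (by rw [← hdetM, h0]; ring)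
  have hdet' : Matrix.det !![M 0 0 - ε, 0; γ - p * 0, M 1 1 + ε] = -(M 0 0 - ε) ^ 2 := by
    rw [Matrix.det_fin_two_of]
    linear_combination (M 0 0 - ε) * htrM
  have key : d = -1 → ∀ n : ℤ, (M 0 0 - ε) ^ 2 ≠ (n : ℂ) ^ 2 / 4 := by
    intro hd1 n hn
    rw [hεd hd1] at hn
    have h1 : (M 0 0 - 1 / 2 - n / 2) * (M 0 0 - 1 / 2 + n / 2) = 0 := by linear_combination hn
    rcases mul_eq_zero.1 h1 with h2 | h2
    · have h3 : M 0 0 = (1 + n) / 2 := by linear_combination h2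
      refine hint hd1 (1 + n) ?_
      push_cast
      rw [← hdetM, show M 1 1 = -M 0 0 by linear_combination htrM, h3]
      ring
    · have h3 : M 0 0 = (1 - n) / 2 := by linear_combination h2
      refine hint hd1 (1 - n) ?_
      push_cast
      rw [← hdetM, show M 1 1 = -M 0 0 by linear_combination htrM, h3]
      ring
  refine ⟨!![M 0 0 - ε, 0; γ - p * 0, M 1 1 + ε], ?_, ?_, ?_⟩
  · intro a b
    fin_cases a <;> fin_cases b
    exacts [t00, t01, t10, t11]
  · rw [hdet']
    by_cases hd1 : d = -1
    · have := key hd1 0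
      simpa using this
    · rw [hε' hd1, sub_zero]
      simpa using hM0
  · intro hd1 n hn
    rw [hdet'] at hn
    exact key hd1 n (by linear_combination -hn)

end Infinity

section LeadingCoefficient

variable {m N : ℕ} {X V : Set (Fin m → ℂ)} {A B : RatFamily m} {a : Fin N → (Fin m → ℂ) → ℂ}
  {κ : Fin N}

/-- The leading coefficient at infinity is holomorphic in the parameters. -/
theorem HasSimplePole.leadingCoeff_analytic (h : HasSimplePole V B a κ)
    (hA : IsHolomorphicFamily X A a) (hV : IsOpen V) (hVX : V ⊆ X) {d : ℤ}
    {L : (Fin m → ℂ) → Matrix (Fin 2) (Fin 2) ℂ} (hL : ∀ x ∈ V, (B x).HasCoeffAtInfty d (L x)) :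
    ∀ x ∈ V, AnalyticMatAt L x := by
  intro x₀ hx₀ b c
  have hVn : ∀ᶠ x in 𝓝 x₀, x ∈ V := hV.mem_nhds hx₀
  obtain ⟨M, hM⟩ : ∃ M : ℝ, ∀ k, ‖a k x₀‖ < M :=
    ⟨(∑ k, ‖a k x₀‖) + 1, fun k => lt_of_le_of_lt (Finset.single_le_sum
      (f := fun k => ‖a k x₀‖) (fun _ _ => norm_nonneg _) (Finset.mem_univ k)) (lt_add_one _)⟩
  have hMpos : 0 < max M 1 := lt_max_of_lt_right one_pos
  have hbd : ∀ᶠ x in 𝓝 x₀, ∀ k, ‖a k x‖ < max M 1 := by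
    rw [eventually_all]
    intro k
    exact ((hA.analytic_pole k x₀ (hVX hx₀)).continuousAt.norm).eventually_lt_const
      (lt_max_of_lt_left (hM k))
  obtain ⟨F, O, hO, hx₀O, hF, hFf⟩ := exists_analyticOnNhd_extension
    (f := fun z : (Fin m → ℂ) × ℂ => z.2 ^ d * (B z.1).evalAt z.2⁻¹ b c) (p := fun _ => (0 : ℂ))
    (r := (max M 1)⁻¹) (x₀ := x₀) (inv_pos.2 hMpos) continuousAt_const
    (by
      filter_upwards [hbd, hVn] with x hx hxV w hw hw0
      have hne : ∀ k, w⁻¹ ≠ a k x := fun k hk => by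
        have h1 := hx k
        rw [← hk, norm_inv] at h1
        rw [mem_closedBall_zero_iff] at hw
        have h2 : 0 < ‖w‖ := norm_pos_iff.2 hw0
        exact absurd h1 (not_lt.2 ((le_inv_comm₀ h2 hMpos).1 hw))
      have h1 : AnalyticAt ℂ (fun z : (Fin m → ℂ) × ℂ => z.2 ^ d) (x, w) :=
        AnalyticAt.fun_zpow analyticAt_snd hw0
      refine h1.mul (AnalyticAt.comp (g := fun z : (Fin m → ℂ) × ℂ => (B z.1).evalAt z.2 b c)
        (f := fun z : (Fin m → ℂ) × ℂ => (z.1, z.2⁻¹)) (h.analytic x hxV _ hne b c) ?_)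
      exact analyticAt_fst.prod (analyticAt_snd.fun_inv hw0))
    (by
      filter_upwards [hVn] with x hx
      refine ⟨_, ((hL x hx b c).comp tendsto_inv₀_nhdsNE_zero).congr fun w => ?_⟩
      simp)
  have h0 : (0 : ℂ) ∈ Metric.ball (0 : ℂ) (max M 1)⁻¹ := Metric.mem_ball_self (inv_pos.2 hMpos)
  have h1 : AnalyticAt ℂ (fun x => F (x, (0 : ℂ))) x₀ :=
    AnalyticAt.comp (g := F) (f := fun x => (x, (0 : ℂ))) (hF (x₀, 0) ⟨hx₀O, h0⟩)
      (analyticAt_id.prod analyticAt_const)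
  refine h1.congr ?_
  filter_upwards [hVn, hO.mem_nhds hx₀O] with x hx hxO
  have h2 : Tendsto (fun w => F (x, w)) (𝓝[≠] 0) (𝓝 (F (x, 0))) := by
    have h3 : ContinuousAt (fun w => F (x, w)) 0 :=
      ContinuousAt.comp (g := F) (f := fun w : ℂ => (x, w)) (hF (x, 0) ⟨hxO, h0⟩).continuousAt
        (by fun_prop)
    exact h3.tendsto.mono_left nhdsWithin_le_nhds
  refine tendsto_nhds_unique h2 (((hL x hx b c).comp tendsto_inv₀_nhdsNE_zero).congr' ?_)
  have hball : ∀ᶠ w in 𝓝[≠] (0 : ℂ), w ∈ Metric.ball (0 : ℂ) (max M 1)⁻¹ :=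
    nhdsWithin_le_nhds (Metric.isOpen_ball.mem_nhds h0)
  filter_upwards [hball, self_mem_nhdsWithin] with w hw hw0
  rw [hFf x hxO w hw hw0]
  simp

/-- An analytic eigenvector of an analytic traceless matrix with nonzero determinant, chosen outside
the kernel of a given linear form. -/
theorem AnalyticMatAt.exists_eigenvector {L : (Fin m → ℂ) → Matrix (Fin 2) (Fin 2) ℂ}
    {x₀ : Fin m → ℂ} (hL : AnalyticMatAt L x₀) (htr : ∀ᶠ x in 𝓝 x₀, (L x).trace = 0)
    (hdet : (L x₀).det ≠ 0) {l₀ l₁ : ℂ} (hl : l₀ ≠ 0 ∨ l₁ ≠ 0) :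
    ∃ (v₀ v₁ e : (Fin m → ℂ) → ℂ), AnalyticAt ℂ v₀ x₀ ∧ AnalyticAt ℂ v₁ x₀ ∧
      l₀ * v₀ x₀ + l₁ * v₁ x₀ ≠ 0 ∧ ∀ᶠ x in 𝓝 x₀, L x 0 0 * v₀ x + L x 0 1 * v₁ x = e x * v₀ x ∧
        L x 1 0 * v₀ x + L x 1 1 * v₁ x = e x * v₁ x := by
  -- an analytic square root of `- det L`
  obtain ⟨s, hs⟩ : ∃ s : ℂ, s ^ 2 = -(L x₀).det := IsAlgClosed.exists_pow_nat_eq _ (by norm_num)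
  have hs0 : s ≠ 0 := by rintro rfl; apply hdet; linear_combination hs
  set q : (Fin m → ℂ) → ℂ := fun x => (L x).det / (L x₀).det with hq
  have hqan : AnalyticAt ℂ q x₀ := hL.det.div analyticAt_const hdet
  have hq1 : q x₀ = 1 := div_self hdet
  have hqs : q x₀ ∈ Complex.slitPlane := by rw [hq1]; exact Complex.one_mem_slitPlane
  set μ : (Fin m → ℂ) → ℂ := fun x => s * Complex.exp (Complex.log (q x) / 2) with hμ
  have hμan : AnalyticAt ℂ μ x₀ := analyticAt_const.mul
    ((hqan.clog hqs).div analyticAt_const (by norm_num)).cexp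
  have hμ2 : ∀ᶠ x in 𝓝 x₀, μ x ^ 2 = -(L x).det := by
    filter_upwards [hqan.continuousAt.eventually_ne (by rw [hq1]; exact one_ne_zero)] with x hx
    rw [hμ, mul_pow, ← Complex.exp_nat_mul, show ((2 : ℕ) : ℂ) * (Complex.log (q x) / 2) =
      Complex.log (q x) by push_cast; ring, Complex.exp_log hx, hs, hq]
    field_simp
  have hμ0 : μ x₀ ≠ 0 := mul_ne_zero hs0 (Complex.exp_ne_zero _)
  -- the columns of `L ± μ` are eigenvectors
  have key : ∀ (σ : ℂ) (b : Fin 2), σ ^ 2 = 1 →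
      l₀ * (L x₀ 0 b + (if b = 0 then σ * μ x₀ else 0)) +
        l₁ * (L x₀ 1 b + (if b = 0 then 0 else σ * μ x₀)) ≠ 0 →
      ∃ (v₀ v₁ e : (Fin m → ℂ) → ℂ), AnalyticAt ℂ v₀ x₀ ∧ AnalyticAt ℂ v₁ x₀ ∧
      l₀ * v₀ x₀ + l₁ * v₁ x₀ ≠ 0 ∧ ∀ᶠ x in 𝓝 x₀, L x 0 0 * v₀ x + L x 0 1 * v₁ x = e x * v₀ x ∧
        L x 1 0 * v₀ x + L x 1 1 * v₁ x = e x * v₁ x := by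
    intro σ b hσ hne
    refine ⟨fun x => L x 0 b + (if b = 0 then σ * μ x else 0),
      fun x => L x 1 b + (if b = 0 then 0 else σ * μ x), fun x => σ * μ x, ?_, ?_, hne, ?_⟩
    · split_ifs
      · exact (hL 0 b).add (analyticAt_const.mul hμan)
      · exact (hL 0 b).add analyticAt_const
    · split_ifs
      · exact (hL 1 b).add analyticAt_const
      · exact (hL 1 b).add (analyticAt_const.mul hμan)
    · filter_upwards [hμ2, htr] with x hx2 hxt
      rw [Matrix.trace_fin_two] at hxt
      rw [Matrix.det_fin_two] at hx2
      have h2 : L x 1 1 = -L x 0 0 := by linear_combination hxt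
      rw [h2] at hx2
      have h3 : (σ * μ x) ^ 2 = L x 0 0 ^ 2 + L x 0 1 * L x 1 0 := by
        rw [mul_pow, hσ, hx2]; ring
      fin_cases b <;> simp [h2] <;> constructor <;>
        first | linear_combination h3 | linear_combination -h3 | ring
  by_contra hcon
  have hall : ∀ (σ : ℂ) (b : Fin 2), σ ^ 2 = 1 →
      l₀ * (L x₀ 0 b + (if b = 0 then σ * μ x₀ else 0)) +
        l₁ * (L x₀ 1 b + (if b = 0 then 0 else σ * μ x₀)) = 0 := by
    intro σ b hσ
    by_contra h
    exact hcon (key σ b hσ h)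
  have a1 := hall 1 0 (by norm_num)
  have a2 := hall (-1) 0 (by norm_num)
  have a3 := hall 1 1 (by norm_num)
  have a4 := hall (-1) 1 (by norm_num)
  simp only [if_true, one_ne_zero, if_false] at a1 a2 a3 a4
  rcases hl with hl | hl
  · have : l₀ * μ x₀ = 0 := by linear_combination (a1 - a2) / 2
    exact (mul_ne_zero hl hμ0) this
  · have : l₁ * μ x₀ = 0 := by linear_combination (a3 - a4) / 2
    exact (mul_ne_zero hl hμ0) this

end LeadingCoefficient

/-! ### Removal of the pole -/

section AnalyticGauge

open Polynomial

variable {m : ℕ} {V : Set (Fin m → ℂ)}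

theorem IsAnalyticPoly.derivative {q : (Fin m → ℂ) → ℂ[X]} (hq : IsAnalyticPoly V q) :
    IsAnalyticPoly V fun x => Polynomial.derivative (q x) := by
  obtain ⟨d, hd⟩ := hq.bdd
  refine ⟨fun n => ?_, d, fun x hx => (natDegree_derivative_le _).trans
    ((Nat.sub_le _ _).trans (hd x hx))⟩
  simp only [coeff_derivative]
  exact (hq.coeff _).mul analyticOnNhd_const

theorem IsAnalyticPoly.analyticAt_eval {q : (Fin m → ℂ) → ℂ[X]} (hq : IsAnalyticPoly V q)
    (hV : IsOpen V) {x : Fin m → ℂ} (hx : x ∈ V) (l : ℂ) :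
    AnalyticAt ℂ (fun z : (Fin m → ℂ) × ℂ => (q z.1).eval z.2) (x, l) := by
  obtain ⟨d, hd⟩ := hq.bdd
  have h1 : AnalyticAt ℂ (fun z : (Fin m → ℂ) × ℂ =>
      ∑ i ∈ Finset.range (d + 1), (q z.1).coeff i * z.2 ^ i) (x, l) :=
    Finset.analyticAt_fun_sum _ fun i _ => (AnalyticAt.comp (g := fun x => (q x).coeff i)
      (f := fun z : (Fin m → ℂ) × ℂ => z.1) (hq.coeff i x hx) analyticAt_fst).mul
      (analyticAt_snd.pow i)
  refine h1.congr ?_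
  filter_upwards [(continuous_fst.tendsto (x, l)).eventually (hV.mem_nhds hx)] with z hz
  exact (eval_eq_sum_range' (Nat.lt_succ_of_le (hd z.1 hz)) _).symm

theorem IsAnalyticPolyMat.det {Q : (Fin m → ℂ) → PolyMat} (hQ : IsAnalyticPolyMat V Q) :
    IsAnalyticPoly V fun x => (Q x).det := by
  simp only [Matrix.det_fin_two]
  exact ((hQ 0 0).mul (hQ 1 1)).sub ((hQ 0 1).mul (hQ 1 0))

theorem IsAnalyticPolyMat.analyticMatAt_evalAt {Q : (Fin m → ℂ) → PolyMat}
    (hQ : IsAnalyticPolyMat V Q) (hV : IsOpen V) {x : Fin m → ℂ} (hx : x ∈ V) (l : ℂ) :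
    AnalyticMatAt (fun z : (Fin m → ℂ) × ℂ => (Q z.1).evalAt z.2) (x, l) := fun a b =>
  (hQ a b).analyticAt_eval hV hx l

/-- A gauge transformation that is holomorphic in the parameters preserves joint holomorphy. -/
theorem IsGauge.analyticMatAt {A B : RatFamily m} {Q : (Fin m → ℂ) → PolyMat} (hV : IsOpen V)
    (hQ : IsAnalyticPolyMat V Q) (h : ∀ x ∈ V, IsGauge (Q x) (A x) (B x)) {x : Fin m → ℂ}
    (hx : x ∈ V) {l : ℂ} (hl : (Q x).det.eval l ≠ 0)
    (hreg : ∀ᶠ z : (Fin m → ℂ) × ℂ in 𝓝 (x, l), RatMat.IsRegularAt (A z.1) z.2)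
    (hA : AnalyticMatAt (fun z : (Fin m → ℂ) × ℂ => (A z.1).evalAt z.2) (x, l)) :
    AnalyticMatAt (fun z : (Fin m → ℂ) × ℂ => (B z.1).evalAt z.2) (x, l) := by
  have hQe := hQ.analyticMatAt_evalAt hV hx l
  have hQ'e : AnalyticMatAt (fun z : (Fin m → ℂ) × ℂ => (Q z.1).deriv.evalAt z.2) (x, l) :=
    IsAnalyticPolyMat.analyticMatAt_evalAt (fun a b => (hQ a b).derivative) hV hx l
  have hd := hQ.det.analyticAt_eval hV hx l
  have hd' := hQ.det.derivative.analyticAt_eval hV hx l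
  refine (AnalyticMatAt.smul (hd.fun_inv hl) ((((hQe.mul hA).add hQ'e).sub
    (AnalyticMatAt.smul (analyticAt_const (v := (1 / 2 : ℂ)).mul (hd'.div hd hl)) hQe)).mul
    hQe.adjugate)).congr ?_
  filter_upwards [hreg, hd.continuousAt.eventually_ne hl,
    (continuous_fst.tendsto (x, l)).eventually (hV.mem_nhds hx)] with z hz1 hz2 hz3
  have h1 := (h z.1 hz3).evalAt_mul hz2 hz1
  simp only [Pi.mul_apply, Pi.div_apply]
  rw [← h1, mul_assoc, Matrix.mul_adjugate, PolyMat.det_evalAt, Matrix.mul_smul, mul_one, smul_smul,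
    inv_mul_cancel₀ hz2, one_smul]

end AnalyticGauge

section Reduction

open Polynomial

variable {m N : ℕ} {X V V' : Set (Fin m → ℂ)} {A A' : RatFamily m} {a : Fin N → (Fin m → ℂ) → ℂ}
  {κ : Fin N} {n : ℕ} {T : (Fin m → ℂ) → PolyMat}

/-- The family `A'` arises from `A` by Schlesinger transformations centred at `a κ`, the eigenvalues
of its residue there are `± n / 2`, it still has a polar solution if `n ≥ 1`, and it has no pole at
`a κ` if `n = 0`.  If `∞` is generic for `A`, then also for `A'`.  The product of the transformations
is proportional to the polynomial matrix `T`. -/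
structure IsPartialReduction (X : Set (Fin m → ℂ)) (A : RatFamily m)
    (a : Fin N → (Fin m → ℂ) → ℂ) (κ : Fin N) (V : Set (Fin m → ℂ)) (n : ℕ) (A' : RatFamily m)
    (T : (Fin m → ℂ) → PolyMat) : Prop where
  chain : SchlesingerChain V {a κ} A A'
  analytic : IsAnalyticPolyMat V T
  det : ∃ (c : (Fin m → ℂ) → ℂ) (j : ℕ), (∀ x ∈ V, c x ≠ 0) ∧
    ∀ x ∈ V, (T x).det = C (c x) * (Polynomial.X - C (a κ x)) ^ j
  gauge : ∀ x ∈ V, IsGauge (T x) (A x) (A' x)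
  poleOrder_le : ∀ x ∈ V, (A' x).poleOrder (a κ x) ≤ 1
  det_residue : ∀ x ∈ V, ((A' x).residue (a κ x)).det = -((n : ℂ) ^ 2 / 4)
  polar : 1 ≤ n → ∀ x ∈ V,
    HasPolarSolution (RatMat.evalAt ((RatFunc.X - RatFunc.C (a κ x)) • A' x)) (a κ x)
  regular : n = 0 → ∀ x ∈ V, RatMat.IsRegularAt (A' x) (a κ x)
  generic : ∀ d, IsGenericAtInfty X A d → IsGenericAtInfty V A' d

namespace IsPartialReduction

theorem mono (h : IsPartialReduction X A a κ V n A' T) (hV : V' ⊆ V) :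
    IsPartialReduction X A a κ V' n A' T where
  chain := h.chain.mono hV subset_rfl
  analytic := h.analytic.mono hV
  det := by
    obtain ⟨c, j, h1, h2⟩ := h.det
    exact ⟨c, j, fun x hx => h1 x (hV hx), fun x hx => h2 x (hV hx)⟩
  gauge x hx := h.gauge x (hV hx)
  poleOrder_le x hx := h.poleOrder_le x (hV hx)
  det_residue x hx := h.det_residue x (hV hx)
  polar hn x hx := h.polar hn x (hV hx)
  regular hn x hx := h.regular hn x (hV hx)
  generic d hd := ⟨hd.1, fun x hx => (h.generic d hd).2 x (hV hx)⟩

theorem det_eval_ne_zero (h : IsPartialReduction X A a κ V n A' T) {x : Fin m → ℂ} (hx : x ∈ V)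
    {l : ℂ} (hl : l ≠ a κ x) : (T x).det.eval l ≠ 0 := by
  obtain ⟨c, j, h1, h2⟩ := h.det
  rw [h2 x hx]
  simp [h1 x hx, sub_eq_zero, hl]

theorem det_ne_zero (h : IsPartialReduction X A a κ V n A' T) {x : Fin m → ℂ} (hx : x ∈ V) :
    (T x).det ≠ 0 := by
  intro h0
  have := h.det_eval_ne_zero hx (l := a κ x + 1) (by simp)
  simp [h0] at this

theorem trace_eq_zero (h : IsPartialReduction X A a κ V n A' T) (hA : IsHolomorphicFamily X A a)
    (hVX : V ⊆ X) {x : Fin m → ℂ} (hx : x ∈ V) : (A' x).trace = 0 :=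
  (h.gauge x hx).trace_eq_zero (h.det_ne_zero hx) (hA.trace_eq_zero x (hVX hx))

theorem hasSimplePole (h : IsPartialReduction X A a κ V n A' T) (hA : IsHolomorphicFamily X A a)
    (hV : IsOpen V) (hVX : V ⊆ X) : HasSimplePole V A' a κ where
  isRegularAt x hx l hl :=
    (h.gauge x hx).isRegularAt (h.det_eval_ne_zero hx (hl κ)) (hA.isRegularAt (hVX hx) hl)
  analytic x hx l hl := by
    refine IsGauge.analyticMatAt hV h.analytic h.gauge hx (h.det_eval_ne_zero hx (hl κ)) ?_
      (hA.analytic x (hVX hx) l (RatMat.not_isPole_iff.2 (hA.isRegularAt (hVX hx) hl)))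
    filter_upwards [eventually_forall_ne (fun k => (hA.analytic_pole k x (hVX hx)).continuousAt) hl,
      (continuous_fst.tendsto (x, l)).eventually (hV.mem_nhds hx)] with z hz1 hz2
    exact hA.isRegularAt (hVX hz2) hz1
  poleOrder_le := h.poleOrder_le

end IsPartialReduction

theorem RatMat.HasCoeffAtInfty.unique {M : RatMat} {d : ℤ} {L L' : Matrix (Fin 2) (Fin 2) ℂ}
    (h : M.HasCoeffAtInfty d L) (h' : M.HasCoeffAtInfty d L') : L = L' := by
  ext b c
  exact tendsto_nhds_unique (h b c) (h' b c)

theorem RatMat.HasCoeffAtInfty.eq_zero_of_lt {M : RatMat} {d d' : ℤ}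
    {L L' : Matrix (Fin 2) (Fin 2) ℂ} (h : M.HasCoeffAtInfty d L) (h' : M.HasCoeffAtInfty d' L')
    (hd : d < d') : L' = 0 := by
  ext b c
  refine tendsto_nhds_unique (h' b c) ?_
  obtain ⟨j, hj⟩ : ∃ j : ℕ, d' = d + (j + 1) := ⟨(d' - d - 1).toNat, by omega⟩
  have h1 : Tendsto (fun l : ℂ => l⁻¹ ^ (j + 1)) (Bornology.cobounded ℂ) (𝓝 0) := by
    have := tendsto_inv₀_cobounded (α := ℂ).pow (j + 1)
    rwa [zero_pow (by omega)] at this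
  have h2 := h1.mul (h b c)
  rw [zero_mul] at h2
  refine h2.congr' ?_
  filter_upwards [Bornology.eventually_ne_cobounded (0 : ℂ)] with l hl
  rw [hj, neg_add, zpow_add₀ hl, zpow_neg l (j + 1 : ℤ), inv_pow]
  norm_cast
  ring

theorem RatMat.HasCoeffAtInfty.degree_unique {M : RatMat} {d d' : ℤ}
    {L L' : Matrix (Fin 2) (Fin 2) ℂ} (h : M.HasCoeffAtInfty d L) (h' : M.HasCoeffAtInfty d' L')
    (hL : L ≠ 0) (hL' : L' ≠ 0) : d = d' := by
  rcases lt_trichotomy d d' with hd | hd | hd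
  · exact absurd (h.eq_zero_of_lt h' hd) hL'
  · exact hd
  · exact absurd (h'.eq_zero_of_lt h hd) hL

namespace IsPartialReduction

/-- The vector that is mapped by the next transformation to a multiple of the first basis vector: it
has to lie outside the kernel of the left eigenvector `(l₀, l₁)` of the residue, and it has to be an
eigenvector of the leading coefficient at a generic point at infinity. -/
theorem exists_vector (h : IsPartialReduction X A a κ V n A' T) (hA : IsHolomorphicFamily X A a)
    (hV : IsOpen V) (hVX : V ⊆ X) {x₀ : Fin m → ℂ} (hx₀ : x₀ ∈ V) {l₀ l₁ : ℂ}
    (hl : l₀ ≠ 0 ∨ l₁ ≠ 0) :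
    ∃ v₀ v₁ : (Fin m → ℂ) → ℂ, AnalyticAt ℂ v₀ x₀ ∧ AnalyticAt ℂ v₁ x₀ ∧
      l₀ * v₀ x₀ + l₁ * v₁ x₀ ≠ 0 ∧ ∀ᶠ x in 𝓝 x₀, ∀ d, IsGenericAtInfty X A d → ∀ L,
        (A' x).HasCoeffAtInfty d L → ∃ e, L 0 0 * v₀ x + L 0 1 * v₁ x = e * v₀ x ∧
        L 1 0 * v₀ x + L 1 1 * v₁ x = e * v₁ x := by
  by_cases hg : ∃ d, IsGenericAtInfty X A d
  · obtain ⟨d, hd⟩ := hg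
    have hgen := h.generic d hd
    choose! L hL hLdet _ using hgen.2
    have hLan := (h.hasSimplePole hA hV hVX).leadingCoeff_analytic hA hV hVX hL
    obtain ⟨v₀, v₁, e, hv₀, hv₁, hne, hev⟩ := (hLan x₀ hx₀).exists_eigenvector (by
      filter_upwards [hV.mem_nhds hx₀] with x hx
      exact (hL x hx).trace_eq_zero (h.trace_eq_zero hA hVX hx)) (hLdet x₀ hx₀) hl
    refine ⟨v₀, v₁, hv₀, hv₁, hne, ?_⟩
    filter_upwards [hev, hV.mem_nhds hx₀] with x hx hxV d' hd' L' hL'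
    have hnz : ∀ M : Matrix (Fin 2) (Fin 2) ℂ, M.det ≠ 0 → M ≠ 0 := fun M hM h0 => hM (by
      rw [h0]; simp)
    obtain ⟨L'', hL'', hdet'', -⟩ := (h.generic d' hd').2 x hxV
    have hdd : d = d' := (hL x hxV).degree_unique hL'' (hnz _ (hLdet x hxV)) (hnz _ hdet'')
    subst hdd
    rw [hL'.unique (hL x hxV)]
    exact ⟨e x, hx⟩
  · rcases hl with hl | hl
    · exact ⟨fun _ => 1, fun _ => 0, analyticAt_const, analyticAt_const, by simpa using hl,
        .of_forall fun x d hd => absurd ⟨d, hd⟩ hg⟩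
    · exact ⟨fun _ => 0, fun _ => 1, analyticAt_const, analyticAt_const, by simpa using hl,
        .of_forall fun x d hd => absurd ⟨d, hd⟩ hg⟩

/-- One more transformation: the first row of its matrix `D` is a left eigenvector of the residue,
and the second row is chosen such that `D` maps the vector of `exists_vector` to a multiple of the
first basis vector. -/
theorem exists_step (h : IsPartialReduction X A a κ V n A' T) (hA : IsHolomorphicFamily X A a)
    (hV : IsOpen V) (hVX : V ⊆ X) {x₀ : Fin m → ℂ} (hx₀ : x₀ ∈ V) (hn : 1 ≤ n) :
    ∃ V' A'' T', IsOpen V' ∧ x₀ ∈ V' ∧ V' ⊆ V ∧ IsPartialReduction X A a κ V' (n - 1) A'' T' := by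
  have hn0 : (n : ℂ) ≠ 0 := by exact_mod_cast (by omega : n ≠ 0)
  have hsp := h.hasSimplePole hA hV hVX
  set P : (Fin m → ℂ) → Matrix (Fin 2) (Fin 2) ℂ := fun x => (A' x).residue (a κ x) with hP
  have hPan : ∀ b c, AnalyticOnNhd ℂ (fun x => P x b c) V := fun b c =>
    hsp.residue_analytic hA hV hVX b c
  have hPtr : ∀ x ∈ V, P x 0 0 + P x 1 1 = 0 := fun x hx => by
    have h1 := h.trace_eq_zero hA hVX hx
    have h2 : ((RatFunc.X - RatFunc.C (a κ x)) • A' x).trace = 0 := by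
      rw [Matrix.trace_smul, h1, smul_zero]
    have h3 := RatMat.trace_evalAt h2 (a κ x)
    rwa [Matrix.trace_fin_two] at h3
  have hPdet : ∀ x ∈ V, P x 0 0 * P x 1 1 - P x 0 1 * P x 1 0 = -((n : ℂ) ^ 2 / 4) := fun x hx => by
    rw [← Matrix.det_fin_two]; exact h.det_residue x hx
  -- `(P + n / 2) (P - n / 2) = 0`, so that each row `r` of `P + n / 2` that is not zero is a left
  -- eigenvector of `P`
  obtain ⟨r, hr⟩ : ∃ r : Fin 2, P x₀ r 0 + (if r = 0 then (n : ℂ) / 2 else 0) ≠ 0 ∨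
      P x₀ r 1 + (if r = 0 then 0 else (n : ℂ) / 2) ≠ 0 := by
    by_contra hcon
    push Not at hcon
    have h0 := (hcon 0).1
    have h1 := (hcon 1).2
    simp only [if_true, one_ne_zero, if_false] at h0 h1
    apply hn0
    linear_combination h0 + h1 - hPtr x₀ hx₀
  set l₀ : (Fin m → ℂ) → ℂ := fun x => P x r 0 + (if r = 0 then (n : ℂ) / 2 else 0) with hl₀
  set l₁ : (Fin m → ℂ) → ℂ := fun x => P x r 1 + (if r = 0 then 0 else (n : ℂ) / 2) with hl₁
  have hl₀an : AnalyticOnNhd ℂ l₀ V := (hPan r 0).add analyticOnNhd_const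
  have hl₁an : AnalyticOnNhd ℂ l₁ V := (hPan r 1).add analyticOnNhd_const
  have hleft : ∀ x ∈ V, l₀ x * P x 0 0 + l₁ x * P x 1 0 = n / 2 * l₀ x ∧
      l₀ x * P x 0 1 + l₁ x * P x 1 1 = n / 2 * l₁ x := by
    intro x hx
    have h1 := hPtr x hx
    have h2 := hPdet x hx
    have h3 : P x 1 1 = -P x 0 0 := by linear_combination h1
    rw [h3] at h2
    have h4 : P x 0 1 * P x 1 0 = (n : ℂ) ^ 2 / 4 - P x 0 0 ^ 2 := by linear_combination -h2
    simp only [hl₀, hl₁]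
    clear_value P
    fin_cases r <;> simp [h3] <;> constructor <;>
      first | linear_combination h4 | linear_combination -h4 | ring
  obtain ⟨v₀, v₁, hv₀, hv₁, hne, hev⟩ := h.exists_vector hA hV hVX hx₀ hr
  have hcont : ContinuousAt (fun x => l₀ x * v₀ x + l₁ x * v₁ x) x₀ :=
    ((hl₀an x₀ hx₀).continuousAt.mul hv₀.continuousAt).add
      ((hl₁an x₀ hx₀).continuousAt.mul hv₁.continuousAt)
  obtain ⟨V', hV'all, hV'o, hx₀V'⟩ := _root_.eventually_nhds_iff.1
    ((((hv₀.eventually_analyticAt.and hv₁.eventually_analyticAt).and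
      (hcont.eventually_ne hne)).and hev).and (hV.mem_nhds hx₀))
  have hV'V : V' ⊆ V := fun x hx => (hV'all x hx).2
  have h' := h.mono hV'V
  set D : (Fin m → ℂ) → Matrix (Fin 2) (Fin 2) ℂ := fun x => !![l₀ x, l₁ x; -v₁ x, v₀ x] with hD
  have hDdet : ∀ x, (D x).det = l₀ x * v₀ x + l₁ x * v₁ x := fun x => by
    rw [hD, Matrix.det_fin_two_of]; ring
  have hDne : ∀ x ∈ V', (D x).det ≠ 0 := fun x hx => by
    rw [hDdet]; exact (hV'all x hx).1.1.2
  have hDan : ∀ b c, AnalyticOnNhd ℂ (fun x => D x b c) V' := by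
    intro b c x hx
    have e0 := hl₀an x (hV'V hx)
    have e1 := hl₁an x (hV'V hx)
    have e2 := (hV'all x hx).1.1.1.1
    have e3 := (hV'all x hx).1.1.1.2.neg
    fin_cases b <;> fin_cases c <;> simp [hD] <;> assumption
  have hpan : AnalyticOnNhd ℂ (a κ) V' := fun x hx => hA.analytic_pole κ x (hVX (hV'V hx))
  have hsdet : ∀ x ∈ V', (stepPoly (a κ x) (D x)).det ≠ 0 := fun x hx => by
    rw [det_stepPoly]
    exact mul_ne_zero (X_sub_C_ne_zero _) (C_ne_zero.2 (hDne x hx))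
  have hex : ∀ x, ∃ B, x ∈ V' → IsGauge (stepPoly (a κ x) (D x)) (A' x) B := fun x => by
    by_cases hx : x ∈ V'
    · obtain ⟨B, hB⟩ := exists_isGauge (A' x) (hsdet x hx)
      exact ⟨B, fun _ => hB⟩
    · exact ⟨0, fun h => absurd h hx⟩
  choose B hB using hex
  set E : (Fin m → ℂ) → Matrix (Fin 2) (Fin 2) ℂ := fun x =>
    ((D x).det)⁻¹ • (D x).adjugate with hE
  have hED : ∀ x ∈ V', E x * D x = 1 := fun x hx => by
    rw [hE, Matrix.smul_mul, Matrix.adjugate_mul, smul_smul, inv_mul_cancel₀ (hDne x hx), one_smul]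
  have hDE : ∀ x ∈ V', D x * E x = 1 := fun x hx => by
    rw [hE, Matrix.mul_smul, Matrix.mul_adjugate, smul_smul, inv_mul_cancel₀ (hDne x hx), one_smul]
  -- the transformed residue is lower triangular
  have hrow : ∀ x ∈ V', ∀ b, (D x * P x * E x) 0 b = n / 2 * (1 : Matrix (Fin 2) (Fin 2) ℂ) 0 b := by
    intro x hx b
    obtain ⟨h1, h2⟩ := hleft x (hV'V hx)
    have h3 : ∀ c, (D x * P x) 0 c = n / 2 * D x 0 c := by
      intro c
      rw [Matrix.mul_apply, Fin.sum_univ_two]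
      fin_cases c
      · simpa [hD] using h1
      · simpa [hD] using h2
    rw [← hDE x hx, Matrix.mul_apply, Matrix.mul_apply, Fin.sum_univ_two, Fin.sum_univ_two, h3, h3]
    ring
  have htrc : ∀ x ∈ V', (D x * P x * E x) 1 1 = -(n / 2) := by
    intro x hx
    have h1 : (D x * P x * E x).trace = 0 := by
      rw [Matrix.trace_mul_comm, ← mul_assoc, hED x hx, one_mul, Matrix.trace_fin_two,
        hPtr x (hV'V hx)]
    rw [Matrix.trace_fin_two, hrow x hx 0] at h1
    simp only [Matrix.one_apply_eq, mul_one] at h1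
    linear_combination h1
  have hstep : ∀ x ∈ V', _ := fun x hx => (hB x hx).residue_step hn (hDne x hx) (hED x hx)
    (h'.poleOrder_le x hx) (h'.polar hn x hx) (by simpa using hrow x hx 0)
    (by simpa using hrow x hx 1) (htrc x hx)
  refine ⟨V', B, fun x => stepPoly (a κ x) (D x) * T x, hV'o, hx₀V', hV'V, ?_⟩
  refine ⟨?_, ?_, ?_, ?_, fun x hx => (hstep x hx).1, fun x hx => (hstep x hx).2.1,
    fun h1 x hx => (hstep x hx).2.2.1 h1, fun h1 x hx => (hstep x hx).2.2.2 h1, ?_⟩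
  · refine h'.chain.tail ⟨a κ, rfl, D, fun _ => 0, hDan, analyticOnNhd_const, fun x hx => ?_⟩
    exact (hB x hx).isSchlesingerTransform (hDne x hx)
  · exact (IsAnalyticPolyMat.stepPoly hpan hDan).mul h'.analytic
  · obtain ⟨c, j, hc, hdet⟩ := h'.det
    refine ⟨fun x => c x * (D x).det, j + 1, fun x hx => mul_ne_zero (hc x hx) (hDne x hx),
      fun x hx => ?_⟩
    rw [Matrix.det_mul, det_stepPoly, hdet x hx, C_mul]
    ring
  · exact fun x hx => (h'.gauge x hx).comp (hB x hx) (h'.det_ne_zero hx) (hsdet x hx)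
  · intro d hd
    refine ⟨hd.1, fun x hx => ?_⟩
    obtain ⟨L, hL, hLdet, hint⟩ := (h'.generic d hd).2 x hx
    obtain ⟨e, he0, he1⟩ := (hV'all x hx).1.2 d hd L hL
    refine (hB x hx).generic_step (hDne x hx) (hED x hx) (h'.trace_eq_zero hA (hV'V.trans hVX) hx)
      hd.1 hL hLdet hint ?_
    have hE0 : ∀ b, E x b 0 = ((D x).det)⁻¹ * (if b = 0 then v₀ x else v₁ x) := by
      intro b
      simp only [hE]
      rw [Matrix.smul_apply, smul_eq_mul, Matrix.adjugate_fin_two]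
      fin_cases b <;> simp [hD]
    have hLE : ∀ b, (L * E x) b 0 = e * E x b 0 := by
      intro b
      rw [Matrix.mul_apply, Fin.sum_univ_two, hE0, hE0, hE0]
      fin_cases b
      · simp only [Fin.zero_eta, if_true, one_ne_zero, if_false]
        linear_combination ((D x).det)⁻¹ * he0
      · simp only [Fin.mk_one, if_true, one_ne_zero, if_false]
        linear_combination ((D x).det)⁻¹ * he1
    rw [mul_assoc, Matrix.mul_apply, Fin.sum_univ_two, hLE, hLE]
    have h1 : (D x * E x) 1 0 = 0 := by rw [hDE x hx]; simp
    rw [Matrix.mul_apply, Fin.sum_univ_two] at h1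
    linear_combination e * h1

theorem exists_regular (hA : IsHolomorphicFamily X A a) (n : ℕ) : ∀ (V : Set (Fin m → ℂ))
    (A' : RatFamily m) (T : (Fin m → ℂ) → PolyMat), IsPartialReduction X A a κ V n A' T → IsOpen V →
    V ⊆ X → ∀ x₀ ∈ V, ∃ V' A'' T', IsOpen V' ∧ x₀ ∈ V' ∧ V' ⊆ V ∧
      IsPartialReduction X A a κ V' 0 A'' T' := by
  induction n with
  | zero => exact fun V A' T h hV hVX x₀ hx₀ => ⟨V, A', T, hV, hx₀, subset_rfl, h⟩
  | succ n ih =>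
    intro V A' T h hV hVX x₀ hx₀
    obtain ⟨V₁, A₁, T₁, hV₁, hx₁, hV₁V, h₁⟩ := h.exists_step hA hV hVX hx₀ (by omega)
    obtain ⟨V₂, A₂, T₂, hV₂, hx₂, hV₂V, h₂⟩ := ih V₁ A₁ T₁ h₁ hV₁ (hV₁V.trans hVX) x₀ hx₁
    exact ⟨V₂, A₂, T₂, hV₂, hx₂, hV₂V.trans hV₁V, h₂⟩

end IsPartialReduction

/-- Near every parameter value, finitely many Schlesinger transformations centred at the pole
`t₁ = a κ` of a non-Schlesinger deformation remove this pole. -/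
theorem IsNonSchlesinger.exists_isPartialReduction (hX : IsOpen X) (hA : IsHolomorphicFamily X A a)
    {i : Fin m} {τ : Fin N} {R : RatFamily m} (hR : IsNonSchlesinger X A a i τ κ R)
    {x₀ : Fin m → ℂ} (hx₀ : x₀ ∈ X) :
    ∃ V A' T, IsOpen V ∧ x₀ ∈ V ∧ V ⊆ X ∧ IsPartialReduction X A a κ V 0 A' T := by
  obtain ⟨n, hn, hev⟩ := hR.exists_hasPolarSolution hX hA hx₀
  obtain ⟨V, hVall, hVo, hx₀V⟩ := _root_.eventually_nhds_iff.1 (hev.and (hX.mem_nhds hx₀))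
  have hVX : V ⊆ X := fun x hx => (hVall x hx).2
  have hT : ∀ x, IsGauge (1 : PolyMat) (A x) (A x) := fun x => by
    obtain ⟨B, hB⟩ := exists_isGauge (Q := 1) (A x) (by simp)
    have h1 := hB.symm_adjugate (by simp)
    rw [Matrix.adjugate_one] at h1
    have h3 := hB.comp h1 (by simp) (by simp)
    rwa [mul_one] at h3
  obtain ⟨V', A'', T', h1, h2, h3, h4⟩ := IsPartialReduction.exists_regular hA n V A (fun _ => 1)
    { chain := .refl
      analytic := fun b c => .const _
      det := ⟨fun _ => 1, 0, by simp, by simp⟩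
      gauge := fun x _ => hT x
      poleOrder_le := fun x hx => (hR.poleOrder_eq_one x (hVX hx)).le
      det_residue := fun x hx => (hVall x hx).1.1
      polar := fun _ x hx => (hVall x hx).1.2
      regular := fun h => absurd h (by omega)
      generic := fun d hd => ⟨hd.1, fun x hx => hd.2 x (hVX hx)⟩ } hVo hVX x₀ hx₀V
  exact ⟨V', A'', T', h1, h2, h3.trans hVX, h4⟩

end Reduction

/-! ### Linear matrix differential equations -/

section MatrixODE

open scoped Matrix.Norms.Operator

variable {E : Type*} [NormedAddCommGroup E] [NormedSpace ℂ E]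

theorem Matrix.norm_apply_le_linfty_opNorm (M : Matrix (Fin 2) (Fin 2) ℂ) (b c : Fin 2) :
    ‖M b c‖ ≤ ‖M‖ := by
  rw [Matrix.linfty_opNorm_def]
  have h1 : ‖M b c‖₊ ≤ ∑ j, ‖M b j‖₊ :=
    Finset.single_le_sum (f := fun j => ‖M b j‖₊) (fun _ _ => zero_le) (Finset.mem_univ c)
  exact_mod_cast h1.trans (Finset.le_sup (f := fun i => ∑ j, ‖M i j‖₊) (Finset.mem_univ b))

theorem Matrix.linfty_opNorm_le_two_mul {M : Matrix (Fin 2) (Fin 2) ℂ} {C : ℝ}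
    (h : ∀ b c, ‖M b c‖ ≤ C) : ‖M‖ ≤ 2 * C := by
  have hC : 0 ≤ C := (norm_nonneg _).trans (h 0 0)
  lift C to NNReal using hC
  rw [Matrix.linfty_opNorm_def]
  have h1 : (Finset.univ.sup fun i => ∑ j, ‖M i j‖₊) ≤ 2 * C := by
    refine Finset.sup_le fun i _ => ?_
    rw [Fin.sum_univ_two, two_mul]
    exact add_le_add (h i 0) (h i 1)
  exact_mod_cast h1

/-- The linear map reading off an entry. -/
noncomputable def Matrix.entryCLM (b c : Fin 2) : Matrix (Fin 2) (Fin 2) ℂ →L[ℂ] ℂ :=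
  LinearMap.toContinuousLinearMap (Matrix.entryLinearMap ℂ ℂ b c)

theorem Matrix.eq_sum_smul_single (M : Matrix (Fin 2) (Fin 2) ℂ) :
    M = ∑ b, ∑ c, M b c • Matrix.single b c (1 : ℂ) := by
  conv_lhs => rw [Matrix.matrix_eq_sum_single M]
  simp [Matrix.smul_single]

theorem AnalyticMatAt.analyticAt {v : E → Matrix (Fin 2) (Fin 2) ℂ} {z : E}
    (h : AnalyticMatAt v z) : AnalyticAt ℂ v z := by
  have h1 : v = fun z => ∑ b, ∑ c, v z b c • Matrix.single b c (1 : ℂ) :=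
    funext fun z => (v z).eq_sum_smul_single
  rw [h1]
  exact Finset.analyticAt_fun_sum _ fun b _ => Finset.analyticAt_fun_sum _ fun c _ =>
    (h b c).smul analyticAt_const

theorem AnalyticAt.analyticMatAt {v : E → Matrix (Fin 2) (Fin 2) ℂ} {z : E}
    (h : AnalyticAt ℂ v z) : AnalyticMatAt v z := fun b c =>
  ((Matrix.entryCLM b c).analyticAt _).comp h

theorem HasMatDerivAt.hasDerivAt {v : ℂ → Matrix (Fin 2) (Fin 2) ℂ}
    {v' : Matrix (Fin 2) (Fin 2) ℂ} {l : ℂ} (h : HasMatDerivAt v v' l) : HasDerivAt v v' l := by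
  have h1 : v = fun z => ∑ b, ∑ c, v z b c • Matrix.single b c (1 : ℂ) :=
    funext fun z => (v z).eq_sum_smul_single
  rw [h1, v'.eq_sum_smul_single]
  exact HasDerivAt.fun_sum fun b _ => HasDerivAt.fun_sum fun c _ => (h b c).smul_const _

theorem HasDerivAt.hasMatDerivAt {v : ℂ → Matrix (Fin 2) (Fin 2) ℂ}
    {v' : Matrix (Fin 2) (Fin 2) ℂ} {l : ℂ} (h : HasDerivAt v v' l) : HasMatDerivAt v v' l :=
  fun b c => (Matrix.entryCLM b c).hasFDerivAt.comp_hasDerivAt l h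

variable {Z : Type*} [NormedAddCommGroup Z] [NormedSpace ℂ Z]

/-- The matrix solution of `dG/ds = - G u` along the lines in direction `e`, normalized by `G = 1`
on the hyperplane `τ = t₀`. -/
theorem exists_matrix_flow [FiniteDimensional ℂ Z] {D : Set Z} {e : Z} {τ : Z →L[ℂ] ℂ} {t₀ : ℂ}
    {ρ : ℝ} {u : Z → Matrix (Fin 2) (Fin 2) ℂ} (hD : IsOpen D) (hτ : τ e = 1)
    (hρ : ∀ z ∈ D, τ z ∈ Metric.ball t₀ ρ)
    (hs : ∀ z ∈ D, ∀ t ∈ Metric.ball t₀ ρ, z + (t - τ z) • e ∈ D)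
    (hu : ∀ z ∈ D, AnalyticMatAt u z) :
    ∃ G : Z → Matrix (Fin 2) (Fin 2) ℂ, (∀ z ∈ D, AnalyticMatAt G z) ∧
      (∀ z ∈ D, τ z = t₀ → G z = 1) ∧
      ∀ z ∈ D, HasMatDerivAt (fun s : ℂ => G (z + s • e)) (-(G z * u z)) 0 := by
  obtain ⟨G, h1, h2, h3⟩ := exists_linear_flow (𝔸 := Matrix (Fin 2) (Fin 2) ℂ) hD hτ hρ hs
    (fun z hz => (hu z hz).analyticAt)
  exact ⟨G, fun z hz => (h1 z hz).analyticMatAt, h2, fun z hz => (h3 z hz).hasMatDerivAt⟩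

/-- Growth of a solution of a linear equation along a complex line. -/
theorem norm_le_mul_exp_of_hasMatDerivAt_line {F u : Z → Matrix (Fin 2) (Fin 2) ℂ} {z e : Z}
    {w : ℂ} {C : ℝ}
    (hF : ∀ s ∈ Set.Icc (0 : ℝ) 1, HasMatDerivAt (fun r : ℂ => F (z + (s * w) • e + r • e))
      (-(F (z + (s * w) • e) * u (z + (s * w) • e))) 0)
    (hu : ∀ s ∈ Set.Icc (0 : ℝ) 1, ‖u (z + (s * w) • e)‖ ≤ C) :
    ‖F (z + w • e)‖ ≤ ‖F z‖ * Real.exp (‖w‖ * C) := by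
  have h1 := norm_le_mul_exp_of_norm_deriv_le (S := 1) (C := ‖w‖ * C)
    (f := fun s : ℝ => F (z + (s * w) • e))
    (f' := fun s => w • (-(F (z + (s * w) • e) * u (z + (s * w) • e)))) zero_le_one
    (fun s hs => by
      have h2 := (hF s hs).hasDerivAt
      have h3 : HasDerivAt (fun r : ℝ => ((r : ℂ) - s) * w) w s := by
        have := ((hasDerivAt_id (s : ℂ)).sub_const (s : ℂ)).mul_const w
        simpa using this.comp_ofReal
      have h4 : HasDerivAt (fun r : ℂ => F (z + (s * w) • e + r • e))
          (-(F (z + (s * w) • e) * u (z + (s * w) • e))) (((s : ℂ) - s) * w) := by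
        simpa using h2
      have h5 := h4.scomp s h3
      refine h5.congr_of_eventuallyEq (Filter.Eventually.of_forall fun r => ?_)
      simp only [Function.comp]
      congr 1
      module)
    (fun s hs => by
      rw [norm_smul, norm_neg, mul_assoc]
      refine mul_le_mul_of_nonneg_left ?_ (norm_nonneg _)
      calc ‖F (z + (s * w) • e) * u (z + (s * w) • e)‖
          ≤ ‖F (z + (s * w) • e)‖ * ‖u (z + (s * w) • e)‖ := norm_mul_le _ _
        _ ≤ ‖F (z + (s * w) • e)‖ * C := mul_le_mul_of_nonneg_left (hu s hs) (norm_nonneg _)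
        _ = C * ‖F (z + (s * w) • e)‖ := mul_comm _ _)
  simpa using h1

/-- Growth of a function along the ray `s ↦ p + exp (σ s) ζ` if its derivative is `O(1 / (λ - p))`
relative to the function. -/
theorem norm_le_mul_exp_of_hasMatDerivAt_ray {f f' : ℂ → Matrix (Fin 2) (Fin 2) ℂ} {p ζ : ℂ}
    {σ K S : ℝ} (hσ : |σ| = 1) (hS : 0 ≤ S)
    (hf : ∀ s ∈ Set.Icc 0 S, HasMatDerivAt f (f' (p + Complex.exp (σ * s) * ζ))
      (p + Complex.exp (σ * s) * ζ))
    (hb : ∀ s ∈ Set.Icc 0 S, ‖Complex.exp (σ * s) * ζ‖ * ‖f' (p + Complex.exp (σ * s) * ζ)‖ ≤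
      K * ‖f (p + Complex.exp (σ * s) * ζ)‖) :
    ‖f (p + Complex.exp (σ * S) * ζ)‖ ≤ ‖f (p + ζ)‖ * Real.exp (K * S) := by
  have h1 := norm_le_mul_exp_of_norm_deriv_le (S := S) (C := K)
    (f := fun s : ℝ => f (p + Complex.exp (σ * s) * ζ))
    (f' := fun s => (σ * (Complex.exp (σ * s) * ζ) : ℂ) • f' (p + Complex.exp (σ * s) * ζ)) hS
    (fun s hs => by
      have h3 : HasDerivAt (fun r : ℝ => p + Complex.exp (σ * r) * ζ)
          (σ * (Complex.exp (σ * s) * ζ)) s := by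
        have h4 : HasDerivAt (fun r : ℂ => p + Complex.exp (σ * r) * ζ)
            (Complex.exp (σ * s) * (σ * 1) * ζ) (s : ℂ) :=
          ((((hasDerivAt_id (s : ℂ)).const_mul (σ : ℂ)).cexp).mul_const ζ).const_add p
        exact h4.comp_ofReal.congr_deriv (by ring)
      exact (hf s hs).hasDerivAt.scomp s h3)
    (fun s hs => by
      rw [norm_smul, norm_mul, Complex.norm_real, Real.norm_eq_abs, hσ, one_mul]
      exact hb s hs)
  simpa using h1

end MatrixODE

/-! ### Boundedness of holomorphic families at their regular points -/

section Boundedness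

theorem RatFunc.isRegularAt_of_bounded {f : RatFunc ℂ} {q : ℂ} {C : ℝ}
    (h : ∀ᶠ l in 𝓝[≠] q, ‖f.value l‖ ≤ C) : f.IsRegularAt q := by
  have hX := RatFunc.isRegularAt_X_sub_C q q
  have h1 : Tendsto ((RatFunc.X - RatFunc.C q) * f).value (𝓝[≠] q) (𝓝 0) := by
    have h2 : Tendsto (fun l : ℂ => ‖l - q‖ * C) (𝓝[≠] q) (𝓝 0) := by
      have : Tendsto (fun l : ℂ => ‖l - q‖ * C) (𝓝 q) (𝓝 (‖q - q‖ * C)) := by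
        apply Continuous.tendsto; fun_prop
      rw [sub_self, norm_zero, zero_mul] at this
      exact this.mono_left nhdsWithin_le_nhds
    refine squeeze_zero_norm' ?_ h2
    filter_upwards [h, f.eventually_isRegularAt q] with l hl hr
    rw [RatFunc.value_mul (RatFunc.isRegularAt_X_sub_C q l) hr, RatFunc.value_X_sub_C, norm_mul]
    exact mul_le_mul_of_nonneg_left hl (norm_nonneg _)
  have hreg := RatFunc.isRegularAt_of_tendsto h1
  have h0 : ((RatFunc.X - RatFunc.C q) * f).value q = 0 :=
    tendsto_nhds_unique ((RatFunc.analyticAt_value hreg).continuousAt.tendsto.mono_left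
      nhdsWithin_le_nhds) h1
  obtain ⟨g, hg, hgf⟩ := hreg.exists_eq_mul h0
  rwa [mul_left_cancel₀ (RatFunc.X_sub_C_ne_zero q) hgf]

theorem RatFunc.exists_tendsto_of_bounded {f : RatFunc ℂ} {C : ℝ}
    (h : ∀ᶠ l in Bornology.cobounded ℂ, ‖f.value l‖ ≤ C) :
    ∃ c, Tendsto f.value (Bornology.cobounded ℂ) (𝓝 c) := by
  obtain ⟨c, hc⟩ := RatFunc.exists_tendsto_cobounded f 1 (by
    have h2 : Tendsto (fun l : ℂ => ‖l⁻¹‖ * C) (Bornology.cobounded ℂ) (𝓝 0) := by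
      have := (tendsto_inv₀_cobounded (α := ℂ)).norm.mul_const C
      rwa [norm_zero, zero_mul] at this
    refine squeeze_zero_norm' ?_ h2
    filter_upwards [h] with l hl
    rw [norm_mul, zpow_neg, zpow_one]
    exact mul_le_mul_of_nonneg_left hl (norm_nonneg _))
  refine ⟨c, hc.congr' ?_⟩
  filter_upwards [Bornology.eventually_ne_cobounded 0] with l hl
  rw [zpow_neg, zpow_one, inv_mul_cancel_left₀ hl]

/-- The maximum principle on a disc. -/
theorem RatFunc.norm_value_le {f : RatFunc ℂ} {q : ℂ} {r C : ℝ} (hr : 0 < r)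
    (hf : ∀ l ∈ Metric.closedBall q r, f.IsRegularAt l)
    (h : ∀ l ∈ Metric.sphere q r, ‖f.value l‖ ≤ C) :
    ∀ l ∈ Metric.closedBall q r, ‖f.value l‖ ≤ C := by
  intro l hl
  refine Complex.norm_le_of_forall_mem_frontier_norm_le (U := Metric.ball q r) Metric.isBounded_ball
    ?_ ?_ (by rwa [closure_ball _ hr.ne'])
  · refine DifferentiableOn.diffContOnCl fun w hw => ?_
    rw [closure_ball _ hr.ne'] at hw
    exact (RatFunc.analyticAt_value (hf w hw)).differentiableAt.differentiableWithinAt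
  · rwa [frontier_ball _ hr.ne']

/-- The maximum principle on the complement of a disc. -/
theorem RatFunc.norm_value_le_of_tendsto {f : RatFunc ℂ} {R C : ℝ} {y : ℂ} (hR : 0 < R)
    (hf : ∀ l, R ≤ ‖l‖ → f.IsRegularAt l) (hy : Tendsto f.value (Bornology.cobounded ℂ) (𝓝 y))
    (h : ∀ l, ‖l‖ = R → ‖f.value l‖ ≤ C) : ∀ l, R ≤ ‖l‖ → ‖f.value l‖ ≤ C := by
  intro l hl
  set g : ℂ → ℂ := Function.update (fun w => f.value w⁻¹) 0 y with hg
  have hg1 : ∀ w ≠ 0, g w = f.value w⁻¹ := fun w hw => by rw [hg, Function.update_of_ne hw]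
  have hR' : 0 < R⁻¹ := inv_pos.2 hR
  have hinv : ∀ w : ℂ, w ≠ 0 → ‖w‖ ≤ R⁻¹ → R ≤ ‖w⁻¹‖ := fun w hw h => by
    rw [norm_inv]; exact (le_inv_comm₀ (norm_pos_iff.2 hw) hR).1 h
  have hd : ∀ w : ℂ, w ≠ 0 → ‖w‖ ≤ R⁻¹ → DifferentiableAt ℂ g w := fun w hw h => by
    have h1 : DifferentiableAt ℂ (fun w => f.value w⁻¹) w :=
      DifferentiableAt.comp w (g := f.value)
        (RatFunc.analyticAt_value (hf _ (hinv w hw h))).differentiableAt (differentiableAt_inv hw)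
    refine h1.congr_of_eventuallyEq ?_
    filter_upwards [isOpen_ne.mem_nhds hw] with v hv using hg1 v hv
  have hc : ContinuousAt g 0 := by
    rw [hg, continuousAt_update_same]
    exact hy.comp tendsto_inv₀_nhdsNE_zero
  have hd0 : DifferentiableAt ℂ g 0 := by
    refine (Complex.analyticAt_of_differentiable_on_punctured_nhds_of_continuousAt ?_
      hc).differentiableAt
    filter_upwards [self_mem_nhdsWithin,
      nhdsWithin_le_nhds (Metric.closedBall_mem_nhds (0 : ℂ) hR')] with w hw hw'
    exact hd w hw (by simpa using hw')
  have hl0 : l ≠ 0 := by rintro rfl; rw [norm_zero] at hl; linarith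
  have key : ‖g l⁻¹‖ ≤ C := by
    refine Complex.norm_le_of_forall_mem_frontier_norm_le (U := Metric.ball 0 R⁻¹)
      Metric.isBounded_ball ?_ ?_ ?_
    · refine DifferentiableOn.diffContOnCl fun w hw => ?_
      rw [closure_ball _ hR'.ne'] at hw
      by_cases hw0 : w = 0
      · rw [hw0]; exact hd0.differentiableWithinAt
      · exact (hd w hw0 (by simpa using hw)).differentiableWithinAt
    · intro w hw
      rw [frontier_ball _ hR'.ne', mem_sphere_zero_iff_norm] at hw
      have hw0 : w ≠ 0 := by rintro rfl; rw [norm_zero] at hw; exact hR'.ne hw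
      rw [hg1 w hw0]
      exact h _ (by rw [norm_inv, hw, inv_inv])
    · rw [closure_ball _ hR'.ne', mem_closedBall_zero_iff, norm_inv]
      exact inv_anti₀ hR hl
  rwa [hg1 _ (inv_ne_zero hl0), inv_inv] at key

theorem exists_eventually_forall_norm_le {Y : Type*} [TopologicalSpace Y] {f : Y × ℂ → ℂ} {x₀ : Y}
    {K : Set ℂ} (hK : IsCompact K) (hf : ∀ l ∈ K, ContinuousAt f (x₀, l)) :
    ∃ C, ∀ᶠ x in 𝓝 x₀, ∀ l ∈ K, ‖f (x, l)‖ ≤ C := by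
  refine hK.induction_on (p := fun s => ∃ C, ∀ᶠ x in 𝓝 x₀, ∀ l ∈ s, ‖f (x, l)‖ ≤ C) ?_ ?_ ?_ ?_
  · exact ⟨0, by simp⟩
  · rintro s t hst ⟨C, hC⟩
    exact ⟨C, hC.mono fun x hx l hl => hx l (hst hl)⟩
  · rintro s t ⟨C, hC⟩ ⟨C', hC'⟩
    refine ⟨max C C', ?_⟩
    filter_upwards [hC, hC'] with x hx hx' l hl
    rcases hl with hl | hl
    · exact (hx l hl).trans (le_max_left _ _)
    · exact (hx' l hl).trans (le_max_right _ _)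
  · intro l hl
    have h1 := (hf l hl).norm.eventually_lt_const (lt_add_one _)
    rw [nhds_prod_eq] at h1
    obtain ⟨p, hp, q, hq, hpq⟩ := eventually_prod_iff.1 h1
    exact ⟨{l | q l}, nhdsWithin_le_nhds hq, ‖f (x₀, l)‖ + 1,
      hp.mono fun x hx l hl => (hpq hx hl).le⟩

end Boundedness

section Families

variable {m N : ℕ} {X : Set (Fin m → ℂ)} {B : RatFamily m} {a : Fin N → (Fin m → ℂ) → ℂ}

/-- A family of rational matrices which is holomorphic away from the points `a k x`. -/
structure IsHolomorphicOff (X : Set (Fin m → ℂ)) (B : RatFamily m)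
    (a : Fin N → (Fin m → ℂ) → ℂ) : Prop where
  isRegularAt : ∀ x ∈ X, ∀ l, (∀ k, l ≠ a k x) → RatMat.IsRegularAt (B x) l
  analytic : ∀ x ∈ X, ∀ l, (∀ k, l ≠ a k x) →
    AnalyticMatAt (fun z : (Fin m → ℂ) × ℂ => (B z.1).evalAt z.2) (x, l)

theorem IsHolomorphicFamily.isHolomorphicOff {A : RatFamily m} (hA : IsHolomorphicFamily X A a) :
    IsHolomorphicOff X A a where
  isRegularAt _ hx _ hl := hA.isRegularAt hx hl
  analytic x hx l hl := hA.analytic x hx l (RatMat.not_isPole_iff.2 (hA.isRegularAt hx hl))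

namespace IsHolomorphicOff

theorem mono {V : Set (Fin m → ℂ)} (h : IsHolomorphicOff X B a) (hV : V ⊆ X) :
    IsHolomorphicOff V B a where
  isRegularAt x hx := h.isRegularAt x (hV hx)
  analytic x hx := h.analytic x (hV hx)

theorem smul_X_sub_C (h : IsHolomorphicOff X B a) (hX : IsOpen X)
    (ha : ∀ k, AnalyticOnNhd ℂ (a k) X) {p : (Fin m → ℂ) → ℂ} (hp : AnalyticOnNhd ℂ p X) :
    IsHolomorphicOff X (fun x => (RatFunc.X - RatFunc.C (p x)) • B x) a where
  isRegularAt x hx l hl := .smul (RatFunc.isRegularAt_X_sub_C _ _) (h.isRegularAt x hx l hl)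
  analytic x hx l hl := by
    have h1 : AnalyticAt ℂ (fun z : (Fin m → ℂ) × ℂ => z.2 - p z.1) (x, l) :=
      analyticAt_snd.sub (AnalyticAt.comp (g := p) (hp x hx) analyticAt_fst)
    refine (AnalyticMatAt.smul h1 (h.analytic x hx l hl)).congr ?_
    have h2 : ∀ᶠ z : (Fin m → ℂ) × ℂ in 𝓝 (x, l), ∀ k, z.2 ≠ a k z.1 :=
      eventually_forall_ne (fun k => (ha k x hx).continuousAt) hl
    filter_upwards [h2, (continuous_fst.tendsto (x, l)).eventually (hX.mem_nhds hx)] with z hz1 hz2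
    rw [RatMat.evalAt_smul_X_sub_C (h.isRegularAt _ hz2 _ hz1)]

/-- Uniform boundedness near `a k`, for the parameters at which there is no pole. -/
theorem exists_bound (h : IsHolomorphicOff X B a) (hX : IsOpen X) {x₀ : Fin m → ℂ} (hx₀ : x₀ ∈ X)
    {k : Fin N} {r : ℝ} (hr : 0 < r)
    (hrx : ∀ᶠ x in 𝓝 x₀, ∀ w ∈ Metric.closedBall (a k x₀) r, ∀ k', k' ≠ k → w ≠ a k' x) :
    ∃ C, ∀ᶠ x in 𝓝 x₀, RatMat.IsRegularAt (B x) (a k x) →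
      ∀ l ∈ Metric.closedBall (a k x₀) r, ∀ b c, ‖(B x).evalAt l b c‖ ≤ C := by
  have hoff : ∀ᶠ x in 𝓝 x₀, ∀ l ∈ Metric.closedBall (a k x₀) r, l ≠ a k x → ∀ k, l ≠ a k x := by
    filter_upwards [hrx] with x hx l hl hlk k'
    by_cases hk' : k' = k
    · rwa [hk']
    · exact hx l hl k' hk'
  have hb : ∀ b c, ∃ C, ∀ᶠ x in 𝓝 x₀, ∀ l ∈ Metric.sphere (a k x₀) r, ‖(B x).evalAt l b c‖ ≤ C := by
    intro b c
    refine exists_eventually_forall_norm_le (f := fun z : (Fin m → ℂ) × ℂ => (B z.1).evalAt z.2 b c)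
      (isCompact_sphere _ _) fun l hl => ?_
    refine (h.analytic x₀ hx₀ l (hoff.self_of_nhds l (Metric.sphere_subset_closedBall hl)
      fun h0 => ?_) b c).continuousAt
    rw [h0, Metric.mem_sphere, dist_self] at hl
    exact hr.ne hl
  choose C hC using hb
  obtain ⟨C', hC'⟩ : ∃ C', ∀ b c, C b c ≤ C' :=
    ⟨max (max (C 0 0) (C 0 1)) (max (C 1 0) (C 1 1)), fun b c => by
      fin_cases b <;> fin_cases c <;> simp⟩
  refine ⟨C', ?_⟩
  have hC2 := eventually_all.2 fun b => eventually_all.2 fun c => hC b c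
  filter_upwards [hoff, hC2, hX.mem_nhds hx₀] with x hx hxC hxX hreg l hl b c
  refine RatFunc.norm_value_le hr (fun w hw => ?_) (fun w hw => (hxC b c w hw).trans (hC' b c)) l hl
  by_cases hwk : w = a k x
  · rw [hwk]; exact hreg b c
  · exact h.isRegularAt x hxX w (hx w hw hwk) b c

/-- Having no pole at `a k` is a closed condition on the parameters. -/
theorem isRegularAt_of_frequently (h : IsHolomorphicOff X B a) (hX : IsOpen X) {x₀ : Fin m → ℂ}
    (hx₀ : x₀ ∈ X) {k : Fin N} {r : ℝ} (hr : 0 < r)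
    (hrx : ∀ᶠ x in 𝓝 x₀, ∀ w ∈ Metric.closedBall (a k x₀) r, ∀ k', k' ≠ k → w ≠ a k' x)
    (hf : ∃ᶠ x in 𝓝 x₀, RatMat.IsRegularAt (B x) (a k x)) : RatMat.IsRegularAt (B x₀) (a k x₀) := by
  obtain ⟨C, hC⟩ := h.exists_bound hX hx₀ hr hrx
  intro b c
  refine RatFunc.isRegularAt_of_bounded (C := C) ?_
  filter_upwards [self_mem_nhdsWithin, nhdsWithin_le_nhds (Metric.closedBall_mem_nhds _ hr)]
    with l hl1 hl2
  have hoff : ∀ k, l ≠ a k x₀ := fun k' => by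
    by_cases hk' : k' = k
    · rw [hk']; exact hl1
    · exact hrx.self_of_nhds l hl2 k' hk'
  have h1 : ContinuousAt (fun x => (B x).evalAt l b c) x₀ :=
    ContinuousAt.comp (g := fun z : (Fin m → ℂ) × ℂ => (B z.1).evalAt z.2 b c)
      (f := fun x => (x, l))
      (h.analytic x₀ hx₀ l hoff b c).continuousAt (continuousAt_id.prodMk continuousAt_const)
  exact le_of_tendsto_of_frequently h1.norm
    ((hf.and_eventually hC).mono fun x hx => hx.2 hx.1 l hl2 b c)

/-- Uniform boundedness near infinity, for the parameters at which there is no pole. -/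
theorem exists_bound_atInfty (h : IsHolomorphicOff X B a) (hX : IsOpen X) {x₀ : Fin m → ℂ}
    (hx₀ : x₀ ∈ X) {R : ℝ} (hR : 0 < R) (hRx : ∀ᶠ x in 𝓝 x₀, ∀ w, R ≤ ‖w‖ → ∀ k, w ≠ a k x) :
    ∃ C, ∀ᶠ x in 𝓝 x₀, RatMat.RegularAtInfty (B x) →
      ∀ l, R ≤ ‖l‖ → ∀ b c, ‖(B x).evalAt l b c‖ ≤ C := by
  have hb : ∀ b c, ∃ C, ∀ᶠ x in 𝓝 x₀, ∀ l ∈ Metric.sphere 0 R, ‖(B x).evalAt l b c‖ ≤ C := by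
    intro b c
    refine exists_eventually_forall_norm_le (f := fun z : (Fin m → ℂ) × ℂ => (B z.1).evalAt z.2 b c)
      (isCompact_sphere _ _) fun l hl => ?_
    exact (h.analytic x₀ hx₀ l (hRx.self_of_nhds l (mem_sphere_zero_iff_norm.1 hl).ge) b c).continuousAt
  choose C hC using hb
  obtain ⟨C', hC'⟩ : ∃ C', ∀ b c, C b c ≤ C' :=
    ⟨max (max (C 0 0) (C 0 1)) (max (C 1 0) (C 1 1)), fun b c => by
      fin_cases b <;> fin_cases c <;> simp⟩
  refine ⟨C', ?_⟩
  have hC2 := eventually_all.2 fun b => eventually_all.2 fun c => hC b c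
  filter_upwards [hRx, hC2, hX.mem_nhds hx₀] with x hx hxC hxX ⟨L, hL⟩ l hl b c
  exact RatFunc.norm_value_le_of_tendsto hR (fun w hw => h.isRegularAt x hxX w (hx w hw) b c)
    ((hL b c).congr fun w => by simp [RatMat.evalAt_apply]) (fun w hw => (hxC b c w (mem_sphere_zero_iff_norm.2 hw)).trans (hC' b c))
    l hl

/-- Having no pole at infinity is a closed condition on the parameters. -/
theorem regularAtInfty_of_frequently (h : IsHolomorphicOff X B a) (hX : IsOpen X) {x₀ : Fin m → ℂ}
    (hx₀ : x₀ ∈ X) {R : ℝ} (hR : 0 < R) (hRx : ∀ᶠ x in 𝓝 x₀, ∀ w, R ≤ ‖w‖ → ∀ k, w ≠ a k x)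
    (hf : ∃ᶠ x in 𝓝 x₀, RatMat.RegularAtInfty (B x)) : RatMat.RegularAtInfty (B x₀) := by
  obtain ⟨C, hC⟩ := h.exists_bound_atInfty hX hx₀ hR hRx
  have hlim : ∀ b c, ∃ y, Tendsto (B x₀ b c).value (Bornology.cobounded ℂ) (𝓝 y) := by
    intro b c
    refine RatFunc.exists_tendsto_of_bounded (C := C) ?_
    filter_upwards [(Bornology.isBounded_def.1 (Metric.isBounded_ball (x := (0 : ℂ)) (r := R)))]
      with l hl
    have hl' : R ≤ ‖l‖ := by simpa using hl
    have h1 : ContinuousAt (fun x => (B x).evalAt l b c) x₀ :=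
      ContinuousAt.comp (g := fun z : (Fin m → ℂ) × ℂ => (B z.1).evalAt z.2 b c)
      (f := fun x => (x, l))
        (h.analytic x₀ hx₀ l (hRx.self_of_nhds l hl') b c).continuousAt
        (continuousAt_id.prodMk continuousAt_const)
    exact le_of_tendsto_of_frequently h1.norm
      ((hf.and_eventually hC).mono fun x hx => hx.2 hx.1 l hl' b c)
  choose L hL using hlim
  exact ⟨Matrix.of L, fun b c => (hL b c).congr fun w => by simp [RatMat.evalAt_apply]⟩

end IsHolomorphicOff

end Families

/-! ### The comparison matrix of a deformation -/

section Deformation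

variable {m N : ℕ}

theorem add_smul_single_eq_update (x : Fin m → ℂ) (j : Fin m) (s : ℂ) :
    x + (s - x j) • Pi.single j 1 = Function.update x j s := by
  ext i
  by_cases h : i = j
  · subst h; simp
  · simp [h]

theorem update_mem_ball {x x₁ : Fin m → ℂ} {ρ : ℝ} (hx : x ∈ Metric.ball x₁ ρ) {j : Fin m} {s : ℂ}
    (hs : s ∈ Metric.ball (x₁ j) ρ) : Function.update x j s ∈ Metric.ball x₁ ρ := by
  have hρ : 0 < ρ := dist_nonneg.trans_lt hx
  rw [ball_pi _ hρ] at hx ⊢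
  intro i _
  by_cases h : i = j
  · subst h; simpa using hs
  · simpa [h] using hx i trivial

theorem apply_mem_ball {x x₁ : Fin m → ℂ} {ρ : ℝ} (hx : x ∈ Metric.ball x₁ ρ) (j : Fin m) :
    x j ∈ Metric.ball (x₁ j) ρ := by
  have hρ : 0 < ρ := dist_nonneg.trans_lt hx
  rw [ball_pi _ hρ] at hx
  exact hx j trivial

theorem matFDeriv_neg {v : (Fin m → ℂ) × ℂ → Matrix (Fin 2) (Fin 2) ℂ} {z e : (Fin m → ℂ) × ℂ} :
    matFDeriv (fun z => -v z) z e = -matFDeriv v z e := by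
  ext a b
  simp only [matFDeriv, Matrix.of_apply, Matrix.neg_apply]
  rw [fderiv_fun_neg]
  rfl

theorem AnalyticMatAt.hasMatDerivAt_line {v : (Fin m → ℂ) × ℂ → Matrix (Fin 2) (Fin 2) ℂ}
    {z : (Fin m → ℂ) × ℂ} (hv : AnalyticMatAt v z) (e : (Fin m → ℂ) × ℂ) :
    HasMatDerivAt (fun s : ℂ => v (z + s • e)) (_root_.matFDeriv v z e) 0 := by
  intro b c
  have h1 : HasDerivAt (fun s : ℂ => z + s • e) e 0 := by
    have := ((hasDerivAt_id (0 : ℂ)).smul_const e).const_add z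
    simpa using this
  have h2 : HasFDerivAt (fun z => v z b c) (fderiv ℂ (fun z => v z b c) z) (z + (0 : ℂ) • e) := by
    rw [zero_smul, add_zero]; exact (hv b c).differentiableAt.hasFDerivAt
  exact h2.comp_hasDerivAt 0 h1

theorem AnalyticMatAt.hasMatDerivAt_snd {v : (Fin m → ℂ) × ℂ → Matrix (Fin 2) (Fin 2) ℂ}
    {z : (Fin m → ℂ) × ℂ} (hv : AnalyticMatAt v z) :
    HasMatDerivAt (fun l => v (z.1, l)) (_root_.matFDeriv v z (0, 1)) z.2 := fun b c =>
  hasDerivAt_snd_of_differentiableAt (hv b c).differentiableAt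

variable {A U : RatFamily m} {a : Fin N → (Fin m → ℂ) → ℂ} {j : Fin m} {κ : Fin N}
  {x₁ : Fin m → ℂ} {ρ r : ℝ}

/-- Over the polydisc of radius `ρ` around `x₁`, the family `A` is deformed isomonodromically by
the traceless family `U` with respect to `x j`, the position of the pole `a κ`, which stays in the
disc of radius `r` around `a κ x₁`; the other poles do not depend on `x j`. -/
structure IsLocalDeformation (A U : RatFamily m) (a : Fin N → (Fin m → ℂ) → ℂ) (j : Fin m)
    (κ : Fin N) (x₁ : Fin m → ℂ) (ρ r : ℝ) : Prop where
  pos : 0 < ρ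
  lt : ρ < r
  analytic_pole : ∀ k, AnalyticOnNhd ℂ (a k) (Metric.ball x₁ ρ)
  holomorphic : IsHolomorphicOff (Metric.ball x₁ ρ) A a
  holomorphic_deformation : IsHolomorphicOff (Metric.ball x₁ ρ) U a
  trace_eq_zero : ∀ x ∈ Metric.ball x₁ ρ, (U x).trace = 0
  zero_curvature : ∀ x ∈ Metric.ball x₁ ρ, ∀ l, (∀ k, l ≠ a k x) →
    matFDeriv (fun z : (Fin m → ℂ) × ℂ => (A z.1).evalAt z.2) (x, l) (Pi.single j 1, 0) =
      matFDeriv (fun z : (Fin m → ℂ) × ℂ => (U z.1).evalAt z.2) (x, l) (0, 1) +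
      ((U x).evalAt l * (A x).evalAt l - (A x).evalAt l * (U x).evalAt l)
  pole_eq : ∀ x ∈ Metric.ball x₁ ρ, a κ x = x j
  pole_update : ∀ x ∈ Metric.ball x₁ ρ, ∀ s ∈ Metric.ball (x₁ j) ρ, ∀ k, k ≠ κ →
    a k (Function.update x j s) = a k x

/-- The set over which the deformation is nonsingular for all values of `x j`. -/
def deformationDomain (a : Fin N → (Fin m → ℂ) → ℂ) (j : Fin m) (κ : Fin N) (x₁ : Fin m → ℂ)
    (ρ r : ℝ) : Set ((Fin m → ℂ) × ℂ) :=
  {z | z.1 ∈ Metric.ball x₁ ρ ∧ r < dist z.2 (x₁ j) ∧ ∀ k, k ≠ κ → z.2 ≠ a k z.1}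

namespace IsLocalDeformation

theorem ne_of_mem (h : IsLocalDeformation A U a j κ x₁ ρ r) {z : (Fin m → ℂ) × ℂ}
    (hz : z ∈ deformationDomain a j κ x₁ ρ r) : ∀ k, z.2 ≠ a k z.1 := by
  intro k
  by_cases hk : k = κ
  · subst hk
    rw [h.pole_eq _ hz.1]
    intro h0
    have h1 := hz.2.1
    have h2 := apply_mem_ball hz.1 j
    rw [h0] at h1
    exact absurd (h1.trans h2) (not_lt.2 h.lt.le)
  · exact hz.2.2 k hk

theorem update_mem (h : IsLocalDeformation A U a j κ x₁ ρ r) {z : (Fin m → ℂ) × ℂ}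
    (hz : z ∈ deformationDomain a j κ x₁ ρ r) {s : ℂ} (hs : s ∈ Metric.ball (x₁ j) ρ) :
    (Function.update z.1 j s, z.2) ∈ deformationDomain a j κ x₁ ρ r :=
  ⟨update_mem_ball hz.1 hs, hz.2.1, fun k hk => by
    rw [h.pole_update _ hz.1 _ hs k hk]; exact hz.2.2 k hk⟩

theorem isOpen_domain (h : IsLocalDeformation A U a j κ x₁ ρ r) :
    IsOpen (deformationDomain a j κ x₁ ρ r) := by
  rw [isOpen_iff_mem_nhds]
  rintro ⟨x, l⟩ hz
  have h1 : ∀ᶠ z : (Fin m → ℂ) × ℂ in 𝓝 (x, l), z.1 ∈ Metric.ball x₁ ρ :=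
    (continuous_fst.tendsto (x, l)).eventually (Metric.isOpen_ball.mem_nhds hz.1)
  have h2 : ∀ᶠ z : (Fin m → ℂ) × ℂ in 𝓝 (x, l), r < dist z.2 (x₁ j) :=
    ((continuous_snd.dist continuous_const).continuousAt (x := (x, l))).eventually_const_lt hz.2.1
  have h3 : ∀ᶠ z : (Fin m → ℂ) × ℂ in 𝓝 (x, l), ∀ k, k ≠ κ → z.2 ≠ a k z.1 := by
    rw [eventually_all]
    intro k
    by_cases hk : k = κ
    · simp [hk]
    · have hc : ContinuousAt (fun z : (Fin m → ℂ) × ℂ => z.2 - a k z.1) (x, l) :=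
        continuousAt_snd.sub (ContinuousAt.comp (g := a k)
          (h.analytic_pole k x hz.1).continuousAt continuousAt_fst)
      filter_upwards [hc.eventually_ne (sub_ne_zero.2 (hz.2.2 k hk))] with z hz _
      exact sub_ne_zero.1 hz
  filter_upwards [h1, h2, h3] with z hz1 hz2 hz3 using ⟨hz1, hz2, hz3⟩

theorem analyticMatAt_initial (h : IsLocalDeformation A U a j κ x₁ ρ r) {z : (Fin m → ℂ) × ℂ}
    (hz : z ∈ deformationDomain a j κ x₁ ρ r) :
    AnalyticMatAt (fun z : (Fin m → ℂ) × ℂ => (A (Function.update z.1 j (x₁ j))).evalAt z.2) z := by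
  intro b c
  have hz' := h.update_mem hz (Metric.mem_ball_self h.pos)
  have h1 : AnalyticAt ℂ
      (fun z : (Fin m → ℂ) × ℂ => ((Function.update z.1 j (x₁ j), z.2) : (Fin m → ℂ) × ℂ)) z := by
    refine AnalyticAt.prod ?_ analyticAt_snd
    rw [analyticAt_pi_iff]
    intro i
    by_cases hi : i = j
    · subst hi; simpa using analyticAt_const
    · simp only [Function.update_of_ne hi]
      exact ((ContinuousLinearMap.proj (R := ℂ) (φ := fun _ : Fin m => ℂ) i).comp
        (ContinuousLinearMap.fst ℂ (Fin m → ℂ) ℂ)).analyticAt z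
  exact AnalyticAt.comp (g := fun z : (Fin m → ℂ) × ℂ => (A z.1).evalAt z.2 b c)
    (f := fun z : (Fin m → ℂ) × ℂ => ((Function.update z.1 j (x₁ j), z.2) : (Fin m → ℂ) × ℂ))
    (h.holomorphic.analytic _ hz'.1 _ (h.ne_of_mem hz') b c) h1

/-- A function on the domain which vanishes for `x j = x₁ j` and satisfies a linear equation with
respect to `x j` vanishes. -/
theorem eq_zero_of_linear (h : IsLocalDeformation A U a j κ x₁ ρ r)
    {F u : (Fin m → ℂ) × ℂ → Matrix (Fin 2) (Fin 2) ℂ}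
    (hu : ∀ z ∈ deformationDomain a j κ x₁ ρ r, AnalyticMatAt u z)
    (hF : ∀ z ∈ deformationDomain a j κ x₁ ρ r,
      HasMatDerivAt (fun s : ℂ => F (z + s • (Pi.single j 1, 0))) (-(F z * u z)) 0)
    (h0 : ∀ z ∈ deformationDomain a j κ x₁ ρ r, z.1 j = x₁ j → F z = 0) :
    ∀ z ∈ deformationDomain a j κ x₁ ρ r, F z = 0 := by
  intro z hz
  set e : (Fin m → ℂ) × ℂ := (Pi.single j 1, 0) with he
  set z₀ : (Fin m → ℂ) × ℂ := (Function.update z.1 j (x₁ j), z.2) with hz₀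
  set w : ℂ := z.1 j - x₁ j with hw
  have hmem : ∀ s ∈ Set.Icc (0 : ℝ) 1, z₀ + ((s : ℂ) * w) • e ∈ deformationDomain a j κ x₁ ρ r := by
    intro s hs
    have h1 : z₀ + ((s : ℂ) * w) • e = (Function.update z.1 j (x₁ j + s * w), z.2) := by
      ext i
      · by_cases hi : i = j
        · subst hi; simp [hz₀, he]
        · simp [hz₀, he, hi]
      · simp [hz₀, he]
    rw [h1]
    refine h.update_mem hz ?_
    have h2 := apply_mem_ball hz.1 j
    rw [Metric.mem_ball, dist_eq_norm] at h2 ⊢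
    rw [add_sub_cancel_left, norm_mul, Complex.norm_real, Real.norm_eq_abs, abs_of_nonneg hs.1]
    exact (mul_le_of_le_one_left (norm_nonneg _) hs.2).trans_lt h2
  have hcont : ContinuousOn (fun s : ℝ => u (z₀ + ((s : ℂ) * w) • e)) (Set.Icc 0 1) := by
    intro s hs
    have h1 : ContinuousAt (fun s : ℝ => z₀ + ((s : ℂ) * w) • e) s := by fun_prop
    exact (ContinuousAt.comp (g := u) (f := fun s : ℝ => z₀ + ((s : ℂ) * w) • e) (hu _ (hmem s hs)).continuousAt h1).continuousWithinAt
  open scoped Matrix.Norms.Operator in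
  obtain ⟨C, hC⟩ := isCompact_Icc.exists_bound_of_continuousOn hcont
  have h2 := norm_le_mul_exp_of_hasMatDerivAt_line (F := F) (u := u) (z := z₀) (e := e) (w := w)
    (C := C) (fun s hs => hF _ (hmem s hs)) hC
  have hz₀mem : z₀ ∈ deformationDomain a j κ x₁ ρ r :=
    h.update_mem hz (Metric.mem_ball_self h.pos)
  have h3 : z₀ + w • e = z := by
    ext i
    · by_cases hi : i = j
      · subst hi; simp [hz₀, he, hw]
      · simp [hz₀, he, hi]
    · simp [hz₀, he]
  rw [h3, h0 z₀ hz₀mem (by simp [hz₀])] at h2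
  simpa using h2

/-- The comparison of the systems for the parameters `x` and `x` with `x j` replaced by `x₁ j`.  If
`Ψ` is a common solution, then `G (x, l) Ψ (x, l)` does not depend on `x j`. -/
theorem exists_flow (h : IsLocalDeformation A U a j κ x₁ ρ r) :
    ∃ G : (Fin m → ℂ) × ℂ → Matrix (Fin 2) (Fin 2) ℂ,
      (∀ z ∈ deformationDomain a j κ x₁ ρ r, AnalyticMatAt G z) ∧
      (∀ z ∈ deformationDomain a j κ x₁ ρ r, z.1 j = x₁ j → G z = 1) ∧
      (∀ z ∈ deformationDomain a j κ x₁ ρ r, (G z).det = 1) ∧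
      (∀ z ∈ deformationDomain a j κ x₁ ρ r, HasMatDerivAt
        (fun s : ℂ => G (z + s • (Pi.single j 1, 0))) (-(G z * (U z.1).evalAt z.2)) 0) ∧
      ∀ z ∈ deformationDomain a j κ x₁ ρ r, HasMatDerivAt (fun l => G (z.1, l))
        ((A (Function.update z.1 j (x₁ j))).evalAt z.2 * G z - G z * (A z.1).evalAt z.2) z.2 := by
  set e : (Fin m → ℂ) × ℂ := (Pi.single j 1, 0) with he
  set u : (Fin m → ℂ) × ℂ → Matrix (Fin 2) (Fin 2) ℂ := fun z => (U z.1).evalAt z.2 with hu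
  set α : (Fin m → ℂ) × ℂ → Matrix (Fin 2) (Fin 2) ℂ := fun z => (A z.1).evalAt z.2 with hα
  set β : (Fin m → ℂ) × ℂ → Matrix (Fin 2) (Fin 2) ℂ := fun z =>
    (A (Function.update z.1 j (x₁ j))).evalAt z.2 with hβ
  have hD := h.isOpen_domain
  have huan : ∀ z ∈ deformationDomain a j κ x₁ ρ r, AnalyticMatAt u z := fun z hz =>
    h.holomorphic_deformation.analytic _ hz.1 _ (h.ne_of_mem hz)
  have hαan : ∀ z ∈ deformationDomain a j κ x₁ ρ r, AnalyticMatAt α z := fun z hz =>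
    h.holomorphic.analytic _ hz.1 _ (h.ne_of_mem hz)
  have hβan : ∀ z ∈ deformationDomain a j κ x₁ ρ r, AnalyticMatAt β z := fun z hz =>
    h.analyticMatAt_initial hz
  obtain ⟨G, hG, hG1, hGt⟩ := exists_matrix_flow (D := deformationDomain a j κ x₁ ρ r) (e := e)
    (τ := (ContinuousLinearMap.proj (R := ℂ) (φ := fun _ : Fin m => ℂ) j).comp
      (ContinuousLinearMap.fst ℂ (Fin m → ℂ) ℂ)) (t₀ := x₁ j) (ρ := ρ) hD (by simp [he])
    (fun z hz => apply_mem_ball hz.1 j)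
    (fun z hz t ht => by
      have h1 : z + (t - z.1 j) • e = (Function.update z.1 j t, z.2) := by
        rw [← add_smul_single_eq_update]; ext i <;> simp [he]
      have h2 := h.update_mem hz ht
      rw [← h1] at h2
      exact h2) huan
  have hGe : ∀ z ∈ deformationDomain a j κ x₁ ρ r, matFDeriv G z e = -(G z * u z) := fun z hz =>
    ((hG z hz).hasMatDerivAt_line e).unique (hGt z hz)
  have hev : ∀ z ∈ deformationDomain a j κ x₁ ρ r,
      ∀ᶠ y in 𝓝 z, y ∈ deformationDomain a j κ x₁ ρ r := fun z hz => hD.mem_nhds hz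
  -- the determinant is constant along the flow because `u` is traceless
  have hdet : ∀ z ∈ deformationDomain a j κ x₁ ρ r, ((G z).det - 1) • (1 : Matrix (Fin 2) (Fin 2) ℂ) = 0 := by
    refine h.eq_zero_of_linear (F := fun z => ((G z).det - 1) • 1) (u := fun _ => 0)
      (fun z _ => .const _ _) (fun z hz => ?_) (fun z hz hz0 => by
        show ((G z).det - 1) • (1 : Matrix (Fin 2) (Fin 2) ℂ) = 0
        rw [hG1 z hz hz0]; simp)
    have h1 : (u z).trace = 0 := RatMat.trace_evalAt (h.trace_eq_zero _ hz.1) _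
    rw [Matrix.trace_fin_two] at h1
    have hGt' := hGt z hz
    have h2 : HasDerivAt (fun s : ℂ => (G (z + s • e)).det - 1) 0 0 := by
      simp only [Matrix.det_fin_two]
      refine ((((hGt' 0 0).fun_mul (hGt' 1 1)).fun_sub
        ((hGt' 0 1).fun_mul (hGt' 1 0))).sub_const 1).congr_deriv ?_
      simp only [Matrix.neg_apply, Matrix.mul_apply, Fin.sum_univ_two, zero_smul, add_zero]
      linear_combination (-(G z 0 0 * G z 1 1) + G z 0 1 * G z 1 0) * h1
    have h3 := HasMatDerivAt.smul h2 (HasMatDerivAt.const 1 0)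
    simpa [he] using h3
  refine ⟨G, hG, hG1, fun z hz => ?_, hGt, fun z hz => ?_⟩
  · have h1 := congrFun (congrFun (hdet z hz) 0) 0
    simpa [sub_eq_zero] using h1
  -- the defect of the equation in `λ` satisfies a linear equation in `x j`
  · set F : (Fin m → ℂ) × ℂ → Matrix (Fin 2) (Fin 2) ℂ := fun z =>
      matFDeriv G z (0, 1) - (β z * G z - G z * α z) with hF
    have hF0 : ∀ z ∈ deformationDomain a j κ x₁ ρ r, F z = 0 := by
      refine h.eq_zero_of_linear (u := u) huan (fun z hz => ?_) (fun z hz hz0 => ?_)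
      · have hFan : AnalyticMatAt F z := ((hG z hz).matFDeriv).sub
          (((hβan z hz).mul (hG z hz)).sub ((hG z hz).mul (hαan z hz)))
        refine cast ?_ (hFan.hasMatDerivAt_line e)
        congr 1
        have hβ0 : matFDeriv β z e = 0 := by
          refine ((hβan z hz).hasMatDerivAt_line e).unique ?_
          have h1 : (fun s : ℂ => β (z + s • e)) = fun _ => β z := by
            funext s
            simp only [hβ, he]
            congr 1
            · congr 1
              ext i
              by_cases hi : i = j
              · subst hi; simp
              · simp [hi]
            · simp
          rw [h1]
          exact .const _ _
        have hzc := h.zero_curvature z.1 hz.1 z.2 (h.ne_of_mem hz)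
        have h1 : matFDeriv (fun z => matFDeriv G z (0, 1)) z e =
            -(matFDeriv G z (0, 1) * u z + G z * matFDeriv u z (0, 1)) := by
          rw [matFDeriv_comm (hG z hz), matFDeriv_congr
            ((hev z hz).mono fun y hy => hGe y hy : (fun y => matFDeriv G y e) =ᶠ[𝓝 z] fun y => -(G y * u y)),
            matFDeriv_neg, matFDeriv_mul (hG z hz) (huan z hz)]
        have h2 : matFDeriv F z e = matFDeriv (fun z => matFDeriv G z (0, 1)) z e -
            (matFDeriv (fun z => β z * G z) z e - matFDeriv (fun z => G z * α z) z e) := by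
          rw [hF, matFDeriv_sub (hG z hz).matFDeriv
            (((hβan z hz).mul (hG z hz)).sub ((hG z hz).mul (hαan z hz))),
            matFDeriv_sub ((hβan z hz).mul (hG z hz)) ((hG z hz).mul (hαan z hz))]
        rw [h2, h1, matFDeriv_mul (hβan z hz) (hG z hz), matFDeriv_mul (hG z hz) (hαan z hz), hβ0,
          hGe z hz]
        -- here the zero curvature equation enters
        have h3 : matFDeriv α z e = matFDeriv u z (0, 1) + (u z * α z - α z * u z) := hzc
        rw [h3]
        simp only [hF]
        noncomm_ring
      · have h1 : matFDeriv G z (0, 1) = 0 := by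
          refine ((hG z hz).hasMatDerivAt_snd).unique ((HasMatDerivAt.const 1 _).congr ?_)
          have h2 : ∀ᶠ l in 𝓝 z.2, (z.1, l) ∈ deformationDomain a j κ x₁ ρ r :=
            (Continuous.prodMk_right z.1).tendsto z.2 |>.eventually (hev z hz)
          filter_upwards [h2] with l hl using hG1 _ hl hz0
        have h3 : β z = α z := by
          simp only [hβ, hα]
          rw [← hz0, Function.update_eq_self]
        simp only [hF]
        rw [h1, h3, hG1 z hz hz0]
        simp
    have h1 := (hG z hz).hasMatDerivAt_snd
    rwa [sub_eq_zero.1 (hF0 z hz)] at h1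

end IsLocalDeformation

end Deformation

/-! ### Growth of the comparison matrix -/

section Growth

open scoped Matrix.Norms.Operator

/-- The factor `4` arises because the operator norm of a `2 × 2` matrix is at most twice the largest
entry, and there are two matrices. -/
theorem norm_mul_sub_mul_le {α β g : Matrix (Fin 2) (Fin 2) ℂ} {t C : ℝ} (ht : 0 ≤ t)
    (hα : ∀ b c, t * ‖α b c‖ ≤ C) (hβ : ∀ b c, t * ‖β b c‖ ≤ C) :
    t * ‖β * g - g * α‖ ≤ 4 * C * ‖g‖ := by
  have hn : ∀ M : Matrix (Fin 2) (Fin 2) ℂ, (∀ b c, t * ‖M b c‖ ≤ C) → t * ‖M‖ ≤ 2 * C := by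
    intro M hM
    have h1 := Matrix.linfty_opNorm_le_two_mul (M := (t : ℂ) • M) (C := C) fun b c => by
      rw [Matrix.smul_apply, norm_smul, Complex.norm_real, Real.norm_eq_abs, abs_of_nonneg ht]
      exact hM b c
    rwa [norm_smul, Complex.norm_real, Real.norm_eq_abs, abs_of_nonneg ht] at h1
  have h1 : ‖β * g - g * α‖ ≤ ‖β‖ * ‖g‖ + ‖g‖ * ‖α‖ :=
    (norm_sub_le _ _).trans (add_le_add (norm_mul_le _ _) (norm_mul_le _ _))
  calc t * ‖β * g - g * α‖ ≤ t * (‖β‖ * ‖g‖ + ‖g‖ * ‖α‖) := mul_le_mul_of_nonneg_left h1 ht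
    _ = (t * ‖β‖) * ‖g‖ + (t * ‖α‖) * ‖g‖ := by ring
    _ ≤ (2 * C) * ‖g‖ + (2 * C) * ‖g‖ := add_le_add
        (mul_le_mul_of_nonneg_right (hn β hβ) (norm_nonneg _))
        (mul_le_mul_of_nonneg_right (hn α hα) (norm_nonneg _))
    _ = 4 * C * ‖g‖ := by ring

variable {g α β : ℂ → Matrix (Fin 2) (Fin 2) ℂ} {p : ℂ} {C : ℝ} {K : ℕ}

theorem exists_bound_on_sphere {g : ℂ → Matrix (Fin 2) (Fin 2) ℂ} {g' : ℂ → Matrix (Fin 2) (Fin 2) ℂ}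
    {p : ℂ} {s : ℝ} (hg : ∀ l, ‖l - p‖ = s → HasMatDerivAt g (g' l) l) :
    ∃ B, ∀ l, ‖l - p‖ = s → ‖g l‖ ≤ B := by
  have h1 : ContinuousOn g (Metric.sphere p s) := fun l hl =>
    (hg l (by simpa [dist_eq_norm] using hl)).hasDerivAt.continuousAt.continuousWithinAt
  obtain ⟨B, hB⟩ := (isCompact_sphere p s).exists_bound_of_continuousOn h1
  exact ⟨B, fun l hl => hB l (by simpa [dist_eq_norm] using hl)⟩

/-- A solution of the comparison equation of two systems with a Fuchsian singularity at `p` grows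
at most polynomially there, with an exponent controlled by the size of the coefficients. -/
theorem exists_growth_bound {s : ℝ} (hs : 0 < s) (hK : 4 * C ≤ K)
    (hg : ∀ l, l ≠ p → ‖l - p‖ ≤ s → HasMatDerivAt g (β l * g l - g l * α l) l)
    (hα : ∀ l, l ≠ p → ‖l - p‖ ≤ s → ∀ b c, ‖l - p‖ * ‖α l b c‖ ≤ C)
    (hβ : ∀ l, l ≠ p → ‖l - p‖ ≤ s → ∀ b c, ‖l - p‖ * ‖β l b c‖ ≤ C) :
    ∃ B, ∀ l, l ≠ p → ‖l - p‖ ≤ s → ∀ b c, ‖l - p‖ ^ K * ‖g l b c‖ ≤ B := by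
  obtain ⟨B, hB⟩ := exists_bound_on_sphere (g := g) (p := p) (s := s) (fun l hl => hg l (by
    rintro rfl; rw [sub_self, norm_zero] at hl; exact hs.ne hl) hl.le)
  refine ⟨B * s ^ K, fun l hl hls b c => ?_⟩
  have hpos : 0 < ‖l - p‖ := norm_pos_iff.2 (sub_ne_zero.2 hl)
  set S := Real.log (s / ‖l - p‖) with hSdef
  have hS : 0 ≤ S := Real.log_nonneg ((one_le_div hpos).2 hls)
  have hexpS : Real.exp S = s / ‖l - p‖ := Real.exp_log (div_pos hs hpos)
  -- the path to `l` is the ray from the point `p + ζ` of the circle of radius `s`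
  set ζ : ℂ := (Real.exp S : ℂ) * (l - p) with hζ
  have hζn : ‖ζ‖ = s := by
    rw [hζ, norm_mul, Complex.norm_real, Real.norm_eq_abs, Real.abs_exp, hexpS,
      div_mul_cancel₀ _ hpos.ne']
  have hpath : ∀ r : ℝ, ‖Complex.exp (((-1 : ℝ) : ℂ) * r) * ζ‖ = Real.exp (-r) * s := fun r => by
    rw [norm_mul, hζn, Complex.norm_exp]; simp
  have hne : ∀ r : ℝ, p + Complex.exp (((-1 : ℝ) : ℂ) * r) * ζ ≠ p := fun r h0 => by
    have h1 := hpath r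
    rw [add_eq_left.1 h0, norm_zero] at h1
    exact (mul_pos (Real.exp_pos _) hs).ne h1
  have hle : ∀ r ∈ Set.Icc 0 S, ‖p + Complex.exp (((-1 : ℝ) : ℂ) * r) * ζ - p‖ ≤ s := fun r hr => by
    rw [add_sub_cancel_left, hpath]
    exact mul_le_of_le_one_left hs.le (Real.exp_le_one_iff.2 (by linarith [hr.1]))
  have h1 := norm_le_mul_exp_of_hasMatDerivAt_ray (f := g) (f' := fun l => β l * g l - g l * α l)
    (p := p) (ζ := ζ) (σ := -1) (K := K) (S := S) (by simp) hS
    (fun r hr => hg _ (hne r) (hle r hr)) (fun r hr => by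
      have h2 := norm_mul_sub_mul_le (g := g (p + Complex.exp (((-1 : ℝ) : ℂ) * r) * ζ))
        (norm_nonneg _) (hα _ (hne r) (hle r hr)) (hβ _ (hne r) (hle r hr))
      rw [add_sub_cancel_left] at h2
      exact h2.trans (mul_le_mul_of_nonneg_right hK (norm_nonneg _)))
  have h2 : p + Complex.exp (((-1 : ℝ) : ℂ) * S) * ζ = l := by
    rw [hζ, ← mul_assoc, Complex.ofReal_exp, ← Complex.exp_add]
    simp
  rw [h2, mul_comm (K : ℝ) S, Real.exp_mul, hexpS, Real.rpow_natCast] at h1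
  have h3 : ‖g l b c‖ ≤ B * (s / ‖l - p‖) ^ K :=
    ((g l).norm_apply_le_linfty_opNorm b c).trans (h1.trans (mul_le_mul_of_nonneg_right
      (hB _ (by rw [add_sub_cancel_left, hζn])) (pow_nonneg (div_pos hs hpos).le _)))
  calc ‖l - p‖ ^ K * ‖g l b c‖ ≤ ‖l - p‖ ^ K * (B * (s / ‖l - p‖) ^ K) :=
        mul_le_mul_of_nonneg_left h3 (pow_nonneg hpos.le _)
    _ = B * s ^ K := by
        rw [div_pow]; field_simp

/-- The analogue of `exists_growth_bound` at infinity. -/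
theorem exists_growth_bound_atInfty {R : ℝ} (hR : 0 < R) (hK : 4 * C ≤ K)
    (hg : ∀ l, R ≤ ‖l‖ → HasMatDerivAt g (β l * g l - g l * α l) l)
    (hα : ∀ l, R ≤ ‖l‖ → ∀ b c, ‖l‖ * ‖α l b c‖ ≤ C)
    (hβ : ∀ l, R ≤ ‖l‖ → ∀ b c, ‖l‖ * ‖β l b c‖ ≤ C) :
    ∃ B, ∀ l, R ≤ ‖l‖ → ∀ b c, ‖g l b c‖ ≤ B * ‖l‖ ^ K := by
  obtain ⟨B, hB⟩ := exists_bound_on_sphere (g := g) (p := 0) (s := R) (fun l hl => hg l (by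
    rw [sub_zero] at hl; exact hl.ge))
  refine ⟨B / R ^ K, fun l hl b c => ?_⟩
  have hpos : 0 < ‖l‖ := hR.trans_le hl
  set S := Real.log (‖l‖ / R) with hSdef
  have hS : 0 ≤ S := Real.log_nonneg ((one_le_div hR).2 hl)
  have hexpS : Real.exp S = ‖l‖ / R := Real.exp_log (div_pos hpos hR)
  set ζ : ℂ := (Real.exp (-S) : ℂ) * l with hζ
  have hζn : ‖ζ‖ = R := by
    rw [hζ, norm_mul, Complex.norm_real, Real.norm_eq_abs, Real.abs_exp, Real.exp_neg, hexpS,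
      inv_div, div_mul_cancel₀ _ hpos.ne']
  have hpath : ∀ r : ℝ, ‖Complex.exp (((1 : ℝ) : ℂ) * r) * ζ‖ = Real.exp r * R := fun r => by
    rw [norm_mul, hζn, Complex.norm_exp]; simp
  have hle : ∀ r ∈ Set.Icc 0 S, R ≤ ‖0 + Complex.exp (((1 : ℝ) : ℂ) * r) * ζ‖ := fun r hr => by
    rw [zero_add, hpath]
    exact le_mul_of_one_le_left hR.le (Real.one_le_exp hr.1)
  have h1 := norm_le_mul_exp_of_hasMatDerivAt_ray (f := g) (f' := fun l => β l * g l - g l * α l)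
    (p := 0) (ζ := ζ) (σ := 1) (K := K) (S := S) (by simp) hS
    (fun r hr => hg _ (hle r hr)) (fun r hr => by
      have h2 := norm_mul_sub_mul_le (g := g (0 + Complex.exp (((1 : ℝ) : ℂ) * r) * ζ))
        (norm_nonneg _) (hα _ (hle r hr)) (hβ _ (hle r hr))
      refine le_trans (le_of_eq ?_) (h2.trans (mul_le_mul_of_nonneg_right hK (norm_nonneg _)))
      rw [zero_add])
  have h2 : 0 + Complex.exp (((1 : ℝ) : ℂ) * S) * ζ = l := by
    rw [hζ, ← mul_assoc, zero_add, Complex.ofReal_exp, ← Complex.exp_add]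
    simp
  rw [h2, mul_comm (K : ℝ) S, Real.exp_mul, hexpS, Real.rpow_natCast] at h1
  have h3 : ‖g l b c‖ ≤ B * (‖l‖ / R) ^ K :=
    ((g l).norm_apply_le_linfty_opNorm b c).trans (h1.trans (mul_le_mul_of_nonneg_right
      (hB _ (by rw [zero_add, sub_zero, hζn])) (pow_nonneg (div_pos hpos hR).le _)))
  refine h3.trans (le_of_eq ?_)
  rw [div_pow]; ring

variable {m N : ℕ} {A U : RatFamily m} {a : Fin N → (Fin m → ℂ) → ℂ} {j : Fin m} {κ : Fin N}
  {x₁ : Fin m → ℂ} {ρ r : ℝ}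

/-- The comparison matrix is bounded where the deformation matrix `U` is bounded. -/
theorem IsLocalDeformation.norm_flow_le (h : IsLocalDeformation A U a j κ x₁ ρ r)
    {G : (Fin m → ℂ) × ℂ → Matrix (Fin 2) (Fin 2) ℂ}
    (hG1 : ∀ z ∈ deformationDomain a j κ x₁ ρ r, z.1 j = x₁ j → G z = 1)
    (hGt : ∀ z ∈ deformationDomain a j κ x₁ ρ r, HasMatDerivAt
        (fun s : ℂ => G (z + s • (Pi.single j 1, 0))) (-(G z * (U z.1).evalAt z.2)) 0)
    {z : (Fin m → ℂ) × ℂ} (hz : z ∈ deformationDomain a j κ x₁ ρ r)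
    (hU : ∀ s ∈ Metric.ball (x₁ j) ρ, ∀ b c, ‖(U (Function.update z.1 j s)).evalAt z.2 b c‖ ≤ C)
    (b c : Fin 2) : ‖G z b c‖ ≤ ‖(1 : Matrix (Fin 2) (Fin 2) ℂ)‖ * Real.exp (ρ * (2 * C)) := by
  set e : (Fin m → ℂ) × ℂ := (Pi.single j 1, 0) with he
  set z₀ : (Fin m → ℂ) × ℂ := (Function.update z.1 j (x₁ j), z.2) with hz₀
  set w : ℂ := z.1 j - x₁ j with hw
  have hwρ : ‖w‖ < ρ := by
    have h2 := apply_mem_ball hz.1 j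
    rwa [Metric.mem_ball, dist_eq_norm] at h2
  have hC : 0 ≤ C := (norm_nonneg _).trans (hU _ (Metric.mem_ball_self h.pos) 0 0)
  have hsm : ∀ s ∈ Set.Icc (0 : ℝ) 1, x₁ j + s * w ∈ Metric.ball (x₁ j) ρ := fun s hs => by
    rw [Metric.mem_ball, dist_eq_norm]
    rw [add_sub_cancel_left, norm_mul, Complex.norm_real, Real.norm_eq_abs, abs_of_nonneg hs.1]
    exact (mul_le_of_le_one_left (norm_nonneg _) hs.2).trans_lt hwρ
  have heq : ∀ s : ℝ, z₀ + ((s : ℂ) * w) • e = (Function.update z.1 j (x₁ j + s * w), z.2) := by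
    intro s
    ext i
    · by_cases hi : i = j
      · subst hi; simp [hz₀, he]
      · simp [hz₀, he, hi]
    · simp [hz₀, he]
  have h2 := norm_le_mul_exp_of_hasMatDerivAt_line (F := G) (u := fun z => (U z.1).evalAt z.2)
    (z := z₀) (e := e) (w := w) (C := 2 * C)
    (fun s hs => hGt _ (by rw [heq]; exact h.update_mem hz (hsm s hs)))
    (fun s hs => by
      rw [heq]; exact Matrix.linfty_opNorm_le_two_mul (hU _ (hsm s hs)))
  have h3 : z₀ + w • e = z := by
    have := heq 1
    simp only [Complex.ofReal_one, one_mul, hw, add_sub_cancel, Function.update_eq_self] at this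
    exact this
  rw [h3, hG1 z₀ (h.update_mem hz (Metric.mem_ball_self h.pos)) (by simp [hz₀])] at h2
  refine ((G z).norm_apply_le_linfty_opNorm b c).trans (h2.trans ?_)
  gcongr

end Growth

/-! ### Extension of the comparison across the removed pole -/

section Extension

theorem isPreconnected_annulus (c : ℂ) {r s : ℝ} (hr : 0 ≤ r) :
    IsPreconnected {l : ℂ | r < dist l c ∧ dist l c < s} := by
  have h1 : IsPreconnected (Set.Ioo r s ×ˢ (Set.univ : Set ℝ)) :=
    isPreconnected_Ioo.prod isPreconnected_univ
  have h2 := h1.image (fun q : ℝ × ℝ => c + q.1 * Complex.exp (q.2 * Complex.I))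
    (by fun_prop)
  convert h2 using 1
  ext l
  simp only [Set.mem_ofPred_eq, Set.mem_image, Set.mem_prod, Set.mem_Ioo, Set.mem_univ, and_true,
    Prod.exists]
  constructor
  · intro hl
    refine ⟨‖l - c‖, Complex.arg (l - c), by rwa [← dist_eq_norm], ?_⟩
    rw [Complex.norm_mul_exp_arg_mul_I]
    ring
  · rintro ⟨q, θ, hq, rfl⟩
    have : dist (c + q * Complex.exp (θ * Complex.I)) c = q := by
      rw [dist_eq_norm, add_sub_cancel_left, norm_mul, Complex.norm_exp_ofReal_mul_I, mul_one,
        Complex.norm_real, Real.norm_eq_abs, abs_of_pos (hr.trans_lt hq.1)]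
    rwa [this]

theorem HasMatDerivAt.adjugate {v : ℂ → Matrix (Fin 2) (Fin 2) ℂ} {v' : Matrix (Fin 2) (Fin 2) ℂ}
    {l : ℂ} (h : HasMatDerivAt v v' l) : HasMatDerivAt (fun l => (v l).adjugate) v'.adjugate l := by
  intro b c
  simp only [Matrix.adjugate_fin_two]
  fin_cases b <;> fin_cases c <;> simp
  · exact h 1 1
  · exact (h 0 1).fun_neg
  · exact (h 1 0).fun_neg
  · exact h 0 0

theorem HasMatDerivAt.det {v : ℂ → Matrix (Fin 2) (Fin 2) ℂ} {v' : Matrix (Fin 2) (Fin 2) ℂ}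
    {l : ℂ} (h : HasMatDerivAt v v' l) : HasDerivAt (fun l => (v l).det)
      (v' * (v l).adjugate).trace l := by
  simp only [Matrix.det_fin_two]
  refine (((h 0 0).fun_mul (h 1 1)).fun_sub ((h 0 1).fun_mul (h 1 0))).congr_deriv ?_
  simp only [Matrix.trace_fin_two, Matrix.mul_apply, Fin.sum_univ_two, Matrix.adjugate_fin_two,
    Matrix.of_apply, Matrix.cons_val_zero, Matrix.cons_val_one]
  ring

theorem Matrix.adjugate_eq_neg_of_trace_eq_zero {M : Matrix (Fin 2) (Fin 2) ℂ} (h : M.trace = 0) :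
    M.adjugate = -M := by
  rw [Matrix.trace_fin_two] at h
  rw [Matrix.adjugate_fin_two]
  ext b c
  fin_cases b <;> fin_cases c <;> simp
  · linear_combination h
  · linear_combination h

/-- A holomorphic traceless system on a disc has a fundamental matrix of determinant one on the
disc. -/
theorem exists_fundamental_matrix {f : ℂ → Matrix (Fin 2) (Fin 2) ℂ} {c : ℂ} {s : ℝ}
    (hs : 0 < s) (hf : ∀ l ∈ Metric.ball c s, AnalyticMatAt f l)
    (htr : ∀ l ∈ Metric.ball c s, (f l).trace = 0) :
    ∃ W : ℂ → Matrix (Fin 2) (Fin 2) ℂ, (∀ l ∈ Metric.ball c s, AnalyticMatAt W l) ∧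
      (∀ l ∈ Metric.ball c s, (W l).det = 1) ∧
      (∀ l ∈ Metric.ball c s, HasMatDerivAt W (-(W l * f l)) l) ∧
      ∀ l ∈ Metric.ball c s, HasMatDerivAt (fun l => (W l).adjugate) (f l * (W l).adjugate) l := by
  obtain ⟨W, hW, hW1, hWd⟩ := exists_matrix_flow (Z := ℂ) (D := Metric.ball c s) (e := 1)
    (τ := ContinuousLinearMap.id ℂ ℂ) (t₀ := c) (ρ := s) (u := f) Metric.isOpen_ball (by simp)
    (fun z hz => hz) (fun z hz t ht => by simpa using ht) hf
  have hWd' : ∀ l ∈ Metric.ball c s, HasMatDerivAt W (-(W l * f l)) l := fun l hl b d => by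
    have h1 := hWd l hl b d
    have h2 : HasDerivAt (fun r : ℂ => r - l) 1 l := (hasDerivAt_id l).sub_const l
    have h1' : HasDerivAt (fun s : ℂ => W (l + s • (1 : ℂ)) b d) ((-(W l * f l)) b d) (l - l) := by
      rwa [sub_self]
    have h3 := HasDerivAt.comp (h := fun r : ℂ => r - l) l h1' h2
    simpa [Function.comp_def] using h3
  refine ⟨W, hW, fun l hl => ?_, hWd', fun l hl => ?_⟩
  · have hd : ∀ l ∈ Metric.ball c s, HasDerivAt (fun l => (W l).det) 0 l := fun l hl => by
      refine (hWd' l hl).det.congr_deriv ?_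
      rw [neg_mul, Matrix.trace_neg, Matrix.trace_mul_comm, ← mul_assoc, Matrix.adjugate_mul,
        Matrix.smul_mul, one_mul, Matrix.trace_smul, htr l hl, smul_zero, neg_zero]
    have h1 := Metric.isOpen_ball.is_const_of_deriv_eq_zero
      (convex_ball c s).isPreconnected (fun l hl => (hd l hl).differentiableAt.differentiableWithinAt)
      (fun l hl => (hd l hl).deriv) hl (Metric.mem_ball_self hs)
    rw [h1, hW1 c (Metric.mem_ball_self hs) rfl, Matrix.det_one]
  · have h1 := (hWd' l hl).adjugate
    have h2 : (-(W l * f l)).adjugate = f l * (W l).adjugate := by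
      rw [show -(W l * f l) = W l * -f l by rw [mul_neg], Matrix.adjugate_mul_distrib,
        Matrix.adjugate_eq_neg_of_trace_eq_zero (by rw [Matrix.trace_neg, htr l hl, neg_zero]),
        neg_neg]
    rwa [h2] at h1

/-- A matrix comparing two systems on an annulus extends to the disc if the systems are
holomorphic on the disc: in terms of fundamental matrices the comparison is constant. -/
theorem exists_extension_of_annulus {f g H : ℂ → Matrix (Fin 2) (Fin 2) ℂ} {c : ℂ} {r s : ℝ}
    (hr : 0 ≤ r) (hrs : r < s) (hf : ∀ l ∈ Metric.ball c s, AnalyticMatAt f l)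
    (hft : ∀ l ∈ Metric.ball c s, (f l).trace = 0)
    (hg : ∀ l ∈ Metric.ball c s, AnalyticMatAt g l)
    (hgt : ∀ l ∈ Metric.ball c s, (g l).trace = 0)
    (hH : ∀ l, r < dist l c → dist l c < s → HasMatDerivAt H (g l * H l - H l * f l) l) :
    ∃ F : ℂ → Matrix (Fin 2) (Fin 2) ℂ, (∀ l ∈ Metric.ball c s, AnalyticMatAt F l) ∧
      ∀ l, r < dist l c → dist l c < s → F l = H l := by
  have hs : 0 < s := hr.trans_lt hrs
  obtain ⟨V, hVan, hVdet, -, hVadj⟩ := exists_fundamental_matrix hs hf hft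
  obtain ⟨W, hWan, hWdet, hWd, -⟩ := exists_fundamental_matrix hs hg hgt
  -- the adjugate of `V` is a fundamental matrix of `f`, and that of `W` one of `g`
  have hconst : ∀ l, r < dist l c → dist l c < s →
      HasMatDerivAt (fun l => W l * H l * (V l).adjugate) 0 l := fun l h1 h2 => by
    have h3 := ((hWd l h2).mul (hH l h1 h2)).mul (hVadj l h2)
    have h4 : (-(W l * g l) * H l + W l * (g l * H l - H l * f l)) * (V l).adjugate +
        W l * H l * (f l * (V l).adjugate) = 0 := by noncomm_ring
    rwa [h4] at h3
  set q : ℂ := c + ((r + s) / 2 : ℝ) with hq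
  have hqd : dist q c = (r + s) / 2 := by
    rw [hq, dist_eq_norm, add_sub_cancel_left, Complex.norm_real, Real.norm_eq_abs,
      abs_of_pos (by linarith)]
  have hopen : IsOpen {l : ℂ | r < dist l c ∧ dist l c < s} :=
    (isOpen_lt continuous_const (continuous_id.dist continuous_const)).inter
      (isOpen_lt (continuous_id.dist continuous_const) continuous_const)
  have heq : ∀ l, r < dist l c → dist l c < s →
      W l * H l * (V l).adjugate = W q * H q * (V q).adjugate := fun l h1 h2 => by
    ext b d
    exact hopen.is_const_of_deriv_eq_zero (isPreconnected_annulus c hr)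
      (f := fun l => (W l * H l * (V l).adjugate) b d)
      (fun l hl => (hconst l hl.1 hl.2 b d).differentiableAt.differentiableWithinAt)
      (fun l hl => (hconst l hl.1 hl.2 b d).deriv) ⟨h1, h2⟩ ⟨by rw [hqd]; linarith, by rw [hqd]; linarith⟩
  refine ⟨fun l => (W l).adjugate * (W q * H q * (V q).adjugate) * V l, fun l hl =>
    ((hWan l hl).adjugate.mul (.const _ _)).mul (hVan l hl), fun l h1 h2 => ?_⟩
  show (W l).adjugate * (W q * H q * (V q).adjugate) * V l = H l
  rw [← heq l h1 h2, ← mul_assoc, ← mul_assoc, Matrix.adjugate_mul, hWdet l h2, one_smul, one_mul,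
    mul_assoc, Matrix.adjugate_mul, hVdet l h2, one_smul, mul_one]

end Extension

section GaugeConjugation

open Polynomial

theorem PolyMat.hasMatDerivAt_evalAt (Q : PolyMat) (l : ℂ) : HasMatDerivAt Q.evalAt (Q.deriv.evalAt l) l :=
  fun b c => Q.hasDerivAt_evalAt l b c

/-- If `A₀` and `A₁` are compared by `G` and transformed by `T₀` and `T₁` into `B₀` and `B₁`, then
`B₀` and `B₁` are compared by a scalar multiple of `T₀ G T₁⁻¹`. -/
theorem hasMatDerivAt_gauge_conj {T₀ T₁ : PolyMat} {A₀ A₁ B₀ B₁ : RatMat} {l : ℂ}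
    {G : ℂ → Matrix (Fin 2) (Fin 2) ℂ} {ψ : ℂ → ℂ}
    (h₀ : IsGauge T₀ A₀ B₀) (h₁ : IsGauge T₁ A₁ B₁) (hT₀ : T₀.det.eval l ≠ 0)
    (hT₁ : T₁.det.eval l ≠ 0) (hA₀ : RatMat.IsRegularAt A₀ l) (hA₁ : RatMat.IsRegularAt A₁ l)
    (hG : HasMatDerivAt G (A₀.evalAt l * G l - G l * A₁.evalAt l) l)
    (hψ : HasDerivAt ψ (-(1 / 2 * ((derivative T₀.det).eval l / T₀.det.eval l) +
      1 / 2 * ((derivative T₁.det).eval l / T₁.det.eval l)) * ψ l) l) :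
    HasMatDerivAt (fun l => ψ l • (T₀.evalAt l * G l * PolyMat.evalAt T₁.adjugate l))
      (B₀.evalAt l * (ψ l • (T₀.evalAt l * G l * PolyMat.evalAt T₁.adjugate l)) -
        (ψ l • (T₀.evalAt l * G l * PolyMat.evalAt T₁.adjugate l)) * B₁.evalAt l) l := by
  have hadj : T₁.adjugate.det = T₁.det := by simp [Matrix.det_adjugate]
  have hT₁0 : T₁.det ≠ 0 := by rintro h; simp [h] at hT₁
  have e₀ := h₀.evalAt_mul hT₀ hA₀
  have e₁ := (h₁.symm_adjugate hT₁0).evalAt_mul (by rwa [hadj]) (h₁.isRegularAt hT₁ hA₁)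
  rw [hadj] at e₁
  set k₀ := 1 / 2 * ((derivative T₀.det).eval l / T₀.det.eval l)
  set k₁ := 1 / 2 * ((derivative T₁.det).eval l / T₁.det.eval l)
  have d₀ : T₀.deriv.evalAt l = B₀.evalAt l * T₀.evalAt l - T₀.evalAt l * A₀.evalAt l +
      k₀ • T₀.evalAt l := by rw [e₀]; abel
  have d₁ : PolyMat.evalAt (PolyMat.deriv T₁.adjugate) l =
      A₁.evalAt l * PolyMat.evalAt T₁.adjugate l - PolyMat.evalAt T₁.adjugate l * B₁.evalAt l +
      k₁ • PolyMat.evalAt T₁.adjugate l := by rw [e₁]; abel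
  have h := HasMatDerivAt.smul hψ (((T₀.hasMatDerivAt_evalAt l).mul hG).mul
    (PolyMat.hasMatDerivAt_evalAt T₁.adjugate l))
  rw [d₀, d₁] at h
  refine cast ?_ h
  congr 1
  generalize T₀.evalAt l = P
  generalize PolyMat.evalAt T₁.adjugate l = Q
  simp only [mul_add, add_mul, mul_sub, sub_mul, smul_add, smul_sub, Matrix.mul_smul,
    Matrix.smul_mul, smul_smul, neg_mul, neg_smul, add_smul, mul_assoc]
  rw [mul_comm (ψ l) k₀, mul_comm (ψ l) k₁]
  abel

end GaugeConjugation

/-! ### The polynomial gauge transformation -/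

section HalfPower

/-- A holomorphic choice of `((λ - t) (λ - c)) ^ (- J / 2)` outside of a disc that contains `t` and
`c`, where `c` is the centre. -/
noncomputable def halfPower (J : ℕ) (t c l : ℂ) : ℂ :=
  Complex.exp (-((J : ℂ) / 2) * Complex.log ((l - t) / (l - c))) * ((l - c) ^ J)⁻¹

variable {J : ℕ} {t c l : ℂ}

theorem div_mem_slitPlane (h : dist t c < dist l c) : (l - t) / (l - c) ∈ Complex.slitPlane := by
  have hpos : 0 < ‖l - c‖ := by rw [← dist_eq_norm]; exact dist_nonneg.trans_lt h
  have hne : l - c ≠ 0 := norm_pos_iff.1 hpos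
  have h1 : (l - t) / (l - c) = 1 + (c - t) / (l - c) := by field_simp; ring
  rw [h1]
  refine Complex.mem_slitPlane_of_norm_lt_one ?_
  rw [norm_div, div_lt_one hpos, ← dist_eq_norm, ← dist_eq_norm, dist_comm c t]
  exact h

theorem sub_ne_zero_of_dist_lt (h : dist t c < dist l c) : l - t ≠ 0 ∧ l - c ≠ 0 := by
  constructor <;> intro h0 <;> rw [sub_eq_zero] at h0 <;> subst h0
  · exact lt_irrefl _ h
  · rw [dist_self] at h; exact absurd h (not_lt.2 dist_nonneg)

theorem hasDerivAt_halfPower (h : dist t c < dist l c) :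
    HasDerivAt (halfPower J t c)
      (-(1 / 2 * (J / (l - c)) + 1 / 2 * (J / (l - t))) * halfPower J t c l) l := by
  obtain ⟨h1, h2⟩ := sub_ne_zero_of_dist_lt h
  have d1 : HasDerivAt (fun l => (l - t) / (l - c)) ((1 * (l - c) - (l - t) * 1) / (l - c) ^ 2) l :=
    ((hasDerivAt_id l).sub_const t).fun_div ((hasDerivAt_id l).sub_const c) h2
  have d2 := ((d1.clog (div_mem_slitPlane h)).const_mul (-((J : ℂ) / 2))).cexp
  have d3 : HasDerivAt (fun l => ((l - c) ^ J)⁻¹) (-(J / (l - c)) * ((l - c) ^ J)⁻¹) l := by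
    refine ((((hasDerivAt_id l).sub_const c).fun_pow J).fun_inv (pow_ne_zero _ h2)).congr_deriv ?_
    rcases J with _ | J
    · simp
    · simp only [id, Nat.add_sub_cancel, pow_succ, mul_one]
      field_simp
  refine (d2.fun_mul d3).congr_deriv ?_
  rw [halfPower]
  generalize Complex.exp (-((J : ℂ) / 2) * Complex.log ((l - t) / (l - c))) = E
  generalize ((l - c) ^ J)⁻¹ = P
  field_simp
  ring

theorem halfPower_sq (h : dist t c < dist l c) :
    halfPower J t c l ^ 2 * ((l - c) ^ J * (l - t) ^ J) = 1 := by
  obtain ⟨h1, h2⟩ := sub_ne_zero_of_dist_lt h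
  have h3 : Complex.exp (-((J : ℂ) / 2) * Complex.log ((l - t) / (l - c))) ^ 2 =
      (((l - t) / (l - c)) ^ J)⁻¹ := by
    rw [← Complex.exp_nat_mul, ← Complex.exp_log (div_ne_zero h1 h2), ← Complex.exp_nat_mul,
      ← Complex.exp_neg, Complex.exp_log (div_ne_zero h1 h2)]
    congr 1
    push_cast
    ring
  have h4 := pow_ne_zero J h1
  have h5 := pow_ne_zero J h2
  rw [halfPower, mul_pow, h3, div_pow]
  field_simp

theorem norm_halfPower_le {r ρ : ℝ} (hρ : dist t c ≤ ρ) (hr : ρ < r) (h : r ≤ dist l c) :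
    ‖halfPower J t c l‖ ≤ 1 + ((r * (r - ρ)) ^ J)⁻¹ := by
  have h1 := halfPower_sq (J := J) (t := t) (c := c) (l := l) (hρ.trans_lt (hr.trans_le h))
  have h0 : 0 ≤ ρ := dist_nonneg.trans hρ
  have hA : 0 < r * (r - ρ) := mul_pos (by linarith) (by linarith)
  have h2 : (r * (r - ρ)) ^ J ≤ ‖(l - c) ^ J * (l - t) ^ J‖ := by
    rw [← mul_pow, norm_pow, norm_mul]
    refine pow_le_pow_left₀ hA.le (mul_le_mul (by rwa [← dist_eq_norm]) ?_ (by linarith)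
      (norm_nonneg _)) J
    have h3 := dist_triangle l t c
    rw [← dist_eq_norm]; linarith
  have h3 : ‖halfPower J t c l‖ ^ 2 * (r * (r - ρ)) ^ J ≤ 1 := by
    have h4 := congrArg norm h1
    rw [norm_mul, norm_pow, norm_one] at h4
    rw [← h4]
    exact mul_le_mul_of_nonneg_left h2 (by positivity)
  have h4 : ‖halfPower J t c l‖ ^ 2 ≤ ((r * (r - ρ)) ^ J)⁻¹ := by
    rw [← one_div, le_div_iff₀ (pow_pos hA J)]; exact h3
  nlinarith [sq_nonneg (‖halfPower J t c l‖ - 1), norm_nonneg (halfPower J t c l)]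

theorem analyticAt_halfPower (h : dist t c < dist l c) :
    AnalyticAt ℂ (fun t => halfPower J t c l) t := by
  obtain ⟨h1, h2⟩ := sub_ne_zero_of_dist_lt h
  unfold halfPower
  have h3 : AnalyticAt ℂ (fun t => (l - t) / (l - c)) t :=
    (analyticAt_const.sub analyticAt_id).fun_div analyticAt_const h2
  exact (analyticAt_const.mul (h3.clog (div_mem_slitPlane h))).cexp.mul analyticAt_const

end HalfPower

section PolynomialGauge

open Polynomial

theorem Polynomial.isBigO_eval_cobounded (p : ℂ[X]) {d : ℕ} (h : p.natDegree ≤ d) :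
    (fun l => p.eval l) =O[Bornology.cobounded ℂ] fun l => l ^ d := by
  have h1 : (fun l => p.eval l) = fun l => ∑ i ∈ Finset.range (d + 1), p.coeff i * l ^ i :=
    _root_.funext fun _ => Polynomial.eval_eq_sum_range' (Nat.lt_succ_of_le h) _
  rw [h1]
  refine Asymptotics.IsBigO.fun_sum fun i hi => ?_
  refine (Asymptotics.IsBigO.of_bound 1 ?_).const_mul_left _
  filter_upwards [(Bornology.isBounded_def.1
    (Metric.isBounded_ball (x := (0 : ℂ)) (r := 1)))] with l hl
  have hl' : 1 ≤ ‖l‖ := by simpa using hl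
  rw [one_mul, norm_pow, norm_pow]
  exact pow_le_pow_right₀ hl' (by have := Finset.mem_range.1 hi; omega)

variable {T₀ T₁ : PolyMat} {A₀ A₁ B₀ B₁ : RatMat} {G : ℂ → Matrix (Fin 2) (Fin 2) ℂ} {c t c₀ c₁ : ℂ}
  {r s : ℝ} {J K d d' : ℕ} {q : Finset ℂ} {Q : ℂ[X]}

theorem Matrix.natDegree_adjugate_le {T : PolyMat} (h : ∀ b e, (T b e).natDegree ≤ d) (b e : Fin 2) :
    (Matrix.adjugate T b e).natDegree ≤ d := by
  rw [Matrix.adjugate_fin_two]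
  fin_cases b <;> fin_cases e <;> simp [h]

/-- A holomorphic comparison of `A₁` and `A₀` outside of a disc, with poles at most at the roots of
`Q` and with polynomial growth, induces a gauge transformation between systems `B₁`, `B₀` that are
gauge equivalent to `A₁`, `A₀` and holomorphic in the disc. -/
theorem exists_polynomial_gauge (hr : dist t c < r) (hrs : r < s)
    (h₀ : IsGauge T₀ A₀ B₀) (h₁ : IsGauge T₁ A₁ B₁)
    (hc₀ : c₀ ≠ 0) (hc₁ : c₁ ≠ 0)
    (hT₀ : T₀.det = C c₀ * (X - C c) ^ J) (hT₁ : T₁.det = C c₁ * (X - C t) ^ J)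
    (hA₀ : ∀ l, r < dist l c → l ∉ q → RatMat.IsRegularAt A₀ l)
    (hA₁ : ∀ l, r < dist l c → l ∉ q → RatMat.IsRegularAt A₁ l)
    (hB₀ : ∀ l ∈ Metric.ball c s, RatMat.IsRegularAt B₀ l) (hB₀t : B₀.trace = 0)
    (hB₁ : ∀ l ∈ Metric.ball c s, RatMat.IsRegularAt B₁ l) (hB₁t : B₁.trace = 0)
    (hq : ∀ z ∈ q, s < dist z c)
    (hG : ∀ l, r < dist l c → l ∉ q →
      HasMatDerivAt G (A₀.evalAt l * G l - G l * A₁.evalAt l) l)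
    (hGdet : ∀ l, r < dist l c → l ∉ q → (G l).det = 1)
    (hQ : ∀ l ∉ q, Q.eval l ≠ 0)
    (hb : ∀ z ∈ q, ∃ B, ∀ᶠ l in 𝓝[≠] z, ∀ b e, ‖Q.eval l * G l b e‖ ≤ B)
    (hg : ∃ B R, ∀ l, R ≤ ‖l‖ → ∀ b e, ‖G l b e‖ ≤ B * ‖l‖ ^ K)
    (hQd : Q.natDegree ≤ d') (hd₀ : ∀ b e, (T₀ b e).natDegree ≤ d)
    (hd₁ : ∀ b e, (T₁ b e).natDegree ≤ d) :
    ∃ P : PolyMat, (∀ b e, (P b e).natDegree ≤ d' + (d + K + d)) ∧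
      (∀ l, r < dist l c → l ∉ q → P.evalAt l =
        (Q.eval l * halfPower J t c l) • (T₀.evalAt l * G l * PolyMat.evalAt T₁.adjugate l)) ∧
      P.det = C (c₀ * c₁) * Q ^ 2 ∧ IsGauge P B₁ B₀ := by
  have hr0 : 0 ≤ r := dist_nonneg.trans hr.le
  set H : ℂ → Matrix (Fin 2) (Fin 2) ℂ := fun l =>
    halfPower J t c l • (T₀.evalAt l * G l * PolyMat.evalAt T₁.adjugate l) with hHdef
  have hne : ∀ l, r < dist l c → l - t ≠ 0 ∧ l - c ≠ 0 := fun l hl =>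
    sub_ne_zero_of_dist_lt (hr.trans hl)
  have hT₀e : ∀ l, r < dist l c → T₀.det.eval l ≠ 0 := fun l hl => by
    rw [hT₀]; simp only [eval_mul, eval_C, eval_pow, eval_sub, eval_X]
    exact mul_ne_zero hc₀ (pow_ne_zero _ (hne l hl).2)
  have hT₁e : ∀ l, r < dist l c → T₁.det.eval l ≠ 0 := fun l hl => by
    rw [hT₁]; simp only [eval_mul, eval_C, eval_pow, eval_sub, eval_X]
    exact mul_ne_zero hc₁ (pow_ne_zero _ (hne l hl).1)
  have hlog : ∀ (k w l : ℂ), k ≠ 0 → l - w ≠ 0 →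
      (derivative (C k * (X - C w) ^ J)).eval l / (C k * (X - C w) ^ J).eval l = J / (l - w) := by
    intro k w l hk hw
    have h1 := pow_ne_zero J hw
    rcases J with _ | J
    · simp
    · simp only [derivative_mul, derivative_C, zero_mul, zero_add, derivative_pow, derivative_sub,
        derivative_X, sub_zero, mul_one, eval_mul, eval_C, eval_pow, eval_sub, eval_X,
        Nat.add_sub_cancel]
      rw [div_eq_div_iff (mul_ne_zero hk h1) hw]
      ring
  -- the half power compensates the determinants of `T₀` and `T₁`, so that `H` compares `B₁` and `B₀`
  have hH : ∀ l, r < dist l c → l ∉ q →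
      HasMatDerivAt H (B₀.evalAt l * H l - H l * B₁.evalAt l) l := fun l hl hlq =>
    hasMatDerivAt_gauge_conj h₀ h₁ (hT₀e l hl) (hT₁e l hl) (hA₀ l hl hlq) (hA₁ l hl hlq)
      (hG l hl hlq) (by
        rw [hT₀, hT₁, hlog _ _ _ hc₀ (hne l hl).2, hlog _ _ _ hc₁ (hne l hl).1]
        exact hasDerivAt_halfPower (hr.trans hl))
  have hHdet : ∀ l, r < dist l c → l ∉ q → (H l).det = c₀ * c₁ := fun l hl hlq => by
    have h1 := halfPower_sq (J := J) (hr.trans hl)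
    have h2 : (Matrix.adjugate T₁).det = T₁.det := by simp [Matrix.det_adjugate]
    simp only [hHdef]
    rw [Matrix.det_smul, Matrix.det_mul, Matrix.det_mul, hGdet l hl hlq, PolyMat.det_evalAt,
      PolyMat.det_evalAt, h2, hT₀, hT₁]
    simp only [eval_mul, eval_C, eval_pow, eval_sub, eval_X, Fintype.card_fin]
    linear_combination c₀ * c₁ * h1
  -- both systems are holomorphic in the disc, so that `H` extends to it
  have hsq : ∀ l, dist l c < s → l ∉ q := fun l hl hlq => absurd (hq l hlq) (not_lt.2 hl.le)
  obtain ⟨F, hF, hFH⟩ := exists_extension_of_annulus (H := H) hr0 hrs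
    (fun l hl => RatMat.analyticMatAt_evalAt (hB₁ l hl)) (fun l _ => RatMat.trace_evalAt hB₁t l)
    (fun l hl => RatMat.analyticMatAt_evalAt (hB₀ l hl)) (fun l _ => RatMat.trace_evalAt hB₀t l)
    (fun l h1 h2 => hH l h1 (hsq l h2))
  set E : ℂ → Matrix (Fin 2) (Fin 2) ℂ := fun l => if dist l c < s then F l else H l with hE
  have hEH : ∀ l, r < dist l c → E l = H l := fun l hl => by
    simp only [hE]
    split_ifs with h
    · exact hFH l hl h
    · rfl
  have hEH' : ∀ z, r < dist z c → E =ᶠ[𝓝 z] H := fun z hz => by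
    filter_upwards [(continuous_id.dist continuous_const).continuousAt.eventually_const_lt hz]
      with l hl using hEH l hl
  have hEd : ∀ l ∉ q, ∀ b e, DifferentiableAt ℂ (fun l => E l b e) l := fun l hl b e => by
    by_cases h : dist l c < s
    · refine (hF l h b e).differentiableAt.congr_of_eventuallyEq ?_
      filter_upwards [(continuous_id.dist continuous_const).continuousAt.eventually_lt_const h]
        with w hw
      have hw' : dist w c < s := hw
      simp only [hE, if_pos hw']
    · have h' : r < dist l c := hrs.trans_le (not_lt.1 h)
      refine (hH l h' hl b e).differentiableAt.congr_of_eventuallyEq ?_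
      exact (hEH' l h').mono fun w hw => by simp only [hw]
  have hHapply : ∀ l b e, H l b e = halfPower J t c l * ∑ f, (∑ k, (T₀ b k).eval l * G l k f) *
      (Matrix.adjugate T₁ f e).eval l := fun l b e => by
    simp only [hHdef, Matrix.smul_apply, Matrix.mul_apply, smul_eq_mul]
    rfl
  have hpower : ∀ {f : Filter ℂ}, (∀ᶠ l in f, r ≤ dist l c) →
      halfPower J t c =O[f] (fun _ => (1 : ℂ)) := fun hf =>
    Asymptotics.IsBigO.of_bound _ (hf.mono fun l hl => by
      rw [norm_one, mul_one]; exact norm_halfPower_le le_rfl hr hl)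
  -- each entry of `Q H` extends to a polynomial
  have hpoly : ∀ b e, ∃ p : ℂ[X], p.natDegree ≤ d' + (d + K + d) ∧
      ∀ l, l ∉ q → Q.eval l * E l b e = p.eval l := by
    intro b e
    have hginf : (fun l => Q.eval l * E l b e) =O[Bornology.cobounded ℂ]
        fun l => l ^ (d' + (d + K + d)) := by
      obtain ⟨B, R, hBR⟩ := hg
      have hdist : ∀ᶠ l in Bornology.cobounded ℂ, r < dist l c := by
        filter_upwards [Bornology.isBounded_def.1 (Metric.isBounded_closedBall (x := c) (r := r))]
          with l hl
        simpa using hl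
      have hGO : ∀ k f, (fun l => G l k f) =O[Bornology.cobounded ℂ] fun l => l ^ K := fun k f => by
        refine Asymptotics.IsBigO.of_bound B ?_
        filter_upwards [Bornology.isBounded_def.1 (Metric.isBounded_ball (x := (0 : ℂ)) (r := R))]
          with l hl
        rw [norm_pow]
        exact hBR l (by simpa using hl) k f
      have h1 : (fun l => H l b e) =O[Bornology.cobounded ℂ] fun l => 1 * (l ^ d * l ^ K * l ^ d) := by
        simp only [hHapply]
        refine (hpower (hdist.mono fun l hl => hl.le)).mul (Asymptotics.IsBigO.fun_sum fun f _ => ?_)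
        exact (Asymptotics.IsBigO.fun_sum fun k _ => (((T₀ b k).isBigO_eval_cobounded (hd₀ b k)).mul
          (hGO k f))).mul (Polynomial.isBigO_eval_cobounded _ (Matrix.natDegree_adjugate_le hd₁ f e))
      have h2 := (Q.isBigO_eval_cobounded hQd).mul h1
      refine (h2.congr' ?_ ?_)
      · filter_upwards [hdist] with l hl
        rw [hEH l hl]
      · exact Filter.Eventually.of_forall fun l => by ring
    obtain ⟨M, hM⟩ := hginf.bound
    obtain ⟨R, -, hR⟩ := (hasBasis_cobounded_norm (E := ℂ)).eventually_iff.1 hM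
    refine exists_polynomial_of_bounded_singularities q (C := M) (R := R) (fun l hl =>
      (Q.differentiable l).mul (hEd l hl b e)) (fun z hz => ?_) (fun l _ hl => ?_)
    · obtain ⟨B, hB⟩ := hb z hz
      have hzr : r < dist z c := hrs.trans (hq z hz)
      have hpO : ∀ p : ℂ[X], (fun l => p.eval l) =O[𝓝[≠] z] fun _ => (1 : ℂ) := fun p =>
        (p.continuous.continuousAt.tendsto.isBigO_one ℂ).mono nhdsWithin_le_nhds
      have hGO : ∀ k f, (fun l => Q.eval l * G l k f) =O[𝓝[≠] z] fun _ => (1 : ℂ) := fun k f =>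
        Asymptotics.IsBigO.of_bound B (hB.mono fun l hl => by
          rw [norm_one, mul_one]; exact hl k f)
      have hdist : ∀ᶠ l in 𝓝[≠] z, r < dist l c := nhdsWithin_le_nhds
        ((continuous_id.dist continuous_const).continuousAt.eventually_const_lt hzr)
      have h1 : (fun l => halfPower J t c l * ∑ f, (∑ k, (T₀ b k).eval l * (Q.eval l * G l k f)) *
          (Matrix.adjugate T₁ f e).eval l) =O[𝓝[≠] z] fun _ => (1 : ℂ) * (1 * 1 * 1) :=
        (hpower (hdist.mono fun l hl => hl.le)).mul (Asymptotics.IsBigO.fun_sum fun f _ =>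
          (Asymptotics.IsBigO.fun_sum fun k _ => (hpO _).mul (hGO k f)).mul (hpO _))
      obtain ⟨B', hB'⟩ := h1.bound
      refine ⟨B' * 1, ?_⟩
      filter_upwards [hB', hdist] with l hl hlr
      rw [hEH l hlr, hHapply]
      refine le_trans (le_of_eq ?_) (hl.trans (by simp))
      congr 1
      simp only [Finset.mul_sum, Finset.sum_mul]
      refine Finset.sum_congr rfl fun f _ => Finset.sum_congr rfl fun k _ => ?_
      ring
    · have := hR (x := l) hl
      rwa [norm_pow] at this
  choose P hPd hPe using hpoly
  set PM : PolyMat := Matrix.of P with hPM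
  have hPH : ∀ l, r < dist l c → l ∉ q → PolyMat.evalAt PM l = Q.eval l • H l := fun l hl hlq => by
    ext b e
    rw [PolyMat.evalAt_apply, Matrix.smul_apply, smul_eq_mul, ← hEH l hl, hPe b e l hlq]
    rfl
  have hinf : {l : ℂ | r < dist l c ∧ l ∉ q}.Infinite := by
    have h1 : {l : ℂ | r < dist l c} ∈ Bornology.cobounded ℂ := by
      filter_upwards [Bornology.isBounded_def.1 (Metric.isBounded_closedBall (x := c) (r := r))]
        with l hl
      simpa using hl
    have h2 : {l : ℂ | r < dist l c}.Infinite := fun hfin => by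
      have h3 := Filter.inter_mem h1 (Bornology.isBounded_def.1 hfin.isBounded)
      rw [Set.inter_compl_self] at h3
      exact Filter.empty_notMem _ h3
    exact h2.sdiff q.finite_toSet
  -- the identities hold at the points outside of the disc, hence identically
  have hdet : PM.det = C (c₀ * c₁) * Q ^ 2 := by
    refine Polynomial.eq_of_infinite_eval_eq _ _ (hinf.mono fun l hl => ?_)
    show PM.det.eval l = (C (c₀ * c₁) * Q ^ 2).eval l
    rw [← PolyMat.det_evalAt, hPH l hl.1 hl.2, Matrix.det_smul, hHdet l hl.1 hl.2]
    simp only [eval_mul, eval_C, eval_pow, Fintype.card_fin]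
    ring
  refine ⟨PM, hPd, fun l hl hlq => ?_, hdet, ?_⟩
  · rw [hPH l hl hlq, hHdef, smul_smul]
  · clear_value H
    have hB₀i := B₀.finite_not_isRegularAt
    have hB₁i := B₁.finite_not_isRegularAt
    have hinf' := (hinf.sdiff hB₀i).sdiff hB₁i
    refine RatMat.eq_of_infinite hinf' fun l hl => ?_
    obtain ⟨⟨⟨hl1, hl2⟩, hl3⟩, hl4⟩ := hl
    simp only [Set.mem_ofPred_eq, not_not] at hl3 hl4
    have hQl := hQ l hl2
    have hdl : PM.det.eval l ≠ 0 := by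
      rw [hdet]; simp only [eval_mul, eval_C, eval_pow]
      exact mul_ne_zero (mul_ne_zero hc₀ hc₁) (pow_ne_zero _ hQl)
    have hhalf : 1 / 2 * ((derivative PM.det).eval l / PM.det.eval l) =
        (derivative Q).eval l / Q.eval l := by
      rw [hdet]
      simp only [derivative_mul, derivative_C, zero_mul, zero_add, derivative_pow, eval_mul, eval_C,
        eval_pow, Nat.cast_ofNat, Nat.add_one_sub_one, pow_one]
      field_simp
    have hPd1 : HasMatDerivAt (PolyMat.evalAt PM) ((derivative Q).eval l • H l +
        Q.eval l • (B₀.evalAt l * H l - H l * B₁.evalAt l)) l := by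
      refine (HasMatDerivAt.smul (Q.hasDerivAt l) (hH l hl1 hl2)).congr ?_
      have h1 : ∀ᶠ w in 𝓝 l, r < dist w c :=
        (continuous_id.dist continuous_const).continuousAt.eventually_const_lt hl1
      have h2 : ∀ᶠ w in 𝓝 l, w ∉ q := q.finite_toSet.isClosed.isOpen_compl.mem_nhds hl2
      filter_upwards [h1, h2] with w hw1 hw2 using hPH w hw1 hw2
    have hPd2 := (PolyMat.hasMatDerivAt_evalAt PM l).unique hPd1
    rw [RatMat.evalAt_mul hl3 (PolyMat.isRegularAt_toRat _ _),
      RatMat.evalAt_sub (((PolyMat.isRegularAt_toRat _ _).mul hl4).add (PolyMat.isRegularAt_toRat _ _))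
        (.smul (PolyMat.isRegularAt_halfLogDeriv hdl) (PolyMat.isRegularAt_toRat _ _)),
      RatMat.evalAt_add ((PolyMat.isRegularAt_toRat _ _).mul hl4) (PolyMat.isRegularAt_toRat _ _),
      RatMat.evalAt_mul (PolyMat.isRegularAt_toRat _ _) hl4,
      RatMat.evalAt_smul (PolyMat.isRegularAt_halfLogDeriv hdl) (PolyMat.isRegularAt_toRat _ _),
      PolyMat.toRat_evalAt, PolyMat.toRat_evalAt, PolyMat.value_halfLogDeriv hdl, hhalf, hPd2,
      hPH l hl1 hl2, smul_smul, div_mul_cancel₀ _ hQl, Matrix.mul_smul, Matrix.smul_mul, smul_sub]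
    abel

end PolynomialGauge

/-! ### The traceless part of the deformation -/

section Traceless

theorem Matrix.adjugate_add_fin_two {R : Type*} [CommRing R] (M K : Matrix (Fin 2) (Fin 2) R) :
    (M + K).adjugate = M.adjugate + K.adjugate := by
  simp only [Matrix.adjugate_fin_two]
  ext b c
  fin_cases b <;> fin_cases c <;> simp [add_comm]

theorem Matrix.adjugate_sub_fin_two {R : Type*} [CommRing R] (M K : Matrix (Fin 2) (Fin 2) R) :
    (M - K).adjugate = M.adjugate - K.adjugate := by
  simp only [Matrix.adjugate_fin_two]
  ext b c
  fin_cases b <;> fin_cases c <;> simp <;> ring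

theorem RatMat.isRegularAt_adjugate {M : RatMat} {q : ℂ} (h : RatMat.IsRegularAt M q) :
    RatMat.IsRegularAt (Matrix.adjugate M) q := by
  intro b c
  rw [Matrix.adjugate_fin_two]
  fin_cases b <;> fin_cases c <;> simp
  · exact h 1 1
  · exact (h 0 1).neg
  · exact (h 1 0).neg
  · exact h 0 0

theorem RatMat.evalAt_adjugate (M : RatMat) (q : ℂ) :
    RatMat.evalAt (Matrix.adjugate M) q = (M.evalAt q).adjugate := by
  ext b c
  rw [Matrix.adjugate_fin_two, Matrix.adjugate_fin_two, RatMat.evalAt_apply]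
  fin_cases b <;> fin_cases c <;> simp [RatMat.evalAt_apply, RatFunc.value_neg']

variable {m N : ℕ}

theorem matFDeriv_adjugate {v : (Fin m → ℂ) × ℂ → Matrix (Fin 2) (Fin 2) ℂ}
    {z e : (Fin m → ℂ) × ℂ} :
    matFDeriv (fun z => (v z).adjugate) z e = (matFDeriv v z e).adjugate := by
  ext b c
  simp only [Matrix.adjugate_fin_two, matFDeriv]
  fin_cases b <;> fin_cases c <;> simp [fderiv_fun_neg]

variable {X : Set (Fin m → ℂ)} {A U : RatFamily m} {a : Fin N → (Fin m → ℂ) → ℂ} {j : Fin m}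

/-- The traceless part of a rational matrix. -/
noncomputable def RatMat.tracelessPart (M : RatMat) : RatMat :=
  (RatFunc.C (1 / 2) : RatFunc ℂ) • (M - Matrix.adjugate M)

namespace RatMat

theorem trace_tracelessPart (M : RatMat) : M.tracelessPart.trace = 0 := by
  rw [tracelessPart, Matrix.trace_smul, Matrix.adjugate_fin_two, Matrix.trace_fin_two]
  simp

theorem isRegularAt_tracelessPart {M : RatMat} {q : ℂ} (h : IsRegularAt M q) :
    IsRegularAt M.tracelessPart q :=
  .smul (RatFunc.isRegularAt_C _ _) (h.sub (isRegularAt_adjugate h))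

theorem evalAt_tracelessPart {M : RatMat} {q : ℂ} (h : IsRegularAt M q) :
    M.tracelessPart.evalAt q = (1 / 2 : ℂ) • (M.evalAt q - (M.evalAt q).adjugate) := by
  rw [tracelessPart, evalAt_smul (RatFunc.isRegularAt_C _ _) (h.sub (isRegularAt_adjugate h)),
    evalAt_sub h (isRegularAt_adjugate h), evalAt_adjugate, RatFunc.value, RatFunc.eval_C]
  rfl

theorem regularAtInfty_tracelessPart {M : RatMat} (h : M.RegularAtInfty) :
    M.tracelessPart.RegularAtInfty := by
  obtain ⟨L, hL⟩ := h
  refine ⟨(1 / 2 : ℂ) • (L - L.adjugate), fun b c => ?_⟩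
  have h1 : Tendsto (fun l : ℂ => l ^ (-(0 : ℤ)) * ((1 / 2 : ℂ) • (M.evalAt l - (M.evalAt l).adjugate)) b c)
      (Bornology.cobounded ℂ) (𝓝 (((1 / 2 : ℂ) • (L - L.adjugate)) b c)) := by
    have e : ∀ b c, Tendsto (fun l => M.evalAt l b c) (Bornology.cobounded ℂ) (𝓝 (L b c)) :=
      fun b c => (hL b c).congr fun l => by simp
    simp only [Matrix.adjugate_fin_two, neg_zero, zpow_zero, one_mul]
    fin_cases b <;> fin_cases c <;> simp only [Matrix.smul_apply, Matrix.sub_apply] <;> simp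
    · exact ((e 0 0).sub (e 1 1)).const_mul _
    · exact ((e 0 1).add (e 0 1)).const_mul _
    · exact ((e 1 0).add (e 1 0)).const_mul _
    · exact ((e 1 1).sub (e 0 0)).const_mul _
  refine h1.congr' ?_
  filter_upwards [M.eventually_cobounded_isRegularAt] with l hl
  rw [evalAt_tracelessPart hl]

end RatMat

theorem IsHolomorphicOff.eventually_ne (hX : IsOpen X) (ha : ∀ k, AnalyticOnNhd ℂ (a k) X)
    {x : Fin m → ℂ} (hx : x ∈ X) {l : ℂ} (hl : ∀ k, l ≠ a k x) :
    ∀ᶠ z : (Fin m → ℂ) × ℂ in 𝓝 (x, l), z.1 ∈ X ∧ ∀ k, z.2 ≠ a k z.1 := by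
  exact ((continuous_fst.tendsto (x, l)).eventually (hX.mem_nhds hx)).and
    (eventually_forall_ne (fun k => (ha k x hx).continuousAt) hl)

theorem IsHolomorphicOff.tracelessPart (hU : IsHolomorphicOff X U a) (hX : IsOpen X)
    (ha : ∀ k, AnalyticOnNhd ℂ (a k) X) : IsHolomorphicOff X (fun x => (U x).tracelessPart) a where
  isRegularAt x hx l hl := RatMat.isRegularAt_tracelessPart (hU.isRegularAt x hx l hl)
  analytic x hx l hl := by
    have h := hU.analytic x hx l hl
    refine (AnalyticMatAt.smul (analyticAt_const (v := (1 / 2 : ℂ))) (h.sub h.adjugate)).congr ?_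
    filter_upwards [eventually_ne hX ha hx hl] with z hz
    rw [RatMat.evalAt_tracelessPart (hU.isRegularAt _ hz.1 _ hz.2)]

/-- The traceless part of a deformation matrix satisfies the same zero curvature equation. -/
theorem zero_curvature_tracelessPart (hU : IsHolomorphicOff X U a)
    (hX : IsOpen X) (ha : ∀ k, AnalyticOnNhd ℂ (a k) X) (htr : ∀ x ∈ X, (A x).trace = 0)
    {x : Fin m → ℂ} (hx : x ∈ X) {l : ℂ} (hl : ∀ k, l ≠ a k x)
    (h : matFDeriv (fun z : (Fin m → ℂ) × ℂ => (A z.1).evalAt z.2) (x, l) (Pi.single j 1, 0) =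
      matFDeriv (fun z : (Fin m → ℂ) × ℂ => (U z.1).evalAt z.2) (x, l) (0, 1) +
      ((U x).evalAt l * (A x).evalAt l - (A x).evalAt l * (U x).evalAt l)) :
    matFDeriv (fun z : (Fin m → ℂ) × ℂ => (A z.1).evalAt z.2) (x, l) (Pi.single j 1, 0) =
      matFDeriv (fun z : (Fin m → ℂ) × ℂ => (U z.1).tracelessPart.evalAt z.2) (x, l) (0, 1) +
      ((U x).tracelessPart.evalAt l * (A x).evalAt l -
        (A x).evalAt l * (U x).tracelessPart.evalAt l) := by
  have hUan := hU.analytic x hx l hl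
  have h1 : matFDeriv (fun z : (Fin m → ℂ) × ℂ => (U z.1).tracelessPart.evalAt z.2) (x, l) (0, 1) =
      (1 / 2 : ℂ) • (matFDeriv (fun z : (Fin m → ℂ) × ℂ => (U z.1).evalAt z.2) (x, l) (0, 1) -
        (matFDeriv (fun z : (Fin m → ℂ) × ℂ => (U z.1).evalAt z.2) (x, l) (0, 1)).adjugate) := by
    rw [matFDeriv_congr (w := fun z : (Fin m → ℂ) × ℂ =>
      (fun _ => (1 / 2 : ℂ)) z • ((U z.1).evalAt z.2 - ((U z.1).evalAt z.2).adjugate)) (by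
        filter_upwards [IsHolomorphicOff.eventually_ne hX ha hx hl] with z hz
        rw [RatMat.evalAt_tracelessPart (hU.isRegularAt _ hz.1 _ hz.2)]),
      matFDeriv_smul analyticAt_const (hUan.sub hUan.adjugate),
      matFDeriv_sub hUan hUan.adjugate, matFDeriv_adjugate]
    simp
  have hAadj : ((A x).evalAt l).adjugate = -(A x).evalAt l :=
    Matrix.adjugate_eq_neg_of_trace_eq_zero (RatMat.trace_evalAt (htr x hx) l)
  have h2 : (matFDeriv (fun z : (Fin m → ℂ) × ℂ => (A z.1).evalAt z.2) (x, l)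
      (Pi.single j 1, 0)).adjugate =
      -matFDeriv (fun z : (Fin m → ℂ) × ℂ => (A z.1).evalAt z.2) (x, l) (Pi.single j 1, 0) := by
    rw [← matFDeriv_adjugate, ← matFDeriv_neg]
    refine matFDeriv_congr ?_
    filter_upwards [IsHolomorphicOff.eventually_ne hX ha hx hl] with z hz
    exact Matrix.adjugate_eq_neg_of_trace_eq_zero (RatMat.trace_evalAt (htr _ hz.1) _)
  have h3 := congrArg Matrix.adjugate h
  rw [h2, Matrix.adjugate_add_fin_two, Matrix.adjugate_sub_fin_two, Matrix.adjugate_mul_distrib,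
    Matrix.adjugate_mul_distrib, hAadj] at h3
  rw [h1, RatMat.evalAt_tracelessPart (hU.isRegularAt x hx l hl)]
  generalize matFDeriv (fun z : (Fin m → ℂ) × ℂ => (A z.1).evalAt z.2) (x, l) (Pi.single j 1, 0) = a'
    at h h3 ⊢
  generalize matFDeriv (fun z : (Fin m → ℂ) × ℂ => (U z.1).evalAt z.2) (x, l) (0, 1) = u' at h h3 ⊢
  have h4 : a' = (1 / 2 : ℂ) • (a' - -a') := by module
  rw [h3, h] at h4
  rw [h, h4]
  simp only [Matrix.mul_smul, Matrix.smul_mul, mul_sub, sub_mul, neg_mul, mul_neg]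
  module

end Traceless

section Selection

/-- Finitely many open conditions can be made to hold everywhere or nowhere on a smaller open set. -/
theorem exists_isOpen_forall_or_forall_not {Y ι : Type*} [TopologicalSpace Y] {P : ι → Y → Prop}
    (s : Finset ι) {W : Set Y} (hW : IsOpen W) (hne : W.Nonempty)
    (hP : ∀ i, ∀ x ∈ W, P i x → ∀ᶠ y in 𝓝 x, P i y) :
    ∃ W', IsOpen W' ∧ W'.Nonempty ∧ W' ⊆ W ∧
      ∀ i ∈ s, (∀ x ∈ W', P i x) ∨ ∀ x ∈ W', ¬ P i x := by
  classical
  induction s using Finset.induction_on with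
  | empty => exact ⟨W, hW, hne, subset_rfl, by simp⟩
  | insert i s _ ih =>
    obtain ⟨W', hW'o, hW'n, hW'W, hs⟩ := ih
    by_cases h : ∃ x ∈ W', P i x
    · obtain ⟨x, hx, hPx⟩ := h
      obtain ⟨O, hO, hOo, hxO⟩ := _root_.eventually_nhds_iff.1 (hP i x (hW'W hx) hPx)
      refine ⟨W' ∩ O, hW'o.inter hOo, ⟨x, hx, hxO⟩, Set.inter_subset_left.trans hW'W,
        fun k hk => ?_⟩
      rcases Finset.mem_insert.1 hk with rfl | hk
      · exact Or.inl fun y hy => hO y hy.2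
      · exact (hs k hk).imp (fun h y hy => h y hy.1) fun h y hy => h y hy.1
    · push Not at h
      refine ⟨W', hW'o, hW'n, hW'W, fun k hk => ?_⟩
      rcases Finset.mem_insert.1 hk with rfl | hk
      · exact Or.inr h
      · exact hs k hk

variable {m N : ℕ} {X : Set (Fin m → ℂ)} {a : Fin N → (Fin m → ℂ) → ℂ} {j : Fin m} {κ : Fin N}

theorem IsPoleParameter.apply_update_eq (h : IsPoleParameter X a j κ) {x₁ : Fin m → ℂ} {ρ : ℝ}
    (hX : Metric.ball x₁ ρ ⊆ X) {k : Fin N} (hk : k ≠ κ) {x : Fin m → ℂ}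
    (hx : x ∈ Metric.ball x₁ ρ) {s : ℂ} (hs : s ∈ Metric.ball (x₁ j) ρ) :
    a k (Function.update x j s) = a k x := by
  have hd : ∀ s ∈ Metric.ball (x₁ j) ρ,
      HasDerivAt (fun s => a k (Function.update x j s)) 0 s := fun s hs => by
    have := h.2 k hk _ (hX (update_mem_ball hx hs))
    simpa using this
  have h1 := Metric.isOpen_ball.is_const_of_deriv_eq_zero (convex_ball (x₁ j) ρ).isPreconnected
    (fun s hs => (hd s hs).differentiableAt.differentiableWithinAt) (fun s hs => (hd s hs).deriv)
    hs (apply_mem_ball hx j)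
  simpa using h1

end Selection

/-! ### Local deformations with uniform bounds -/

section BoundedDeformation

variable {m N : ℕ} {X W : Set (Fin m → ℂ)} {A U : RatFamily m} {a : Fin N → (Fin m → ℂ) → ℂ}
  {j : Fin m} {κ : Fin N} {x₁ : Fin m → ℂ} {ρ r s R : ℝ} {S : Finset (Fin N)} {K : ℕ}

/-- A local deformation with uniform bounds at the singular points: at the other poles `a k` and at
infinity either `A` is Fuchsian, with the entries of `(λ - a k) A` and `λ A`, respectively, bounded
by `K / 4`, or the deformation matrix `U` is bounded.  The set `S` consists of the (finite) poles of the first kind. -/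
structure IsBoundedDeformation (A U : RatFamily m) (a : Fin N → (Fin m → ℂ) → ℂ) (j : Fin m)
    (κ : Fin N) (x₁ : Fin m → ℂ) (ρ r s R : ℝ) (S : Finset (Fin N)) (K : ℕ) : Prop where
  isLocalDeformation : IsLocalDeformation A U a j κ x₁ ρ r
  lt : r < s
  pos : 0 < R
  lt_dist : ∀ x ∈ Metric.ball x₁ ρ, ∀ k, k ≠ κ → s < dist (a k x) (x₁ j)
  pole_injective : ∀ x ∈ Metric.ball x₁ ρ, Function.Injective fun k => a k x
  mem_domain : ∀ x ∈ Metric.ball x₁ ρ, ∀ l, R ≤ ‖l‖ → (x, l) ∈ deformationDomain a j κ x₁ ρ r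
  fuchsian : ∀ k ∈ S, k ≠ κ ∧ ∃ C : ℝ, 4 * C ≤ K ∧ ∃ δ > 0, ∀ x ∈ Metric.ball x₁ ρ,
    dist (a k x) (a k x₁) < δ ∧ ∀ l ∈ Metric.closedBall (a k x₁) δ, l ≠ a k x →
      ∀ b c, ‖l - a k x‖ * ‖(A x).evalAt l b c‖ ≤ C
  bounded : ∀ k, k ≠ κ → k ∉ S → ∃ C : ℝ, ∃ δ > 0, ∀ x ∈ Metric.ball x₁ ρ,
    dist (a k x) (a k x₁) < δ ∧ ∀ l ∈ Metric.closedBall (a k x₁) δ,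
      ∀ b c, ‖(U x).evalAt l b c‖ ≤ C
  atInfty : (∃ C : ℝ, 4 * C ≤ K ∧ ∀ x ∈ Metric.ball x₁ ρ, ∀ l, R ≤ ‖l‖ →
      ∀ b c, ‖l‖ * ‖(A x).evalAt l b c‖ ≤ C) ∨
    ∃ C : ℝ, ∀ x ∈ Metric.ball x₁ ρ, ∀ l, R ≤ ‖l‖ → ∀ b c, ‖(U x).evalAt l b c‖ ≤ C

/-- Local existence of a bounded deformation, if each of the alternatives holds on an open set. -/
theorem exists_isBoundedDeformation (hX : IsOpen X) (hA : IsHolomorphicFamily X A a)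
    (hU : IsHolomorphicOff X U a) (hUt : ∀ x ∈ X, (U x).trace = 0)
    (hzc : ∀ x ∈ X, ∀ l, (∀ k, l ≠ a k x) →
      matFDeriv (fun z : (Fin m → ℂ) × ℂ => (A z.1).evalAt z.2) (x, l) (Pi.single j 1, 0) =
        matFDeriv (fun z : (Fin m → ℂ) × ℂ => (U z.1).evalAt z.2) (x, l) (0, 1) +
        ((U x).evalAt l * (A x).evalAt l - (A x).evalAt l * (U x).evalAt l))
    (hpar : IsPoleParameter X a j κ) (hW : IsOpen W) (hWX : W ⊆ X) (hx₁ : x₁ ∈ W)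
    (hS : ∀ k ∈ S, k ≠ κ ∧ ∀ x ∈ W, (A x).poleOrder (a k x) ≤ 1)
    (hSc : ∀ k, k ≠ κ → k ∉ S → ∀ x ∈ W, RatMat.IsRegularAt (U x) (a k x))
    (hinf : (∀ x ∈ W, (A x).FuchsianAtInfty) ∨ ∀ x ∈ W, (U x).RegularAtInfty) :
    ∃ ρ r s R K, IsBoundedDeformation A U a j κ x₁ ρ r s R S K ∧ Metric.ball x₁ ρ ⊆ W := by
  have hx₁X := hWX hx₁
  have hcont : ∀ k, ContinuousAt (a k) x₁ := fun k => (hA.analytic_pole k x₁ hx₁X).continuousAt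
  have hAoff := hA.isHolomorphicOff
  have hWn : ∀ᶠ x in 𝓝 x₁, x ∈ W := hW.mem_nhds hx₁
  have haκ : a κ x₁ = x₁ j := hpar.1 x₁ hx₁X
  obtain ⟨s, hs, hsx⟩ := hA.exists_radius hx₁X κ
  rw [haκ] at hsx
  have hsd : ∀ᶠ x in 𝓝 x₁, ∀ k, k ≠ κ → s < dist (a k x) (x₁ j) := by
    filter_upwards [hsx] with x hx k hk
    by_contra h
    exact hx (a k x) (Metric.mem_closedBall.2 (not_lt.1 h)) k hk rfl
  choose δ hδ hδx using fun k => hA.exists_radius hx₁X k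
  have hnear : ∀ k, ∀ᶠ x in 𝓝 x₁, dist (a k x) (a k x₁) < δ k := fun k =>
    (hcont k).eventually (Metric.ball_mem_nhds _ (hδ k))
  -- a radius enclosing all finite poles
  obtain ⟨R, hR0, hRc, hRa⟩ : ∃ R > 0, ‖x₁ j‖ + s < R ∧ ∀ k, ‖a k x₁‖ < R :=
    ⟨‖x₁ j‖ + s + 1 + ∑ k, ‖a k x₁‖, by positivity,
      by have := Finset.sum_nonneg fun k (_ : k ∈ Finset.univ) => norm_nonneg (a k x₁); linarith,
      fun k => by
        have h1 := Finset.single_le_sum (f := fun k => ‖a k x₁‖) (fun _ _ => norm_nonneg _)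
          (Finset.mem_univ k)
        have h2 := norm_nonneg (x₁ j)
        linarith⟩
  have hRx : ∀ᶠ x in 𝓝 x₁, ∀ w, R ≤ ‖w‖ → ∀ k, w ≠ a k x := by
    have h1 : ∀ᶠ x in 𝓝 x₁, ∀ k, ‖a k x‖ < R :=
      eventually_all.2 fun k => (hcont k).norm.eventually_lt_const (hRa k)
    filter_upwards [h1] with x hx w hw k hk
    rw [hk] at hw
    exact absurd (hx k) (not_lt.2 hw)
  -- bounds at the finite poles
  have hfu : ∀ k, ∃ C, k ∈ S → ∀ᶠ x in 𝓝 x₁, ∀ l ∈ Metric.closedBall (a k x₁) (δ k), l ≠ a k x →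
      ∀ b c, ‖l - a k x‖ * ‖(A x).evalAt l b c‖ ≤ C := by
    intro k
    obtain ⟨C, hC⟩ := (hAoff.smul_X_sub_C hX hA.analytic_pole (hA.analytic_pole k)).exists_bound
      hX hx₁X (hδ k) (hδx k)
    refine ⟨C, fun hk => ?_⟩
    filter_upwards [hC, hWn, hδx k] with x hx hxW hxδ l hl hlk b c
    have hoff : ∀ k', l ≠ a k' x := fun k' => by
      by_cases h : k' = k
      · rw [h]; exact hlk
      · exact hxδ l hl k' h
    have h1 := hx (RatMat.poleOrder_le_one_iff.1 ((hS k hk).2 x hxW)) l hl b c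
    rwa [RatMat.evalAt_smul_X_sub_C (hAoff.isRegularAt x (hWX hxW) l hoff), Matrix.smul_apply,
      norm_smul] at h1
  have hbd : ∀ k, ∃ C, k ≠ κ → k ∉ S → ∀ᶠ x in 𝓝 x₁, ∀ l ∈ Metric.closedBall (a k x₁) (δ k),
      ∀ b c, ‖(U x).evalAt l b c‖ ≤ C := by
    intro k
    obtain ⟨C, hC⟩ := hU.exists_bound hX hx₁X (hδ k) (hδx k)
    refine ⟨C, fun hk hkS => ?_⟩
    filter_upwards [hC, hWn] with x hx hxW l hl b c
    exact hx (hSc k hk hkS x hxW) l hl b c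
  choose C hC using hfu
  choose C' hC' using hbd
  -- bounds at infinity
  obtain ⟨M, hM⟩ : ∃ M : ℝ, (∀ᶠ x in 𝓝 x₁, ∀ l, R ≤ ‖l‖ → ∀ b c, ‖l‖ * ‖(A x).evalAt l b c‖ ≤ M) ∨
      ∀ᶠ x in 𝓝 x₁, ∀ l, R ≤ ‖l‖ → ∀ b c, ‖(U x).evalAt l b c‖ ≤ M := by
    rcases hinf with hinf | hinf
    · obtain ⟨M, hM⟩ := (hAoff.smul_X_sub_C hX hA.analytic_pole
        (analyticOnNhd_const (v := (0 : ℂ)))).exists_bound_atInfty hX hx₁X hR0 hRx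
      refine ⟨M, Or.inl ?_⟩
      filter_upwards [hM, hWn, hRx] with x hx hxW hxR l hl b c
      have hreg : ∀ l, R ≤ ‖l‖ → RatMat.IsRegularAt (A x) l := fun l hl =>
        hAoff.isRegularAt x (hWX hxW) l (hxR l hl)
      have h1 : RatMat.RegularAtInfty ((RatFunc.X - RatFunc.C (0 : ℂ)) • A x) := by
        obtain ⟨L, hL⟩ := hinf x hxW
        refine ⟨L, fun b c => (hL b c).congr' ?_⟩
        filter_upwards [(A x).eventually_cobounded_isRegularAt] with w hw
        rw [RatMat.evalAt_smul_X_sub_C hw, Matrix.smul_apply]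
        simp
      have h2 := hx h1 l hl b c
      rwa [RatMat.evalAt_smul_X_sub_C (hreg l hl), Matrix.smul_apply, norm_smul, sub_zero] at h2
    · obtain ⟨M, hM⟩ := hU.exists_bound_atInfty hX hx₁X hR0 hRx
      refine ⟨M, Or.inr ?_⟩
      filter_upwards [hM, hWn] with x hx hxW
      exact hx (hinf x hxW)
  obtain ⟨K, hK⟩ := exists_nat_ge (4 * (|M| + ∑ k, |C k|))
  have hKM : 4 * M ≤ K := by
    have h1 := Finset.sum_nonneg fun k (_ : k ∈ Finset.univ) => abs_nonneg (C k)
    have h2 := le_abs_self M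
    linarith
  have hKC : ∀ k, 4 * C k ≤ K := fun k => by
    have h1 := Finset.single_le_sum (f := fun k => |C k|) (fun _ _ => abs_nonneg _)
      (Finset.mem_univ k)
    have h2 := le_abs_self (C k)
    have h3 := abs_nonneg M
    linarith
  -- a polydisc on which all bounds hold
  have hCall : ∀ᶠ x in 𝓝 x₁, ∀ k ∈ S, ∀ l ∈ Metric.closedBall (a k x₁) (δ k), l ≠ a k x →
      ∀ b c, ‖l - a k x‖ * ‖(A x).evalAt l b c‖ ≤ C k :=
    (Filter.eventually_all_finset S).2 fun k hk => hC k hk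
  have hCall' : ∀ᶠ x in 𝓝 x₁, ∀ k, k ≠ κ → k ∉ S → ∀ l ∈ Metric.closedBall (a k x₁) (δ k),
      ∀ b c, ‖(U x).evalAt l b c‖ ≤ C' k := by
    rw [eventually_all]
    intro k
    by_cases h1 : k = κ
    · simp [h1]
    by_cases h2 : k ∈ S
    · simp [h2]
    filter_upwards [hC' k h1 h2] with x hx _ _ using hx
  have hMall : (∃ C : ℝ, 4 * C ≤ K ∧ ∀ᶠ x in 𝓝 x₁, ∀ l, R ≤ ‖l‖ →
      ∀ b c, ‖l‖ * ‖(A x).evalAt l b c‖ ≤ C) ∨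
    ∃ C : ℝ, ∀ᶠ x in 𝓝 x₁, ∀ l, R ≤ ‖l‖ → ∀ b c, ‖(U x).evalAt l b c‖ ≤ C :=
    hM.imp (fun h => ⟨M, hKM, h⟩) fun h => ⟨M, h⟩
  obtain ⟨ρ₀, hρ₀, hball⟩ := Metric.eventually_nhds_iff_ball.1
    (((((hsd.and (eventually_all.2 hnear)).and hRx).and hCall).and hCall').and hWn)
  obtain ⟨ρ₁, hρ₁, hball₁⟩ : ∃ ρ₁ > 0, (∃ C : ℝ, 4 * C ≤ K ∧ ∀ x ∈ Metric.ball x₁ ρ₁, ∀ l, R ≤ ‖l‖ →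
      ∀ b c, ‖l‖ * ‖(A x).evalAt l b c‖ ≤ C) ∨
    ∃ C : ℝ, ∀ x ∈ Metric.ball x₁ ρ₁, ∀ l, R ≤ ‖l‖ → ∀ b c, ‖(U x).evalAt l b c‖ ≤ C := by
    rcases hMall with ⟨C, h1, h2⟩ | ⟨C, h2⟩
    · obtain ⟨ρ₁, hρ₁, h3⟩ := Metric.eventually_nhds_iff_ball.1 h2
      exact ⟨ρ₁, hρ₁, Or.inl ⟨C, h1, h3⟩⟩
    · obtain ⟨ρ₁, hρ₁, h3⟩ := Metric.eventually_nhds_iff_ball.1 h2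
      exact ⟨ρ₁, hρ₁, Or.inr ⟨C, h3⟩⟩
  set ρ := min (min ρ₀ ρ₁) (s / 4) with hρdef
  have hρ : 0 < ρ := lt_min (lt_min hρ₀ hρ₁) (by positivity)
  have hsub₀ : Metric.ball x₁ ρ ⊆ Metric.ball x₁ ρ₀ :=
    Metric.ball_subset_ball ((min_le_left _ _).trans (min_le_left _ _))
  have hsub₁ : Metric.ball x₁ ρ ⊆ Metric.ball x₁ ρ₁ :=
    Metric.ball_subset_ball ((min_le_left _ _).trans (min_le_right _ _))
  have hρs : ρ ≤ s / 4 := min_le_right _ _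
  have hWsub : Metric.ball x₁ ρ ⊆ W := fun x hx => (hball x (hsub₀ hx)).2
  have hXsub : Metric.ball x₁ ρ ⊆ X := hWsub.trans hWX
  refine ⟨ρ, s / 2, s, R, K, ⟨⟨hρ, by linarith, fun k x hx => hA.analytic_pole k x (hXsub hx),
    hAoff.mono hXsub, hU.mono hXsub, fun x hx => hUt x (hXsub hx),
    fun x hx => hzc x (hXsub hx), fun x hx => hpar.1 x (hXsub hx),
    fun x hx w hw k hk => hpar.apply_update_eq hXsub hk hx hw⟩, by linarith, hR0,
    fun x hx k hk => (hball x (hsub₀ hx)).1.1.1.1.1 k hk,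
    fun x hx => hA.pole_injective x (hXsub hx), fun x hx l hl => ⟨hx, ?_, fun k _ =>
      (hball x (hsub₀ hx)).1.1.1.2 l hl k⟩, fun k hk => ⟨(hS k hk).1, C k, hKC k, δ k, hδ k,
      fun x hx => ⟨(hball x (hsub₀ hx)).1.1.1.1.2 k, (hball x (hsub₀ hx)).1.1.2 k hk⟩⟩,
    fun k hk hkS => ⟨C' k, δ k, hδ k, fun x hx => ⟨(hball x (hsub₀ hx)).1.1.1.1.2 k,
      (hball x (hsub₀ hx)).1.2 k hk hkS⟩⟩, ?_⟩, hWsub⟩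
  · show s / 2 < dist l (x₁ j)
    rw [dist_eq_norm]
    have := norm_sub_norm_le l (x₁ j)
    linarith
  · exact hball₁.imp (fun ⟨C, h1, h2⟩ => ⟨C, h1, fun x hx => h2 x (hsub₁ hx)⟩)
      fun ⟨C, h2⟩ => ⟨C, fun x hx => h2 x (hsub₁ hx)⟩

namespace IsBoundedDeformation

theorem near_pole_mem_domain (h : IsBoundedDeformation A U a j κ x₁ ρ r s R S K) {x : Fin m → ℂ}
    (hx : x ∈ Metric.ball x₁ ρ) {k : Fin N} (hk : k ≠ κ) {δ : ℝ}
    (hδ : dist (a k x) (a k x₁) < δ) :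
    ∃ ε > 0, ∀ l, ‖l - a k x‖ ≤ ε → l ∈ Metric.closedBall (a k x₁) δ ∧
      (l ≠ a k x → (x, l) ∈ deformationDomain a j κ x₁ ρ r) := by
  have h1 : ∀ᶠ l in 𝓝 (a k x), l ∈ Metric.ball (a k x₁) δ := Metric.isOpen_ball.mem_nhds hδ
  have h2 : ∀ᶠ l in 𝓝 (a k x), r < dist l (x₁ j) :=
    (continuous_id.dist continuous_const).continuousAt.eventually_const_lt
      (h.lt.trans (h.lt_dist x hx k hk))
  have h3 : ∀ᶠ l in 𝓝 (a k x), ∀ k', k' ≠ k → l ≠ a k' x := by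
    rw [eventually_all]
    intro k'
    by_cases hkk : k' = k
    · simp [hkk]
    · have : a k x ≠ a k' x := fun h0 => hkk (h.pole_injective x hx h0).symm
      filter_upwards [isOpen_ne.mem_nhds this] with l hl _ using hl
  obtain ⟨ε, hε, hball⟩ := Metric.nhds_basis_closedBall.eventually_iff.1 ((h1.and h2).and h3)
  refine ⟨ε, hε, fun l hl => ?_⟩
  have hl' := hball (x := l) (by rwa [Metric.mem_closedBall, dist_eq_norm])
  refine ⟨Metric.ball_subset_closedBall hl'.1.1, fun hlk => ⟨hx, hl'.1.2, fun k' hk' => ?_⟩⟩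
  by_cases hkk : k' = k
  · rw [hkk]; exact hlk
  · exact hl'.2 k' hkk

end IsBoundedDeformation

end BoundedDeformation

/-! ### Growth and holomorphy of the polynomial gauge transformation -/

section FlowGrowth

open Polynomial

variable {m N : ℕ} {A U : RatFamily m} {a : Fin N → (Fin m → ℂ) → ℂ}
  {j : Fin m} {κ : Fin N} {x₁ : Fin m → ℂ} {ρ r s R : ℝ} {S : Finset (Fin N)} {K : ℕ}
  {G : (Fin m → ℂ) × ℂ → Matrix (Fin 2) (Fin 2) ℂ}

/-- The polynomial clearing the poles of the comparison matrix, which at `a k`, `k ∈ S`, are of order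
at most `K`. -/
noncomputable def clearingPoly (a : Fin N → (Fin m → ℂ) → ℂ) (S : Finset (Fin N)) (K : ℕ)
    (x : Fin m → ℂ) : ℂ[X] :=
  ∏ k ∈ S, (Polynomial.X - C (a k x)) ^ K

namespace IsBoundedDeformation

theorem growth_pole (h : IsBoundedDeformation A U a j κ x₁ ρ r s R S K)
    (hG1 : ∀ z ∈ deformationDomain a j κ x₁ ρ r, z.1 j = x₁ j → G z = 1)
    (hGt : ∀ z ∈ deformationDomain a j κ x₁ ρ r, HasMatDerivAt
        (fun s : ℂ => G (z + s • (Pi.single j 1, 0))) (-(G z * (U z.1).evalAt z.2)) 0)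
    (hGl : ∀ z ∈ deformationDomain a j κ x₁ ρ r, HasMatDerivAt (fun l => G (z.1, l))
        ((A (Function.update z.1 j (x₁ j))).evalAt z.2 * G z - G z * (A z.1).evalAt z.2) z.2)
    {x : Fin m → ℂ} (hx : x ∈ Metric.ball x₁ ρ) {k : Fin N} (hk : k ≠ κ) :
    ∃ B, ∀ᶠ l in 𝓝[≠] (a k x), ∀ b e, ‖(clearingPoly a S K x).eval l * G (x, l) b e‖ ≤ B := by
  have hL := h.isLocalDeformation
  set x₀ := Function.update x j (x₁ j) with hx₀def
  have hx₀ : x₀ ∈ Metric.ball x₁ ρ := update_mem_ball hx (Metric.mem_ball_self hL.pos)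
  have hax₀ : a k x₀ = a k x := hL.pole_update x hx _ (Metric.mem_ball_self hL.pos) k hk
  have hpb : ∀ p : ℂ[X], ∃ M, 0 ≤ M ∧ ∀ᶠ l in 𝓝[≠] (a k x), ‖p.eval l‖ ≤ M := fun p =>
    ⟨‖p.eval (a k x)‖ + 1, by positivity, nhdsWithin_le_nhds
      ((p.continuous.norm.continuousAt.eventually_lt_const (lt_add_one _)).mono fun l hl => hl.le)⟩
  by_cases hkS : k ∈ S
  · obtain ⟨-, C, hCK, δ, hδ, hbd⟩ := h.fuchsian k hkS
    obtain ⟨ε, hε, hdom⟩ := h.near_pole_mem_domain hx hk (hbd x hx).1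
    obtain ⟨B, hB⟩ := exists_growth_bound (g := fun l => G (x, l)) (α := (A x).evalAt)
      (β := (A x₀).evalAt) (p := a k x) hε hCK
      (fun l hl hlε => hGl (x, l) ((hdom l hlε).2 hl))
      (fun l hl hlε => (hbd x hx).2 l (hdom l hlε).1 hl)
      (fun l hl hlε => by
        have := (hbd x₀ hx₀).2 l (hdom l hlε).1 (by rwa [hax₀])
        rwa [hax₀] at this)
    obtain ⟨M, hM, hMe⟩ := hpb (∏ k' ∈ S.erase k, (Polynomial.X - Polynomial.C (a k' x)) ^ K)
    refine ⟨M * B, ?_⟩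
    filter_upwards [hMe, self_mem_nhdsWithin,
      nhdsWithin_le_nhds (Metric.closedBall_mem_nhds (a k x) hε)] with l hl1 hl2 hl3 b e
    have h1 := hB l hl2 (by rwa [← dist_eq_norm]) b e
    rw [clearingPoly, ← Finset.mul_prod_erase S _ hkS, eval_mul, norm_mul, norm_mul]
    simp only [eval_pow, eval_sub, eval_X, eval_C, norm_pow]
    calc ‖l - a k x‖ ^ K * ‖eval l (∏ k' ∈ S.erase k, (Polynomial.X - Polynomial.C (a k' x)) ^ K)‖ *
          ‖G (x, l) b e‖ = ‖eval l (∏ k' ∈ S.erase k, (Polynomial.X - Polynomial.C (a k' x)) ^ K)‖ *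
          (‖l - a k x‖ ^ K * ‖G (x, l) b e‖) := by ring
      _ ≤ M * B := mul_le_mul hl1 h1 (by positivity) hM
  · obtain ⟨C, δ, hδ, hbd⟩ := h.bounded k hk hkS
    obtain ⟨ε, hε, hdom⟩ := h.near_pole_mem_domain hx hk (hbd x hx).1
    obtain ⟨M, hM, hMe⟩ := hpb (clearingPoly a S K x)
    obtain ⟨B, hB⟩ : ∃ B, ∀ l, l ≠ a k x → ‖l - a k x‖ ≤ ε → ∀ b e, ‖G (x, l) b e‖ ≤ B :=
      ⟨_, fun l hl hlε b e => hL.norm_flow_le hG1 hGt ((hdom l hlε).2 hl) (fun t ht b c =>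
        (hbd _ (update_mem_ball hx ht)).2 l (hdom l hlε).1 b c) b e⟩
    refine ⟨M * B, ?_⟩
    filter_upwards [hMe, self_mem_nhdsWithin,
      nhdsWithin_le_nhds (Metric.closedBall_mem_nhds (a k x) hε)] with l hl1 hl2 hl3 b e
    rw [norm_mul]
    exact mul_le_mul hl1 (hB l hl2 (by rwa [← dist_eq_norm]) b e) (norm_nonneg _) hM

theorem growth_atInfty (h : IsBoundedDeformation A U a j κ x₁ ρ r s R S K)
    (hG1 : ∀ z ∈ deformationDomain a j κ x₁ ρ r, z.1 j = x₁ j → G z = 1)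
    (hGt : ∀ z ∈ deformationDomain a j κ x₁ ρ r, HasMatDerivAt
        (fun s : ℂ => G (z + s • (Pi.single j 1, 0))) (-(G z * (U z.1).evalAt z.2)) 0)
    (hGl : ∀ z ∈ deformationDomain a j κ x₁ ρ r, HasMatDerivAt (fun l => G (z.1, l))
        ((A (Function.update z.1 j (x₁ j))).evalAt z.2 * G z - G z * (A z.1).evalAt z.2) z.2)
    {x : Fin m → ℂ} (hx : x ∈ Metric.ball x₁ ρ) :
    ∃ B R', ∀ l, R' ≤ ‖l‖ → ∀ b e, ‖G (x, l) b e‖ ≤ B * ‖l‖ ^ K := by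
  have hL := h.isLocalDeformation
  set x₀ := Function.update x j (x₁ j) with hx₀def
  have hx₀ : x₀ ∈ Metric.ball x₁ ρ := update_mem_ball hx (Metric.mem_ball_self hL.pos)
  rcases h.atInfty with ⟨C, hCK, hbd⟩ | ⟨C, hbd⟩
  · obtain ⟨B, hB⟩ := exists_growth_bound_atInfty (g := fun l => G (x, l)) (α := (A x).evalAt)
      (β := (A x₀).evalAt) h.pos hCK (fun l hl => hGl (x, l) (h.mem_domain x hx l hl))
      (hbd x hx) (hbd x₀ hx₀)
    exact ⟨B, R, hB⟩
  · obtain ⟨B, hB⟩ : ∃ B, ∀ l, R ≤ ‖l‖ → ∀ b e, ‖G (x, l) b e‖ ≤ B :=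
      ⟨_, fun l hl b e => hL.norm_flow_le hG1 hGt (h.mem_domain x hx l hl) (fun t ht b c =>
        hbd _ (update_mem_ball hx ht) l hl b c) b e⟩
    refine ⟨B, max R 1, fun l hl b e => (hB l ((le_max_left _ _).trans hl) b e).trans ?_⟩
    have hB0 : 0 ≤ B := (norm_nonneg _).trans (hB l ((le_max_left _ _).trans hl) b e)
    exact le_mul_of_one_le_right hB0 (one_le_pow₀ ((le_max_right _ _).trans hl))

end IsBoundedDeformation

end FlowGrowth

section Interpolation

open Polynomial

variable {m : ℕ} {V : Set (Fin m → ℂ)} {q : (Fin m → ℂ) → ℂ[X]}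

/-- A family of polynomials of bounded degree whose values at sufficiently many fixed points are
analytic has analytic coefficients. -/
theorem IsAnalyticPoly.of_eval {M : ℕ} (hd : ∀ x ∈ V, (q x).natDegree ≤ M) {v : ℕ → ℂ}
    (hv : Function.Injective v) (h : ∀ i, AnalyticOnNhd ℂ (fun x => (q x).eval (v i)) V)
    (hV : IsOpen V) : IsAnalyticPoly V q := by
  refine ⟨fun n => ?_, M, hd⟩
  have h1 : ∀ x ∈ V, (q x).coeff n = ∑ i ∈ Finset.range (M + 1),
      (q x).eval (v i) * (Lagrange.basis (Finset.range (M + 1)) v i).coeff n := by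
    intro x hx
    have h2 := Lagrange.eq_interpolate (f := q x) (s := Finset.range (M + 1)) (v := v) hv.injOn (by
      rw [Finset.card_range]
      exact (Polynomial.degree_le_natDegree).trans_lt
        (by exact_mod_cast Nat.lt_succ_of_le (hd x hx)))
    conv_lhs => rw [h2]
    rw [Lagrange.interpolate_apply, finsetSum_coeff]
    simp only [coeff_C_mul]
  intro x hx
  have h3 : AnalyticAt ℂ (fun x => ∑ i ∈ Finset.range (M + 1),
      (q x).eval (v i) * (Lagrange.basis (Finset.range (M + 1)) v i).coeff n) x :=
    Finset.analyticAt_fun_sum _ fun i _ => (h i x hx).mul analyticAt_const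
  refine h3.congr ?_
  filter_upwards [hV.mem_nhds hx] with y hy using (h1 y hy).symm

end Interpolation

/-! ### Holomorphic families of gauge transformations -/

section GaugeFamily

open Polynomial

theorem PolyMat.evalAt_adjugate (Q : PolyMat) (l : ℂ) :
    PolyMat.evalAt Q.adjugate l = (Q.evalAt l).adjugate :=
  RingHom.map_adjugate (Polynomial.evalRingHom l) Q

theorem AnalyticMatAt.comp {E F : Type*} [NormedAddCommGroup E] [NormedSpace ℂ E]
    [NormedAddCommGroup F] [NormedSpace ℂ F] {v : E → Matrix (Fin 2) (Fin 2) ℂ} {g : F → E} {y : F}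
    (hv : AnalyticMatAt v (g y)) (hg : AnalyticAt ℂ g y) : AnalyticMatAt (fun y => v (g y)) y :=
  fun b e => AnalyticAt.comp (g := fun z => v z b e) (f := g) (hv b e) hg

variable {m N : ℕ} {X V : Set (Fin m → ℂ)} {A A' U : RatFamily m} {a : Fin N → (Fin m → ℂ) → ℂ}
  {j : Fin m} {κ : Fin N} {x₁ : Fin m → ℂ} {ρ r s R : ℝ} {S : Finset (Fin N)} {K : ℕ}
  {T : (Fin m → ℂ) → PolyMat}

theorem analyticAt_update_const (j : Fin m) (c : ℂ) (x : Fin m → ℂ) :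
    AnalyticAt ℂ (fun x : Fin m → ℂ => Function.update x j c) x := by
  rw [analyticAt_pi_iff]
  intro i
  by_cases hi : i = j
  · subst hi; simpa using analyticAt_const
  · simp only [Function.update_of_ne hi]
    exact (ContinuousLinearMap.proj (R := ℂ) (φ := fun _ : Fin m => ℂ) i).analyticAt x

theorem isAnalyticPoly_clearingPoly (ha : ∀ k ∈ S, AnalyticOnNhd ℂ (a k) V) :
    IsAnalyticPoly V (clearingPoly a S K) := by
  classical
  induction S using Finset.induction_on with
  | empty =>
    have h1 : clearingPoly a ∅ K = fun _ => 1 := by funext x; simp [clearingPoly]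
    rw [h1]
    exact IsAnalyticPoly.const 1
  | insert k S hk ih =>
    have h1 : clearingPoly a (insert k S) K = fun x =>
        (Polynomial.X - C (a k x)) ^ K * clearingPoly a S K x := by
      funext x
      simp only [clearingPoly]
      rw [Finset.prod_insert hk]
    rw [h1]
    exact ((IsAnalyticPoly.X_sub_C (ha k (Finset.mem_insert_self _ _))).pow K).mul
      (ih fun k' hk' => ha k' (Finset.mem_insert_of_mem hk'))

/-- The reduced systems for `x` and for `x` with `x j` replaced by `x₁ j` are related by a
polynomial gauge transformation that is holomorphic in the parameters and whose determinant only
vanishes at the Fuchsian points `a k`, `k ∈ S`. -/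
theorem IsBoundedDeformation.exists_gauge_family
    (h : IsBoundedDeformation A U a j κ x₁ ρ r s R S K)
    (hred : IsPartialReduction X A a κ V 0 A' T) (hA : IsHolomorphicFamily X A a) (hV : IsOpen V)
    (hVX : V ⊆ X) (hsub : Metric.ball x₁ ρ ⊆ V) :
    ∃ P : (Fin m → ℂ) → PolyMat, IsAnalyticPolyMat (Metric.ball x₁ ρ) P ∧
      (∀ x ∈ Metric.ball x₁ ρ, IsGauge (P x) (A' x) (A' (Function.update x j (x₁ j)))) ∧
      ∃ c : (Fin m → ℂ) → ℂ, (∀ x ∈ Metric.ball x₁ ρ, c x ≠ 0) ∧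
        ∀ x ∈ Metric.ball x₁ ρ, (P x).det = C (c x) * clearingPoly a S K x ^ 2 := by
  classical
  have hL := h.isLocalDeformation
  obtain ⟨G, hGan, hG1, hGdet, hGt, hGl⟩ := hL.exists_flow
  obtain ⟨c, J, hc, hdetT⟩ := hred.det
  choose d hd using fun b e => (hred.analytic b e).bdd
  obtain ⟨D, hD⟩ : ∃ D, ∀ b e, ∀ x ∈ V, (T x b e).natDegree ≤ D :=
    ⟨∑ b, ∑ e, d b e, fun b e x hx => (hd b e x hx).trans
      ((Finset.single_le_sum (f := fun e => d b e) (fun _ _ => Nat.zero_le _)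
        (Finset.mem_univ e)).trans (Finset.single_le_sum (f := fun b => ∑ e, d b e)
        (fun _ _ => Nat.zero_le _) (Finset.mem_univ b)))⟩
  have hSκ : ∀ k ∈ S, k ≠ κ := fun k hk => (h.fuchsian k hk).1
  obtain ⟨D', hD'⟩ := (isAnalyticPoly_clearingPoly (S := S) (K := K)
    (fun k _ => hL.analytic_pole k)).bdd
  have hsp := hred.hasSimplePole hA hV hVX
  have hupd : ∀ x ∈ Metric.ball x₁ ρ, Function.update x j (x₁ j) ∈ Metric.ball x₁ ρ :=
    fun x hx => update_mem_ball hx (Metric.mem_ball_self hL.pos)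
  have hregB : ∀ x ∈ Metric.ball x₁ ρ, ∀ l ∈ Metric.ball (x₁ j) s, RatMat.IsRegularAt (A' x) l := by
    intro x hx l hl
    by_cases hlκ : l = a κ x
    · rw [hlκ]; exact hred.regular rfl x (hsub hx)
    · refine hsp.isRegularAt x (hsub hx) l fun k => ?_
      by_cases hk : k = κ
      · rwa [hk]
      · rintro rfl
        exact absurd (h.lt_dist x hx k hk) (not_lt.2 (Metric.mem_ball.1 hl).le)
  have hP : ∀ x ∈ Metric.ball x₁ ρ, ∃ P : PolyMat,
      (∀ b e, (P b e).natDegree ≤ D' + (D + K + D)) ∧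
      (∀ l, (x, l) ∈ deformationDomain a j κ x₁ ρ r → P.evalAt l =
        ((clearingPoly a S K x).eval l * halfPower J (x j) (x₁ j) l) •
          ((T (Function.update x j (x₁ j))).evalAt l * G (x, l) * ((T x).evalAt l).adjugate)) ∧
      P.det = C (c (Function.update x j (x₁ j)) * c x) * clearingPoly a S K x ^ 2 ∧
      IsGauge P (A' x) (A' (Function.update x j (x₁ j))) := by
    intro x hx
    have hx₀ := hupd x hx
    set x₀ := Function.update x j (x₁ j) with hx₀def
    have hpole : ∀ k, k ≠ κ → a k x₀ = a k x := fun k hk =>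
      hL.pole_update x hx _ (Metric.mem_ball_self hL.pos) k hk
    set q : Finset ℂ := (Finset.univ.erase κ).image fun k => a k x with hq
    have hmemq : ∀ k, k ≠ κ → a k x ∈ q := fun k hk =>
      Finset.mem_image.2 ⟨k, Finset.mem_erase.2 ⟨hk, Finset.mem_univ _⟩, rfl⟩
    have hqmem : ∀ z ∈ q, ∃ k, k ≠ κ ∧ a k x = z := fun z hz => by
      obtain ⟨k, hk, hkz⟩ := Finset.mem_image.1 hz
      exact ⟨k, (Finset.mem_erase.1 hk).1, hkz⟩
    have hdom : ∀ l, r < dist l (x₁ j) → l ∉ q → (x, l) ∈ deformationDomain a j κ x₁ ρ r :=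
      fun l hl hlq => ⟨hx, hl, fun k hk h0 => hlq (by
        have h1 : l = a k x := h0
        rw [h1]; exact hmemq k hk)⟩
    have hdom₀ : ∀ l, r < dist l (x₁ j) → l ∉ q → (x₀, l) ∈ deformationDomain a j κ x₁ ρ r :=
      fun l hl hlq => hL.update_mem (hdom l hl hlq) (Metric.mem_ball_self hL.pos)
    have hκ₀ : a κ x₀ = x₁ j := by rw [hL.pole_eq x₀ hx₀, hx₀def]; simp
    obtain ⟨P, hP1, hP2, hP3, hP4⟩ := exists_polynomial_gauge (G := fun l => G (x, l))
      (c := x₁ j) (t := x j) (c₀ := c x₀) (c₁ := c x) (r := r) (s := s) (J := J) (K := K) (d := D)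
      (d' := D') (q := q) (Q := clearingPoly a S K x)
      ((Metric.mem_ball.1 (apply_mem_ball hx j)).trans hL.lt) h.lt (hred.gauge x₀ (hsub hx₀))
      (hred.gauge x (hsub hx)) (hc x₀ (hsub hx₀)) (hc x (hsub hx))
      (by rw [hdetT x₀ (hsub hx₀), hκ₀]) (by rw [hdetT x (hsub hx), hL.pole_eq x hx])
      (fun l hl hlq => hL.holomorphic.isRegularAt x₀ hx₀ l (hL.ne_of_mem (hdom₀ l hl hlq)))
      (fun l hl hlq => hL.holomorphic.isRegularAt x hx l (hL.ne_of_mem (hdom l hl hlq)))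
      (hregB x₀ hx₀) (hred.trace_eq_zero hA hVX (hsub hx₀))
      (hregB x hx) (hred.trace_eq_zero hA hVX (hsub hx))
      (fun z hz => by
        obtain ⟨k, hk, rfl⟩ := hqmem z hz
        exact h.lt_dist x hx k hk)
      (fun l hl hlq => hGl (x, l) (hdom l hl hlq)) (fun l hl hlq => hGdet (x, l) (hdom l hl hlq))
      (fun l hlq => by
        rw [clearingPoly, eval_prod]
        refine Finset.prod_ne_zero_iff.2 fun k hk => ?_
        rw [eval_pow]
        refine pow_ne_zero _ ?_
        rw [eval_sub, eval_X, eval_C, sub_ne_zero]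
        rintro rfl
        exact hlq (hmemq k (hSκ k hk)))
      (fun z hz => by
        obtain ⟨k, hk, rfl⟩ := hqmem z hz
        exact h.growth_pole hG1 hGt hGl hx hk)
      (h.growth_atInfty hG1 hGt hGl hx) (hD' x hx) (fun b e => hD b e x₀ (hsub hx₀))
      (fun b e => hD b e x (hsub hx))
    refine ⟨P, hP1, fun l hl => ?_, hP3, hP4⟩
    rw [hP2 l hl.2.1 fun hlq => ?_, PolyMat.evalAt_adjugate]
    obtain ⟨k, hk, hkl⟩ := hqmem l hlq
    exact hl.2.2 k hk hkl.symm
  choose! P hPd hPe hPdet hPg using hP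
  refine ⟨P, fun b e => ?_, hPg, fun x => c (Function.update x j (x₁ j)) * c x, fun x hx =>
    mul_ne_zero (hc _ (hsub (hupd x hx))) (hc x (hsub hx)), hPdet⟩
  -- the values of `P` at the real points `R + i` beyond all poles depend holomorphically on `x`
  refine IsAnalyticPoly.of_eval (fun x hx => hPd x hx b e) (v := fun i : ℕ => ((R + i : ℝ) : ℂ))
    (fun i i' hii => by simpa using hii) (fun i x hx => ?_) Metric.isOpen_ball
  set l : ℂ := ((R + i : ℝ) : ℂ) with hl
  have hlR : R ≤ ‖l‖ := by
    rw [hl, Complex.norm_real, Real.norm_eq_abs]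
    have := h.pos
    rw [abs_of_pos (by positivity)]
    simp
  have hmem : ∀ x ∈ Metric.ball x₁ ρ, (x, l) ∈ deformationDomain a j κ x₁ ρ r := fun x hx =>
    h.mem_domain x hx l hlR
  have hx₀ := hupd x hx
  have hpair : AnalyticAt ℂ (fun x : Fin m → ℂ => (x, l)) x := analyticAt_id.prod analyticAt_const
  have hTx : ∀ x ∈ V, AnalyticMatAt (fun x => (T x).evalAt l) x := fun x hx =>
    AnalyticMatAt.comp (v := fun z : (Fin m → ℂ) × ℂ => (T z.1).evalAt z.2) (g := fun x => (x, l))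
      (hred.analytic.analyticMatAt_evalAt hV hx l) (analyticAt_id.prod analyticAt_const)
  have hT₀ : AnalyticMatAt (fun x => (T (Function.update x j (x₁ j))).evalAt l) x :=
    AnalyticMatAt.comp (v := fun x => (T x).evalAt l) (hTx _ (hsub hx₀))
      (analyticAt_update_const j (x₁ j) x)
  have hGx : AnalyticMatAt (fun x => G (x, l)) x :=
    AnalyticMatAt.comp (v := G) (g := fun x => (x, l)) (hGan _ (hmem x hx)) hpair
  have hQx : AnalyticAt ℂ (fun x => (clearingPoly a S K x).eval l) x :=
    AnalyticAt.comp (g := fun z : (Fin m → ℂ) × ℂ => (clearingPoly a S K z.1).eval z.2)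
      (f := fun x => (x, l)) ((isAnalyticPoly_clearingPoly (S := S) (K := K)
        (fun k _ => hL.analytic_pole k)).analyticAt_eval Metric.isOpen_ball hx l) hpair
  have hφ : AnalyticAt ℂ (fun x : Fin m → ℂ => halfPower J (x j) (x₁ j) l) x :=
    AnalyticAt.comp (g := fun t => halfPower J t (x₁ j) l) (f := fun x : Fin m → ℂ => x j)
      (analyticAt_halfPower (((Metric.mem_ball.1 (apply_mem_ball hx j)).trans hL.lt).trans
        (hmem x hx).2.1))
      ((ContinuousLinearMap.proj (R := ℂ) (φ := fun _ : Fin m => ℂ) j).analyticAt x)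
  refine ((AnalyticMatAt.smul (hQx.fun_mul hφ)
    ((hT₀.mul hGx).mul (hTx x (hsub hx)).adjugate)) b e).congr ?_
  filter_upwards [Metric.isOpen_ball.mem_nhds hx] with y hy
  have := hPe y hy l (hmem y hy)
  rw [← this]
  rfl

end GaugeFamily

/-! ### Independence of the parameter -/

section IndependentCoefficient

open Polynomial

variable {m N : ℕ} {X V : Set (Fin m → ℂ)} {A A' : RatFamily m} {a : Fin N → (Fin m → ℂ) → ℂ}
  {κ : Fin N} {T : (Fin m → ℂ) → PolyMat}

/-- For a weak isomonodromy deformation with respect to `x j = a κ x`, the traceless part of the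
deformation matrix, together with its regularity properties. -/
theorem IsWeakIsomonodromic.exists_deformation (hX : IsOpen X) (hA : IsHolomorphicFamily X A a)
    {j : Fin m} {R₁ : RatFamily m} (hR : IsWeakIsomonodromic X A a j κ R₁) :
    ∃ U : RatFamily m, IsHolomorphicOff X U a ∧ (∀ x ∈ X, (U x).trace = 0) ∧
      (∀ x ∈ X, ∀ l, (∀ k, l ≠ a k x) →
        matFDeriv (fun z : (Fin m → ℂ) × ℂ => (A z.1).evalAt z.2) (x, l) (Pi.single j 1, 0) =
          matFDeriv (fun z : (Fin m → ℂ) × ℂ => (U z.1).evalAt z.2) (x, l) (0, 1) +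
          ((U x).evalAt l * (A x).evalAt l - (A x).evalAt l * (U x).evalAt l)) ∧
      (∀ x ∈ X, ∀ k, k ≠ κ → ¬ RatMat.IsRegularAt (U x) (a k x) → (R₁ x).IsPole (a k x)) ∧
      ∀ x ∈ X, ¬ (U x).RegularAtInfty → (A x).FuchsianAtInfty := by
  set U₁ : RatFamily m := fun x =>
    -RatMat.simplePole (a κ x) ((A x).residue (a κ x)) + R₁ x with hU₁
  have hAoff := hA.isHolomorphicOff
  have hneg : ∀ (M : RatMat) (q : ℂ), RatMat.IsRegularAt M q → RatMat.IsRegularAt (-M) q :=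
    fun M q h b c => (h b c).neg
  have hRreg : ∀ x ∈ X, ∀ l, (∀ k, l ≠ a k x) → RatMat.IsRegularAt (R₁ x) l := fun x hx l hl => by
    rw [← RatMat.not_isPole_iff]
    intro hp
    have h1 := hR.poleOrder_eq_one x hx l hp
    have h2 : (A x).IsPole l := by rw [RatMat.IsPole, h1]; exact one_ne_zero
    obtain ⟨k, hk⟩ := (hA.isPole_iff x hx l).1 h2
    exact hl k hk.symm
  have hU₁reg : ∀ x l, l ≠ a κ x → RatMat.IsRegularAt (R₁ x) l → RatMat.IsRegularAt (U₁ x) l :=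
    fun x l hl h => (hneg _ _ (RatMat.isRegularAt_simplePole hl _)).add h
  have hzc : ∀ x ∈ X, ∀ l, (∀ k, l ≠ a k x) → _ := fun x hx l hl =>
    hR.isIsomonodromic.hasCommonSolution.zero_curvature hx (hAoff.isRegularAt x hx l hl)
      (hU₁reg x l (hl κ) (hRreg x hx l hl)) (hAoff.analytic x hx l hl)
  have hU₁off : IsHolomorphicOff X U₁ a :=
    ⟨fun x hx l hl => hU₁reg x l (hl κ) (hRreg x hx l hl), fun x hx l hl => (hzc x hx l hl).1⟩
  refine ⟨fun x => (U₁ x).tracelessPart, hU₁off.tracelessPart hX hA.analytic_pole,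
    fun x _ => RatMat.trace_tracelessPart _, fun x hx l hl =>
      zero_curvature_tracelessPart hU₁off hX hA.analytic_pole hA.trace_eq_zero hx hl (hzc x hx l hl).2,
    fun x hx k hk hreg => ?_, fun x hx hreg => ?_⟩
  · by_contra hp
    exact hreg (RatMat.isRegularAt_tracelessPart (hU₁reg x _
      (fun h => hk (hA.pole_injective x hx h)) (RatMat.not_isPole_iff.1 hp)))
  · refine hR.atInfty x hx fun ⟨L, hL⟩ => hreg (RatMat.regularAtInfty_tracelessPart ⟨L, fun b c => ?_⟩)
    have h1 : Tendsto (fun l : ℂ => -((A x).residue (a κ x) b c * (l - a κ x)⁻¹))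
        (Bornology.cobounded ℂ) (𝓝 0) := by
      have h2 : Tendsto (fun l : ℂ => (l - a κ x)⁻¹) (Bornology.cobounded ℂ) (𝓝 0) :=
        tendsto_inv₀_cobounded.comp (tendsto_sub_const_cobounded (a κ x))
      have h3 := (h2.const_mul ((A x).residue (a κ x) b c)).neg
      rwa [mul_zero, neg_zero] at h3
    have h2 := h1.add (hL b c)
    rw [zero_add] at h2
    refine h2.congr' ?_
    filter_upwards [(R₁ x).eventually_cobounded_isRegularAt,
      Bornology.eventually_ne_cobounded (a κ x)] with l hl hlκ
    have h3 : (U₁ x).evalAt l b c = -(RatMat.simplePole (a κ x) ((A x).residue (a κ x))).evalAt l b c +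
        (R₁ x).evalAt l b c := by
      simp only [hU₁]
      rw [RatMat.evalAt_add (hneg _ _ (RatMat.isRegularAt_simplePole hlκ _)) hl, Matrix.add_apply,
        RatMat.evalAt_apply, Matrix.neg_apply, RatFunc.value_neg', RatMat.evalAt_apply _ _ b c]
      rfl
    rw [h3, RatMat.evalAt_simplePole hlκ]
    simp only [neg_zero, zpow_zero, one_mul, Matrix.smul_apply, smul_eq_mul]
    ring

/-- For a weak deformation, the reduced system is brought by further Schlesinger transformations,
over a smaller open set, to a system which does not depend on `x j`: the reduced system for a fixed
value of `x j`. -/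
theorem IsPartialReduction.exists_independent (h : IsPartialReduction X A a κ V 0 A' T)
    (hX : IsOpen X) (hA : IsHolomorphicFamily X A a) (hV : IsOpen V) (hVX : V ⊆ X)
    {j : Fin m} {R₁ : RatFamily m} (hR : IsWeakIsomonodromic X A a j κ R₁)
    {W : Set (Fin m → ℂ)} (hW : IsOpen W) (hWn : W.Nonempty) (hWV : W ⊆ V) :
    ∃ V' : Set (Fin m → ℂ), IsOpen V' ∧ V'.Nonempty ∧ V' ⊆ W ∧
      ∃ A'' : RatFamily m,
        SchlesingerChain V'
          {p | ∃ k, p = a k ∧ (k = κ ∨ ∀ x ∈ V', (R₁ x).IsPole (a k x))} A' A'' ∧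
        (∀ x ∈ V', ∀ s : ℂ, Function.update x j s ∈ V' →
          A'' (Function.update x j s) = A'' x) ∧
        (∀ x ∈ V', (A'' x).trace = 0 ∧ ¬ (A'' x).IsPole (a κ x) ∧
          ∀ q, (A'' x).IsPole q → (A x).IsPole q) ∧
        ∀ d : ℤ, IsGenericAtInfty X A d → HasOrderAtInfty V' A'' d := by
  classical
  have hWX : W ⊆ X := hWV.trans hVX
  obtain ⟨U, hU, hUt, hzc, hUR, hUinf⟩ := hR.exists_deformation hX hA
  have hpar := hR.isIsomonodromic.isPoleParameter
  have hcont : ∀ k, ∀ x ∈ X, ContinuousAt (a k) x := fun k x hx =>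
    (hA.analytic_pole k x hx).continuousAt
  -- having no pole is a closed condition, so that after shrinking `W` each singular point is a pole
  -- of `U` either for all parameters or for none
  obtain ⟨W', hW'o, ⟨x₁, hx₁⟩, hW'W, hconst⟩ := exists_isOpen_forall_or_forall_not
    (P := fun (k : Option (Fin N)) x => k.elim (¬ (U x).RegularAtInfty)
      fun k => ¬ RatMat.IsRegularAt (U x) (a k x)) Finset.univ hW hWn (fun k x hx hk => by
    have hxX := hWX hx
    cases k with
    | none =>
      by_contra hcon
      refine hk ?_
      have hcon' : ∃ᶠ y in 𝓝 x, (U y).RegularAtInfty := by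
        refine (not_eventually.1 hcon).mono fun y hy => not_not.1 hy
      have hRx : ∀ᶠ y in 𝓝 x, ∀ w, (∑ k, ‖a k x‖) + 1 ≤ ‖w‖ → ∀ k, w ≠ a k y := by
        have h1 : ∀ᶠ y in 𝓝 x, ∀ k, ‖a k y‖ < (∑ k, ‖a k x‖) + 1 :=
          eventually_all.2 fun k => (hcont k x hxX).norm.eventually_lt_const
            (lt_of_le_of_lt (Finset.single_le_sum (f := fun k => ‖a k x‖)
              (fun _ _ => norm_nonneg _) (Finset.mem_univ k)) (lt_add_one _))
        filter_upwards [h1] with y hy w hw k hk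
        rw [hk] at hw
        exact absurd (hy k) (not_lt.2 hw)
      exact hU.regularAtInfty_of_frequently hX hxX (by positivity) hRx hcon'
    | some k =>
      by_contra hcon
      refine hk ?_
      have hcon' : ∃ᶠ y in 𝓝 x, RatMat.IsRegularAt (U y) (a k y) :=
        (not_eventually.1 hcon).mono fun y hy => not_not.1 hy
      obtain ⟨r, hr, hrx⟩ := hA.exists_radius hxX k
      exact hU.isRegularAt_of_frequently hX hxX hr hrx hcon')
  have hW'X : W' ⊆ X := hW'W.trans hWX
  set S : Finset (Fin N) := Finset.univ.filter fun k =>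
    k ≠ κ ∧ ∀ x ∈ W', ¬ RatMat.IsRegularAt (U x) (a k x) with hS
  have hSR : ∀ k ∈ S, k ≠ κ ∧ ∀ x ∈ W', (R₁ x).IsPole (a k x) := fun k hk => by
    obtain ⟨-, h1, h2⟩ := Finset.mem_filter.1 hk
    exact ⟨h1, fun x hx => hUR x (hW'X hx) k h1 (h2 x hx)⟩
  obtain ⟨ρ, r, s, R, K, hB, hball⟩ := exists_isBoundedDeformation (S := S) hX hA hU hUt hzc hpar
    hW'o hW'X hx₁
    (fun k hk => ⟨(hSR k hk).1, fun x hx =>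
      (hR.poleOrder_eq_one x (hW'X hx) _ ((hSR k hk).2 x hx)).le⟩)
    (fun k hk hkS x hx => by
      rcases hconst (some k) (Finset.mem_univ _) with h1 | h1
      · exact absurd (Finset.mem_filter.2 ⟨Finset.mem_univ k, hk, h1⟩) hkS
      · exact not_not.1 (h1 x hx))
    (by
      rcases hconst none (Finset.mem_univ _) with h1 | h1
      · exact Or.inl fun x hx => hUinf x (hW'X hx) (h1 x hx)
      · exact Or.inr fun x hx => not_not.1 (h1 x hx))
  have hL := hB.isLocalDeformation
  have hballV : Metric.ball x₁ ρ ⊆ V := hball.trans (hW'W.trans hWV)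
  obtain ⟨P, hPan, hPg, c, hc, hPdet⟩ := hB.exists_gauge_family h hA hV hVX hballV
  -- the gauge transformation is a product of Schlesinger transformations
  set 𝒞 : Set ((Fin m → ℂ) → ℂ) := {p | ∃ k, p = a k ∧ (k = κ ∨ k ∈ S)} with h𝒞
  set cs : List ((Fin m → ℂ) → ℂ) := S.toList.flatMap fun k => List.replicate (2 * K) (a k) with hcs
  have hdet : ∀ x ∈ Metric.ball x₁ ρ, (P x).det =
      C (c x) * (cs.map fun q => Polynomial.X - C (q x)).prod := by
    intro x hx
    rw [hPdet x hx, hcs, clearingPoly, List.map_flatMap, List.flatMap_def, List.prod_flatten,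
      List.map_map]
    simp only [Function.comp_def, List.map_replicate, List.prod_replicate]
    rw [Finset.prod_map_toList, ← Finset.prod_pow]
    congr 1
    refine Finset.prod_congr rfl fun k _ => ?_
    rw [← pow_mul, mul_comm]
  obtain ⟨V', hV'o, hV'n, hV'sub, hprod⟩ := isGenericallySchlesingerProduct_of_det (𝒞 := 𝒞)
    (p := a κ) ⟨κ, rfl, Or.inl rfl⟩ cs (Metric.ball x₁ ρ) c (hL.analytic_pole κ)
    Metric.isOpen_ball ⟨x₁, Metric.mem_ball_self hL.pos⟩ (fun q hq => by
      obtain ⟨k, hk, hqk⟩ := List.mem_flatMap.1 hq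
      rw [List.eq_of_mem_replicate hqk]
      exact ⟨⟨k, rfl, Or.inr (Finset.mem_toList.1 hk)⟩, hL.analytic_pole k⟩) P hPan hc hdet
  set A'' : RatFamily m := fun x => A' (Function.update x j (x₁ j)) with hA''
  have hupd : ∀ x ∈ Metric.ball x₁ ρ, Function.update x j (x₁ j) ∈ Metric.ball x₁ ρ :=
    fun x hx => update_mem_ball hx (Metric.mem_ball_self hL.pos)
  refine ⟨V', hV'o, hV'n, hV'sub.trans (hball.trans hW'W), A'', ?_, ?_, ?_, ?_⟩
  · refine (hprod A' A'' fun x hx => hPg x (hV'sub hx)).mono subset_rfl ?_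
    rintro p ⟨k, rfl, hk⟩
    exact ⟨k, rfl, hk.imp id fun hkS x hx => (hSR k hkS).2 x (hball (hV'sub hx))⟩
  · intro x _ s _
    simp only [hA'', Function.update_idem]
  · intro x hx
    have hxb := hV'sub hx
    have hx₀ := hupd x hxb
    have hpole : ∀ k, k ≠ κ → a k (Function.update x j (x₁ j)) = a k x := fun k hk =>
      hL.pole_update x hxb _ (Metric.mem_ball_self hL.pos) k hk
    -- the poles of the reduced system for the fixed value of `x j`
    have hpoles : ∀ q, (A'' x).IsPole q → ∃ k, k ≠ κ ∧ q = a k x := fun q hq => by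
      by_contra hcon
      push Not at hcon
      refine RatMat.not_isPole_iff.2 ?_ hq
      by_cases hqκ : q = a κ (Function.update x j (x₁ j))
      · rw [hqκ]; exact h.regular rfl _ (hballV hx₀)
      · refine (h.hasSimplePole hA hV hVX).isRegularAt _ (hballV hx₀) q fun k => ?_
        by_cases hk : k = κ
        · rwa [hk]
        · rw [hpole k hk]; exact hcon k hk
    have hxX := hVX (hballV hxb)
    refine ⟨h.trace_eq_zero hA hVX (hballV hx₀), fun hp => ?_, fun q hq => ?_⟩
    · obtain ⟨k, hk, hkκ⟩ := hpoles _ hp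
      exact hk (hA.pole_injective x hxX hkκ).symm
    · obtain ⟨k, -, rfl⟩ := hpoles q hq
      exact (hA.isPole_iff x hxX _).2 ⟨k, rfl⟩
  · intro d hd x hx
    obtain ⟨L, hL', hLdet, -⟩ := (h.generic d hd).2 _ (hballV (hupd x (hV'sub hx)))
    exact ⟨L, hL', fun h0 => hLdet (by rw [h0]; simp)⟩

end IndependentCoefficient

theorem proposition1 {m N : ℕ} (X : Set (Fin m → ℂ)) (hX : IsOpen X)
    (A : RatFamily m) (a : Fin N → (Fin m → ℂ) → ℂ) (hA : IsHolomorphicFamily X A a)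
    (i : Fin m) (τ κ : Fin N) (R : RatFamily m) (hR : IsNonSchlesinger X A a i τ κ R) :
    ∀ x₀ ∈ X, ∃ V : Set (Fin m → ℂ), IsOpen V ∧ x₀ ∈ V ∧ V ⊆ X ∧
      ∃ A' : RatFamily m,
        -- finitely many transformations centred at `t₁` remove the pole `t₁` and keep the others
        SchlesingerChain V {a κ} A A' ∧
        (∀ x ∈ V, (A' x).trace = 0 ∧ ¬ (A' x).IsPole (a κ x) ∧
          ∀ q, q ≠ a κ x → (A' x).poleOrder q = (A x).poleOrder q) ∧
        (∀ d : ℤ, IsGenericAtInfty X A d → HasOrderAtInfty V A' d) ∧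
        -- weak deformations: further transformations make the coefficient independent of `t₁`
        ∀ (j : Fin m) (R₁ : RatFamily m), IsWeakIsomonodromic X A a j κ R₁ →
          ∀ W : Set (Fin m → ℂ), IsOpen W → W.Nonempty → W ⊆ V →
            ∃ V' : Set (Fin m → ℂ), IsOpen V' ∧ V'.Nonempty ∧ V' ⊆ W ∧
              ∃ A'' : RatFamily m,
                SchlesingerChain V'
                  {p | ∃ k, p = a k ∧ (k = κ ∨ ∀ x ∈ V', (R₁ x).IsPole (a k x))} A' A'' ∧
                (∀ x ∈ V', ∀ s : ℂ, Function.update x j s ∈ V' →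
                  A'' (Function.update x j s) = A'' x) ∧
                (∀ x ∈ V', (A'' x).trace = 0 ∧ ¬ (A'' x).IsPole (a κ x) ∧
                  ∀ q, (A'' x).IsPole q → (A x).IsPole q) ∧
                ∀ d : ℤ, IsGenericAtInfty X A d → HasOrderAtInfty V' A'' d := by
  intro x₀ hx₀
  obtain ⟨V, A', T, hV, hx₀V, hVX, h⟩ := hR.exists_isPartialReduction hX hA hx₀
  refine ⟨V, hV, hx₀V, hVX, A', h.chain, fun x hx => ⟨h.trace_eq_zero hA hVX hx,
    RatMat.not_isPole_iff.2 (h.regular rfl x hx), fun q hq =>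
      (h.gauge x hx).poleOrder_eq (h.det_eval_ne_zero hx hq)⟩, fun d hd x hx => ?_,
    fun j R₁ hR₁ W hW hWn hWV => h.exists_independent hX hA hV hVX hR₁ hW hWn hWV⟩
  obtain ⟨L, hL, hLdet, -⟩ := (h.generic d hd).2 x hx
  exact ⟨L, hL, fun h0 => hLdet (by rw [h0]; simp)⟩
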